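/- Consider the cardinality-constrained portfolio problem $\min\{x^T(\tilde Q+\mathrm{diag}(d))x-\mu^Tx : Ax\le b,\ 0\le x_j\le u_j,\ x_j=0 \text{ if } z_j=0,\ z\in\{0,1\}^n,\ \sum_j z_j\le N\}$ in $n\ge1$ variables, where $u,d\ge 0$, $A$ has $m$ rows, none of them zero, and $\tilde Q\succeq0$ has rank $H$, with nonzero eigenvalues $\lambda_1,\dots,\lambda_H$ and corresponding orthonormal eigenvectors $v^1,\dots,v^H$, which are part of the input. It is reformulated as $$\min\ \sum_{h=1}^H\lambda_hy_h^2+\sum_{j=1}^nd_jx_j^2-\mu^Tx$$ $$\text{s.t.}\quad Ax\le b,\qquad (v^h)^Tx=y_h\ (1\le h\le H),\qquad 0\le x_j\le u_j,\ z_j\in\{0,1\},\ x_j=0\text{ if }z_j=0\ (1\le j\le n),\qquad \sum_{j=1}^nz_j\le N.$$ Let $G$ be the graph whose vertices are the rows of $A$, two distinct rows being adjacent if some variable has a nonzero coefficient in both. Suppose that a tree-decomposition of $G$ of width $\omega$ with at most $n+m$ nodes is given (for instance an optimal one, where $\omega$ is the treewidth of $G$). For a row vector $a$ write $|\mathrm{supp}(a)|$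 for the number of its nonzero entries and $\sigma(a)=\sum_j|a_j|u_j$. For $\epsilon>0$ call $(x,y,z)$ $\epsilon$-feasible if it satisfies the bounds, the indicator constraints and the cardinality constraint exactly, and if each remaining constraint, once scaled, is violated by at most $\epsilon$ times the number of variables in it: $a_r^Tx\le b_r+\epsilon\,|\mathrm{supp}(a_r)|\,\sigma(a_r)$ for every row $a_r$ of $A$, and $|(v^h)^Tx-y_h|\le\epsilon\,(|\mathrm{supp}(v^h)|+1)\,\sigma(v^h)$ for every $h$. Call it superoptimal if its objective value is at most that of every feasible solution of the reformulation. There is an algorithm on the real RAM (unit-cost exact arithmetic and comparisons on reals) that, given such a problem, the tree-decomposition and $0<\epsilon<1$, either correctly declares that the problem is infeasible or outputs an $\epsilon$-feasible (hence cardinality-feasible), superoptimal $(x,y,z)$, in time $O\big(n\,(2/\epsilon)^{2\omega+2H+2}\,n^2\big)$, where the constant in $O(\cdot)$ is absolute. -/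

import Mathlib

/-! ## A real RAM

Programs are finite syntax trees, fixed once and for all inputs.  Memory consists of arrays of
natural numbers and arrays of real numbers, with two indices; array names are part of the program.
The natural-number operations are `+` and truncated `-`, the real operations are `+`, `-`, `*`, `/`,
the tests are exact comparisons.  There is no conversion from reals to natural numbers (no rounding)
and the only constants in a program are natural numbers.  Every operation, memory access, assignment
and test costs one step. -/

namespace RealRAM

/-- Expressions with values in `ℕ`. -/
inductive NExp where
  | const (c : ℕ)
  | cell (a : ℕ) (i j : NExp)
  | add (e f : NExp)
  | sub (e f : NExp)

/-- Expressions with values in `ℝ`. -/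
inductive RExp where
  | ofNat (e : NExp)
  | cell (a : ℕ) (i j : NExp)
  | add (e f : RExp)
  | sub (e f : RExp)
  | mul (e f : RExp)
  | div (e f : RExp)

/-- Tests. -/
inductive Test where
  | natLe (e f : NExp)
  | realLe (e f : RExp)
  | neg (p : Test)
  | and (p q : Test)

/-- Structured programs. -/
inductive Prog where
  | skip
  | setNat (a : ℕ) (i j e : NExp)
  | setReal (a : ℕ) (i j : NExp) (e : RExp)
  | seq (p q : Prog)
  | ite (c : Test) (p q : Prog)
  | while (c : Test) (p : Prog)

/-- Memory: `nat a i j` and `real a i j` are the contents of cell `(i, j)` of array `a`. -/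
structure Store where
  nat : ℕ → ℕ → ℕ → ℕ
  real : ℕ → ℕ → ℕ → ℝ

/-- Memory after writing the natural number `x` to a cell. -/
def Store.writeNat (s : Store) (a i j x : ℕ) : Store where
  nat := fun a' i' j' => if a' = a ∧ i' = i ∧ j' = j then x else s.nat a' i' j'
  real := s.real

/-- Memory after writing the real number `x` to a cell. -/
noncomputable def Store.writeReal (s : Store) (a i j : ℕ) (x : ℝ) : Store where
  nat := s.nat
  real := fun a' i' j' => if a' = a ∧ i' = i ∧ j' = j then x else s.real a' i' j'

/-- Value of a natural-number expression. -/
def NExp.eval (s : Store) : NExp → ℕ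
  | .const c => c
  | .cell a i j => s.nat a (i.eval s) (j.eval s)
  | .add e f => e.eval s + f.eval s
  | .sub e f => e.eval s - f.eval s

/-- Number of steps spent on evaluating a natural-number expression. -/
def NExp.cost : NExp → ℕ
  | .const _ => 1
  | .cell _ i j => i.cost + j.cost + 1
  | .add e f => e.cost + f.cost + 1
  | .sub e f => e.cost + f.cost + 1

/-- Value of a real expression. -/
noncomputable def RExp.eval (s : Store) : RExp → ℝ
  | .ofNat e => (e.eval s : ℝ)
  | .cell a i j => s.real a (i.eval s) (j.eval s)
  | .add e f => e.eval s + f.eval s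
  | .sub e f => e.eval s - f.eval s
  | .mul e f => e.eval s * f.eval s
  | .div e f => e.eval s / f.eval s

/-- Number of steps spent on evaluating a real expression. -/
def RExp.cost : RExp → ℕ
  | .ofNat e => e.cost + 1
  | .cell _ i j => i.cost + j.cost + 1
  | .add e f => e.cost + f.cost + 1
  | .sub e f => e.cost + f.cost + 1
  | .mul e f => e.cost + f.cost + 1
  | .div e f => e.cost + f.cost + 1

/-- Truth of a test. -/
def Test.Holds (s : Store) : Test → Prop
  | .natLe e f => e.eval s ≤ f.eval s
  | .realLe e f => e.eval s ≤ f.eval s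
  | .neg p => ¬ p.Holds s
  | .and p q => p.Holds s ∧ q.Holds s

/-- Number of steps spent on a test. -/
def Test.cost : Test → ℕ
  | .natLe e f => e.cost + f.cost + 1
  | .realLe e f => e.cost + f.cost + 1
  | .neg p => p.cost + 1
  | .and p q => p.cost + q.cost + 1

/-- `Exec p s t s'`: started in memory `s`, the program `p` halts after exactly `t` steps
in memory `s'`. -/
inductive Exec : Prog → Store → ℕ → Store → Prop where
  | skip (s : Store) : Exec .skip s 1 s
  | setNat (s : Store) (a : ℕ) (i j e : NExp) :
      Exec (.setNat a i j e) s (i.cost + j.cost + e.cost + 1)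
        (s.writeNat a (i.eval s) (j.eval s) (e.eval s))
  | setReal (s : Store) (a : ℕ) (i j : NExp) (e : RExp) :
      Exec (.setReal a i j e) s (i.cost + j.cost + e.cost + 1)
        (s.writeReal a (i.eval s) (j.eval s) (e.eval s))
  | seq {p q : Prog} {s s' s'' : Store} {t t' : ℕ} :
      Exec p s t s' → Exec q s' t' s'' → Exec (.seq p q) s (t + t') s''
  | iteTrue {c : Test} {p q : Prog} {s s' : Store} {t : ℕ} :
      c.Holds s → Exec p s t s' → Exec (.ite c p q) s (c.cost + t) s'
  | iteFalse {c : Test} {p q : Prog} {s s' : Store} {t : ℕ} :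
      ¬ c.Holds s → Exec q s t s' → Exec (.ite c p q) s (c.cost + t) s'
  | whileFalse {c : Test} {p : Prog} {s : Store} :
      ¬ c.Holds s → Exec (.while c p) s c.cost s
  | whileTrue {c : Test} {p : Prog} {s s' s'' : Store} {t t' : ℕ} :
      c.Holds s → Exec p s t s' → Exec (.while c p) s' t' s'' →
        Exec (.while c p) s (c.cost + t + t') s''

/-- A vector as the contents of cells `(0, 0), (1, 0), …`; all other cells are `0`. -/
def vecCells {α : Type} [Zero α] {n : ℕ} (f : Fin n → α) (i j : ℕ) : α :=
  if h : i < n ∧ j = 0 then f ⟨i, h.1⟩ else 0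

/-- A matrix as the contents of an array; all cells outside the matrix are `0`. -/
def matCells {α : Type} [Zero α] {m n : ℕ} (f : Fin m → Fin n → α) (i j : ℕ) : α :=
  if h : i < m ∧ j < n then f ⟨i, h.1⟩ ⟨j, h.2⟩ else 0

end RealRAM

/-! ## Tree-decompositions -/

/-- `(T, X)` is a tree-decomposition of `G`. -/
structure IsTreeDecomposition {V τ : Type} (G : SimpleGraph V) (T : SimpleGraph τ)
    (X : τ → Finset V) : Prop where
  isTree : T.IsTree
  /-- The nodes whose bags contain `v` form a nonempty subtree. -/
  subtree : ∀ v : V, (T.induce {t | v ∈ X t}).Connected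
  edge : ∀ u v : V, G.Adj u v → ∃ t, u ∈ X t ∧ v ∈ X t

/-- The tree on the nodes `0, …, k - 1` with root `0` given by parent pointers. -/
def parentGraph {k : ℕ} (par : Fin k → Fin k) : SimpleGraph (Fin k) :=
  SimpleGraph.fromRel fun s t => par s = t

/-- A tree-decomposition of a graph on `Fin m` with `k` nodes, as handed to a program: the tree is
rooted at node `0`, given by parent pointers, and every other node has a larger number than
its parent. -/
structure RootedTreeDecomposition {m : ℕ} (G : SimpleGraph (Fin m)) (k : ℕ) where
  par : Fin k → Fin k
  bag : Fin k → Finset (Fin m)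
  par_le : ∀ t, (par t).val ≤ t.val
  par_eq : ∀ t, par t = t ↔ t.val = 0
  isTreeDecomposition : IsTreeDecomposition G (parentGraph par) bag

/-- The width of a tree-decomposition: the largest size of a bag, minus one
(so it is `-1` if there are no vertices). -/
def RootedTreeDecomposition.width {m k : ℕ} {G : SimpleGraph (Fin m)}
    (D : RootedTreeDecomposition G k) : ℤ :=
  (Finset.univ.sup fun t => (D.bag t).card : ℕ) - 1

/-! ## The portfolio problem -/

/-- Data of the portfolio problem with covariance `Qt + diag d`, where `Qt` is positive
semidefinite of rank `H` and comes with its eigenvector-eigenvalue decomposition: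
minimise `∑ h, lam h * y h ^ 2 + ∑ j, d j * x j ^ 2 - ∑ j, mu j * x j` subject to `A x ≤ b`,
`v h ⬝ x = y h`, `0 ≤ x j ≤ u j`, `z j ∈ {0, 1}`, `x j = 0` if `z j = 0`, and `∑ j, z j ≤ N`. -/
structure Portfolio (n m H : ℕ) where
  A : Matrix (Fin m) (Fin n) ℝ
  b : Fin m → ℝ
  u : Fin n → ℝ
  N : ℕ
  d : Fin n → ℝ
  mu : Fin n → ℝ
  Qt : Matrix (Fin n) (Fin n) ℝ
  lam : Fin H → ℝ
  v : Fin H → Fin n → ℝ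
  u_nonneg : ∀ j, 0 ≤ u j
  d_nonneg : ∀ j, 0 ≤ d j
  /-- No row of `A` vanishes. -/
  row_ne_zero : ∀ r, ∃ j, A r j ≠ 0
  posSemidef : Qt.PosSemidef
  rank_eq : Qt.rank = H
  lam_pos : ∀ h, 0 < lam h
  eigen : ∀ h, Matrix.mulVec Qt (v h) = lam h • v h
  orthonormal : ∀ h h', ∑ j, v h j * v h' j = if h = h' then 1 else 0

/-- A vector of values for the variables. -/
structure PortfolioPoint (n H : ℕ) where
  x : Fin n → ℝ
  y : Fin H → ℝ
  z : Fin n → ℕ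

namespace Portfolio

variable {n m H : ℕ}

/-- The constraint-block intersection graph of `A x ≤ b` (the blocks are the single variables):
two rows are adjacent if some variable occurs in both. -/
def rowGraph (I : Portfolio n m H) : SimpleGraph (Fin m) :=
  SimpleGraph.fromRel fun r r' => ∃ j, I.A r j ≠ 0 ∧ I.A r' j ≠ 0

/-- The objective function. -/
def objective (I : Portfolio n m H) (p : PortfolioPoint n H) : ℝ :=
  ∑ h, I.lam h * p.y h ^ 2 + ∑ j, I.d j * p.x j ^ 2 - ∑ j, I.mu j * p.x j

/-- Bounds, indicator constraints and the cardinality constraint. -/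
def Basic (I : Portfolio n m H) (p : PortfolioPoint n H) : Prop :=
  (∀ j, 0 ≤ p.x j ∧ p.x j ≤ I.u j) ∧ (∀ j, p.z j = 0 ∨ p.z j = 1) ∧
    (∀ j, p.z j = 0 → p.x j = 0) ∧ ∑ j, p.z j ≤ I.N

/-- Feasible points. -/
def Feasible (I : Portfolio n m H) (p : PortfolioPoint n H) : Prop :=
  I.Basic p ∧ (∀ r, ∑ j, I.A r j * p.x j ≤ I.b r) ∧ ∀ h, ∑ j, I.v h j * p.x j = p.y h

/-- The number of variables that occur in a row `a`. -/
noncomputable def support (a : Fin n → ℝ) : ℕ := {j | a j ≠ 0}.ncard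

/-- The factor by which the row `a` has to be divided, so that its coefficients have absolute sum
`1` once every variable `x j` is rescaled to range over `[0, 1]`. -/
def scale (I : Portfolio n m H) (a : Fin n → ℝ) : ℝ := ∑ j, |a j| * I.u j

/-- `ε`-feasibility: the bounds, the indicator constraints and the cardinality constraint hold
exactly, and every other constraint, once scaled, is violated by at most `ε` times the number
of blocks that occur in it (in a row `v h ⬝ x = y h` the variable `y h` is a further block). -/
def EpsFeasible (I : Portfolio n m H) (ε : ℝ) (p : PortfolioPoint n H) : Prop :=
  I.Basic p ∧
    (∀ r, ∑ j, I.A r j * p.x j ≤ I.b r + ε * support (I.A r) * I.scale (I.A r)) ∧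
    ∀ h, |∑ j, I.v h j * p.x j - p.y h| ≤ ε * (support (I.v h) + 1) * I.scale (I.v h)

/-- Superoptimality: the value is at most that of every feasible point. -/
def Superoptimal (I : Portfolio n m H) (p : PortfolioPoint n H) : Prop :=
  ∀ q, I.Feasible q → I.objective p ≤ I.objective q

/-- Initial memory. Natural-number arrays: `0` holds `n, m, H, N, k` in its cells
`(0, 0), …, (4, 0)`, `1` the parent pointers, `2` the membership matrix of the bags.  Real arrays:
`0` holds `ε`, and `1, …, 7` hold `A, b, u, d, mu, lam, v`.  All other cells are `0`. -/
noncomputable def input (I : Portfolio n m H) {k : ℕ} (D : RootedTreeDecomposition I.rowGraph k)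
    (ε : ℝ) : RealRAM.Store where
  nat
    | 0 => RealRAM.vecCells ![n, m, H, I.N, k]
    | 1 => RealRAM.vecCells fun t => (D.par t).val
    | 2 => RealRAM.matCells fun t r => if r ∈ D.bag t then 1 else 0
    | _ => fun _ _ => 0
  real
    | 0 => RealRAM.vecCells ![ε]
    | 1 => RealRAM.matCells I.A
    | 2 => RealRAM.vecCells I.b
    | 3 => RealRAM.vecCells I.u
    | 4 => RealRAM.vecCells I.d
    | 5 => RealRAM.vecCells I.mu
    | 6 => RealRAM.vecCells I.lam
    | 7 => RealRAM.matCells I.v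
    | _ => fun _ _ => 0

/-- A program ends by declaring the instance infeasible if it leaves `0` in cell `(0, 0)` of the
natural-number array `3`. -/
def DeclaresInfeasible (s : RealRAM.Store) : Prop := s.nat 3 0 0 = 0

/-- The point that a program returns: `z` in the natural-number array `4`, `x` and `y` in the
real arrays `8` and `9`. -/
def output (n H : ℕ) (s : RealRAM.Store) : PortfolioPoint n H where
  x := fun j => s.real 8 j 0
  y := fun h => s.real 9 h 0
  z := fun j => s.nat 4 j 0

end Portfolio

/-!
Every row of the scaled problem is rounded, and the rounded problem is solved exactly by dynamic
programming along the tree-decomposition.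

*Relaxation.* The eigenvectors are treated as further rows that lie in all bags, which makes
`R = m + H` rows. The variable `x j` is confined to one of `M = 4 K` intervals of length `u j / M` and
is replaced by the cheapest point of this interval, so that the separable part of the objective does
not increase (`exists_choice_le`). The contribution of `x j` to a row, shifted so that it is
nonnegative and divided by `σ`, is rounded down to a multiple `d * g` of the grid length
`g = 4 ε / 5`, where `d` is called a digit. These contributions to a row sum to at most `1`,
so the digits of a feasible point sum to less than `K`, the least number with `K * g > 1`
(`valid_rowData`, `sound_rowData`). The rounded sum of a row of `A` has to be compatible
with the right-hand side, and `y h` is taken as the number closest to zero that is compatible with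
the rounded sum of the eigenvector. Thus each feasible point yields a choice of intervals that
passes the rounded tests and is not more expensive, while a choice that passes them is
`ε`-feasible, because each variable of a row loses at most `g + 1 / M ≤ ε` (`epsFeasible_point`).

*Dynamic program.* The variables become leaves of the tree, attached to the bags that contain their
rows. The rows are coloured greedily such that rows in a common bag get different colours, which
needs no more colours than the largest bag, together with the eigenvectors, has rows
(`arrange_spec`). A partial solution then has the code `∑ r, D r * K ^ col r`, where `D r` is the
rounded sum of row `r`; codes of disjoint sets of variables are added when a node is merged into its
parent, and a row is evaluated and its digit cleared at the top node of its subtree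
(`Stage.sem_final`, `treeDP_spec`).

*Running time.* Since no rounded sum may reach `K`, only `T = K * (K + 1) / 2` pairs of values of a
digit have to be tried in a merge, hence `T ^ L` pairs of codes with `L ≤ ω + 1 + H` colours. As
`K ≤ 5 / 8 * (2 / ε) + 1`, the number `T` is smaller than `(2 / ε) ^ 2` by a constant factor less
than `1`, and `T ^ L` beats `(2 / ε) ^ (2 * L)` by a geometric factor, which absorbs the powers of
`L` in the remaining work (`exists_pairs_le`, `cost_le`). The numerical constants in the cost bounds
of the single programs are generous.

The algorithm is an explicit program for the real RAM, and its correctness and cost are established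
by a calculus of weakest preconditions (`RealRAM.WP`) in which the postcondition also sees the
number of steps.
-/

/-! ### A weakest-precondition calculus for the real RAM -/

namespace RealRAM

/-- Weakest precondition: `p`, started in `s`, halts after some number `t` of steps in some memory
`s'` such that `Q t s'`. -/
def WP (p : Prog) (s : Store) (Q : ℕ → Store → Prop) : Prop :=
  ∃ t s', Exec p s t s' ∧ Q t s'

theorem WP.mono {p : Prog} {s : Store} {Q Q' : ℕ → Store → Prop} (h : WP p s Q)
    (hQ : ∀ t s', Q t s' → Q' t s') : WP p s Q' := by
  obtain ⟨t, s', h1, h2⟩ := h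
  exact ⟨t, s', h1, hQ _ _ h2⟩

@[simp] theorem WP_skip {s : Store} {Q : ℕ → Store → Prop} : WP .skip s Q ↔ Q 1 s := by
  constructor
  · rintro ⟨t, s', h, hQ⟩
    cases h
    exact hQ
  · intro h
    exact ⟨_, _, .skip s, h⟩

@[simp] theorem WP_setNat {s : Store} {Q : ℕ → Store → Prop} {a : ℕ} {i j e : NExp} :
    WP (.setNat a i j e) s Q ↔
      Q (i.cost + j.cost + e.cost + 1) (s.writeNat a (i.eval s) (j.eval s) (e.eval s)) := by
  constructor
  · rintro ⟨t, s', h, hQ⟩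
    cases h
    exact hQ
  · intro h
    exact ⟨_, _, .setNat s a i j e, h⟩

@[simp] theorem WP_setReal {s : Store} {Q : ℕ → Store → Prop} {a : ℕ} {i j : NExp} {e : RExp} :
    WP (.setReal a i j e) s Q ↔
      Q (i.cost + j.cost + e.cost + 1) (s.writeReal a (i.eval s) (j.eval s) (e.eval s)) := by
  constructor
  · rintro ⟨t, s', h, hQ⟩
    cases h
    exact hQ
  · intro h
    exact ⟨_, _, .setReal s a i j e, h⟩

@[simp] theorem WP_seq {s : Store} {Q : ℕ → Store → Prop} {p q : Prog} :
    WP (.seq p q) s Q ↔ WP p s fun t s' => WP q s' fun t' s'' => Q (t + t') s'' := by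
  constructor
  · rintro ⟨t, s', h, hQ⟩
    cases h with
    | seq h1 h2 => exact ⟨_, _, h1, _, _, h2, hQ⟩
  · rintro ⟨t, s', h1, t', s'', h2, hQ⟩
    exact ⟨_, _, .seq h1 h2, hQ⟩

theorem WP_ite {s : Store} {Q : ℕ → Store → Prop} {c : Test} {p q : Prog} :
    WP (.ite c p q) s Q ↔
      (c.Holds s → WP p s fun t s' => Q (c.cost + t) s') ∧
        (¬ c.Holds s → WP q s fun t s' => Q (c.cost + t) s') := by
  constructor
  · rintro ⟨t, s', h, hQ⟩
    cases h with
    | iteTrue h1 h2 => exact ⟨fun _ => ⟨_, _, h2, hQ⟩, fun h => absurd h1 h⟩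
    | iteFalse h1 h2 => exact ⟨fun h => absurd h h1, fun _ => ⟨_, _, h2, hQ⟩⟩
  · rintro ⟨h1, h2⟩
    by_cases hc : c.Holds s
    · obtain ⟨t, s', h, hQ⟩ := h1 hc
      exact ⟨_, _, .iteTrue hc h, hQ⟩
    · obtain ⟨t, s', h, hQ⟩ := h2 hc
      exact ⟨_, _, .iteFalse hc h, hQ⟩

/-- The natural-number arrays that a program writes to. -/
def Prog.natW : Prog → List ℕ
  | .skip => []
  | .setNat a _ _ _ => [a]
  | .setReal _ _ _ _ => []
  | .seq p q => p.natW ++ q.natW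
  | .ite _ p q => p.natW ++ q.natW
  | .while _ p => p.natW

/-- The real arrays that a program writes to. -/
def Prog.realW : Prog → List ℕ
  | .skip => []
  | .setNat _ _ _ _ => []
  | .setReal a _ _ _ => [a]
  | .seq p q => p.realW ++ q.realW
  | .ite _ p q => p.realW ++ q.realW
  | .while _ p => p.realW

/-- The two memories differ at most in the natural-number arrays in `A` and the real arrays
in `B`.  The arrays are listed by number, so that `decide` can compare the lists. -/
structure Frame (A B : List ℕ) (s s' : Store) : Prop where
  nat : ∀ a, a ∉ A → s'.nat a = s.nat a
  real : ∀ a, a ∉ B → s'.real a = s.real a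

theorem Frame.refl (A B : List ℕ) (s : Store) : Frame A B s s := ⟨fun _ _ => rfl, fun _ _ => rfl⟩

theorem Frame.trans {A B : List ℕ} {s s' s'' : Store} (h : Frame A B s s')
    (h' : Frame A B s' s'') : Frame A B s s'' :=
  ⟨fun a ha => (h'.nat a ha).trans (h.nat a ha), fun a ha => (h'.real a ha).trans (h.real a ha)⟩

theorem Frame.mono {A B A' B' : List ℕ} {s s' : Store} (h : Frame A B s s')
    (hA : A ⊆ A') (hB : B ⊆ B') : Frame A' B' s s' :=
  ⟨fun a ha => h.nat a fun h' => ha (hA h'), fun a ha => h.real a fun h' => ha (hB h')⟩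

theorem Store.writeNat_nat_ne {s : Store} {a i j x a' : ℕ} (h : a' ≠ a) :
    (s.writeNat a i j x).nat a' = s.nat a' := by
  funext i' j'
  simp [Store.writeNat, h]

theorem Store.writeReal_real_ne {s : Store} {a i j : ℕ} {x : ℝ} {a' : ℕ} (h : a' ≠ a) :
    (s.writeReal a i j x).real a' = s.real a' := by
  funext i' j'
  simp [Store.writeReal, h]

theorem Exec.frame {p : Prog} {s s' : Store} {t : ℕ} (h : Exec p s t s') :
    Frame p.natW p.realW s s' := by
  induction h with
  | skip s => exact .refl _ _ _
  | setNat s a i j e =>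
    exact ⟨fun b hb => Store.writeNat_nat_ne (by simpa [Prog.natW] using hb), fun _ _ => rfl⟩
  | setReal s a i j e =>
    exact ⟨fun _ _ => rfl, fun b hb => Store.writeReal_real_ne (by simpa [Prog.realW] using hb)⟩
  | seq _ _ h1 h2 =>
    exact (h1.mono (List.subset_append_left _ _) (List.subset_append_left _ _)).trans
      (h2.mono (List.subset_append_right _ _) (List.subset_append_right _ _))
  | iteTrue _ _ h => exact h.mono (List.subset_append_left _ _) (List.subset_append_left _ _)
  | iteFalse _ _ h => exact h.mono (List.subset_append_right _ _) (List.subset_append_right _ _)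
  | whileFalse _ => exact .refl _ _ _
  | whileTrue _ _ _ h1 h2 => exact Frame.trans h1 h2

theorem WP.frame {p : Prog} {s : Store} {Q : ℕ → Store → Prop} (A B : List ℕ) (h : WP p s Q)
    (hA : p.natW ⊆ A := by decide) (hB : p.realW ⊆ B := by decide) :
    WP p s fun t s' => Q t s' ∧ Frame A B s s' := by
  obtain ⟨t, s', h1, h2⟩ := h
  exact ⟨t, s', h1, h2, h1.frame.mono hA hB⟩

instance : Add NExp := ⟨.add⟩
instance : Sub NExp := ⟨.sub⟩
instance (c : ℕ) : OfNat NExp c := ⟨.const c⟩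
instance : Add RExp := ⟨.add⟩
instance : Sub RExp := ⟨.sub⟩
instance : Mul RExp := ⟨.mul⟩
instance : Div RExp := ⟨.div⟩
instance (c : ℕ) : OfNat RExp c := ⟨.ofNat (.const c)⟩
instance : Coe NExp RExp := ⟨.ofNat⟩

/-- The natural-number variable in cell `(0, 0)` of array `a`. -/
def nv (a : ℕ) : NExp := .cell a (.const 0) (.const 0)
/-- Entry `i` of the natural-number vector in array `a`. -/
def n1 (a : ℕ) (i : NExp) : NExp := .cell a i (.const 0)
/-- Entry `(i, j)` of the natural-number array `a`. -/
def n2 (a : ℕ) (i j : NExp) : NExp := .cell a i j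
/-- The real variable in cell `(0, 0)` of array `a`. -/
def rv (a : ℕ) : RExp := .cell a (.const 0) (.const 0)
/-- Entry `i` of the real vector in array `a`. -/
def r1 (a : ℕ) (i : NExp) : RExp := .cell a i (.const 0)
/-- Entry `(i, j)` of the real array `a`. -/
def r2 (a : ℕ) (i j : NExp) : RExp := .cell a i j
/-- Assignment to a natural-number variable. -/
def setN (a : ℕ) (e : NExp) : Prog := .setNat a (.const 0) (.const 0) e
/-- Assignment to a real variable. -/
def setR (a : ℕ) (e : RExp) : Prog := .setReal a (.const 0) (.const 0) e

/-- Counting loop: variable `i` runs from `0` to `e - 1`. -/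
def forP (i : ℕ) (e : NExp) (body : Prog) : Prog :=
  .seq (setN i 0) (.while (.natLe (nv i + 1) e) (.seq body (setN i (nv i + 1))))

section Eval

variable (s : Store)

@[simp] theorem eval_natLit (c : ℕ) : NExp.eval s (no_index (OfNat.ofNat c)) = OfNat.ofNat c := rfl
@[simp] theorem eval_const (c : ℕ) : NExp.eval s (.const c) = c := rfl
@[simp] theorem eval_natAdd (e f : NExp) : NExp.eval s (e + f) = e.eval s + f.eval s := rfl
@[simp] theorem eval_natSub (e f : NExp) : NExp.eval s (e - f) = e.eval s - f.eval s := rfl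
@[simp] theorem eval_nv (a : ℕ) : NExp.eval s (nv a) = s.nat a 0 0 := rfl
@[simp] theorem eval_n1 (a : ℕ) (i : NExp) : NExp.eval s (n1 a i) = s.nat a (i.eval s) 0 := rfl
@[simp] theorem eval_n2 (a : ℕ) (i j : NExp) :
    NExp.eval s (n2 a i j) = s.nat a (i.eval s) (j.eval s) := rfl
@[simp] theorem eval_realLit (c : ℕ) :
    RExp.eval s (no_index (OfNat.ofNat c)) = ((OfNat.ofNat c : ℕ) : ℝ) := rfl
@[simp] theorem eval_ofNat (e : NExp) : RExp.eval s (.ofNat e) = (e.eval s : ℝ) := rfl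
@[simp] theorem eval_realAdd (e f : RExp) : RExp.eval s (e + f) = e.eval s + f.eval s := rfl
@[simp] theorem eval_realSub (e f : RExp) : RExp.eval s (e - f) = e.eval s - f.eval s := rfl
@[simp] theorem eval_realMul (e f : RExp) : RExp.eval s (e * f) = e.eval s * f.eval s := rfl
@[simp] theorem eval_realDiv (e f : RExp) : RExp.eval s (e / f) = e.eval s / f.eval s := rfl
@[simp] theorem eval_rv (a : ℕ) : RExp.eval s (rv a) = s.real a 0 0 := rfl
@[simp] theorem eval_r1 (a : ℕ) (i : NExp) : RExp.eval s (r1 a i) = s.real a (i.eval s) 0 := rfl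
@[simp] theorem eval_r2 (a : ℕ) (i j : NExp) :
    RExp.eval s (r2 a i j) = s.real a (i.eval s) (j.eval s) := rfl

@[simp] theorem cost_natLit (c : ℕ) : NExp.cost (no_index (OfNat.ofNat c)) = 1 := rfl
@[simp] theorem cost_const (c : ℕ) : NExp.cost (.const c) = 1 := rfl
@[simp] theorem cost_natAdd (e f : NExp) : (e + f).cost = e.cost + f.cost + 1 := rfl
@[simp] theorem cost_natSub (e f : NExp) : (e - f).cost = e.cost + f.cost + 1 := rfl
@[simp] theorem cost_nv (a : ℕ) : (nv a).cost = 3 := rfl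
@[simp] theorem cost_n1 (a : ℕ) (i : NExp) : (n1 a i).cost = i.cost + 1 + 1 := rfl
@[simp] theorem cost_n2 (a : ℕ) (i j : NExp) : (n2 a i j).cost = i.cost + j.cost + 1 := rfl
@[simp] theorem cost_realLit (c : ℕ) : RExp.cost (no_index (OfNat.ofNat c)) = 2 := rfl
@[simp] theorem cost_ofNat (e : NExp) : RExp.cost (.ofNat e) = e.cost + 1 := rfl
@[simp] theorem cost_realAdd (e f : RExp) : (e + f).cost = e.cost + f.cost + 1 := rfl
@[simp] theorem cost_realSub (e f : RExp) : (e - f).cost = e.cost + f.cost + 1 := rfl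
@[simp] theorem cost_realMul (e f : RExp) : (e * f).cost = e.cost + f.cost + 1 := rfl
@[simp] theorem cost_realDiv (e f : RExp) : (e / f).cost = e.cost + f.cost + 1 := rfl
@[simp] theorem cost_rv (a : ℕ) : (rv a).cost = 3 := rfl
@[simp] theorem cost_r1 (a : ℕ) (i : NExp) : (r1 a i).cost = i.cost + 1 + 1 := rfl
@[simp] theorem cost_r2 (a : ℕ) (i j : NExp) : (r2 a i j).cost = i.cost + j.cost + 1 := rfl

@[simp] theorem nat_writeNat (a i j x a' i' j' : ℕ) : (s.writeNat a i j x).nat a' i' j' =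
    if a' = a ∧ i' = i ∧ j' = j then x else s.nat a' i' j' := rfl
@[simp] theorem real_writeNat (a i j x : ℕ) : (s.writeNat a i j x).real = s.real := rfl
@[simp] theorem real_writeReal (a i j : ℕ) (x : ℝ) (a' i' j' : ℕ) :
    (s.writeReal a i j x).real a' i' j' =
      if a' = a ∧ i' = i ∧ j' = j then x else s.real a' i' j' := rfl
@[simp] theorem nat_writeReal (a i j : ℕ) (x : ℝ) : (s.writeReal a i j x).nat = s.nat := rfl

@[simp] theorem holds_natLe (e f : NExp) :
    (Test.natLe e f).Holds s ↔ e.eval s ≤ f.eval s := .rfl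
@[simp] theorem holds_realLe (e f : RExp) :
    (Test.realLe e f).Holds s ↔ e.eval s ≤ f.eval s := .rfl
@[simp] theorem holds_neg (p : Test) : (Test.neg p).Holds s ↔ ¬ p.Holds s := .rfl
@[simp] theorem holds_and (p q : Test) :
    (Test.and p q).Holds s ↔ p.Holds s ∧ q.Holds s := .rfl

end Eval

attribute [simp] Test.cost

@[simp] theorem WP_setN {s : Store} {Q : ℕ → Store → Prop} {a : ℕ} {e : NExp} :
    WP (setN a e) s Q ↔ Q (e.cost + 3) (s.writeNat a 0 0 (e.eval s)) := by
  rw [setN, WP_setNat, NExp.cost, show 1 + 1 + e.cost + 1 = e.cost + 3 by omega]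
  rfl

@[simp] theorem WP_setR {s : Store} {Q : ℕ → Store → Prop} {a : ℕ} {e : RExp} :
    WP (setR a e) s Q ↔ Q (e.cost + 3) (s.writeReal a 0 0 (e.eval s)) := by
  rw [setR, WP_setReal, NExp.cost, show 1 + 1 + e.cost + 1 = e.cost + 3 by omega]
  rfl

theorem WP_while {c : Test} {p : Prog} {s : Store} {Q : ℕ → Store → Prop} :
    WP (.while c p) s Q ↔
      (c.Holds s → WP p s fun t s' => WP (.while c p) s' fun t' s'' => Q (c.cost + t + t') s'') ∧
        (¬ c.Holds s → Q c.cost s) := by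
  constructor
  · rintro ⟨t, s', h, hQ⟩
    cases h with
    | whileFalse h1 => exact ⟨fun h => absurd h h1, fun _ => hQ⟩
    | whileTrue h1 h2 h3 => exact ⟨fun _ => ⟨_, _, h2, _, _, h3, hQ⟩, fun h => absurd h1 h⟩
  · rintro ⟨h1, h2⟩
    by_cases hc : c.Holds s
    · obtain ⟨t, s', h, t', s'', h', hQ⟩ := h1 hc
      exact ⟨_, _, .whileTrue hc h h', hQ⟩
    · exact ⟨_, _, .whileFalse hc, h2 hc⟩

/-- Rule for counting loops.  The invariant `Inv m` describes the memory before round `m`; rounds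
may have different costs.  What the loop does not write is known to be unchanged. -/
theorem WP_forP {i : ℕ} {e : NExp} {body : Prog} {s : Store} {Q : ℕ → Store → Prop}
    (A B : List ℕ) (N : ℕ) (c : ℕ → ℕ) (Inv : ℕ → Store → Prop)
    (h0 : Inv 0 (s.writeNat i 0 0 0))
    (hN : ∀ m s', Inv m s' → Frame A B s s' → e.eval s' = N)
    (hb : ∀ m s', m < N → Inv m s' → Frame A B s s' → s'.nat i 0 0 = m →
      WP body s' fun t s'' => t ≤ c m ∧ Inv (m + 1) (s''.writeNat i 0 0 (m + 1)))
    (hQ : ∀ t s', Inv N s' → Frame A B s s' →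
      t ≤ (∑ m ∈ Finset.range N, c m) + (N + 1) * (e.cost + 20) → Q t s')
    (hi : i ∉ body.natW := by decide)
    (hA : i :: body.natW ⊆ A := by decide) (hB : body.realW ⊆ B := by decide) :
    WP (forP i e body) s Q := by
  have hiA : i ∈ A := hA (by simp)
  have hwr : ∀ s' x, Frame A B s s' → Frame A B s (s'.writeNat i 0 0 x) := by
    intro s' x h
    refine ⟨fun a ha => ?_, fun a ha => by simpa using h.real a ha⟩
    rw [Store.writeNat_nat_ne (fun h' : a = i => ha (h' ▸ hiA)), h.nat a ha]
  have key : ∀ k m s', m + k = N → Inv m s' → Frame A B s s' → s'.nat i 0 0 = m →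
      WP (.while (.natLe (nv i + 1) e) (.seq body (setN i (nv i + 1)))) s' fun t s'' =>
        Inv N s'' ∧ Frame A B s s'' ∧
          t ≤ (∑ l ∈ Finset.range k, c (m + l)) + (k + 1) * (e.cost + 20) - 4 := by
    intro k
    induction k with
    | zero =>
      intro m s' hm h1 h2 h3
      rw [WP_while]
      have := hN m s' h1 h2
      refine ⟨fun h => ?_, fun _ => ?_⟩
      · simp [h3] at h
        omega
      · obtain rfl : m = N := by omega
        refine ⟨h1, h2, ?_⟩
        simp
        omega
    | succ k ih =>
      intro m s' hm h1 h2 h3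
      rw [WP_while]
      have := hN m s' h1 h2
      refine ⟨fun _ => ?_, fun h => ?_⟩
      · rw [WP_seq]
        refine (WP.frame body.natW body.realW (hb m s' (by omega) h1 h2 h3) (List.Subset.refl _)
          (List.Subset.refl _)).mono ?_
        rintro t s1 ⟨⟨ht, h4⟩, h5⟩
        have hi' : s1.nat i 0 0 = m := by rw [h5.nat i hi, h3]
        replace h5 : Frame A B s' s1 := h5.mono (fun x hx => hA (by simp [hx])) hB
        simp only [WP_setN, eval_natAdd, eval_nv, hi']
        refine (ih (m + 1) _ (by omega) h4 (hwr _ _ (h2.trans h5)) (by simp)).mono ?_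
        rintro t' s2 ⟨h6, h7, h8⟩
        refine ⟨h6, h7, ?_⟩
        rw [Finset.sum_range_succ']
        have : ∑ l ∈ Finset.range k, c (m + 1 + l) = ∑ l ∈ Finset.range k, c (m + (l + 1)) :=
          Finset.sum_congr rfl fun l _ => by congr 1; omega
        rw [this] at h8
        simp
        have h9 : (k + 1 + 1) * (e.cost + 20) = (k + 1) * (e.cost + 20) + (e.cost + 20) := by ring
        have h10 : (k + 1) * (e.cost + 20) = k * (e.cost + 20) + (e.cost + 20) := by ring
        omega
      · simp [h3] at h
        omega
  rw [forP, WP_seq]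
  simp only [WP_setN]
  refine (key N 0 _ (by omega) h0 (hwr _ _ (.refl _ _ _)) (by simp)).mono ?_
  rintro t s' ⟨h1, h2, h3⟩
  refine hQ _ _ h1 h2 ?_
  simp only [zero_add] at h3
  have h10 : (N + 1) * (e.cost + 20) = N * (e.cost + 20) + (e.cost + 20) := by ring
  simp
  omega

end RealRAM

/-! ### Dynamic programming over a tree of bags -/

open Finset in
/-- If all digits `f c` are smaller than `K`, they can be read off from the number they form. -/
theorem digit_sum_pow {K L c₀ : ℕ} {f : ℕ → ℕ} (hf : ∀ c, f c < K) (hc : c₀ < L) :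
    (∑ c ∈ range L, f c * K ^ c) / K ^ c₀ % K = f c₀ := by
  induction L generalizing f c₀ with
  | zero => omega
  | succ L ih =>
    have hK : 0 < K := lt_of_le_of_lt (Nat.zero_le _) (hf 0)
    rw [sum_range_succ']
    have h1 : ∑ c ∈ range L, f (c + 1) * K ^ (c + 1) = K * ∑ c ∈ range L, f (c + 1) * K ^ c := by
      rw [mul_sum]
      exact sum_congr rfl fun c _ => by ring
    rw [h1, pow_zero, mul_one]
    cases c₀ with
    | zero =>
      rw [pow_zero, Nat.div_one, Nat.mul_add_mod, Nat.mod_eq_of_lt (hf 0)]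
    | succ c₀ =>
      rw [pow_succ', ← Nat.div_div_eq_div_mul, Nat.mul_add_div hK, Nat.div_eq_of_lt (hf 0),
        add_zero]
      exact ih (f := fun c => f (c + 1)) (fun c => hf _) (by omega)

open Finset in
theorem sum_pow_lt {K L : ℕ} {f : ℕ → ℕ} (hf : ∀ c, f c < K) :
    ∑ c ∈ range L, f c * K ^ c < K ^ L := by
  induction L with
  | zero => simp
  | succ L ih =>
    rw [sum_range_succ, pow_succ]
    have : (f L + 1) * K ^ L ≤ K * K ^ L := Nat.mul_le_mul_right _ (hf L)
    nlinarith

open Finset in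
/-- Two codes with `L` digits to base `K` can be added without a carry. -/
def NoCarry (K L a b : ℕ) : Prop :=
  ∃ f g : ℕ → ℕ, (∀ c, f c + g c < K) ∧ a = ∑ c ∈ range L, f c * K ^ c ∧
    b = ∑ c ∈ range L, g c * K ^ c

theorem NoCarry.add_lt {K L a b : ℕ} (h : NoCarry K L a b) : a + b < K ^ L := by
  obtain ⟨f, g, h1, rfl, rfl⟩ := h
  rw [← Finset.sum_add_distrib]
  simp_rw [← add_mul]
  exact sum_pow_lt (f := fun c => f c + g c) h1

/-- A separable optimisation problem whose rows are arranged along a tree.  Variable `j < n` takes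
a choice `c ≤ M`, choice `0` meaning that the variable is switched off; this costs `cst j c` and
contributes `dg r j c` to row `r < R`.  If the contributions to row `r` add up to `d`, then
`pok r d` has to hold, at an additional cost `pen r d`.  The tree has the inner nodes `0, …, k - 1`
and a leaf `k + j` for each variable `j`; `par` points to the parents, `bag t r` says that row `r`
belongs to node `t`, `top r` is the node closest to the root with this property, and `col` colours
the rows with `L` colours. -/
structure TreeDP where
  (n R k K L M : ℕ)
  (top col par : ℕ → ℕ)
  bag : ℕ → ℕ → Prop
  dg : ℕ → ℕ → ℕ → ℕ
  cst : ℕ → ℕ → ℝ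
  pen : ℕ → ℕ → ℝ
  pok : ℕ → ℕ → Prop

namespace TreeDP

open Finset

/-- Variable `j` occurs in row `r`. -/
def Inc (P : TreeDP) (r j : ℕ) : Prop := ∃ c ≤ P.M, P.dg r j c ≠ 0

/-- The properties of the tree, the colouring and the contributions on which the dynamic program
relies: in particular, different rows in a common bag have different colours, and the
contributions to a row add up to less than `K`. -/
structure Valid (P : TreeDP) : Prop where
  par_lt : ∀ s, 0 < s → s < P.k + P.n → P.par s < s
  top_le : ∀ r < P.R, ∀ s < P.k + P.n, P.bag s r → P.top r ≤ s
  top_lt : ∀ r < P.R, P.top r < P.k + P.n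
  bag_top : ∀ r < P.R, P.bag (P.top r) r
  bag_par : ∀ s < P.k + P.n, ∀ r < P.R, P.bag s r → P.top r ≠ s → P.bag (P.par s) r
  bag_leaf : ∀ j < P.n, ∀ r < P.R, P.Inc r j → P.bag (P.k + j) r
  col_inj : ∀ s < P.k + P.n, ∀ r < P.R, ∀ r' < P.R, P.bag s r → P.bag s r' →
    P.col r = P.col r' → r = r'
  col_lt : ∀ r < P.R, P.col r < P.L
  sum_lt : ∀ r < P.R, ∀ x : ℕ → ℕ, (∀ j < P.n, x j ≤ P.M) → ∑ j ∈ range P.n, P.dg r j (x j) < P.K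

/-- The total contribution to row `r` of the variables in `J`. -/
def rowSum (P : TreeDP) (J : Finset ℕ) (x : ℕ → ℕ) (r : ℕ) : ℕ := ∑ j ∈ J, P.dg r j (x j)

/-- If every node `u` has been merged into node `h u`, these are the variables whose leaves have
been merged into `s`. -/
def held (P : TreeDP) (h : ℕ → ℕ) (s : ℕ) : Finset ℕ := (range P.n).filter fun j => h (P.k + j) = s

/-- The partial solutions kept at node `s`, when every node `u` has been merged into node `h u`, and
the rows in `F` are completed.  The code `a` has the sums of the uncompleted rows as its digits, at
the positions given by their colours; `cnt` variables are switched on; the cost `v` comprises the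
penalties of completed rows. -/
structure Sem (P : TreeDP) (h : ℕ → ℕ) (F : Finset ℕ) (s a cnt : ℕ) (v : ℝ) (x : ℕ → ℕ) : Prop where
  supp : ∀ j, j ∉ P.held h s → x j = 0
  le : ∀ j, x j ≤ P.M
  code : a = ∑ r ∈ range P.R \ F, P.rowSum (P.held h s) x r * P.K ^ P.col r
  count : cnt = ((P.held h s).filter fun j => x j ≠ 0).card
  ok : ∀ r ∈ F, h (P.top r) = s → P.pok r (P.rowSum (P.held h s) x r)
  val : v = ∑ j ∈ P.held h s, P.cst j (x j) +
    ∑ r ∈ F.filter fun r => h (P.top r) = s, P.pen r (P.rowSum (P.held h s) x r)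

/-- The situation when all nodes above `t` have been merged, so that `t` comes next, and some of
the rows whose topmost node is `t` have been completed. -/
structure Stage (P : TreeDP) (h : ℕ → ℕ) (F : Finset ℕ) (t : ℕ) : Prop where
  lt : t < P.k + P.n
  le : ∀ u < P.k + P.n, h u ≤ t
  fix : ∀ u ≤ t, h u = u
  sub : ∀ r ∈ F, r < P.R ∧ t ≤ P.top r
  sup : ∀ r < P.R, t < P.top r → r ∈ F
  bag : ∀ j < P.n, ∀ r < P.R, r ∉ F → P.Inc r j → P.bag (h (P.k + j)) r
  eq : ∀ j < P.n, ∀ r ∈ F, P.Inc r j → h (P.k + j) = h (P.top r)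

variable {P : TreeDP} {h : ℕ → ℕ} {F : Finset ℕ} {t s a cnt r : ℕ} {v : ℝ} {x : ℕ → ℕ}

theorem mem_held {j : ℕ} : j ∈ P.held h s ↔ j < P.n ∧ h (P.k + j) = s := by
  simp [held]

theorem Valid.rowSum_lt (hP : P.Valid) {J : Finset ℕ} (hJ : J ⊆ range P.n) (hx : ∀ j, x j ≤ P.M)
    (hr : r < P.R) : P.rowSum J x r < P.K :=
  (sum_le_sum_of_subset hJ).trans_lt (hP.sum_lt r hr x fun j _ => hx j)

theorem held_subset : P.held h s ⊆ range P.n := filter_subset _ _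

theorem exists_inc {J : Finset ℕ} (hx : ∀ j, x j ≤ P.M) (h0 : P.rowSum J x r ≠ 0) :
    ∃ j ∈ J, P.Inc r j := by
  obtain ⟨j, hj, h1⟩ := exists_ne_zero_of_sum_ne_zero h0
  exact ⟨j, hj, x j, hx j, h1⟩

theorem Valid.stage_init (hP : P.Valid) (h0 : 0 < P.k + P.n) :
    P.Stage (fun u => u) ∅ (P.k + P.n - 1) where
  lt := by omega
  le := fun u hu => by omega
  fix := fun u _ => rfl
  sub := by simp
  sup := fun r hr h => by have := hP.top_lt r hr; omega
  bag := fun j hj r hr _ hi => hP.bag_leaf j hj r hr hi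
  eq := by simp

/-- The variables of a row are all held by its topmost node when that node comes next. -/
theorem Stage.held_top (hP : P.Valid) (hS : P.Stage h F t) (hr : r < P.R) (hF : r ∉ F)
    (ht : P.top r = t) {j : ℕ} (hj : j < P.n) (hi : P.Inc r j) : h (P.k + j) = t := by
  have h1 := hS.bag j hj r hr hF hi
  have h2 := hS.le (P.k + j) (by omega)
  have h3 := hP.top_le r hr (h (P.k + j)) (by have := hS.lt; omega) h1
  omega

theorem Stage.complete (hP : P.Valid) (hS : P.Stage h F t) (hr : r < P.R) (hF : r ∉ F)
    (ht : P.top r = t) : P.Stage h (insert r F) t where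
  lt := hS.lt
  le := hS.le
  fix := hS.fix
  sub := by
    intro r' hr'
    rcases mem_insert.1 hr' with rfl | h'
    · exact ⟨hr, ht.ge⟩
    · exact hS.sub r' h'
  sup := fun r' hr' h' => mem_insert_of_mem (hS.sup r' hr' h')
  bag := fun j hj r' hr' h' hi => hS.bag j hj r' hr' (fun h'' => h' (mem_insert_of_mem h'')) hi
  eq := by
    intro j hj r' hr' hi
    rcases mem_insert.1 hr' with rfl | h'
    · rw [hS.held_top hP hr hF ht hj hi, ht, hS.fix t le_rfl]
    · exact hS.eq j hj r' h' hi

/-- The map `h` after merging `t` into its parent. -/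
def mergeMap (P : TreeDP) (h : ℕ → ℕ) (t : ℕ) (u : ℕ) : ℕ := if h u = t then P.par t else h u

theorem Stage.merge (hP : P.Valid) (hS : P.Stage h F t) (ht : 0 < t)
    (hF : ∀ r < P.R, P.top r = t → r ∈ F) : P.Stage (P.mergeMap h t) F (t - 1) where
  lt := by have := hS.lt; omega
  le := by
    intro u hu
    have := hS.le u hu
    have := hP.par_lt t ht hS.lt
    unfold mergeMap
    split_ifs <;> omega
  fix := by
    intro u hu
    have := hS.fix u (by omega)
    unfold mergeMap
    rw [if_neg (by omega), this]
  sub := fun r hr => ⟨(hS.sub r hr).1, by have := (hS.sub r hr).2; omega⟩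
  sup := by
    intro r hr h'
    by_cases h'' : P.top r = t
    · exact hF r hr h''
    · exact hS.sup r hr (by omega)
  bag := by
    intro j hj r hr h' hi
    have h1 := hS.bag j hj r hr h' hi
    unfold mergeMap
    split_ifs with h2
    · rw [h2] at h1
      exact hP.bag_par t hS.lt r hr h1 fun h3 => h' (hF r hr h3)
    · exact h1
  eq := by
    intro j hj r hr hi
    unfold mergeMap
    rw [hS.eq j hj r hr hi]

/-- The digit of the code at position `c`. -/
def slot (P : TreeDP) (F J : Finset ℕ) (x : ℕ → ℕ) (c : ℕ) : ℕ :=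
  ∑ r ∈ (range P.R \ F).filter fun r => P.col r = c, P.rowSum J x r

theorem Valid.code_eq (hP : P.Valid) (J : Finset ℕ) :
    ∑ r ∈ range P.R \ F, P.rowSum J x r * P.K ^ P.col r =
      ∑ c ∈ range P.L, P.slot F J x c * P.K ^ c := by
  rw [← sum_fiberwise_of_maps_to (t := range P.L) (g := P.col)]
  · refine sum_congr rfl fun c _ => ?_
    rw [slot, sum_mul]
    refine sum_congr rfl fun r hr => ?_
    rw [(mem_filter.1 hr).2]
  · intro r hr
    simp only [mem_sdiff, mem_range] at hr
    exact mem_range.2 (hP.col_lt r hr.1)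

/-- At a node, an uncompleted row of colour `c` that has variables there is the only such row. -/
theorem Stage.slot_eq (hP : P.Valid) (hS : P.Stage h F t) {J : Finset ℕ}
    (hJ : ∀ j ∈ J, j < P.n ∧ h (P.k + j) = s) (hs : s < P.k + P.n) (hx : ∀ j, x j ≤ P.M)
    (hr : r < P.R) (hF : r ∉ F) (hb : P.bag s r) :
    P.slot F J x (P.col r) = P.rowSum J x r := by
  refine sum_eq_single_of_mem r (by simp [hr, hF]) fun r' hr' hne => ?_
  by_contra h0
  obtain ⟨j, hj, hi⟩ := exists_inc hx h0
  simp only [mem_filter, mem_sdiff, mem_range] at hr'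
  have h1 := hS.bag j (hJ j hj).1 r' hr'.1.1 hr'.1.2 hi
  rw [(hJ j hj).2] at h1
  exact hne (hP.col_inj s hs r' hr'.1.1 r hr h1 hb hr'.2)

theorem Stage.slot_lt (hP : P.Valid) (hS : P.Stage h F t) {J : Finset ℕ}
    (hJ : ∀ j ∈ J, j < P.n ∧ h (P.k + j) = s) (hK : 0 < P.K) (hs : s < P.k + P.n)
    (hx : ∀ j, x j ≤ P.M) (c : ℕ) : P.slot F J x c < P.K := by
  by_cases h0 : P.slot F J x c = 0
  · omega
  obtain ⟨r, hr, h1⟩ := exists_ne_zero_of_sum_ne_zero h0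
  simp only [mem_filter, mem_sdiff, mem_range] at hr
  obtain ⟨j, hj, hi⟩ := exists_inc hx h1
  have h2 := hS.bag j (hJ j hj).1 r hr.1.1 hr.1.2 hi
  rw [(hJ j hj).2] at h2
  rw [← hr.2, hS.slot_eq hP hJ hs hx hr.1.1 hr.1.2 h2]
  exact hP.rowSum_lt (fun j hj => mem_range.2 (hJ j hj).1) hx hr.1.1

theorem Sem.code_lt (hP : P.Valid) (hS : P.Stage h F t) (hK : 0 < P.K) (hs : s < P.k + P.n)
    (hx : P.Sem h F s a cnt v x) : a < P.K ^ P.L := by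
  rw [hx.code, hP.code_eq]
  exact sum_pow_lt (hS.slot_lt hP (fun j hj => mem_held.1 hj) hK hs hx.le)

theorem Sem.count_le (hx : P.Sem h F s a cnt v x) : cnt ≤ P.n := by
  rw [hx.count]
  refine (card_filter_le _ _).trans ((card_le_card held_subset).trans ?_)
  simp

/-- Completing a row at its topmost node. -/
theorem Stage.sem_complete (hP : P.Valid) (hS : P.Stage h F t) (hr : r < P.R)
    (hF : r ∉ F) (ht : P.top r = t) :
    P.Sem h (insert r F) t a cnt v x ↔ ∃ a₀ v₀, P.Sem h F t a₀ cnt v₀ x ∧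
      P.pok r (a₀ / P.K ^ P.col r % P.K) ∧
      a = a₀ - (a₀ / P.K ^ P.col r % P.K) * P.K ^ P.col r ∧
      v = v₀ + P.pen r (a₀ / P.K ^ P.col r % P.K) := by
  have hdig : (∀ j, x j ≤ P.M) → (∑ r ∈ range P.R \ F,
      P.rowSum (P.held h t) x r * P.K ^ P.col r) / P.K ^ P.col r % P.K
        = P.rowSum (P.held h t) x r := by
    intro hx
    have hK : 0 < P.K := (Nat.zero_le _).trans_lt (hP.rowSum_lt (held_subset (h := h) (s := t)) hx hr)
    rw [hP.code_eq, digit_sum_pow (hS.slot_lt hP (fun j hj => mem_held.1 hj) hK hS.lt hx)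
      (hP.col_lt r hr)]
    exact hS.slot_eq hP (fun j hj => mem_held.1 hj) hS.lt hx hr hF (ht ▸ hP.bag_top r hr)
  have hsum : ∀ f : ℕ → ℕ, ∑ r' ∈ range P.R \ F, f r' = ∑ r' ∈ range P.R \ insert r F, f r' + f r := by
    intro f
    rw [sdiff_insert, sum_erase_add _ _ (by simp [hr, hF])]
  have hpen : ∀ f : ℕ → ℝ, ∑ r' ∈ (insert r F).filter (fun r' => h (P.top r') = t), f r' =
      ∑ r' ∈ F.filter (fun r' => h (P.top r') = t), f r' + f r := by
    intro f
    rw [filter_insert, if_pos (by rw [ht, hS.fix t le_rfl]), sum_insert (by simp [hF]), add_comm]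
  have hht : h (P.top r) = t := by rw [ht, hS.fix t le_rfl]
  constructor
  · intro hx
    refine ⟨_, _, ⟨hx.supp, hx.le, rfl, hx.count, fun r' hr' => hx.ok r' (mem_insert_of_mem hr'),
      rfl⟩, ?_, ?_, ?_⟩
    · rw [hdig hx.le]
      exact hx.ok r (mem_insert_self _ _) hht
    · rw [hdig hx.le, hx.code, hsum]
      omega
    · rw [hdig hx.le, hx.val, hpen]
      ring
  · rintro ⟨a₀, v₀, hx, h1, rfl, rfl⟩
    rw [hx.code, hdig hx.le] at h1 ⊢
    refine ⟨hx.supp, hx.le, ?_, hx.count, ?_, ?_⟩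
    · rw [hsum]
      omega
    · intro r' hr' h2
      rcases mem_insert.1 hr' with rfl | h3
      · exact h1
      · exact hx.ok r' h3 h2
    · rw [hpen, hx.val]
      ring

/-- Completing a row does not matter for the other nodes. -/
theorem Stage.sem_complete_ne (hP : P.Valid) (hS : P.Stage h F t) (hr : r < P.R)
    (hF : r ∉ F) (ht : P.top r = t) (hs : s ≠ t) :
    P.Sem h (insert r F) s a cnt v x ↔ P.Sem h F s a cnt v x := by
  have hht : h (P.top r) = t := by rw [ht, hS.fix t le_rfl]
  have hsum : (∀ j, x j ≤ P.M) → ∑ r' ∈ range P.R \ F, P.rowSum (P.held h s) x r' * P.K ^ P.col r' =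
      ∑ r' ∈ range P.R \ insert r F, P.rowSum (P.held h s) x r' * P.K ^ P.col r' := by
    intro hx
    rw [sdiff_insert, ← sum_erase_add _ _ (show r ∈ range P.R \ F by simp [hr, hF])]
    have : P.rowSum (P.held h s) x r = 0 := by
      by_contra h0
      obtain ⟨j, hj, hi⟩ := exists_inc hx h0
      rw [mem_held] at hj
      exact hs (hj.2.symm.trans (hS.held_top hP hr hF ht hj.1 hi))
    rw [this, zero_mul, add_zero]
  have hfil : (insert r F).filter (fun r' => h (P.top r') = s) =
      F.filter fun r' => h (P.top r') = s := by
    rw [filter_insert, if_neg (by rw [hht]; exact hs.symm)]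
  constructor
  · intro hx
    refine ⟨hx.supp, hx.le, ?_, hx.count, fun r' hr' => hx.ok r' (mem_insert_of_mem hr'), ?_⟩
    · rw [hx.code, hsum hx.le]
    · rw [hx.val, hfil]
  · intro hx
    refine ⟨hx.supp, hx.le, ?_, hx.count, ?_, ?_⟩
    · rw [hx.code, hsum hx.le]
    · intro r' hr' h2
      rcases mem_insert.1 hr' with rfl | h3
      · exact absurd (h2.symm.trans hht) hs
      · exact hx.ok r' h3 h2
    · rw [hx.val, hfil]

theorem held_mergeMap_ne (h1 : s ≠ P.par t) (h2 : s ≠ t) :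
    P.held (P.mergeMap h t) s = P.held h s := by
  refine filter_congr fun j _ => ?_
  unfold mergeMap
  split_ifs with h3
  · rw [h3]
    exact ⟨fun h => absurd h.symm h1, fun h => absurd h.symm h2⟩
  · rfl

theorem mergeMap_eq_iff_ne {u : ℕ} (h1 : s ≠ P.par t) (h2 : s ≠ t) :
    P.mergeMap h t u = s ↔ h u = s := by
  unfold mergeMap
  split_ifs with h3
  · rw [h3]
    exact ⟨fun h => absurd h.symm h1, fun h => absurd h.symm h2⟩
  · rfl

/-- Merging `t` into its parent does not matter for the other nodes. -/
theorem sem_merge_ne (h1 : s ≠ P.par t) (h2 : s ≠ t) :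
    P.Sem (P.mergeMap h t) F s a cnt v x ↔ P.Sem h F s a cnt v x := by
  have h3 := held_mergeMap_ne (h := h) h1 h2
  have h4 : ∀ u, P.mergeMap h t u = s ↔ h u = s := fun u => mergeMap_eq_iff_ne h1 h2
  constructor <;> rintro ⟨a1, a2, a3, a4, a5, a6⟩
  · simp only [h3, h4] at a1 a3 a4 a5 a6
    exact ⟨a1, a2, a3, a4, a5, a6⟩
  · refine ⟨?_, a2, ?_, ?_, ?_, ?_⟩ <;> simp only [h3, h4] <;> assumption

theorem mergeMap_eq_par {u : ℕ} : P.mergeMap h t u = P.par t ↔ h u = P.par t ∨ h u = t := by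
  unfold mergeMap
  split_ifs with h3 <;> simp [h3]

theorem held_mergeMap_par : P.held (P.mergeMap h t) (P.par t) = P.held h (P.par t) ∪ P.held h t := by
  ext j
  simp only [mem_held, mem_union, mergeMap_eq_par]
  tauto

theorem disjoint_held (h1 : s ≠ t) : Disjoint (P.held h s) (P.held h t) := by
  rw [disjoint_left]
  intro j hj hj'
  rw [mem_held] at hj hj'
  exact h1 (hj.2.symm.trans hj'.2)

theorem rowSum_union {J J' : Finset ℕ} (hJ : Disjoint J J') :
    P.rowSum (J ∪ J') x r = P.rowSum J x r + P.rowSum J' x r := sum_union hJ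

theorem rowSum_congr {J : Finset ℕ} {x' : ℕ → ℕ} (h1 : ∀ j ∈ J, x j = x' j) :
    P.rowSum J x r = P.rowSum J x' r := sum_congr rfl fun j hj => by rw [h1 j hj]

theorem sum_filter_or_eq {ι : Type*} [DecidableEq ι] {A : Finset ι} {g : ι → ℕ} {p : ℕ} (h1 : p ≠ t)
    (f : ι → ℝ) : ∑ r ∈ A.filter (fun r => g r = p ∨ g r = t), f r =
      ∑ r ∈ A.filter (fun r => g r = p), f r + ∑ r ∈ A.filter (fun r => g r = t), f r := by
  rw [filter_or, sum_union]
  rw [disjoint_filter]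
  intro r _ h2 h3
  exact h1 (h2.symm.trans h3)

theorem rowSum_completed (hS : P.Stage h F t) {J : Finset ℕ} (hx : ∀ j, x j ≤ P.M) (hr : r ∈ F)
    (hJ : ∀ j ∈ J, j < P.n ∧ h (P.k + j) ≠ h (P.top r)) : P.rowSum J x r = 0 := by
  by_contra h0
  obtain ⟨j, hj, hi⟩ := exists_inc hx h0
  exact (hJ j hj).2 (hS.eq j (hJ j hj).1 r hr hi)

/-- The partial solutions at the parent, after `t` has been merged into it. -/
theorem Stage.sem_merge (hP : P.Valid) (hS : P.Stage h F t) (hK : 0 < P.K) (ht : 0 < t)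
    (hF : ∀ r < P.R, P.top r = t → r ∈ F) :
    P.Sem (P.mergeMap h t) F (P.par t) a cnt v x ↔ ∃ a₁ c₁ v₁ x₁ a₂ c₂ v₂ x₂,
      P.Sem h F (P.par t) a₁ c₁ v₁ x₁ ∧ P.Sem h F t a₂ c₂ v₂ x₂ ∧ NoCarry P.K P.L a₁ a₂ ∧
      a = a₁ + a₂ ∧ cnt = c₁ + c₂ ∧ v = v₁ + v₂ ∧ x = x₁ + x₂ := by
  have hlt := hP.par_lt t ht hS.lt
  have hdis := disjoint_held (P := P) (h := h) (s := P.par t) (t := t) hlt.ne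
  have hu := held_mergeMap_par (P := P) (h := h) (t := t)
  have h4 : ∀ u, P.mergeMap h t u = P.par t ↔ h u = P.par t ∨ h u = t := fun u => mergeMap_eq_par
  have hS' := hS.merge hP ht hF
  have hpar : ∀ y : ℕ → ℕ, (∀ j, y j ≤ P.M) → ∀ r ∈ F, h (P.top r) = P.par t →
      P.rowSum (P.held h t) y r = 0 := by
    intro y hy r hr h1
    refine rowSum_completed hS hy hr fun j hj => ?_
    rw [mem_held] at hj
    exact ⟨hj.1, by rw [hj.2, h1]; exact hlt.ne'⟩
  have hcld : ∀ y : ℕ → ℕ, (∀ j, y j ≤ P.M) → ∀ r ∈ F, h (P.top r) = t →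
      P.rowSum (P.held h (P.par t)) y r = 0 := by
    intro y hy r hr h1
    refine rowSum_completed hS hy hr fun j hj => ?_
    rw [mem_held] at hj
    exact ⟨hj.1, by rw [hj.2, h1]; exact hlt.ne⟩
  constructor
  · intro hx
    set x₁ : ℕ → ℕ := fun j => if j ∈ P.held h (P.par t) then x j else 0 with hx₁
    set x₂ : ℕ → ℕ := fun j => if j ∈ P.held h t then x j else 0 with hx₂
    have e1 : ∀ j ∈ P.held h (P.par t), x₁ j = x j := fun j hj => by simp [hx₁, hj]
    have e2 : ∀ j ∈ P.held h t, x₂ j = x j := fun j hj => by simp [hx₂, hj]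
    have l1 : ∀ j, x₁ j ≤ P.M := fun j => by
      simp only [hx₁]; split_ifs; exacts [hx.le j, Nat.zero_le _]
    have l2 : ∀ j, x₂ j ≤ P.M := fun j => by
      simp only [hx₂]; split_ifs; exacts [hx.le j, Nat.zero_le _]
    have s1 : ∀ r, P.rowSum (P.held h (P.par t)) x₁ r = P.rowSum (P.held h (P.par t)) x r :=
      fun r => rowSum_congr e1
    have s2 : ∀ r, P.rowSum (P.held h t) x₂ r = P.rowSum (P.held h t) x r :=
      fun r => rowSum_congr e2
    refine ⟨_, _, _, x₁, _, _, _, x₂, ⟨fun j hj => by simp [hx₁, hj], l1, rfl, rfl, ?_, rfl⟩,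
      ⟨fun j hj => by simp [hx₂, hj], l2, rfl, rfl, ?_, rfl⟩, ?_, ?_, ?_, ?_, ?_⟩
    · intro r hr h1
      have := hx.ok r hr ((h4 _).2 (Or.inl h1))
      rwa [hu, rowSum_union hdis, hpar x hx.le r hr h1, add_zero, ← s1] at this
    · intro r hr h1
      have := hx.ok r hr ((h4 _).2 (Or.inr h1))
      rwa [hu, rowSum_union hdis, hcld x hx.le r hr h1, zero_add, ← s2] at this
    · refine ⟨P.slot F (P.held h (P.par t)) x, P.slot F (P.held h t) x, ?_, ?_, ?_⟩
      · intro c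
        have := hS'.slot_lt hP (J := P.held (P.mergeMap h t) (P.par t)) (s := P.par t)
          (fun j hj => mem_held.1 hj) hK (hlt.trans hS.lt) hx.le c
        rw [hu] at this
        refine lt_of_eq_of_lt ?_ this
        rw [slot, slot, slot, ← sum_add_distrib]
        exact sum_congr rfl fun r _ => (rowSum_union hdis).symm
      · simp only [s1, hP.code_eq]
      · simp only [s2, hP.code_eq]
    · rw [hx.code, hu, ← sum_add_distrib]
      refine sum_congr rfl fun r _ => ?_
      rw [rowSum_union hdis, s1, s2, add_mul]
    · rw [hx.count, hu, filter_union, card_union_of_disjoint (disjoint_filter_filter hdis)]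
      congr 2
      · exact filter_congr fun j hj => by rw [e1 j hj]
      · exact filter_congr fun j hj => by rw [e2 j hj]
    · rw [hx.val, hu, sum_union hdis]
      simp only [h4]
      rw [sum_filter_or_eq hlt.ne]
      have q1 : ∑ j ∈ P.held h (P.par t), P.cst j (x₁ j) = ∑ j ∈ P.held h (P.par t), P.cst j (x j) :=
        sum_congr rfl fun j hj => by rw [e1 j hj]
      have q2 : ∑ j ∈ P.held h t, P.cst j (x₂ j) = ∑ j ∈ P.held h t, P.cst j (x j) :=
        sum_congr rfl fun j hj => by rw [e2 j hj]
      have q3 : ∑ r ∈ F.filter (fun r => h (P.top r) = P.par t),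
          P.pen r (P.rowSum (P.held h (P.par t) ∪ P.held h t) x r) =
          ∑ r ∈ F.filter (fun r => h (P.top r) = P.par t),
            P.pen r (P.rowSum (P.held h (P.par t)) x₁ r) := by
        refine sum_congr rfl fun r hr => ?_
        rw [mem_filter] at hr
        rw [rowSum_union hdis, hpar x hx.le r hr.1 hr.2, add_zero, s1]
      have q4 : ∑ r ∈ F.filter (fun r => h (P.top r) = t),
          P.pen r (P.rowSum (P.held h (P.par t) ∪ P.held h t) x r) =
          ∑ r ∈ F.filter (fun r => h (P.top r) = t),
            P.pen r (P.rowSum (P.held h t) x₂ r) := by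
        refine sum_congr rfl fun r hr => ?_
        rw [mem_filter] at hr
        rw [rowSum_union hdis, hcld x hx.le r hr.1 hr.2, zero_add, s2]
      rw [q1, q2, q3, q4]
      ring
    · funext j
      simp only [Pi.add_apply, hx₁, hx₂]
      by_cases j1 : j ∈ P.held h (P.par t)
      · simp [j1, disjoint_left.1 hdis j1]
      · by_cases j2 : j ∈ P.held h t
        · simp [j1, j2]
        · simp [j1, j2, hx.supp j (by rw [hu, mem_union]; tauto)]
  · rintro ⟨a₁, c₁, v₁, x₁, a₂, c₂, v₂, x₂, y1, y2, -, rfl, rfl, rfl, rfl⟩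
    have e1 : ∀ j ∈ P.held h (P.par t), (x₁ + x₂) j = x₁ j := fun j hj => by
      simp [y2.supp j (disjoint_left.1 hdis hj)]
    have e2 : ∀ j ∈ P.held h t, (x₁ + x₂) j = x₂ j := fun j hj => by
      simp [y1.supp j (disjoint_right.1 hdis hj)]
    have le : ∀ j, (x₁ + x₂) j ≤ P.M := by
      intro j
      by_cases j1 : j ∈ P.held h (P.par t)
      · rw [e1 j j1]; exact y1.le j
      · simp only [Pi.add_apply, y1.supp j j1, zero_add]; exact y2.le j
    have s1 : ∀ r, P.rowSum (P.held h (P.par t)) (x₁ + x₂) r = P.rowSum (P.held h (P.par t)) x₁ r :=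
      fun r => rowSum_congr e1
    have s2 : ∀ r, P.rowSum (P.held h t) (x₁ + x₂) r = P.rowSum (P.held h t) x₂ r :=
      fun r => rowSum_congr e2
    have su : ∀ r, P.rowSum (P.held h (P.par t) ∪ P.held h t) (x₁ + x₂) r =
        P.rowSum (P.held h (P.par t)) x₁ r + P.rowSum (P.held h t) x₂ r := fun r => by
      rw [rowSum_union hdis, s1, s2]
    refine ⟨?_, le, ?_, ?_, ?_, ?_⟩
    · intro j hj
      rw [hu, mem_union] at hj
      simp [y1.supp j (fun h => hj (Or.inl h)), y2.supp j (fun h => hj (Or.inr h))]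
    · rw [y1.code, y2.code, hu, ← sum_add_distrib]
      exact sum_congr rfl fun r _ => by rw [su, add_mul]
    · rw [y1.count, y2.count, hu, filter_union, card_union_of_disjoint (disjoint_filter_filter hdis)]
      congr 2
      · exact filter_congr fun j hj => by rw [e1 j hj]
      · exact filter_congr fun j hj => by rw [e2 j hj]
    · intro r hr h1
      rw [hu, su]
      rcases (h4 _).1 h1 with h2 | h2
      · rw [hpar x₂ y2.le r hr h2, add_zero]
        exact y1.ok r hr h2
      · rw [hcld x₁ y1.le r hr h2, zero_add]
        exact y2.ok r hr h2
    · rw [y1.val, y2.val, hu, sum_union hdis]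
      simp only [h4, su]
      rw [sum_filter_or_eq hlt.ne]
      have q1 : ∑ j ∈ P.held h (P.par t), P.cst j ((x₁ + x₂) j) =
          ∑ j ∈ P.held h (P.par t), P.cst j (x₁ j) := sum_congr rfl fun j hj => by rw [e1 j hj]
      have q2 : ∑ j ∈ P.held h t, P.cst j ((x₁ + x₂) j) = ∑ j ∈ P.held h t, P.cst j (x₂ j) :=
        sum_congr rfl fun j hj => by rw [e2 j hj]
      have q3 : ∑ r ∈ F.filter (fun r => h (P.top r) = P.par t),
          P.pen r (P.rowSum (P.held h (P.par t)) x₁ r + P.rowSum (P.held h t) x₂ r) =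
          ∑ r ∈ F.filter (fun r => h (P.top r) = P.par t),
            P.pen r (P.rowSum (P.held h (P.par t)) x₁ r) := by
        refine sum_congr rfl fun r hr => ?_
        rw [mem_filter] at hr
        rw [hpar x₂ y2.le r hr.1 hr.2, add_zero]
      have q4 : ∑ r ∈ F.filter (fun r => h (P.top r) = t),
          P.pen r (P.rowSum (P.held h (P.par t)) x₁ r + P.rowSum (P.held h t) x₂ r) =
          ∑ r ∈ F.filter (fun r => h (P.top r) = t),
            P.pen r (P.rowSum (P.held h t) x₂ r) := by
        refine sum_congr rfl fun r hr => ?_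
        rw [mem_filter] at hr
        rw [hcld x₁ y1.le r hr.1 hr.2, zero_add]
      rw [q1, q2, q3, q4]
      ring

/-- The partial solutions at an inner node at the beginning. -/
theorem sem_init_inner (ht : s < P.k) :
    P.Sem (fun u => u) ∅ s a cnt v x ↔ a = 0 ∧ cnt = 0 ∧ v = 0 ∧ x = 0 := by
  have h1 : P.held (fun u => u) s = ∅ := by
    ext j
    simp only [mem_held, notMem_empty, iff_false, not_and]
    omega
  constructor
  · rintro ⟨a1, a2, a3, a4, a5, a6⟩
    simp only [h1] at a1 a3 a4 a6
    exact ⟨by simpa [rowSum] using a3, by simpa using a4, by simpa using a6, funext fun j => by simpa using a1 j⟩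
  · rintro ⟨rfl, rfl, rfl, rfl⟩
    constructor <;> simp [h1, rowSum]

/-- The partial solutions at a leaf at the beginning. -/
theorem sem_init_leaf {j : ℕ} (hj : j < P.n) :
    P.Sem (fun u => u) ∅ (P.k + j) a cnt v x ↔ ∃ c ≤ P.M,
      a = ∑ r ∈ range P.R, P.dg r j c * P.K ^ P.col r ∧ cnt = (if c = 0 then 0 else 1) ∧
      v = P.cst j c ∧ x = fun j' => if j' = j then c else 0 := by
  have h1 : P.held (fun u => u) (P.k + j) = {j} := by
    ext j'
    simp only [mem_held, mem_singleton]
    omega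
  constructor
  · rintro ⟨a1, a2, a3, a4, a5, a6⟩
    simp only [h1] at a1 a3 a4 a6
    refine ⟨x j, a2 j, by simpa [rowSum] using a3, ?_, by simpa using a6, funext fun j' => ?_⟩
    · rw [a4, filter_singleton]
      by_cases h2 : x j = 0 <;> simp [h2]
    · split_ifs with h2
      · rw [h2]
      · exact a1 j' (by simpa using h2)
  · rintro ⟨c, hc, rfl, rfl, rfl, rfl⟩
    refine ⟨?_, ?_, ?_, ?_, ?_, ?_⟩
    · intro j' hj'
      rw [h1, mem_singleton] at hj'
      simp [hj']
    · intro j'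
      split_ifs <;> omega
    · simp [h1, rowSum]
    · rw [h1, filter_singleton]
      by_cases h2 : c = 0 <;> simp [h2]
    · simp
    · simp [h1]

/-- At the root, when everything has been merged and completed, the partial solutions are the
solutions. -/
theorem Stage.sem_final (hP : P.Valid) (hS : P.Stage h F 0) (hF : ∀ r < P.R, r ∈ F) :
    P.Sem h F 0 a cnt v x ↔ (∀ j, P.n ≤ j → x j = 0) ∧ (∀ j, x j ≤ P.M) ∧ a = 0 ∧
      cnt = ((range P.n).filter fun j => x j ≠ 0).card ∧
      (∀ r < P.R, P.pok r (P.rowSum (range P.n) x r)) ∧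
      v = ∑ j ∈ range P.n, P.cst j (x j) + ∑ r ∈ range P.R, P.pen r (P.rowSum (range P.n) x r) := by
  have hF' : F = range P.R := by
    ext r
    exact ⟨fun h => mem_range.2 (hS.sub r h).1, fun h => hF r (mem_range.1 h)⟩
  have h1 : P.held h 0 = range P.n := by
    refine filter_true_of_mem fun j hj => ?_
    rw [mem_range] at hj
    exact Nat.le_zero.1 (hS.le _ (by omega))
  have h2 : ∀ r < P.R, h (P.top r) = 0 := fun r hr => Nat.le_zero.1 (hS.le _ (hP.top_lt r hr))
  subst hF'
  have h3 : (range P.R).filter (fun r => h (P.top r) = 0) = range P.R :=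
    filter_true_of_mem fun r hr => h2 r (mem_range.1 hr)
  constructor
  · rintro ⟨a1, a2, a3, a4, a5, a6⟩
    rw [h1] at a1 a3 a4 a5 a6
    rw [h3] at a6
    exact ⟨fun j hj => a1 j (by simpa using hj), a2, by simpa using a3, a4,
      fun r hr => a5 r (mem_range.2 hr) (h2 r hr), a6⟩
  · rintro ⟨a1, a2, a3, a4, a5, a6⟩
    refine ⟨?_, a2, ?_, ?_, ?_, ?_⟩
    · rw [h1]
      exact fun j hj => a1 j (by simpa using hj)
    · simpa using a3
    · rw [h1]
      exact a4
    · rw [h1]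
      exact fun r hr _ => a5 r (mem_range.1 hr)
    · rw [h1, h3]
      exact a6

end TreeDP

/-! ### The tables of the dynamic program -/

/-!
Names for the arrays of the memory; the arrays up to number 9 hold the input and the output.

* The rows and the tree: `arrR` and `arrL` hold the numbers of rows and of colours, `arrTop` and
  `arrCol` the topmost node and the colour of each row, `arrPar` the parent pointers of the nodes and
  leaves. During the colouring, `arrDone` marks the coloured rows and `arrUsed` the forbidden colours.
* The rounded problem: `arrK`, `arrM` and `arrS` hold the number of digits, of intervals and of codes,
  `arrPow` the powers of the number of digits, `arrCode` and `reaCst` the code and the cost of each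
  choice, `arrPok` and `reaPen` the admissibility and the penalty of each rounded sum of a row.
  Row `c` of `arrPairA` and `arrPairB` lists the pairs of codes with `c` digits that can be added without
  a carry, and `arrLen` holds its length.
* The tables: a table of a node consists of `arrS` consecutive rows of `arrOk` (occupied entries),
  `reaVal` (costs) and `arrSol` (solutions), one for each code, starting at the row stored in
  `arrLoc`. The columns are the numbers of variables that are switched on; the solution of column `c`
  starts at cell `c * n`, which is looked up in `arrMul`. Rows from `arrFree` on are unused. For each
  entry, `arrRowA`, `arrCntA`, `arrRowB` and `arrCntB` locate the two entries it was made from.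
* `varRow`, …, `varCntB` and `reaEx` are the operands of `relax`, and the names that begin with `ctr`
  are loop counters. The remaining arrays are local variables.
-/

namespace RealRAM

notation "arrR" => 10
notation "arrTop" => 11
notation "arrCol" => 12
notation "arrDone" => 13
notation "arrUsed" => 14
notation "arrL" => 15
notation "arrPar" => 16
notation "arrK" => 17
notation "arrM" => 18
notation "arrPow" => 19
notation "arrCode" => 20
notation "arrPok" => 21
notation "arrPairA" => 22
notation "arrPairB" => 23
notation "arrLen" => 24
notation "arrMul" => 25
notation "arrOk" => 26
notation "arrSol" => 27
notation "arrLoc" => 28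
notation "arrFree" => 29
notation "arrS" => 30
notation "arrRowA" => 31
notation "arrCntA" => 32
notation "arrRowB" => 33
notation "arrCntB" => 34
notation "arrDig" => 35
notation "arrAcc" => 36
notation "arrKp" => 37
notation "arrD" => 38
notation "arrLo" => 39
notation "arrOff" => 40
notation "arrT" => 41
notation "varRow" => 42
notation "varCnt" => 43
notation "varRowA" => 44
notation "varCntA" => 45
notation "varRowB" => 46
notation "varCntB" => 47
notation "ctrT" => 50
notation "ctrR" => 51
notation "ctrA" => 52
notation "ctrC" => 53
notation "ctrJ" => 54
notation "ctrI" => 55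
notation "ctrX" => 56
notation "ctrY" => 57
notation "reaCst" => 16
notation "reaPen" => 17
notation "reaVal" => 19
notation "reaEx" => 24

/-- A nonempty list of programs, run one after the other. -/
def seqs : List Prog → Prog
  | [] => .skip
  | [p] => p
  | p :: q :: l => .seq p (seqs (q :: l))

@[simp] theorem WP_seqs_singleton {p : Prog} {s : Store} {Q : ℕ → Store → Prop} :
    WP (seqs [p]) s Q ↔ WP p s Q := .rfl

@[simp] theorem WP_seqs_cons {p q : Prog} {l : List Prog} {s : Store} {Q : ℕ → Store → Prop} :
    WP (seqs (p :: q :: l)) s Q ↔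
      WP p s fun t s' => WP (seqs (q :: l)) s' fun t' s'' => Q (t + t') s'' := by
  rw [seqs, WP_seq]

theorem Frame.writeNat {A B : List ℕ} {s s' : Store} {a i j x : ℕ} (h : Frame A B s s')
    (ha : a ∈ A := by decide) : Frame A B s (s'.writeNat a i j x) :=
  ⟨fun b hb => by rw [Store.writeNat_nat_ne (fun h' : b = a => hb (h' ▸ ha)), h.nat b hb],
    fun b hb => by rw [real_writeNat, h.real b hb]⟩

theorem Frame.writeReal {A B : List ℕ} {s s' : Store} {a i j : ℕ} {x : ℝ} (h : Frame A B s s')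
    (ha : a ∈ B := by decide) : Frame A B s (s'.writeReal a i j x) :=
  ⟨fun b hb => by rw [nat_writeReal, h.nat b hb],
    fun b hb => by rw [Store.writeReal_real_ne (fun h' : b = a => hb (h' ▸ ha)), h.real b hb]⟩

theorem for_cost {t N c d A : ℕ} (h : t ≤ ∑ _m ∈ Finset.range N, c + (N + 1) * d)
    (hA : c + d ≤ A) : t ≤ (N + 1) * A := by
  rw [Finset.sum_const, Finset.card_range, smul_eq_mul] at h
  have h1 := Nat.mul_le_mul_left (N + 1) hA
  nlinarith

/-- If the entries `(varRowA, varCntA)` and `(varRowB, varCntB)` are occupied, and adding their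
values and the extra cost improves on the entry `(varRow, varCnt)`, update the latter. -/
def relax : Prog :=
  .ite (.and (.natLe 1 (n2 arrOk (nv varRowA) (nv varCntA)))
      (.and (.natLe 1 (n2 arrOk (nv varRowB) (nv varCntB)))
        (.neg (.and (.natLe 1 (n2 arrOk (nv varRow) (nv varCnt)))
          (.realLe (r2 reaVal (nv varRow) (nv varCnt))
            (r2 reaVal (nv varRowA) (nv varCntA) + r2 reaVal (nv varRowB) (nv varCntB) +
              rv reaEx))))))
    (.seq (.setReal reaVal (nv varRow) (nv varCnt)
        (r2 reaVal (nv varRowA) (nv varCntA) + r2 reaVal (nv varRowB) (nv varCntB) + rv reaEx))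
      (.seq (.setNat arrOk (nv varRow) (nv varCnt) 1)
        (.seq (.setNat arrRowA (nv varRow) (nv varCnt) (nv varRowA))
          (.seq (.setNat arrCntA (nv varRow) (nv varCnt) (nv varCntA))
            (.seq (.setNat arrRowB (nv varRow) (nv varCnt) (nv varRowB))
              (.setNat arrCntB (nv varRow) (nv varCnt) (nv varCntB)))))))
    .skip

/-- The candidates `C a c v ra ca rb cb` (value `v` for entry `(a, c)`, made from the entries
`(ra, ca)` and `(rb, cb)`) have been taken into account in the table at `f`: each occupied entry is
a candidate, and no candidate is better. -/
def Best (S n : ℕ) (s : Store) (f : ℕ) (C : ℕ → ℕ → ℝ → ℕ → ℕ → ℕ → ℕ → Prop) : Prop :=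
  ∀ a < S, ∀ c ≤ n,
    (s.nat arrOk (f + a) c ≠ 0 → C a c (s.real reaVal (f + a) c) (s.nat arrRowA (f + a) c)
      (s.nat arrCntA (f + a) c) (s.nat arrRowB (f + a) c) (s.nat arrCntB (f + a) c)) ∧
    ∀ v ra ca rb cb, C a c v ra ca rb cb →
      s.nat arrOk (f + a) c ≠ 0 ∧ s.real reaVal (f + a) c ≤ v

theorem Best.congr {S n f : ℕ} {s s' : Store} {C C' : ℕ → ℕ → ℝ → ℕ → ℕ → ℕ → ℕ → Prop}
    (h : Best S n s f C) (hs : Frame [27, 28, 29, 38, 39, 40, 41, 42, 43, 44, 45, 46, 47, 50, 51, 52,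
      53, 54, 55, 56, 57] [24] s s')
    (hC : ∀ a c v ra ca rb cb, C a c v ra ca rb cb ↔ C' a c v ra ca rb cb) :
    Best S n s' f C' := by
  intro a ha c hc
  have := h a ha c hc
  simp only [hC] at this
  simpa [hs.nat, hs.real] using this

/-- The two memories agree on the table rows outside `f, …, f + S - 1`. -/
def SameRows (S f : ℕ) (s s' : Store) : Prop :=
  ∀ row, row < f ∨ f + S ≤ row → s'.nat arrOk row = s.nat arrOk row ∧
    s'.real reaVal row = s.real reaVal row ∧ s'.nat arrSol row = s.nat arrSol row

theorem SameRows.refl (S f : ℕ) (s : Store) : SameRows S f s s := fun _ _ => ⟨rfl, rfl, rfl⟩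

theorem SameRows.trans {S f : ℕ} {s s' s'' : Store} (h : SameRows S f s s')
    (h' : SameRows S f s' s'') : SameRows S f s s'' := fun row hr =>
  ⟨(h' row hr).1.trans (h row hr).1, (h' row hr).2.1.trans (h row hr).2.1,
    (h' row hr).2.2.trans (h row hr).2.2⟩

theorem SameRows.of_frame {S f : ℕ} {s s' : Store} {A B : List ℕ} (h : Frame A B s s')
    (h1 : arrOk ∉ A := by decide) (h2 : arrSol ∉ A := by decide) (h3 : reaVal ∉ B := by decide) :
    SameRows S f s s' :=
  fun row _ => ⟨by rw [h.nat _ h1], by rw [h.real _ h3], by rw [h.nat _ h2]⟩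

theorem relax_spec {S n f a₀ c₀ : ℕ} {s : Store} {C : ℕ → ℕ → ℝ → ℕ → ℕ → ℕ → ℕ → Prop}
    (hrow : s.nat varRow 0 0 = f + a₀) (hcnt : s.nat varCnt 0 0 = c₀) (ha : a₀ < S)
    (h : Best S n s f C) :
    WP relax s fun t s' => t ≤ 200 ∧ SameRows S f s s' ∧
      Best S n s' f fun a c v ra ca rb cb => C a c v ra ca rb cb ∨ (a = a₀ ∧ c = c₀ ∧
        ra = s.nat varRowA 0 0 ∧ ca = s.nat varCntA 0 0 ∧
        rb = s.nat varRowB 0 0 ∧ cb = s.nat varCntB 0 0 ∧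
        s.nat arrOk ra ca ≠ 0 ∧ s.nat arrOk rb cb ≠ 0 ∧
        v = s.real reaVal ra ca + s.real reaVal rb cb + s.real reaEx 0 0) := by
  rw [relax, WP_ite]
  simp only [holds_and, holds_natLe, holds_neg, holds_realLe, eval_natLit, eval_n2, eval_nv,
    eval_r2, eval_realAdd, eval_rv, hrow, hcnt]
  constructor
  · rintro ⟨h1, h2, h3⟩
    simp only [WP_seq, WP_setReal, WP_setNat]
    refine ⟨by simp, ?_, ?_⟩
    · intro row hr
      have : row ≠ f + a₀ := by omega
      refine ⟨?_, ?_, ?_⟩ <;> funext c <;> simp [hrow, this]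
    · intro a ha c hc
      obtain ⟨b1, b2⟩ := h a ha c hc
      by_cases hac : a = a₀ ∧ c = c₀
      · obtain ⟨rfl, rfl⟩ := hac
        constructor
        · intro _
          right
          simp [hrow, hcnt]
          omega
        · rintro v ra ca rb cb (h4 | ⟨-, -, rfl, rfl, rfl, rfl, -, -, rfl⟩)
          · have := b2 v ra ca rb cb h4
            simp only [not_and, not_le] at h3
            have := h3 (by omega)
            simp [hrow, hcnt]
            linarith
          · simp [hrow, hcnt]
      · have hac' : ¬ (f + a = f + a₀ ∧ c = c₀) := fun h => hac ⟨by omega, h.2⟩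
        constructor
        · intro h5
          left
          simp [hrow, hcnt, hac] at h5 ⊢
          exact b1 h5
        · rintro v ra ca rb cb (h4 | h4)
          · simpa [hrow, hcnt, hac] using b2 v ra ca rb cb h4
          · exact absurd ⟨h4.1, h4.2.1⟩ hac
  · intro h1
    simp only [WP_skip]
    refine ⟨by simp, SameRows.refl _ _ _, ?_⟩
    intro a ha c hc
    obtain ⟨b1, b2⟩ := h a ha c hc
    refine ⟨fun h => Or.inl (b1 h), ?_⟩
    rintro v ra ca rb cb (h4 | ⟨rfl, rfl, rfl, rfl, rfl, rfl, h5, h6, rfl⟩)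
    · exact b2 v ra ca rb cb h4
    · have h7 : ¬ ¬ _ := fun h' => h1 ⟨Nat.one_le_iff_ne_zero.2 h5, Nat.one_le_iff_ne_zero.2 h6, h'⟩
      rw [not_not] at h7
      exact ⟨Nat.one_le_iff_ne_zero.1 h7.1, h7.2⟩

/-- The solution stored with the table entry `(row, c)`. -/
def sol (n : ℕ) (s : Store) (row c j : ℕ) : ℕ := if j < n then s.nat arrSol row (c * n + j) else 0

/-- For each entry of the new table, add the solutions of the two entries it was made from. -/
def copySol : Prog :=
  forP ctrA (nv arrS) (forP ctrC (nv 0 + 1) (forP ctrJ (nv 0)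
    (.setNat arrSol (nv arrFree + nv ctrA) (n1 arrMul (nv ctrC) + nv ctrJ)
      (n2 arrSol (n2 arrRowA (nv arrFree + nv ctrA) (nv ctrC))
          (n1 arrMul (n2 arrCntA (nv arrFree + nv ctrA) (nv ctrC)) + nv ctrJ) +
        n2 arrSol (n2 arrRowB (nv arrFree + nv ctrA) (nv ctrC))
          (n1 arrMul (n2 arrCntB (nv arrFree + nv ctrA) (nv ctrC)) + nv ctrJ)))))

/-- The entry `(row, c)` contains the sum of the solutions of the entries it was made from. -/
def SolAt (n : ℕ) (s : Store) (row c j : ℕ) : Prop :=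
  s.nat arrSol row (c * n + j) =
    s.nat arrSol (s.nat arrRowA row c) (s.nat arrCntA row c * n + j) +
    s.nat arrSol (s.nat arrRowB row c) (s.nat arrCntB row c * n + j)

theorem mul_add_inj {n c c' j j' : ℕ} (hj : j < n) (hj' : j' < n) (h : c * n + j = c' * n + j') :
    c = c' ∧ j = j' := by
  have h1 : c = c' := by
    have e1 : (c * n + j) / n = c := by
      rw [mul_comm, Nat.mul_add_div (by omega), Nat.div_eq_of_lt hj, add_zero]
    have e2 : (c' * n + j') / n = c' := by
      rw [mul_comm, Nat.mul_add_div (by omega), Nat.div_eq_of_lt hj', add_zero]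
    rw [← e1, ← e2, h]
  subst h1
  exact ⟨rfl, by omega⟩

theorem copySol_spec {S n f : ℕ} {s : Store} (hn : s.nat 0 0 0 = n) (hS : s.nat arrS 0 0 = S)
    (hf : s.nat arrFree 0 0 = f) (hmul : ∀ c ≤ n, s.nat arrMul c 0 = c * n)
    (hptr : ∀ a < S, ∀ c ≤ n, s.nat arrOk (f + a) c ≠ 0 →
      s.nat arrRowA (f + a) c < f ∧ s.nat arrCntA (f + a) c ≤ n ∧
      s.nat arrRowB (f + a) c < f ∧ s.nat arrCntB (f + a) c ≤ n) :
    WP copySol s fun t s' => t ≤ 1000 * ((S + 1) * (n + 1) * (n + 1)) ∧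
      (∀ row, row < f ∨ f + S ≤ row → s'.nat arrSol row = s.nat arrSol row) ∧
      ∀ a < S, ∀ c ≤ n, s.nat arrOk (f + a) c ≠ 0 → ∀ j < n, SolAt n s' (f + a) c j := by
  set tgt : ℕ → ℕ → ℕ → ℕ := fun a c j =>
    s.nat arrSol (s.nat arrRowA (f + a) c) (s.nat arrCntA (f + a) c * n + j) +
    s.nat arrSol (s.nat arrRowB (f + a) c) (s.nat arrCntB (f + a) c * n + j) with htgt
  -- the entries `(a, c, j)` with `D a c j` have been copied
  let Inv : (ℕ → ℕ → ℕ → Prop) → Store → Prop := fun D s' =>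
    (∀ row, row < f ∨ f + S ≤ row → s'.nat arrSol row = s.nat arrSol row) ∧
    ∀ a < S, ∀ c ≤ n, s.nat arrOk (f + a) c ≠ 0 → ∀ j < n, D a c j →
      s'.nat arrSol (f + a) (c * n + j) = tgt a c j
  have hInv : ∀ D D' s1 s2, Inv D s1 → s2.nat arrSol = s1.nat arrSol →
      (∀ a c j, j < n → c ≤ n → D' a c j → D a c j) → Inv D' s2 := by
    rintro D D' s1 s2 ⟨h1, h2⟩ h3 h4
    refine ⟨fun row hr => by rw [h3, h1 row hr], fun a ha c hc ho j hj hD => ?_⟩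
    rw [h3]
    exact h2 a ha c hc ho j hj (h4 a c j hj hc hD)
  unfold copySol
  refine WP_forP [27, 52, 53, 54] [] S (fun _ => 600 * ((n + 1) * (n + 1)))
    (fun m => Inv fun a c j => a < m) ?_ ?_ ?_ ?_
  · exact ⟨fun row hr => by rw [Store.writeNat_nat_ne (by decide)], fun a ha c hc ho j hj hD => by omega⟩
  · intro m s1 _ hs
    simp [hs.nat, hS]
  · intro a₀ s1 ha0 hI1 hf1 hc1
    refine WP_forP [27, 53, 54] [] (n + 1) (fun _ => 200 * (n + 1))
      (fun m => Inv fun a c j => a < a₀ ∨ a = a₀ ∧ c < m) ?_ ?_ ?_ ?_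
    · exact hInv _ _ _ _ hI1 (Store.writeNat_nat_ne (by decide)) fun a c j _ _ h => by omega
    · intro m s2 _ hs
      simp [hs.nat, hf1.nat, hn]
    · intro c₀ s2 hc0 hI2 hf2 hc2
      refine WP_forP [27, 54] [] n (fun _ => 100)
        (fun m => Inv fun a c j => a < a₀ ∨ a = a₀ ∧ (c < c₀ ∨ c = c₀ ∧ j < m)) ?_ ?_ ?_ ?_
      · exact hInv _ _ _ _ hI2 (Store.writeNat_nat_ne (by decide)) fun a c j _ _ h => by omega
      · intro m s3 _ hs
        simp [hs.nat, hf2.nat, hf1.nat, hn]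
      · intro j₀ s3 hj0 hI3 hf3 hc3
        rw [WP_setNat]
        have e1 : s3.nat arrFree 0 0 = f := by simp [hf3.nat, hf2.nat, hf1.nat, hf]
        have e2 : s3.nat ctrA 0 0 = a₀ := by simp [hf3.nat, hf2.nat, hc1]
        have e3 : s3.nat ctrC 0 0 = c₀ := by simp [hf3.nat, hc2]
        have e4 : ∀ c ≤ n, s3.nat arrMul c 0 = c * n := fun c hc => by
          simpa [hf3.nat, hf2.nat, hf1.nat] using hmul c hc
        have e5 : s3.nat arrRowA = s.nat arrRowA := by simp [hf3.nat, hf2.nat, hf1.nat]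
        have e6 : s3.nat arrRowB = s.nat arrRowB := by simp [hf3.nat, hf2.nat, hf1.nat]
        have e7 : s3.nat arrCntA = s.nat arrCntA := by simp [hf3.nat, hf2.nat, hf1.nat]
        have e8 : s3.nat arrCntB = s.nat arrCntB := by simp [hf3.nat, hf2.nat, hf1.nat]
        refine ⟨by simp, ?_, ?_⟩
        · intro row hr
          have : row ≠ f + a₀ := by omega
          rw [← hI3.1 row hr]
          funext c
          simp [e1, e2, this]
        · intro a ha c hc ho j hj hD
          simp only [nat_writeNat, eval_natAdd, eval_nv, eval_n1, eval_n2, e1, e2, e3, hc3,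
            e4 c₀ (by omega), e5, e6, e7, e8]
          by_cases hh : a = a₀ ∧ c = c₀ ∧ j = j₀
          · obtain ⟨rfl, rfl, rfl⟩ := hh
            obtain ⟨p1, p2, p3, p4⟩ := hptr a ha c hc ho
            rw [e4 _ p2, e4 _ p4, hI3.1 _ (Or.inl p1), hI3.1 _ (Or.inl p3)]
            simp [htgt]
          · have h1 : ¬ (f + a = f + a₀ ∧ c * n + j = c₀ * n + j₀) := by
              rintro ⟨h1, h2⟩
              have := mul_add_inj hj hj0 h2
              exact hh ⟨by omega, this⟩
            have h2 := hI3.2 a ha c hc ho j hj (by omega)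
            simp only [true_and]
            rw [if_neg h1]
            exact h2
      · intro t s3 hI3 hf3 ht
        refine ⟨?_, hInv _ _ _ _ hI3 (Store.writeNat_nat_ne (by decide)) fun a c j _ _ h => by omega⟩
        simp at ht
        nlinarith
    · intro t s2 hI2 hf2 ht
      refine ⟨?_, hInv _ _ _ _ hI2 (Store.writeNat_nat_ne (by decide)) fun a c j _ _ h => by omega⟩
      simp at ht
      nlinarith
  · intro t s1 hI1 hf1 ht
    refine ⟨?_, hI1.1, ?_⟩
    · have := for_cost (A := 1000 * ((n + 1) * (n + 1))) ht (by simp; nlinarith)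
      linarith
    · intro a ha c hc ho j hj
      obtain ⟨p1, p2, p3, p4⟩ := hptr a ha c hc ho
      rw [SolAt, hf1.nat arrRowA (by decide), hf1.nat arrCntA (by decide),
        hf1.nat arrRowB (by decide), hf1.nat arrCntB (by decide), hI1.1 _ (Or.inl p1),
        hI1.1 _ (Or.inl p3)]
      exact hI1.2 a ha c hc ho j hj ha


/-- The table at `base` represents the set `Q` of partial solutions: occupied entries contain
members of `Q`, and every member of `Q` is matched by an entry that is not more expensive. -/
def Tab (P : TreeDP) (s : Store) (base : ℕ) (Q : ℕ → ℕ → ℝ → (ℕ → ℕ) → Prop) : Prop :=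
  ∀ a < P.K ^ P.L, ∀ c ≤ P.n,
    (s.nat arrOk (base + a) c ≠ 0 →
      Q a c (s.real reaVal (base + a) c) (sol P.n s (base + a) c)) ∧
    ∀ v x, Q a c v x → s.nat arrOk (base + a) c ≠ 0 ∧ s.real reaVal (base + a) c ≤ v

theorem Tab.congr {P : TreeDP} {s s' : Store} {base f : ℕ} {Q Q' : ℕ → ℕ → ℝ → (ℕ → ℕ) → Prop}
    (h : Tab P s base Q) (hs : SameRows (P.K ^ P.L) f s s') (hb : base + P.K ^ P.L ≤ f)
    (hQ : ∀ a c v x, Q' a c v x ↔ Q a c v x) : Tab P s' base Q' := by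
  intro a ha c hc
  obtain ⟨h1, h2⟩ := h a ha c hc
  obtain ⟨e1, e2, e3⟩ := hs (base + a) (Or.inl (by omega))
  simp only [hQ, e1, e2]
  have e4 : sol P.n s' (base + a) c = sol P.n s (base + a) c := by
    funext j
    rw [sol, sol, e3]
  rw [e4]
  exact ⟨h1, h2⟩

/-- The data of `P` are in memory, together with the table of all pairs of codes that can be added
without a carry. -/
structure Loaded (P : TreeDP) (s : Store) : Prop where
  n : s.nat 0 0 0 = P.n
  k : s.nat 0 4 0 = P.k
  R : s.nat arrR 0 0 = P.R
  K : s.nat arrK 0 0 = P.K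
  L : s.nat arrL 0 0 = P.L
  M : s.nat arrM 0 0 = P.M
  S : s.nat arrS 0 0 = P.K ^ P.L
  top : ∀ r < P.R, s.nat arrTop r 0 = P.top r
  col : ∀ r < P.R, s.nat arrCol r 0 = P.col r
  par : ∀ t < P.k + P.n, s.nat arrPar t 0 = P.par t
  pow : ∀ c ≤ P.L, s.nat arrPow c 0 = P.K ^ c
  code : ∀ j < P.n, ∀ c ≤ P.M,
    s.nat arrCode j c = ∑ r ∈ Finset.range P.R, P.dg r j c * P.K ^ P.col r
  pok : ∀ r < P.R, ∀ d < P.K, (s.nat arrPok r d ≠ 0 ↔ P.pok r d)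
  pen : ∀ r < P.R, ∀ d < P.K, s.real reaPen r d = P.pen r d
  cst : ∀ j < P.n, ∀ c ≤ P.M, s.real reaCst j c = P.cst j c
  mul : ∀ c ≤ P.n, s.nat arrMul c 0 = c * P.n
  len : s.nat arrLen P.L 0 = (P.K * (P.K + 1) / 2) ^ P.L
  pair : ∀ i < (P.K * (P.K + 1) / 2) ^ P.L,
    NoCarry P.K P.L (s.nat arrPairA P.L i) (s.nat arrPairB P.L i)
  pair_surj : ∀ a b, NoCarry P.K P.L a b → ∃ i < (P.K * (P.K + 1) / 2) ^ P.L,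
    s.nat arrPairA P.L i = a ∧ s.nat arrPairB P.L i = b

theorem Loaded.congr {P : TreeDP} {s s' : Store} (h : Loaded P s)
    (hs : Frame [26, 27, 28, 29, 31, 32, 33, 34, 35, 36, 37, 38, 39, 40, 41, 42, 43, 44, 45, 46, 47,
      50, 51, 52, 53, 54, 55, 56, 57] [19, 24] s s') : Loaded P s' := by
  constructor <;> simp only [hs.nat 0 (by decide), hs.nat arrR (by decide),
    hs.nat arrK (by decide), hs.nat arrL (by decide), hs.nat arrM (by decide),
    hs.nat arrS (by decide), hs.nat arrTop (by decide), hs.nat arrCol (by decide),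
    hs.nat arrPar (by decide), hs.nat arrPow (by decide), hs.nat arrCode (by decide),
    hs.nat arrPok (by decide), hs.real reaPen (by decide), hs.real reaCst (by decide),
    hs.nat arrMul (by decide), hs.nat arrLen (by decide), hs.nat arrPairA (by decide),
    hs.nat arrPairB (by decide)]
  exacts [h.n, h.k, h.R, h.K, h.L, h.M, h.S, h.top, h.col, h.par, h.pow, h.code, h.pok, h.pen,
    h.cst, h.mul, h.len, h.pair, h.pair_surj]

/-- If a table contains the best candidates and their solutions, it represents the set `Q`, provided
that each candidate belongs to `Q` and each member of `Q` is matched by a candidate. -/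
theorem Best.tab {P : TreeDP} {s s' : Store} {f : ℕ} {C : ℕ → ℕ → ℝ → ℕ → ℕ → ℕ → ℕ → Prop}
    {Q : ℕ → ℕ → ℝ → (ℕ → ℕ) → Prop} (h : Best (P.K ^ P.L) P.n s f C)
    (hs : Frame [27, 52, 53, 54] [] s s')
    (hrow : ∀ row, row < f ∨ f + P.K ^ P.L ≤ row → s'.nat arrSol row = s.nat arrSol row)
    (hsol : ∀ a < P.K ^ P.L, ∀ c ≤ P.n, s.nat arrOk (f + a) c ≠ 0 → ∀ j < P.n,
      SolAt P.n s' (f + a) c j)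
    (hlt : ∀ a c v ra ca rb cb, C a c v ra ca rb cb → ra < f ∧ rb < f)
    (hsound : ∀ a c v ra ca rb cb, C a c v ra ca rb cb →
      Q a c v (sol P.n s ra ca + sol P.n s rb cb))
    (hcomplete : ∀ a c v x, Q a c v x → ∃ v' ≤ v, ∃ ra ca rb cb, C a c v' ra ca rb cb) :
    Tab P s' f Q := by
  intro a ha c hc
  obtain ⟨h1, h2⟩ := h a ha c hc
  rw [hs.nat arrOk (by decide), hs.real reaVal (by decide)]
  refine ⟨fun h3 => ?_, fun v x hx => ?_⟩
  · have h4 := h1 h3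
    obtain ⟨l1, l2⟩ := hlt _ _ _ _ _ _ _ h4
    have h5 := hsound _ _ _ _ _ _ _ h4
    convert h5 using 1
    funext j
    simp only [sol, Pi.add_apply]
    split_ifs with hj
    · have := hsol a ha c hc h3 j hj
      rw [SolAt, hs.nat arrRowA (by decide), hs.nat arrCntA (by decide),
        hs.nat arrRowB (by decide), hs.nat arrCntB (by decide), hrow _ (Or.inl l1),
        hrow _ (Or.inl l2)] at this
      exact this
    · rfl
  · obtain ⟨v', hv, ra, ca, rb, cb, h3⟩ := hcomplete a c v x hx
    obtain ⟨h4, h5⟩ := h2 _ _ _ _ _ h3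
    exact ⟨h4, h5.trans hv⟩

/-- The tables of the nodes up to `t` represent their partial solutions.  Table entry `(0, 0)` is
neutral for merging, and the rows from `arrFree` on are still unused. -/
structure Tables (P : TreeDP) (s : Store) (h : ℕ → ℕ) (F : Finset ℕ) (t : ℕ) : Prop where
  pos : 0 < s.nat arrFree 0 0
  unitOk : s.nat arrOk 0 0 ≠ 0
  unitVal : s.real reaVal 0 0 = 0
  unitSol : ∀ j < P.n, s.nat arrSol 0 j = 0
  fresh : ∀ row, s.nat arrFree 0 0 ≤ row → ∀ c, s.nat arrOk row c = 0
  loc : ∀ u ≤ t, s.nat arrLoc u 0 + P.K ^ P.L ≤ s.nat arrFree 0 0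
  tab : ∀ u ≤ t, Tab P s (s.nat arrLoc u 0) (P.Sem h F u)

/-- Replacing the table of node `p` by a new one. -/
theorem Tables.step {P : TreeDP} {s s' : Store} {h h' : ℕ → ℕ} {F F' : Finset ℕ} {t t' p f : ℕ}
    (hT : Tables P s h F t) (hf : s.nat arrFree 0 0 = f) (ht : t' ≤ t)
    (hs : SameRows (P.K ^ P.L) f s s')
    (hloc : ∀ u, s'.nat arrLoc u 0 = if u = p then f else s.nat arrLoc u 0)
    (hf' : s'.nat arrFree 0 0 = f + P.K ^ P.L)
    (htab : Tab P s' f (P.Sem h' F' p))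
    (hne : ∀ u ≤ t', u ≠ p → ∀ a c v x, P.Sem h' F' u a c v x ↔ P.Sem h F u a c v x) :
    Tables P s' h' F' t' := by
  have h0 := hs 0 (Or.inl (hf ▸ hT.pos))
  refine ⟨?_, ?_, ?_, ?_, ?_, ?_, ?_⟩
  · have := hT.pos
    omega
  · rw [h0.1]; exact hT.unitOk
  · rw [h0.2.1]; exact hT.unitVal
  · rw [h0.2.2]; exact hT.unitSol
  · intro row hr c
    rw [hf'] at hr
    rw [(hs row (Or.inr hr)).1]
    exact hT.fresh row (by omega) c
  · intro u hu
    have := hT.loc u (by omega)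
    rw [hloc, hf']
    split_ifs <;> omega
  · intro u hu
    rw [hloc]
    split_ifs with h1
    · rw [h1]; exact htab
    · exact (hT.tab u (by omega)).congr hs (hf ▸ hT.loc u (by omega)) (hne u hu h1)

theorem Tables.best {P : TreeDP} {s : Store} {h : ℕ → ℕ} {F : Finset ℕ} {t f : ℕ}
    (hT : Tables P s h F t) (hf : s.nat arrFree 0 0 = f) :
    Best (P.K ^ P.L) P.n s f fun _ _ _ _ _ _ _ => False := by
  intro a ha c hc
  rw [hT.fresh (f + a) (by omega)]
  simp


/-- Make the newly computed table the table of node `p`. -/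
def install (p : NExp) : Prog := seqs [
  copySol, .setNat arrLoc p 0 (nv arrFree), setN arrFree (nv arrFree + nv arrS)]

theorem install_spec {P : TreeDP} {s s1 : Store} {h h' : ℕ → ℕ} {F F' : Finset ℕ} {t t' p₀ f : ℕ}
    {p : NExp} {C : ℕ → ℕ → ℝ → ℕ → ℕ → ℕ → ℕ → Prop} (hL : Loaded P s) (hT : Tables P s h F t)
    (hf : s.nat arrFree 0 0 = f) (ht : t' ≤ t)
    (hf1 : Frame [26, 31, 32, 33, 34, 38, 39, 40, 42, 43, 44, 45, 46, 47, 52, 53, 55, 56, 57]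
      [19, 24] s s1)
    (hR1 : SameRows (P.K ^ P.L) f s s1) (hB1 : Best (P.K ^ P.L) P.n s1 f C)
    (hp : ∀ s2, Frame [27, 52, 53, 54] [] s1 s2 → p.eval s2 = p₀) (hpc : p.cost ≤ 20)
    (hC : ∀ a c v ra ca rb cb, C a c v ra ca rb cb → ra < f ∧ ca ≤ P.n ∧ rb < f ∧ cb ≤ P.n)
    (hsound : ∀ a c v ra ca rb cb, C a c v ra ca rb cb →
      P.Sem h' F' p₀ a c v (sol P.n s ra ca + sol P.n s rb cb))
    (hcomplete : ∀ a c v x, P.Sem h' F' p₀ a c v x →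
      ∃ v' ≤ v, ∃ ra ca rb cb, C a c v' ra ca rb cb)
    (hne : ∀ u ≤ t', u ≠ p₀ → ∀ a c v x, P.Sem h' F' u a c v x ↔ P.Sem h F u a c v x) :
    WP (install p) s1 fun τ s' => τ ≤ 1100 * ((P.K ^ P.L + 1) * (P.n + 1) * (P.n + 1)) ∧
      Tables P s' h' F' t' := by
  have hfS : s1.nat arrFree 0 0 = f := by simp [hf1.nat, hf]
  rw [install, WP_seqs_cons]
  refine ((copySol_spec (S := P.K ^ P.L) (n := P.n) (f := f) (s := s1)
    (by simp [hf1.nat, hL.n]) (by simp [hf1.nat, hL.S]) hfS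
    (fun c hc => by simp [hf1.nat, hL.mul c hc]) ?_).frame [27, 52, 53, 54] []).mono ?_
  · intro a ha c hc ho
    exact hC _ _ _ _ _ _ _ ((hB1 a ha c hc).1 ho)
  rintro τ s2 ⟨⟨hτ, hrow2, hsol2⟩, hf2⟩
  simp only [WP_seqs_cons, WP_seqs_singleton, WP_setNat, WP_setN]
  have e1 : s2.nat arrFree 0 0 = f := by simp [hf2.nat, hfS]
  have e2 : p.eval s2 = p₀ := hp s2 hf2
  have e3 : s2.nat arrS 0 0 = P.K ^ P.L := by simp [hf2.nat, hf1.nat, hL.S]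
  have hR2 : SameRows (P.K ^ P.L) f s s2 := hR1.trans fun row hr =>
    ⟨by rw [hf2.nat arrOk (by decide)], by rw [hf2.real reaVal (by decide)], hrow2 row hr⟩
  have hsol : ∀ row, row < f → ∀ c, sol P.n s1 row c = sol P.n s row c := by
    intro row hrow c
    funext j
    rw [sol, sol, (hR1 row (Or.inl hrow)).2.2]
  have htab : Tab P s2 f (P.Sem h' F' p₀) := by
    refine hB1.tab hf2 hrow2 hsol2 ?_ ?_ hcomplete
    · intro a c v ra ca rb cb hc
      have := hC _ _ _ _ _ _ _ hc
      exact ⟨this.1, this.2.2.1⟩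
    · intro a c v ra ca rb cb hc
      have := hC _ _ _ _ _ _ _ hc
      rw [hsol _ this.1, hsol _ this.2.2.1]
      exact hsound _ _ _ _ _ _ _ hc
  refine ⟨?_, ?_⟩
  · simp only [cost_nv, cost_natAdd, cost_natLit]
    have h1 : 1 ≤ (P.K ^ P.L + 1) * (P.n + 1) * (P.n + 1) :=
      Nat.mul_pos (Nat.mul_pos (Nat.succ_pos _) (Nat.succ_pos _)) (Nat.succ_pos _)
    omega
  · have hfin : Frame [28, 29] [] s2 ((s2.writeNat arrLoc (p.eval s2)
        (NExp.eval s2 0) (NExp.eval s2 (nv arrFree))).writeNat arrFree 0 0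
        ((nv arrFree + nv arrS).eval (s2.writeNat arrLoc (p.eval s2)
        (NExp.eval s2 0) (NExp.eval s2 (nv arrFree))))) := (Frame.refl _ _ s2).writeNat.writeNat
    refine hT.step hf ht (hR2.trans (.of_frame hfin)) (p := p₀) ?_ ?_ ?_ hne
    · intro u
      simp [e1, e2, hf2.nat, hf1.nat]
    · simp [e1, e3]
    · exact htab.congr (f := f + P.K ^ P.L) (.of_frame hfin) le_rfl fun _ _ _ _ => .rfl

/-- Complete row `ctrR` in the table of node `arrT`, by moving each entry to the code whose digit
for this row is erased.  As natural numbers cannot be divided, the digit `arrD` of the current code is kept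
up to date by counting: `arrLo` is the part of the code below this digit, and `arrOff` is the amount
that the digit contributes to the code. -/
def complete : Prog := seqs [
  setN arrD 0, setN arrLo 0, setN arrOff 0, setN varRowB 0, setN varCntB 0,
  forP ctrA (nv arrS) (seqs [
    .ite (.natLe 1 (n2 arrPok (nv ctrR) (nv arrD)))
      (forP ctrC (nv 0 + 1) (seqs [
        setN varRowA (n1 arrLoc (nv arrT) + nv ctrA), setN varCntA (nv ctrC),
        setN varRow (nv arrFree + (nv ctrA - nv arrOff)), setN varCnt (nv ctrC),
        setR reaEx (r2 reaPen (nv ctrR) (nv arrD)), relax]))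
      .skip,
    setN arrLo (nv arrLo + 1),
    .ite (.natLe (n1 arrPow (n1 arrCol (nv ctrR))) (nv arrLo))
      (seqs [setN arrLo 0, setN arrD (nv arrD + 1),
        setN arrOff (nv arrOff + n1 arrPow (n1 arrCol (nv ctrR))),
        .ite (.natLe (nv arrK) (nv arrD)) (.seq (setN arrD 0) (setN arrOff 0)) .skip])
      .skip]),
  install (nv arrT)]

theorem succ_div_mod {a Q : ℕ} (hQ : 0 < Q) :
    (a % Q + 1 < Q → (a + 1) % Q = a % Q + 1 ∧ (a + 1) / Q = a / Q) ∧
      (a % Q + 1 = Q → (a + 1) % Q = 0 ∧ (a + 1) / Q = a / Q + 1) := by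
  have h1 := Nat.div_add_mod a Q
  constructor
  · intro h
    have h2 : a + 1 = Q * (a / Q) + (a % Q + 1) := by omega
    rw [h2, Nat.mul_add_mod, Nat.mod_eq_of_lt h, Nat.mul_add_div hQ, Nat.div_eq_of_lt h]
    exact ⟨rfl, rfl⟩
  · intro h
    have h2 : a + 1 = Q * (a / Q + 1) := by rw [mul_add]; omega
    rw [h2, Nat.mul_mod_right, Nat.mul_div_cancel_left _ hQ]
    exact ⟨rfl, rfl⟩

theorem Best.congr' {S n f : ℕ} {s : Store} {C C' : ℕ → ℕ → ℝ → ℕ → ℕ → ℕ → ℕ → Prop}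
    (h : Best S n s f C) (hC : ∀ a c v ra ca rb cb, C a c v ra ca rb cb ↔ C' a c v ra ca rb cb) :
    Best S n s f C' := h.congr (.refl _ _ _) hC

theorem complete_spec {P : TreeDP} {s : Store} {h : ℕ → ℕ} {F : Finset ℕ} {t r : ℕ}
    (hP : P.Valid) (hL : Loaded P s) (hS : P.Stage h F t) (hT : Tables P s h F t) (hK : 0 < P.K)
    (hr : r < P.R) (hF : r ∉ F) (ht : P.top r = t) (hst : s.nat arrT 0 0 = t)
    (hsr : s.nat ctrR 0 0 = r) :
    WP complete s fun τ s' => τ ≤ 3000 * ((P.K ^ P.L + 1) * (P.n + 1) * (P.n + 1)) ∧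
      Tables P s' h (insert r F) t := by
  obtain ⟨f, hf⟩ : ∃ f, s.nat arrFree 0 0 = f := ⟨_, rfl⟩
  obtain ⟨Q, hQ⟩ : ∃ Q, P.K ^ P.col r = Q := ⟨_, rfl⟩
  obtain ⟨src, hsrc⟩ : ∃ src, s.nat arrLoc t 0 = src := ⟨_, rfl⟩
  have hQ0 : 0 < Q := hQ ▸ Nat.pow_pos hK
  have hsrcf : src + P.K ^ P.L ≤ f := by
    have := hT.loc t le_rfl
    omega
  have hpos : 0 < f := hf ▸ hT.pos
  -- the candidates coming from the old entries with `D`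
  let C : (ℕ → ℕ → Prop) → ℕ → ℕ → ℝ → ℕ → ℕ → ℕ → ℕ → Prop := fun D a c v ra ca rb cb =>
    ∃ a₀ c₀, D a₀ c₀ ∧ a₀ < P.K ^ P.L ∧ c₀ ≤ P.n ∧ P.pok r (a₀ / Q % P.K) ∧
      a = a₀ - a₀ / Q % P.K * Q ∧ c = c₀ ∧ ra = src + a₀ ∧ ca = c₀ ∧ rb = 0 ∧ cb = 0 ∧
      s.nat arrOk (src + a₀) c₀ ≠ 0 ∧
      v = s.real reaVal (src + a₀) c₀ + P.pen r (a₀ / Q % P.K)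
  have hC : ∀ D D' : ℕ → ℕ → Prop, (∀ a₀ c₀, a₀ < P.K ^ P.L → c₀ ≤ P.n → P.pok r (a₀ / Q % P.K) →
      (D a₀ c₀ ↔ D' a₀ c₀)) → ∀ a c v ra ca rb cb, C D a c v ra ca rb cb ↔ C D' a c v ra ca rb cb := by
    intro D D' hD a c v ra ca rb cb
    constructor <;> rintro ⟨a₀, c₀, h1, h2, h3, h4, h5⟩
    · exact ⟨a₀, c₀, (hD a₀ c₀ h2 h3 h4).1 h1, h2, h3, h4, h5⟩
    · exact ⟨a₀, c₀, (hD a₀ c₀ h2 h3 h4).2 h1, h2, h3, h4, h5⟩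
  have hdig : ∀ a₀, a₀ / Q % P.K * Q ≤ a₀ := fun a₀ =>
    (Nat.mul_le_mul_right _ (Nat.mod_le _ _)).trans (Nat.div_mul_le_self _ _)
  unfold complete
  simp only [WP_seqs_cons, WP_seqs_singleton, WP_setN, eval_natLit, cost_natLit]
  set s0 := ((((s.writeNat arrD 0 0 0).writeNat arrLo 0 0 0).writeNat arrOff 0 0 0).writeNat
    varRowB 0 0 0).writeNat varCntB 0 0 0 with hs0
  have hf0 : Frame [38, 39, 40, 46, 47] [] s s0 :=
    ((((Frame.refl _ _ s).writeNat).writeNat).writeNat).writeNat.writeNat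
  refine WP_forP [26, 31, 32, 33, 34, 38, 39, 40, 42, 43, 44, 45, 52, 53] [19, 24] (P.K ^ P.L)
    (fun _ => 700 * (P.n + 1))
    (fun m s' => SameRows (P.K ^ P.L) f s s' ∧ Best (P.K ^ P.L) P.n s' f (C fun a _ => a < m) ∧
      s'.nat arrD 0 0 = m / Q % P.K ∧ s'.nat arrLo 0 0 = m % Q ∧
      s'.nat arrOff 0 0 = m / Q % P.K * Q) ?_ ?_ ?_ ?_
  · refine ⟨.of_frame (A := [38, 39, 40, 46, 47, 52]) (B := []) (hf0.mono (by decide) (by decide)).writeNat,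
      (hT.best hf).congr (hf0.mono (by decide) (by decide)).writeNat ?_, by simp [hs0], by simp [hs0],
      by simp [hs0]⟩
    intro a c v ra ca rb cb
    simp only [false_iff]
    rintro ⟨a₀, c₀, h1, -⟩
    omega
  · intro m s' _ hs
    simp [hs.nat, hf0.nat, hL.S]
  · intro a s1 ha ⟨hR1, hB1, hd1, hlo1, hoff1⟩ hf1 hc1
    have hr1 : s1.nat ctrR 0 0 = r := by simp [hf1.nat, hf0.nat, hsr]
    have hdK : a / Q % P.K < P.K := Nat.mod_lt _ hK
    -- one round consists of the relaxations and of the update of the digit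
    have hupd : ∀ s2 τ, SameRows (P.K ^ P.L) f s s2 →
        Best (P.K ^ P.L) P.n s2 f (C fun a' _ => a' < a + 1) →
        Frame [26, 31, 32, 33, 34, 42, 43, 44, 45, 53] [19, 24] s1 s2 → τ ≤ 600 * (P.n + 1) →
        WP (seqs [setN arrLo (nv arrLo + 1),
          .ite (.natLe (n1 arrPow (n1 arrCol (nv ctrR))) (nv arrLo))
            (seqs [setN arrLo 0, setN arrD (nv arrD + 1),
              setN arrOff (nv arrOff + n1 arrPow (n1 arrCol (nv ctrR))),
              .ite (.natLe (nv arrK) (nv arrD)) (.seq (setN arrD 0) (setN arrOff 0)) .skip])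
            .skip]) s2 fun τ' s3 => τ + τ' ≤ 700 * (P.n + 1) ∧
            (fun m s' => SameRows (P.K ^ P.L) f s s' ∧
              Best (P.K ^ P.L) P.n s' f (C fun a _ => a < m) ∧
              s'.nat arrD 0 0 = m / Q % P.K ∧ s'.nat arrLo 0 0 = m % Q ∧
              s'.nat arrOff 0 0 = m / Q % P.K * Q) (a + 1) (s3.writeNat ctrA 0 0 (a + 1)) := by
      intro s2 τ hR2 hB2 hf2 hτ
      have e1 : s2.nat arrPow (s2.nat arrCol (s2.nat ctrR 0 0) 0) 0 = Q := by
        simp only [hf2.nat arrPow (by decide), hf2.nat arrCol (by decide), hf2.nat ctrR (by decide),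
          hf1.nat arrPow (by decide), hf1.nat arrCol (by decide), hr1, hf0.nat arrPow (by decide),
          hf0.nat arrCol (by decide), hL.col r hr]
        rw [hL.pow _ (hP.col_lt r hr).le, hQ]
      have e2 : s2.nat arrLo 0 0 = a % Q := by simp [hf2.nat, hlo1]
      have e3 : s2.nat arrD 0 0 = a / Q % P.K := by simp [hf2.nat, hd1]
      have e4 : s2.nat arrOff 0 0 = a / Q % P.K * Q := by simp [hf2.nat, hoff1]
      have e5 : s2.nat arrK 0 0 = P.K := by simp [hf2.nat, hf1.nat, hf0.nat, hL.K]
      obtain ⟨d1, d2⟩ := succ_div_mod (a := a) hQ0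
      obtain ⟨d3, d4⟩ := succ_div_mod (a := a / Q) hK
      have hlo : a % Q + 1 ≤ Q := Nat.mod_lt _ hQ0
      have hfin : ∀ s3, Frame [38, 39, 40, 52] [] s2 s3 → SameRows (P.K ^ P.L) f s s3 ∧
          Best (P.K ^ P.L) P.n s3 f (C fun a' _ => a' < a + 1) := fun s3 h3 =>
        ⟨hR2.trans (.of_frame h3), hB2.congr (h3.mono (by decide) (by decide)) fun _ _ _ _ _ _ _ => .rfl⟩
      simp only [WP_seqs_cons, WP_seqs_singleton, WP_setN, WP_ite, holds_natLe, WP_seq, WP_skip,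
        eval_natLit, eval_natAdd, eval_n1, eval_nv, nat_writeNat]
      norm_num only [e1, e2, e3, e4, e5, ite_true, ite_false, if_true, if_false, and_true, true_and,
        false_and]
      refine ⟨fun h1 => ⟨fun h2 => ?_, fun h2 => ?_⟩, fun h1 => ?_⟩
      · obtain ⟨g1, g2⟩ := d2 (by omega)
        obtain ⟨g3, g4⟩ := d4 (by omega)
        refine ⟨?_, (hfin _ ?_).1, (hfin _ ?_).2, ?_, ?_, ?_⟩
        · simp; omega
        · exact (((((((Frame.refl _ _ s2).writeNat).writeNat).writeNat).writeNat).writeNat).writeNat).writeNat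
        · exact (((((((Frame.refl _ _ s2).writeNat).writeNat).writeNat).writeNat).writeNat).writeNat).writeNat
        · simp [g2, g3]
        · simp [g1]
        · simp [g2, g3]
      · obtain ⟨g1, g2⟩ := d2 (by omega)
        obtain ⟨g3, g4⟩ := d3 (by omega)
        refine ⟨?_, (hfin _ ?_).1, (hfin _ ?_).2, ?_, ?_, ?_⟩
        · simp; omega
        · exact (((((Frame.refl _ _ s2).writeNat).writeNat).writeNat).writeNat).writeNat
        · exact (((((Frame.refl _ _ s2).writeNat).writeNat).writeNat).writeNat).writeNat
        · simp [g2, g3]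
        · simp [g1]
        · simp [g2, g3, add_mul]
      · obtain ⟨g1, g2⟩ := d1 (by omega)
        refine ⟨?_, (hfin _ ?_).1, (hfin _ ?_).2, ?_, ?_, ?_⟩
        · simp; omega
        · exact (((Frame.refl _ _ s2).writeNat).writeNat)
        · exact (((Frame.refl _ _ s2).writeNat).writeNat)
        · simp [g2]
        · simp [g1]
        · simp [g2]
    rw [WP_seqs_cons, WP_ite]
    have hok : s1.nat arrPok r (a / Q % P.K) ≠ 0 ↔ P.pok r (a / Q % P.K) := by
      rw [hf1.nat arrPok (by decide), hf0.nat arrPok (by decide), hL.pok r hr _ hdK]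
    simp only [holds_natLe, eval_natLit, eval_n2, eval_nv, hr1, hd1]
    refine ⟨fun h1 => ?_, fun h1 => ?_⟩
    · have h1' := hok.1 (Nat.one_le_iff_ne_zero.1 h1)
      refine WP_forP [26, 31, 32, 33, 34, 42, 43, 44, 45, 53] [19, 24] (P.n + 1) (fun _ => 300)
        (fun m s' => SameRows (P.K ^ P.L) f s s' ∧
          Best (P.K ^ P.L) P.n s' f (C fun a' c' => a' < a ∨ a' = a ∧ c' < m)) ?_ ?_ ?_ ?_
      · exact ⟨hR1.trans (.of_frame (A := [53]) (B := []) (Frame.refl _ _ _).writeNat),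
          hB1.congr (Frame.refl _ _ _).writeNat (hC _ _ fun a' c' _ _ _ => by omega)⟩
      · intro m s2 _ hs
        simp [hs.nat, hf1.nat, hf0.nat, hL.n]
      · intro c s2 hc ⟨hR2, hB2⟩ hf2 hc2
        simp only [WP_seqs_cons, WP_seqs_singleton, WP_setN, WP_setR]
        set s3 := ((((s2.writeNat varRowA 0 0 _).writeNat varCntA 0 0 _).writeNat varRow 0 0
          _).writeNat varCnt 0 0 _).writeReal reaEx 0 0 _ with hs3
        have hf3 : Frame [42, 43, 44, 45] [24] s2 s3 :=
          ((((Frame.refl _ _ s2).writeNat).writeNat).writeNat).writeNat.writeReal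
        have g1 : s3.nat varRow 0 0 = f + (a - a / Q % P.K * Q) := by
          simp [hs3, hf2.nat, hoff1, hc1, hf1.nat, hf0.nat, hf]
        have g2 : s3.nat varCnt 0 0 = c := by simp [hs3, hc2]
        have g3 : s3.nat varRowA 0 0 = src + a := by
          simp [hs3, hf2.nat, hc1, hf1.nat, hf0.nat, hst, hsrc]
        have g4 : s3.nat varCntA 0 0 = c := by simp [hs3, hc2]
        have g5 : s3.nat varRowB 0 0 = 0 := by simp [hs3, hf2.nat, hf1.nat, hs0]
        have g6 : s3.nat varCntB 0 0 = 0 := by simp [hs3, hf2.nat, hf1.nat, hs0]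
        have g7 : s3.real reaEx 0 0 = P.pen r (a / Q % P.K) := by
          simp [hs3, hf2.nat, hr1, hd1, hf2.real, hf1.real, hf0.real, hL.pen r hr _ hdK]
        have hR3 : SameRows (P.K ^ P.L) f s s3 := hR2.trans (.of_frame hf3)
        refine (relax_spec g1 g2 ((Nat.sub_le _ _).trans_lt ha)
          (hB2.congr (hf3.mono (by decide) (by decide)) fun _ _ _ _ _ _ _ => .rfl)).mono ?_
        rintro τ s4 ⟨hτ, hR4, hB4⟩
        refine ⟨by simp; omega, (hR3.trans hR4).trans
          (.of_frame (A := [53]) (B := []) (Frame.refl _ _ _).writeNat), ?_⟩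
        refine hB4.congr (Frame.refl _ _ _).writeNat fun a' c' v ra ca rb cb => ?_
        simp only [g3, g4, g5, g6, g7]
        have k1 := hR3 (src + a) (Or.inl (by omega))
        have k2 := hR3 0 (Or.inl hpos)
        constructor
        · rintro (⟨a₀, c₀, h2, h3⟩ | ⟨rfl, rfl, rfl, rfl, rfl, rfl, h2, -, rfl⟩)
          · exact ⟨a₀, c₀, by omega, h3⟩
          · rw [k1.1] at h2
            refine ⟨a, _, by omega, ha, by omega, h1', rfl, rfl, rfl, rfl, rfl, rfl, h2, ?_⟩
            rw [k1.2.1, k2.2.1, hT.unitVal, add_zero]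
        · rintro ⟨a₀, c₀, h2, h3, h4, h5, h6, rfl, rfl, rfl, rfl, rfl, h7, rfl⟩
          by_cases h8 : a₀ = a ∧ ca = c
          · obtain ⟨rfl, rfl⟩ := h8
            right
            rw [k1.1, k2.1, k1.2.1, k2.2.1, hT.unitVal, add_zero]
            exact ⟨h6, rfl, rfl, rfl, rfl, rfl, h7, hT.unitOk, rfl⟩
          · left
            exact ⟨a₀, _, by omega, h3, h4, h5, h6, rfl, rfl, rfl, rfl, rfl, h7, rfl⟩
      · intro τ s2 ⟨hR2, hB2⟩ hf2 hτ
        refine hupd s2 _ hR2 (hB2.congr' (hC _ _ fun a' c' _ hc' _ => by omega)) hf2 ?_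
        simp at hτ ⊢
        nlinarith
    · rw [WP_skip]
      refine hupd s1 _ hR1 (hB1.congr' (hC _ _ fun a' c' _ _ hp => ?_)) (.refl _ _ _) (by simp; omega)
      have : a' ≠ a := by
        rintro rfl
        exact h1 (Nat.one_le_iff_ne_zero.2 (hok.2 hp))
      omega
  · rintro τ s1 ⟨hR1, hB1, -⟩ hf1 hτ
    have hf1' : Frame [26, 31, 32, 33, 34, 38, 39, 40, 42, 43, 44, 45, 46, 47, 52, 53, 55, 56, 57]
        [19, 24] s s1 := (hf0.mono (by decide) (by decide)).trans (hf1.mono (by decide) (by decide))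
    refine (install_spec (h' := h) (F' := insert r F) (p₀ := t) hL hT hf le_rfl hf1' hR1 hB1 ?_
      (by simp) ?_ ?_ ?_ ?_).mono ?_
    · intro s2 hs2
      simp [hs2.nat, hf1'.nat, hst]
    · rintro a c v ra ca rb cb ⟨a₀, c₀, -, h1, h2, -, -, -, rfl, rfl, rfl, rfl, -⟩
      exact ⟨by omega, h2, hpos, Nat.zero_le _⟩
    · rintro a c v ra ca rb cb ⟨a₀, c₀, -, h1, h2, h3, rfl, rfl, rfl, rfl, rfl, rfl, h4, rfl⟩
      have h5 := ((hT.tab t le_rfl) a₀ h1 _ h2).1 (hsrc ▸ h4)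
      rw [hS.sem_complete hP hr hF ht, hQ]
      have h6 : sol P.n s 0 0 = 0 := by
        funext j
        rw [sol]
        split_ifs with hj
        · rw [zero_mul, zero_add]
          exact hT.unitSol j hj
        · rfl
      rw [h6, add_zero, ← hsrc]
      exact ⟨a₀, _, h5, h3, rfl, rfl⟩
    · intro a c v x hx
      rw [hS.sem_complete hP hr hF ht, hQ] at hx
      obtain ⟨a₀, v₀, h1, h2, h3, rfl⟩ := hx
      have h4 := h1.code_lt hP hS hK hS.lt
      obtain ⟨h5, h6⟩ := ((hT.tab t le_rfl) a₀ h4 c h1.count_le).2 v₀ x h1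
      rw [hsrc] at h5 h6
      exact ⟨_, add_le_add_left h6 _, _, _, _, _, a₀, c, h4, h4, h1.count_le, h2, h3, rfl, rfl, rfl,
        rfl, rfl, h5, rfl⟩
    · intro u _ hu a c v x
      exact hS.sem_complete_ne hP hr hF ht hu
    · rintro τ2 s2 ⟨hτ2, hT2⟩
      refine ⟨?_, hT2⟩
      have := for_cost (A := 1500 * ((P.n + 1) * (P.n + 1))) hτ (by simp; nlinarith)
      have h1 : 1 ≤ (P.K ^ P.L + 1) * (P.n + 1) * (P.n + 1) :=
        Nat.mul_pos (Nat.mul_pos (Nat.succ_pos _) (Nat.succ_pos _)) (Nat.succ_pos _)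
      have h2 : (P.K ^ P.L + 1) * (1500 * ((P.n + 1) * (P.n + 1))) =
        1500 * ((P.K ^ P.L + 1) * (P.n + 1) * (P.n + 1)) := by ring
      omega

/-- Merge the table of node `arrT` into the table of its parent. -/
def merge : Prog := seqs [
  setR reaEx 0,
  forP ctrI (n1 arrLen (nv arrL)) (forP ctrX (nv 0 + 1) (forP ctrY (nv 0 + 1 - nv ctrX) (seqs [
    setN varRowA (n1 arrLoc (n1 arrPar (nv arrT)) + n2 arrPairA (nv arrL) (nv ctrI)),
    setN varCntA (nv ctrX),
    setN varRowB (n1 arrLoc (nv arrT) + n2 arrPairB (nv arrL) (nv ctrI)),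
    setN varCntB (nv ctrY),
    setN varRow (nv arrFree + (n2 arrPairA (nv arrL) (nv ctrI) + n2 arrPairB (nv arrL) (nv ctrI))),
    setN varCnt (nv ctrX + nv ctrY),
    relax]))),
  install (n1 arrPar (nv arrT))]

theorem merge_spec {P : TreeDP} {s : Store} {h : ℕ → ℕ} {F : Finset ℕ} {t : ℕ}
    (hP : P.Valid) (hL : Loaded P s) (hS : P.Stage h F t) (hT : Tables P s h F t) (hK : 0 < P.K)
    (ht : 0 < t) (hF : ∀ r < P.R, P.top r = t → r ∈ F) (hst : s.nat arrT 0 0 = t) :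
    WP merge s fun τ s' => τ ≤ 3000 * (((P.K * (P.K + 1) / 2) ^ P.L + P.K ^ P.L + 1) *
        (P.n + 1) * (P.n + 1)) ∧ Tables P s' (P.mergeMap h t) F (t - 1) := by
  obtain ⟨f, hf⟩ : ∃ f, s.nat arrFree 0 0 = f := ⟨_, rfl⟩
  obtain ⟨T, hTT⟩ : ∃ T, (P.K * (P.K + 1) / 2) ^ P.L = T := ⟨_, rfl⟩
  obtain ⟨srcp, hsrcp⟩ : ∃ src, s.nat arrLoc (P.par t) 0 = src := ⟨_, rfl⟩
  obtain ⟨src, hsrc⟩ : ∃ src, s.nat arrLoc t 0 = src := ⟨_, rfl⟩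
  have hpt := hP.par_lt t ht hS.lt
  have hsrcf : src + P.K ^ P.L ≤ f := by
    have := hT.loc t le_rfl
    omega
  have hsrcpf : srcp + P.K ^ P.L ≤ f := by
    have := hT.loc (P.par t) (by omega)
    omega
  have hpair := hL.pair
  have hpair' := hL.pair_surj
  rw [hTT] at hpair hpair'
  set pa : ℕ → ℕ := fun i => s.nat arrPairA P.L i with hpa
  set pb : ℕ → ℕ := fun i => s.nat arrPairB P.L i with hpb
  have hlt : ∀ i < T, pa i + pb i < P.K ^ P.L := fun i hi => (hpair i hi).add_lt
  let C : (ℕ → ℕ → ℕ → Prop) → ℕ → ℕ → ℝ → ℕ → ℕ → ℕ → ℕ → Prop := fun D a c v ra ca rb cb =>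
    ∃ i x y, D i x y ∧ i < T ∧ x + y ≤ P.n ∧ a = pa i + pb i ∧ c = x + y ∧ ra = srcp + pa i ∧
      ca = x ∧ rb = src + pb i ∧ cb = y ∧ s.nat arrOk (srcp + pa i) x ≠ 0 ∧
      s.nat arrOk (src + pb i) y ≠ 0 ∧
      v = s.real reaVal (srcp + pa i) x + s.real reaVal (src + pb i) y
  have hC : ∀ D D' : ℕ → ℕ → ℕ → Prop, (∀ i x y, x + y ≤ P.n → (D i x y ↔ D' i x y)) →
      ∀ a c v ra ca rb cb, C D a c v ra ca rb cb ↔ C D' a c v ra ca rb cb := by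
    intro D D' hD a c v ra ca rb cb
    constructor <;> rintro ⟨i, x, y, h1, h2, h3, h4⟩
    · exact ⟨i, x, y, (hD i x y h3).1 h1, h2, h3, h4⟩
    · exact ⟨i, x, y, (hD i x y h3).2 h1, h2, h3, h4⟩
  let Inv : (ℕ → ℕ → ℕ → Prop) → Store → Prop := fun D s' =>
    SameRows (P.K ^ P.L) f s s' ∧ Best (P.K ^ P.L) P.n s' f (C D)
  have hInv : ∀ D D' s1 s2, Inv D s1 → Frame [55, 56, 57] [] s1 s2 →
      (∀ i x y, x + y ≤ P.n → (D i x y ↔ D' i x y)) → Inv D' s2 := by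
    rintro D D' s1 s2 ⟨h1, h2⟩ h3 h4
    exact ⟨h1.trans (.of_frame h3), h2.congr (h3.mono (by decide) (by decide)) (hC _ _ h4)⟩
  unfold merge
  simp only [WP_seqs_cons, WP_seqs_singleton, WP_setR]
  set s0 := s.writeReal reaEx 0 0 (RExp.eval s 0) with hs0
  have hf0 : Frame [] [24] s s0 := (Frame.refl _ _ s).writeReal
  refine WP_forP [26, 31, 32, 33, 34, 42, 43, 44, 45, 46, 47, 55, 56, 57] [19] T
    (fun _ => 800 * ((P.n + 1) * (P.n + 1))) (fun m => Inv fun i _ _ => i < m) ?_ ?_ ?_ ?_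
  · refine ⟨.of_frame (hf0.mono (A' := [55]) (B' := [24]) (by decide) (by decide)).writeNat,
      (hT.best hf).congr (hf0.mono (by decide) (by decide)).writeNat ?_⟩
    intro a c v ra ca rb cb
    simp only [false_iff]
    rintro ⟨i, x, y, h1, -⟩
    omega
  · intro m s' _ hs
    simp [hs.nat, hf0.nat, hL.L, hL.len, hTT]
  · intro i s1 hi hI1 hf1 hc1
    refine WP_forP [26, 31, 32, 33, 34, 42, 43, 44, 45, 46, 47, 56, 57] [19] (P.n + 1)
      (fun _ => 400 * (P.n + 1)) (fun m => Inv fun i' x _ => i' < i ∨ i' = i ∧ x < m) ?_ ?_ ?_ ?_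
    · exact hInv _ _ _ _ hI1 (Frame.refl _ _ _).writeNat fun i' x y _ => by omega
    · intro m s2 _ hs
      simp [hs.nat, hf1.nat, hf0.nat, hL.n]
    · intro x s2 hx hI2 hf2 hc2
      refine WP_forP [26, 31, 32, 33, 34, 42, 43, 44, 45, 46, 47, 57] [19] (P.n + 1 - x)
        (fun _ => 300) (fun m => Inv fun i' x' y => i' < i ∨ i' = i ∧ (x' < x ∨ x' = x ∧ y < m))
        ?_ ?_ ?_ ?_
      · exact hInv _ _ _ _ hI2 (Frame.refl _ _ _).writeNat fun i' x y _ => by omega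
      · intro m s3 _ hs
        simp [hs.nat, hf2.nat, hf1.nat, hf0.nat, hL.n, hc2]
      · intro y s3 hy ⟨hR3, hB3⟩ hf3 hc3
        simp only [WP_seqs_cons, WP_seqs_singleton, WP_setN]
        set s4 := (((((s3.writeNat varRowA 0 0 _).writeNat varCntA 0 0 _).writeNat varRowB 0 0
          _).writeNat varCntB 0 0 _).writeNat varRow 0 0 _).writeNat varCnt 0 0 _ with hs4
        have hf4 : Frame [42, 43, 44, 45, 46, 47] [] s3 s4 :=
          ((((((Frame.refl _ _ s3).writeNat).writeNat).writeNat).writeNat).writeNat).writeNat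
        have q1 : s3.nat arrLoc = s.nat arrLoc := by simp [hf3.nat, hf2.nat, hf1.nat, hf0.nat]
        have q2 : s3.nat arrPar t 0 = P.par t := by
          simp [hf3.nat, hf2.nat, hf1.nat, hf0.nat, hL.par t hS.lt]
        have q3 : s3.nat arrT 0 0 = t := by simp [hf3.nat, hf2.nat, hf1.nat, hf0.nat, hst]
        have q4 : s3.nat arrPairA P.L i = pa i := by simp [hf3.nat, hf2.nat, hf1.nat, hf0.nat, hpa]
        have q5 : s3.nat arrPairB P.L i = pb i := by simp [hf3.nat, hf2.nat, hf1.nat, hf0.nat, hpb]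
        have q6 : s3.nat arrL 0 0 = P.L := by simp [hf3.nat, hf2.nat, hf1.nat, hf0.nat, hL.L]
        have q7 : s3.nat ctrI 0 0 = i := by simp [hf3.nat, hf2.nat, hc1]
        have q8 : s3.nat ctrX 0 0 = x := by simp [hf3.nat, hc2]
        have q9 : s3.nat arrFree 0 0 = f := by simp [hf3.nat, hf2.nat, hf1.nat, hf0.nat, hf]
        have g1 : s4.nat varRow 0 0 = f + (pa i + pb i) := by simp [hs4, q6, q7, q4, q5, q9]
        have g2 : s4.nat varCnt 0 0 = x + y := by simp [hs4, q8, hc3]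
        have g3 : s4.nat varRowA 0 0 = srcp + pa i := by
          simp [hs4, q1, q2, q3, q4, q6, q7, hsrcp]
        have g4 : s4.nat varCntA 0 0 = x := by simp [hs4, q8]
        have g5 : s4.nat varRowB 0 0 = src + pb i := by simp [hs4, q1, q3, q5, q6, q7, hsrc]
        have g6 : s4.nat varCntB 0 0 = y := by simp [hs4, hc3]
        have g7 : s4.real reaEx 0 0 = 0 := by simp [hs4, hf3.real, hf2.real, hf1.real, hs0]
        have hR4 : SameRows (P.K ^ P.L) f s s4 := hR3.trans (.of_frame hf4)
        have hi' := hlt i hi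
        refine (relax_spec g1 g2 hi'
          (hB3.congr (hf4.mono (by decide) (by decide)) fun _ _ _ _ _ _ _ => .rfl)).mono ?_
        rintro τ s5 ⟨hτ, hR5, hB5⟩
        refine ⟨by simp; omega, (hR4.trans hR5).trans
          (.of_frame (A := [57]) (B := []) (Frame.refl _ _ _).writeNat), ?_⟩
        refine hB5.congr (Frame.refl _ _ _).writeNat fun a' c' v ra ca rb cb => ?_
        simp only [g3, g4, g5, g6, g7, add_zero]
        have k1 := hR4 (srcp + pa i) (Or.inl (by omega))
        have k2 := hR4 (src + pb i) (Or.inl (by omega))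
        constructor
        · rintro (⟨i₀, x₀, y₀, h2, h3⟩ | ⟨rfl, rfl, rfl, rfl, rfl, rfl, h2, h3, rfl⟩)
          · exact ⟨i₀, x₀, y₀, by omega, h3⟩
          · rw [k1.1] at h2
            rw [k2.1] at h3
            refine ⟨i, _, _, by omega, hi, by omega, rfl, rfl, rfl, rfl, rfl, rfl, h2, h3, ?_⟩
            rw [k1.2.1, k2.2.1]
        · rintro ⟨i₀, x₀, y₀, h2, h3, h4, rfl, rfl, rfl, rfl, rfl, rfl, h7, h8, rfl⟩
          by_cases h9 : i₀ = i ∧ ca = x ∧ cb = y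
          · obtain ⟨rfl, rfl, rfl⟩ := h9
            right
            rw [k1.1, k2.1, k1.2.1, k2.2.1]
            exact ⟨rfl, rfl, rfl, rfl, rfl, rfl, h7, h8, rfl⟩
          · left
            exact ⟨i₀, _, _, by omega, h3, h4, rfl, rfl, rfl, rfl, rfl, rfl, h7, h8, rfl⟩
      · intro τ s3 hI3 hf3 hτ
        refine ⟨?_, hInv _ _ _ _ hI3 (Frame.refl _ _ _).writeNat fun i' x' y _ => by omega⟩
        simp at hτ
        have : P.n + 1 - x ≤ P.n + 1 := Nat.sub_le _ _
        nlinarith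
    · intro τ s2 hI2 hf2 hτ
      refine ⟨?_, hInv _ _ _ _ hI2 (Frame.refl _ _ _).writeNat fun i' x' y _ => by omega⟩
      simp at hτ
      nlinarith
  · rintro τ s1 ⟨hR1, hB1⟩ hf1 hτ
    have hf1' : Frame [26, 31, 32, 33, 34, 38, 39, 40, 42, 43, 44, 45, 46, 47, 52, 53, 55, 56, 57]
        [19, 24] s s1 := (hf0.mono (by decide) (by decide)).trans (hf1.mono (by decide) (by decide))
    refine (install_spec (h' := P.mergeMap h t) (F' := F) (p₀ := P.par t) hL hT hf (Nat.sub_le t 1)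
      hf1' hR1 hB1 ?_ (by simp) ?_ ?_ ?_ ?_).mono ?_
    · intro s2 hs2
      simp [hs2.nat, hf1'.nat, hst, hL.par t hS.lt]
    · rintro a c v ra ca rb cb ⟨i, x, y, -, hi, h1, -, -, rfl, rfl, rfl, rfl, -⟩
      have := hlt i hi
      exact ⟨by omega, by omega, by omega, by omega⟩
    · rintro a c v ra ca rb cb ⟨i, x, y, -, hi, h1, rfl, rfl, rfl, rfl, rfl, rfl, h2, h3, rfl⟩
      have := hlt i hi
      have h4 := ((hT.tab _ hpt.le) (pa i) (by omega) _ (by omega)).1 (hsrcp ▸ h2)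
      have h5 := ((hT.tab t le_rfl) (pb i) (by omega) _ (by omega)).1 (hsrc ▸ h3)
      rw [hsrcp] at h4
      rw [hsrc] at h5
      rw [hS.sem_merge hP hK ht hF]
      exact ⟨_, _, _, _, _, _, _, _, h4, h5, hpair i hi, rfl, rfl, rfl, rfl⟩
    · intro a c v x hx
      have hcn := hx.count_le
      rw [hS.sem_merge hP hK ht hF] at hx
      obtain ⟨a₁, c₁, v₁, x₁, a₂, c₂, v₂, x₂, y1, y2, y3, rfl, rfl, rfl, rfl⟩ := hx
      obtain ⟨i, hi, rfl, rfl⟩ := hpair' _ _ y3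
      have := hlt i hi
      obtain ⟨h4, h4'⟩ := ((hT.tab _ hpt.le) (pa i) (by omega) _ y1.count_le).2 _ _ y1
      obtain ⟨h5, h5'⟩ := ((hT.tab t le_rfl) (pb i) (by omega) _ y2.count_le).2 _ _ y2
      rw [hsrcp] at h4 h4'
      rw [hsrc] at h5 h5'
      exact ⟨_, add_le_add h4' h5', _, _, _, _, i, _, _, hi, hi, hcn, rfl, rfl, rfl, rfl, rfl,
        rfl, h4, h5, rfl⟩
    · intro u hu1 hu a c v x
      exact TreeDP.sem_merge_ne hu (by omega)
    · rintro τ2 s2 ⟨hτ2, hT2⟩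
      refine ⟨?_, hT2⟩
      rw [hTT]
      have := for_cost (A := 1000 * ((P.n + 1) * (P.n + 1))) hτ (by simp; nlinarith)
      have h1 : 1 ≤ (P.n + 1) * (P.n + 1) := Nat.mul_pos (Nat.succ_pos _) (Nat.succ_pos _)
      simp only [cost_realLit]
      have e1 : (T + 1) * (1000 * ((P.n + 1) * (P.n + 1))) =
        1000 * (T * ((P.n + 1) * (P.n + 1))) + 1000 * ((P.n + 1) * (P.n + 1)) := by ring
      have e2 : (P.K ^ P.L + 1) * (P.n + 1) * (P.n + 1) =
        P.K ^ P.L * ((P.n + 1) * (P.n + 1)) + (P.n + 1) * (P.n + 1) := by ring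
      have e3 : (T + P.K ^ P.L + 1) * (P.n + 1) * (P.n + 1) = T * ((P.n + 1) * (P.n + 1)) +
        P.K ^ P.L * ((P.n + 1) * (P.n + 1)) + (P.n + 1) * (P.n + 1) := by ring
      omega

/-- Enter choice `ctrC` of variable `ctrJ` into the table at `arrFree`. -/
def leafEntry : Prog := seqs [
  setN varRow (nv arrFree + n2 arrCode (nv ctrJ) (nv ctrC)),
  .ite (.natLe (nv ctrC) 0) (setN varCnt 0) (setN varCnt 1),
  .ite (.and (.natLe 1 (n2 arrOk (nv varRow) (nv varCnt)))
      (.realLe (r2 reaVal (nv varRow) (nv varCnt)) (r2 reaCst (nv ctrJ) (nv ctrC))))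
    .skip
    (seqs [.setReal reaVal (nv varRow) (nv varCnt) (r2 reaCst (nv ctrJ) (nv ctrC)),
      .setNat arrOk (nv varRow) (nv varCnt) 1,
      .setNat arrSol (nv varRow) (n1 arrMul (nv varCnt) + nv ctrJ) (nv ctrC)])]

/-- Set up the tables of all nodes; the inner nodes share one table. -/
def initTables : Prog := seqs [
  .setNat arrOk 0 0 1,
  setN arrFree (nv arrS),
  forP ctrJ (nv 0) (seqs [
    forP ctrC (nv arrM + 1) leafEntry,
    .setNat arrLoc (n1 0 4 + nv ctrJ) 0 (nv arrFree),
    setN arrFree (nv arrFree + nv arrS)])]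

/-- The choices `c < m` of variable `j` have been entered into the table at `f`. -/
structure LeafInv (P : TreeDP) (f j m : ℕ) (s : Store) : Prop where
  sound : ∀ a < P.K ^ P.L, ∀ c ≤ P.n, s.nat arrOk (f + a) c ≠ 0 → ∃ d < m,
    a = ∑ r ∈ Finset.range P.R, P.dg r j d * P.K ^ P.col r ∧ c = (if d = 0 then 0 else 1) ∧
    s.real reaVal (f + a) c = P.cst j d ∧ s.nat arrSol (f + a) (c * P.n + j) = d
  complete : ∀ d < m, ∀ a c, a = ∑ r ∈ Finset.range P.R, P.dg r j d * P.K ^ P.col r →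
    c = (if d = 0 then 0 else 1) → s.nat arrOk (f + a) c ≠ 0 ∧ s.real reaVal (f + a) c ≤ P.cst j d
  zero : ∀ a < P.K ^ P.L, ∀ c, ∀ j' < P.n, j' ≠ j → s.nat arrSol (f + a) (c * P.n + j') = 0

theorem LeafInv.congr {P : TreeDP} {f j m : ℕ} {s s' : Store} (h : LeafInv P f j m s)
    (hs : Frame [28, 29, 42, 43, 53, 54] [] s s') : LeafInv P f j m s' := by
  obtain ⟨h1, h2, h3⟩ := h
  constructor <;> simpa only [hs.nat arrOk (by decide), hs.nat arrSol (by decide),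
    hs.real reaVal (by decide)]

theorem _root_.TreeDP.Valid.leaf_code_lt {P : TreeDP} (hP : P.Valid) (hK : 0 < P.K) {j d : ℕ} (hj : j < P.n)
    (hd : d ≤ P.M) : ∑ r ∈ Finset.range P.R, P.dg r j d * P.K ^ P.col r < P.K ^ P.L :=
  ((TreeDP.sem_init_leaf hj).2 ⟨d, hd, rfl, rfl, rfl, rfl⟩).code_lt hP
    (hP.stage_init (by omega)) hK (by omega)

theorem leafEntry_spec {P : TreeDP} {s : Store} {f j d : ℕ} (hP : P.Valid) (hL : Loaded P s)
    (hK : 0 < P.K) (hj : j < P.n) (hd : d ≤ P.M) (hsj : s.nat ctrJ 0 0 = j)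
    (hsc : s.nat ctrC 0 0 = d) (hf : s.nat arrFree 0 0 = f) (hI : LeafInv P f j d s) :
    WP leafEntry s fun t s' => t ≤ 200 ∧ SameRows (P.K ^ P.L) f s s' ∧ LeafInv P f j (d + 1) s' := by
  have hlt := hP.leaf_code_lt hK hj hd
  obtain ⟨a₀, ha₀⟩ : ∃ a, ∑ r ∈ Finset.range P.R, P.dg r j d * P.K ^ P.col r = a := ⟨_, rfl⟩
  obtain ⟨c₀, hc₀⟩ : ∃ c, (if d = 0 then 0 else 1) = c := ⟨_, rfl⟩
  rw [ha₀] at hlt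
  have hc₀n : c₀ ≤ P.n := by rw [← hc₀]; split_ifs <;> omega
  have main : ∀ s1 τ, Frame [42, 43] [] s s1 → s1.nat varRow 0 0 = f + a₀ → s1.nat varCnt 0 0 = c₀ →
      τ ≤ 100 → WP (.ite (.and (.natLe 1 (n2 arrOk (nv varRow) (nv varCnt)))
        (.realLe (r2 reaVal (nv varRow) (nv varCnt)) (r2 reaCst (nv ctrJ) (nv ctrC))))
        .skip
        (seqs [.setReal reaVal (nv varRow) (nv varCnt) (r2 reaCst (nv ctrJ) (nv ctrC)),
          .setNat arrOk (nv varRow) (nv varCnt) 1,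
          .setNat arrSol (nv varRow) (n1 arrMul (nv varCnt) + nv ctrJ) (nv ctrC)])) s1
        fun t s' => τ + t ≤ 200 ∧ SameRows (P.K ^ P.L) f s s' ∧ LeafInv P f j (d + 1) s' := by
    intro s1 τ hf1 h1 h2 hτ
    have hI1 := hI.congr (hf1.mono (by decide) (by decide))
    have e1 : s1.nat ctrJ 0 0 = j := by simp [hf1.nat, hsj]
    have e2 : s1.nat ctrC 0 0 = d := by simp [hf1.nat, hsc]
    have e3 : s1.real reaCst j d = P.cst j d := by simp [hf1.real, hL.cst j hj d hd]
    have e4 : s1.nat arrMul c₀ 0 = c₀ * P.n := by simp [hf1.nat, hL.mul c₀ hc₀n]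
    rw [WP_ite]
    simp only [holds_and, holds_natLe, holds_realLe, eval_natLit, eval_n2, eval_nv, eval_r2,
      h1, h2, e1, e2, e3]
    refine ⟨fun h3 => ?_, fun h3 => ?_⟩
    · rw [WP_skip]
      refine ⟨by simp; omega, .of_frame hf1, ?_, ?_, hI1.zero⟩
      · intro a ha c hc ho
        obtain ⟨d', hd', h⟩ := hI1.sound a ha c hc ho
        exact ⟨d', by omega, h⟩
      · intro d' hd' a c ha hc
        rcases Nat.lt_succ_iff_lt_or_eq.1 hd' with h | rfl
        · exact hI1.complete d' h a c ha hc
        · rw [ha, hc, ha₀, hc₀]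
          exact ⟨by omega, h3.2⟩
    · simp only [WP_seqs_cons, WP_seqs_singleton, WP_setReal, WP_setNat]
      refine ⟨by simp; omega, ?_, ?_, ?_, ?_⟩
      · refine (SameRows.of_frame hf1).trans fun row hr => ?_
        have : row ≠ f + a₀ := by omega
        refine ⟨?_, ?_, ?_⟩ <;> funext c <;> simp [h1, this]
      · intro a ha c hc ho
        by_cases hac : a = a₀ ∧ c = c₀
        · obtain ⟨rfl, rfl⟩ := hac
          exact ⟨d, by omega, ha₀.symm, hc₀.symm, by simp [h1, h2, e1, e2, e3], by
            simp [h1, h2, e1, e2, e4]⟩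
        · simp [h1, h2, hac] at ho
          obtain ⟨d', hd', g1, g2, g3, g4⟩ := hI1.sound a ha c hc ho
          refine ⟨d', by omega, g1, g2, by simpa [h1, h2, hac] using g3, ?_⟩
          have : ¬ (a = a₀ ∧ (c = c₀ ∨ P.n = 0)) := fun ⟨h, h'⟩ =>
            hac ⟨h, h'.resolve_right (by omega)⟩
          simp only [nat_writeNat, nat_writeReal, eval_nv, eval_natAdd, eval_n1]
          norm_num [h1, h2, e1, e4]
          rw [if_neg this]
          exact g4
      · intro d' hd' a c ha hc
        by_cases hac : a = a₀ ∧ c = c₀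
        · obtain ⟨rfl, rfl⟩ := hac
          refine ⟨by simp [h1, h2], ?_⟩
          simp only [real_writeNat, real_writeReal, eval_nv, h1, h2, eval_r2, e1, e2, e3, and_self, if_true]
          rcases Nat.lt_succ_iff_lt_or_eq.1 hd' with h | rfl
          · obtain ⟨g1, g2⟩ := hI1.complete d' h _ _ ha hc
            have : ¬ _ := fun h' => h3 ⟨Nat.one_le_iff_ne_zero.2 g1, h'⟩
            linarith
          · exact le_rfl
        · rcases Nat.lt_succ_iff_lt_or_eq.1 hd' with h | rfl
          · simpa [h1, h2, hac] using hI1.complete d' h a c ha hc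
          · exact absurd ⟨ha.trans ha₀, hc.trans hc₀⟩ hac
      · intro a ha c j' hj' hne
        have : ¬ (a = a₀ ∧ c * P.n + j' = c₀ * P.n + j) := fun ⟨h, h'⟩ =>
            hne (mul_add_inj hj' hj h').2
        simp only [nat_writeNat, nat_writeReal, eval_nv, eval_natAdd, eval_n1]
        norm_num [h1, h2, e1, e4]
        rw [if_neg this]
        exact hI1.zero a ha c j' hj' hne
  unfold leafEntry
  simp only [WP_seqs_cons, WP_setN, WP_ite, holds_natLe, eval_natLit, eval_nv, eval_natAdd, eval_n2,
    hf, hsj, hsc, hL.code j hj d hd, ha₀]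
  refine ⟨fun h => ?_, fun h => ?_⟩
  · simp only [WP_seqs_singleton]
    refine (main _ 50 ((Frame.refl _ _ s).writeNat).writeNat (by simp) ?_ (by omega)).mono ?_
    · simp at h
      simp [← hc₀]
      omega
    · rintro t s' ⟨h1, h2⟩
      exact ⟨by simp; omega, h2⟩
  · simp only [WP_seqs_singleton]
    refine (main _ 50 ((Frame.refl _ _ s).writeNat).writeNat (by simp) ?_ (by omega)).mono ?_
    · simp at h
      simp [← hc₀]
      omega
    · rintro t s' ⟨h1, h2⟩
      exact ⟨by simp; omega, h2⟩

theorem LeafInv.tab {P : TreeDP} {f j : ℕ} {s : Store} (h : LeafInv P f j (P.M + 1) s)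
    (hj : j < P.n) : Tab P s f (P.Sem (fun u => u) ∅ (P.k + j)) := by
  intro a ha c hc
  simp only [TreeDP.sem_init_leaf hj]
  refine ⟨fun ho => ?_, ?_⟩
  · obtain ⟨d, hd, h1, h2, h3, h4⟩ := h.sound a ha c hc ho
    refine ⟨d, by omega, h1, h2, h3, funext fun j' => ?_⟩
    rw [sol]
    split_ifs with h5 h6 h6
    · rw [h6, h4]
    · exact h.zero a ha c j' h5 h6
    · omega
    · rfl
  · rintro v x ⟨d, hd, h1, h2, rfl, -⟩
    exact h.complete d (by omega) a c h1 h2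

theorem initTables_spec {P : TreeDP} {s : Store} (hP : P.Valid) (hL : Loaded P s) (hK : 0 < P.K)
    (hk : 0 < P.k) (hok : ∀ row c, s.nat arrOk row c = 0) (hsol : ∀ row c, s.nat arrSol row c = 0)
    (hval : s.real reaVal 0 0 = 0) (hloc : ∀ u, s.nat arrLoc u 0 = 0) :
    WP initTables s fun t s' => t ≤ 500 * ((P.n + 1) * (P.M + 2)) ∧
      Tables P s' (fun u => u) ∅ (P.k + P.n - 1) := by
  have hS0 : 0 < P.K ^ P.L := Nat.pow_pos hK
  unfold initTables
  simp only [WP_seqs_cons, WP_seqs_singleton, WP_setNat, WP_setN, eval_natLit, eval_nv]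
  set s0 := (s.writeNat arrOk 0 0 1).writeNat arrFree 0 0 _ with hs0
  have hf0 : Frame [26, 29] [] s s0 := ((Frame.refl _ _ s).writeNat).writeNat
  have hF0 : s0.nat arrFree 0 0 = P.K ^ P.L := by simp [hs0, hL.S]
  have hok0 : ∀ row c, s0.nat arrOk row c = if row = 0 ∧ c = 0 then 1 else 0 := by
    intro row c
    simp [hs0, hok]
  let Inv : ℕ → Store → Prop := fun m s' => Tables P s' (fun u => u) ∅ (P.k + m - 1) ∧
    ∀ row, s'.nat arrFree 0 0 ≤ row → ∀ c, s'.nat arrSol row c = 0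
  have hInv : ∀ m s1 s2, Inv m s1 → Frame [54] [] s1 s2 → Inv m s2 := by
    rintro m s1 s2 ⟨⟨h1, h2, h3, h4, h5, h6, h7⟩, h8⟩ hs
    have e1 := hs.nat arrFree (by decide)
    have e2 := hs.nat arrOk (by decide)
    have e3 := hs.real reaVal (by decide)
    have e4 := hs.nat arrSol (by decide)
    have e5 := hs.nat arrLoc (by decide)
    refine ⟨⟨by rwa [e1], by rwa [e2], by rwa [e3], by rwa [e4], by rwa [e1, e2], by rwa [e1, e5], ?_⟩,
      by rwa [e1, e4]⟩
    intro u hu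
    rw [e5]
    exact (h7 u hu).congr (.of_frame hs) (h6 u hu) fun _ _ _ _ => .rfl
  refine WP_forP [26, 27, 28, 29, 42, 43, 53, 54] [19] P.n (fun _ => 300 * (P.M + 2)) Inv ?_ ?_ ?_ ?_
  · refine hInv 0 s0 _ ⟨⟨by omega, by simp [hok0], by simp [hf0.real, hval], ?_, ?_, ?_, ?_⟩, ?_⟩
      (Frame.refl _ _ _).writeNat
    · intro j hj
      simp [hf0.nat, hsol]
    · intro row hr c
      rw [hok0, if_neg (by omega)]
    · intro u hu
      simp [hf0.nat, hloc, hF0]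
    · intro u hu a ha c hc
      simp only [TreeDP.sem_init_inner (show u < P.k by omega)]
      have e1 : s0.nat arrLoc u 0 = 0 := by simp [hf0.nat, hloc]
      have e2 : s0.real reaVal 0 0 = 0 := by simp [hf0.real, hval]
      rw [e1, zero_add, hok0]
      refine ⟨fun h => ?_, ?_⟩
      · have h1 : a = 0 ∧ c = 0 := by
          by_contra h1
          exact h (if_neg h1)
        obtain ⟨rfl, rfl⟩ := h1
        refine ⟨rfl, rfl, e2, funext fun j => ?_⟩
        simp [sol, hf0.nat, hsol]
      · rintro v x ⟨rfl, rfl, rfl, -⟩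
        simp [e2]
    · intro row hr c
      simp [hf0.nat, hsol]
  · intro m s1 _ hs
    simp [hs.nat, hf0.nat, hL.n]
  · intro j s1 hj ⟨hT1, hz1⟩ hf1 hc1
    obtain ⟨f, hf⟩ : ∃ f, s1.nat arrFree 0 0 = f := ⟨_, rfl⟩
    have hL1 : Loaded P s1 := hL.congr ((hf0.mono (by decide) (by decide)).trans
      (hf1.mono (by decide) (by decide)))
    have hpos := hT1.pos
    simp only [WP_seqs_cons, WP_seqs_singleton]
    refine WP_forP [26, 27, 42, 43, 53] [19] (P.M + 1) (fun _ => 200)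
      (fun m s' => SameRows (P.K ^ P.L) f s1 s' ∧ LeafInv P f j m s') ?_ ?_ ?_ ?_
    · refine ⟨.of_frame (A := [53]) (B := []) (Frame.refl _ _ _).writeNat,
        LeafInv.congr (s := s1) ⟨?_, ?_, ?_⟩ (Frame.refl _ _ _).writeNat⟩
      · intro a ha c hc ho
        exact absurd (hT1.fresh (f + a) (by omega) c) ho
      · intro d hd
        omega
      · intro a ha c j' _ _
        exact hz1 _ (by omega) _
    · intro m s2 _ hs
      simp [hs.nat, hL1.M]
    · intro d s2 hd ⟨hR2, hI2⟩ hf2 hc2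
      refine (leafEntry_spec hP (hL1.congr (hf2.mono (by decide) (by decide))) hK hj (by omega)
        (by simp [hf2.nat, hc1]) hc2 (by simp [hf2.nat, hf]) hI2).mono ?_
      rintro τ s3 ⟨hτ, hR3, hI3⟩
      exact ⟨hτ, (hR2.trans hR3).trans (.of_frame (A := [53]) (B := []) (Frame.refl _ _ _).writeNat),
        hI3.congr (Frame.refl _ _ _).writeNat⟩
    · rintro τ s2 ⟨hR2, hI2⟩ hf2 hτ
      simp only [WP_setNat, WP_setN, eval_natLit]
      have hL2 : Loaded P s2 := hL1.congr (hf2.mono (by decide) (by decide))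
      have e1 : s2.nat arrFree 0 0 = f := by simp [hf2.nat, hf]
      have e2 : s2.nat ctrJ 0 0 = j := by simp [hf2.nat, hc1]
      have e3 : NExp.eval s2 (n1 0 4 + nv ctrJ) = P.k + j := by
        have := hL2.k
        simp [e2, this]
      have e4 : s2.nat arrLoc = s1.nat arrLoc := by simp [hf2.nat]
      rw [e3]
      set s3 := (s2.writeNat arrLoc (P.k + j) 0 _).writeNat arrFree 0 0 _ with hs3
      have hf3 : Frame [28, 29] [] s2 s3 := ((Frame.refl _ _ s2).writeNat).writeNat
      have e5 : s3.nat arrFree 0 0 = f + P.K ^ P.L := by simp [hs3, e1, hL2.S]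
      have e6 : ∀ u, s3.nat arrLoc u 0 = if u = P.k + j then f else s1.nat arrLoc u 0 := by
        intro u
        simp [hs3, e1, e4]
      have hR3 : SameRows (P.K ^ P.L) f s1 s3 := hR2.trans (.of_frame hf3)
      refine ⟨?_, hInv (j + 1) s3 _ ⟨⟨?_, ?_, ?_, ?_, ?_, ?_, ?_⟩, ?_⟩ (Frame.refl _ _ _).writeNat⟩
      · simp at hτ ⊢
        omega
      · omega
      · rw [(hR3 0 (Or.inl (by omega))).1]; exact hT1.unitOk
      · rw [(hR3 0 (Or.inl (by omega))).2.1]; exact hT1.unitVal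
      · rw [(hR3 0 (Or.inl (by omega))).2.2]; exact hT1.unitSol
      · intro row hr c
        rw [(hR3 row (Or.inr (by omega))).1]; exact hT1.fresh row (by omega) c
      · intro u hu
        rw [e6, e5]
        split_ifs with h1
        · omega
        · have := hT1.loc u (by omega)
          omega
      · intro u hu
        rw [e6]
        split_ifs with h1
        · rw [h1]
          exact (hI2.congr (hf3.mono (by decide) (by decide))).tab hj
        · exact (hT1.tab u (by omega)).congr hR3 (hf ▸ hT1.loc u (by omega)) fun _ _ _ _ => .rfl
      · intro row hr c
        rw [(hR3 row (Or.inr (by omega))).2.2]; exact hz1 row (by omega) c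
  · rintro τ s1 ⟨hT1, -⟩ hf1 hτ
    refine ⟨?_, hT1⟩
    have := for_cost (A := 400 * (P.M + 2)) hτ (by simp; omega)
    simp
    nlinarith

/-- The dynamic program: from the last node down to the root, complete the rows whose topmost node
has been reached and merge the node into its parent. -/
def treeDP : Prog :=
  forP ctrT (n1 0 4 + nv 0) (seqs [
    setN arrT (n1 0 4 + nv 0 - (nv ctrT + 1)),
    forP ctrR (nv arrR)
      (.ite (.and (.natLe (n1 arrTop (nv ctrR)) (nv arrT)) (.natLe (nv arrT) (n1 arrTop (nv ctrR))))
        complete .skip),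
    .ite (.natLe 1 (nv arrT)) merge .skip])

theorem _root_.TreeDP.Valid.card_top_le {P : TreeDP} (hP : P.Valid) (t : ℕ) :
    ((Finset.range P.R).filter fun r => P.top r = t).card ≤ P.L := by
  rw [← Finset.card_range P.L]
  refine Finset.card_le_card_of_injOn P.col ?_ ?_
  · intro r hr
    simp only [Finset.coe_filter, Finset.mem_range, Set.mem_ofPred_eq] at hr
    simpa using hP.col_lt r hr.1
  · intro r hr r' hr' h
    simp only [Finset.coe_filter, Finset.mem_range, Set.mem_ofPred_eq] at hr hr'
    have h1 := hP.top_lt r hr.1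
    rw [hr.2] at h1
    exact hP.col_inj t h1 r hr.1 r' hr'.1 (hr.2 ▸ hP.bag_top r hr.1) (hr'.2 ▸ hP.bag_top r' hr'.1) h

theorem treeDP_spec {P : TreeDP} {s : Store} (hP : P.Valid) (hL : Loaded P s) (hK : 0 < P.K)
    (hk : 0 < P.k) (hT : Tables P s (fun u => u) ∅ (P.k + P.n - 1)) :
    WP treeDP s fun τ s' => τ ≤ 7000 * ((P.k + P.n + 1) *
        (((P.K * (P.K + 1) / 2) ^ P.L + P.K ^ P.L + 1) * (P.L + 1) * ((P.n + 1) * (P.n + 1)) +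
          P.R)) ∧
      ∃ h F, P.Stage h F 0 ∧ (∀ r < P.R, r ∈ F) ∧ Tables P s' h F 0 := by
  obtain ⟨X, hX⟩ : ∃ X, (P.K ^ P.L + 1) * (P.n + 1) * (P.n + 1) = X := ⟨_, rfl⟩
  obtain ⟨Y, hY⟩ : ∃ Y, ((P.K * (P.K + 1) / 2) ^ P.L + P.K ^ P.L + 1) * (P.n + 1) * (P.n + 1) = Y :=
    ⟨_, rfl⟩
  have hXY : X ≤ Y := by
    rw [← hX, ← hY]
    gcongr
    omega
  have hY1 : 1 ≤ Y := by
    rw [← hY]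
    exact Nat.mul_pos (Nat.mul_pos (Nat.succ_pos _) (Nat.succ_pos _)) (Nat.succ_pos _)
  have hYL : (((P.K * (P.K + 1) / 2) ^ P.L + P.K ^ P.L + 1) * (P.L + 1) * ((P.n + 1) * (P.n + 1)) +
          P.R) = Y * (P.L + 1) + P.R := by
    rw [← hY]
    ring
  rw [hYL]
  let Inv : ℕ → Store → Prop := fun m s' => ∃ h F,
    P.Stage h F (P.k + P.n - 1 - m) ∧ Tables P s' h F (P.k + P.n - 1 - m) ∧
      if m < P.k + P.n then ∀ r < P.R, r ∈ F ↔ P.k + P.n - 1 - m < P.top r else ∀ r < P.R, r ∈ F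
  have hTc : ∀ (h : ℕ → ℕ) (F : Finset ℕ) (t : ℕ) (s1 s2 : Store), Tables P s1 h F t →
      Frame [41, 50, 51] [] s1 s2 → Tables P s2 h F t := by
    rintro h F t s1 s2 ⟨h1, h2, h3, h4, h5, h6, h7⟩ hs
    have e1 := hs.nat arrFree (by decide)
    have e2 := hs.nat arrOk (by decide)
    have e3 := hs.real reaVal (by decide)
    have e4 := hs.nat arrSol (by decide)
    have e5 := hs.nat arrLoc (by decide)
    refine ⟨by rwa [e1], by rwa [e2], by rwa [e3], by rwa [e4], by rwa [e1, e2], by rwa [e1, e5], ?_⟩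
    intro u hu
    rw [e5]
    exact (h7 u hu).congr (.of_frame hs) (h6 u hu) fun _ _ _ _ => .rfl
  have hfull : [26, 27, 28, 29, 31, 32, 33, 34, 38, 39, 40, 41, 42, 43, 44, 45, 46, 47, 50, 51, 52,
      53, 54, 55, 56, 57] ⊆ [26, 27, 28, 29, 31, 32, 33, 34, 35, 36, 37, 38, 39, 40, 41, 42, 43, 44,
      45, 46, 47, 50, 51, 52, 53, 54, 55, 56, 57] := by decide
  unfold treeDP
  refine WP_forP [26, 27, 28, 29, 31, 32, 33, 34, 38, 39, 40, 41, 42, 43, 44, 45, 46, 47, 50, 51, 52,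
      53, 54, 55, 56, 57] [19, 24] (P.k + P.n) (fun _ => 6500 * (Y * (P.L + 1) + P.R)) Inv ?_ ?_ ?_ ?_
  · refine ⟨fun u => u, ∅, ?_, ?_, ?_⟩
    · simpa using hP.stage_init (by omega)
    · exact hTc _ _ _ _ _ (by simpa using hT) (Frame.refl _ _ _).writeNat
    · rw [if_pos (by omega)]
      intro r hr
      have := hP.top_lt r hr
      simp
      omega
  · intro m s' _ hs
    simp [hs.nat, hL.k, hL.n]
  · intro m s1 hm ⟨h, F, hS1, hT1, hF1⟩ hf1 hc1
    rw [if_pos hm] at hF1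
    obtain ⟨t, ht⟩ : ∃ t, P.k + P.n - 1 - m = t := ⟨_, rfl⟩
    rw [ht] at hS1 hT1 hF1
    have hL1 : Loaded P s1 := hL.congr (hf1.mono hfull (by decide))
    simp only [WP_seqs_cons, WP_seqs_singleton, WP_setN]
    set s2 := s1.writeNat arrT 0 0 _ with hs2
    have ht2 : s2.nat arrT 0 0 = t := by
      simp [hs2, hL1.k, hL1.n, hc1]
      omega
    have hf2 : Frame [41] [] s1 s2 := (Frame.refl _ _ s1).writeNat
    refine WP_forP [26, 27, 28, 29, 31, 32, 33, 34, 38, 39, 40, 42, 43, 44, 45, 46, 47, 51, 52,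
      53, 54] [19, 24] P.R (fun r => 100 + if P.top r = t then 3000 * X else 0)
      (fun r₀ s' => ∃ F, P.Stage h F t ∧ Tables P s' h F t ∧
        ∀ r < P.R, r ∈ F ↔ t < P.top r ∨ P.top r = t ∧ r < r₀) ?_ ?_ ?_ ?_
    · refine ⟨F, hS1, hTc _ _ _ _ _ hT1 ((hf2.mono (by decide) (by decide)).writeNat), ?_⟩
      intro r hr
      rw [hF1 r hr]
      omega
    · intro r₀ s3 _ hs3
      simp [hs3.nat, hf2.nat, hL1.R]
    · rintro r s3 hr ⟨F', hS3, hT3, hF3⟩ hf3 hc3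
      have hL3 : Loaded P s3 := hL1.congr ((hf2.mono (by decide) (by decide)).trans
        (hf3.mono (by decide) (by decide)))
      have ht3 : s3.nat arrT 0 0 = t := by simp [hf3.nat, ht2]
      rw [WP_ite]
      simp only [holds_and, holds_natLe, eval_n1, eval_nv, hc3, hL3.top r hr, ht3]
      refine ⟨fun h1 => ?_, fun h1 => ?_⟩
      · have h2 : P.top r = t := le_antisymm h1.1 h1.2
        have hrF : r ∉ F' := by
          rw [hF3 r hr]
          omega
        refine (complete_spec hP hL3 hS3 hT3 hK hr hrF h2 ht3 hc3).mono ?_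
        rintro τ s4 ⟨hτ, hT4⟩
        rw [hX] at hτ
        refine ⟨?_, insert r F', hS3.complete hP hr hrF h2,
          hTc _ _ _ _ _ hT4 (Frame.refl _ _ _).writeNat, ?_⟩
        · rw [if_pos h2]
          simp
          omega
        · intro r' hr'
          rw [Finset.mem_insert, hF3 r' hr']
          constructor
          · rintro (rfl | h3)
            · exact Or.inr ⟨h2, Nat.lt_succ_self _⟩
            · omega
          · omega
      · rw [WP_skip]
        refine ⟨by simp; omega, F', hS3, hTc _ _ _ _ _ hT3 (Frame.refl _ _ _).writeNat, ?_⟩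
        intro r' hr'
        rw [hF3 r' hr']
        constructor
        · omega
        · rintro (h3 | h3)
          · exact Or.inl h3
          · have : r' ≠ r := by
              rintro rfl
              omega
            omega
    · rintro τ s3 ⟨F', hS3, hT3, hF3⟩ hf3 hτ
      have hL3 : Loaded P s3 := hL1.congr ((hf2.mono (by decide) (by decide)).trans
        (hf3.mono (by decide) (by decide)))
      have ht3 : s3.nat arrT 0 0 = t := by simp [hf3.nat, ht2]
      have hτ' : τ ≤ 123 * P.R + 23 + 3000 * (P.L * Y) := by
        have h1 : ∑ r ∈ Finset.range P.R, (100 + if P.top r = t then 3000 * X else 0) ≤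
            P.R * 100 + P.L * (3000 * Y) := by
          rw [Finset.sum_add_distrib, ← Finset.sum_filter, Finset.sum_const, Finset.sum_const,
            Finset.card_range, smul_eq_mul, smul_eq_mul]
          exact Nat.add_le_add_left (Nat.mul_le_mul (hP.card_top_le t)
            (Nat.mul_le_mul_left _ hXY)) _
        have h2 : P.L * (3000 * Y) = 3000 * (P.L * Y) := by ring
        have h3 := hτ.trans (Nat.add_le_add_right h1 _)
        simp only [cost_nv] at h3
        omega
      have hall : ∀ r < P.R, P.top r = t → r ∈ F' := fun r hr h => (hF3 r hr).2 (Or.inr ⟨h, hr⟩)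
      have hYe : Y * (P.L + 1) = P.L * Y + Y := by ring
      rw [WP_ite]
      simp only [holds_natLe, eval_natLit, eval_nv, ht3]
      refine ⟨fun h1 => ?_, fun h1 => ?_⟩
      · refine (merge_spec hP hL3 hS3 hT3 hK (by omega) hall ht3).mono ?_
        rintro τ2 s4 ⟨hτ2, hT4⟩
        rw [hY] at hτ2
        have e : P.k + P.n - 1 - (m + 1) = t - 1 := by omega
        refine ⟨?_, P.mergeMap h t, F', ?_, ?_, ?_⟩
        · simp
          rw [hYe]
          omega
        · rw [e]
          exact hS3.merge hP (by omega) hall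
        · rw [e]
          exact hTc _ _ _ _ _ hT4 (Frame.refl _ _ _).writeNat
        · rw [if_pos (by omega)]
          intro r hr
          rw [hF3 r hr, e]
          omega
      · rw [WP_skip]
        have e : P.k + P.n - 1 - (m + 1) = t := by omega
        refine ⟨?_, h, F', ?_, ?_, ?_⟩
        · simp
          rw [hYe]
          omega
        · rw [e]
          exact hS3
        · rw [e]
          exact hTc _ _ _ _ _ hT3 (Frame.refl _ _ _).writeNat
        · rw [if_neg (by omega)]
          intro r hr
          rw [hF3 r hr]
          omega
  · rintro τ s1 ⟨h, F, hS1, hT1, hF1⟩ hf1 hτ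
    have e : P.k + P.n - 1 - (P.k + P.n) = 0 := by omega
    rw [e] at hS1 hT1
    rw [if_neg (lt_irrefl _)] at hF1
    refine ⟨?_, h, F, hS1, hF1, hT1⟩
    have h1 : 1 ≤ Y * (P.L + 1) := Nat.mul_pos hY1 (Nat.succ_pos _)
    have := for_cost (A := 7000 * (Y * (P.L + 1) + P.R)) hτ (by simp; omega)
    refine this.trans (le_of_eq ?_)
    ring

end RealRAM

/-! ### Rounding -/

open Finset in
/-- The largest `d < K` such that `d = 0` or `d * g < w`. -/
noncomputable def roundDigit (g : ℝ) (K : ℕ) (w : ℝ) : ℕ :=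
  ((range (K - 1)).filter fun q : ℕ => ((q : ℝ) + 1) * g < w).card

open Finset in
theorem roundDigit_mul_le {g w : ℝ} {K : ℕ} (hg : 0 ≤ g) (hw : 0 ≤ w) :
    roundDigit g K w * g ≤ w ∧ (w ≤ roundDigit g K w * g + g ∨ roundDigit g K w = K - 1) := by
  unfold roundDigit
  generalize K - 1 = N
  induction N with
  | zero => simp [hw]
  | succ N ih =>
    rw [range_add_one, filter_insert]
    split_ifs with h
    · rw [card_insert_of_notMem (by simp)]
      set c := ((range N).filter fun q : ℕ => ((q : ℝ) + 1) * g < w).card with hc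
      have hcN : c ≤ N := (card_filter_le _ _).trans (by simp)
      have : c = N := by
        rcases ih.2 with h1 | h1
        · by_contra hne
          have : (c : ℝ) + 1 ≤ N := by exact_mod_cast lt_of_le_of_ne hcN hne
          nlinarith
        · exact h1
      rw [this]
      push_cast
      exact ⟨h.le, Or.inr rfl⟩
    · refine ⟨ih.1, ?_⟩
      rcases ih.2 with h1 | h1
      · exact Or.inl h1
      · left
        rw [h1]
        push Not at h
        linarith

/-- The data of a portfolio problem in the form in which the program works with them.  The rows
`r < m` are inequality constraints with right-hand sides `b`, the rows `m ≤ r < m + H` are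
eigenvectors with eigenvalues `lam`; `e` is the precision, `K` the number of digits. -/
structure RowData where
  (n m H k K L : ℕ)
  B : ℕ → ℕ → ℝ
  (b u d mu lam : ℕ → ℝ)
  e : ℝ
  (top col par : ℕ → ℕ)
  bag : ℕ → ℕ → Prop

namespace RowData

open Finset

variable (p : RowData)

/-- The number of intervals into which the range of a variable is divided. -/
def M : ℕ := p.K + p.K + p.K + p.K
/-- The number of rows. -/
def R : ℕ := p.m + p.H
/-- The scaling factor of a row. -/
noncomputable def sig (r : ℕ) : ℝ := ∑ j ∈ range p.n, |p.B r j| * p.u j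
/-- The absolute value of the smallest possible value of a row. -/
noncomputable def neg (r : ℕ) : ℝ := ∑ j ∈ range p.n, if 0 ≤ p.B r j then 0 else -p.B r j * p.u j
/-- The number of variables in a row. -/
noncomputable def sup (r : ℕ) : ℝ := ∑ j ∈ range p.n, if p.B r j ≠ 0 then 1 else 0
/-- The grid width in a row. -/
noncomputable def grid (r : ℕ) : ℝ := 4 * p.e * p.sig r / 5
/-- The contribution of `x j = x` to row `r`, shifted so that its smallest value is `0`. -/
noncomputable def term (r j : ℕ) (x : ℝ) : ℝ :=
  if 0 ≤ p.B r j then p.B r j * x else -p.B r j * (p.u j - x)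
/-- The minimiser of `d x ^ 2 - μ x` over an interval. -/
noncomputable def rep (d mu lo hi : ℝ) : ℝ :=
  if mu ≤ 2 * d * lo then lo else if 2 * d * hi ≤ mu then hi else mu / (2 * d)
/-- The value of variable `j` for choice `c`: zero for `c = 0`, and otherwise the cheapest point of
the interval number `c - 1`. -/
noncomputable def xval (j c : ℕ) : ℝ :=
  if c = 0 then 0 else rep (p.d j) (p.mu j) (((c - 1 : ℕ) : ℝ) / p.M * p.u j)
    ((((c - 1 : ℕ) : ℝ) + 1) / p.M * p.u j)
/-- The cost of choice `c` for variable `j`. -/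
noncomputable def cost (j c : ℕ) : ℝ := p.d j * p.xval j c * p.xval j c - p.mu j * p.xval j c
/-- The rounded contribution of choice `c` for variable `j` to row `r`. -/
noncomputable def dig (r j c : ℕ) : ℕ := roundDigit (p.grid r) p.K (p.term r j (p.xval j c))
/-- The left end of the interval of values of row `r` that are compatible with the rounded sum
`D`. -/
noncomputable def ylo (r D : ℕ) : ℝ := D * p.grid r - p.neg r - p.sig r / p.M
/-- The right end of this interval. -/
noncomputable def yhi (r D : ℕ) : ℝ := (D + p.sup r) * p.grid r - p.neg r + p.sig r / p.M
/-- The point of this interval that is closest to `0`. -/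
noncomputable def yval (r D : ℕ) : ℝ :=
  if 0 ≤ p.ylo r D then p.ylo r D else if p.yhi r D ≤ 0 then p.yhi r D else 0
/-- The relaxed constraint on the rounded sum of a row. -/
def ok (r D : ℕ) : Prop := r < p.m → D * p.grid r ≤ p.b r + p.neg r + p.sig r / p.M
/-- The contribution of row `r` to the objective. -/
noncomputable def pen (r D : ℕ) : ℝ :=
  if r < p.m then 0 else p.lam (r - p.m) * p.yval r D * p.yval r D

/-- The optimisation problem to which the dynamic program is applied. -/
noncomputable def tree : TreeDP where
  n := p.n
  R := p.R
  k := p.k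
  K := p.K
  L := p.L
  M := p.M
  top := p.top
  col := p.col
  par := p.par
  bag := p.bag
  dg := p.dig
  cst := p.cost
  pen := p.pen
  pok := p.ok

/-- The numerical requirements on the data. -/
structure Sound : Prop where
  e_pos : 0 < p.e
  K_gt : 5 < p.K * (4 * p.e)
  u_nonneg : ∀ j < p.n, 0 ≤ p.u j
  d_nonneg : ∀ j < p.n, 0 ≤ p.d j

variable {p}

theorem rep_mem {d mu lo hi : ℝ} (h : lo ≤ hi) (hd : 0 ≤ d) :
    lo ≤ rep d mu lo hi ∧ rep d mu lo hi ≤ hi := by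
  unfold rep
  split_ifs with h1 h2
  · exact ⟨le_rfl, h⟩
  · exact ⟨h, le_rfl⟩
  · push Not at h1 h2
    have hd' : 0 < d := by
      rcases hd.eq_or_lt with rfl | h'
      · linarith
      · exact h'
    rw [le_div_iff₀ (by linarith), div_le_iff₀ (by linarith)]
    constructor <;> linarith

theorem rep_le {d mu lo hi z : ℝ} (hd : 0 ≤ d) (h1 : lo ≤ z) (h2 : z ≤ hi) :
    d * rep d mu lo hi * rep d mu lo hi - mu * rep d mu lo hi ≤ d * z ^ 2 - mu * z := by
  unfold rep
  split_ifs with h3 h4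
  · nlinarith [mul_nonneg hd (sub_nonneg.2 h1), mul_nonneg (sub_nonneg.2 h1) (sub_nonneg.2 h3),
      mul_nonneg hd (sq_nonneg (z - lo))]
  · nlinarith [mul_nonneg (sub_nonneg.2 h2) (sub_nonneg.2 h4), mul_nonneg hd (sq_nonneg (z - hi))]
  · push Not at h3 h4
    have hd' : 0 < d := by
      rcases hd.eq_or_lt with rfl | h'
      · linarith
      · exact h'
    have : mu = 2 * d * (mu / (2 * d)) := by field_simp
    set y := mu / (2 * d) with hy
    rw [this]
    nlinarith [mul_nonneg hd (sq_nonneg (z - y))]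

theorem Sound.K_pos (hp : p.Sound) : 0 < p.K := by
  rcases Nat.eq_zero_or_pos p.K with h | h
  · have := hp.K_gt
    rw [h] at this
    norm_num at this
  · exact h

theorem Sound.M_pos (hp : p.Sound) : (0 : ℝ) < p.M := by
  have := hp.K_pos
  rw [M]
  exact_mod_cast (by omega)

theorem M_eq : (p.M : ℝ) = 4 * p.K := by
  rw [M]
  push_cast
  ring

theorem Sound.xval_mem (hp : p.Sound) {j c : ℕ} (hj : j < p.n) (hc : c ≤ p.M) :
    0 ≤ p.xval j c ∧ p.xval j c ≤ p.u j := by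
  have hu := hp.u_nonneg j hj
  have hM := hp.M_pos
  unfold xval
  split_ifs with h
  · exact ⟨le_rfl, hu⟩
  · have h1 : ((c - 1 : ℕ) : ℝ) + 1 ≤ p.M := by
      have : (c - 1) + 1 ≤ p.M := by omega
      exact_mod_cast this
    have h2 : (((c - 1 : ℕ) : ℝ) + 1) / p.M ≤ 1 := by rwa [div_le_one hM]
    have h3 : ((c - 1 : ℕ) : ℝ) / p.M ≤ (((c - 1 : ℕ) : ℝ) + 1) / p.M := by gcongr; linarith
    have h4 : 0 ≤ ((c - 1 : ℕ) : ℝ) / p.M := by positivity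
    obtain ⟨g1, g2⟩ := rep_mem (mu := p.mu j) (mul_le_mul_of_nonneg_right h3 hu) (hp.d_nonneg j hj)
    exact ⟨(mul_nonneg h4 hu).trans g1, g2.trans (mul_le_of_le_one_left hu h2)⟩

theorem term_nonneg {r j : ℕ} {x : ℝ} (h0 : 0 ≤ x) (h1 : x ≤ p.u j) :
    0 ≤ p.term r j x ∧ p.term r j x ≤ |p.B r j| * p.u j := by
  unfold term
  split_ifs with h
  · rw [abs_of_nonneg h]
    exact ⟨mul_nonneg h h0, mul_le_mul_of_nonneg_left h1 h⟩
  · push Not at h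
    rw [abs_of_neg h]
    exact ⟨mul_nonneg (by linarith) (by linarith),
      mul_le_mul_of_nonneg_left (by linarith) (by linarith)⟩

theorem sum_term (r : ℕ) (x : ℕ → ℝ) :
    ∑ j ∈ range p.n, p.term r j (x j) = ∑ j ∈ range p.n, p.B r j * x j + p.neg r := by
  rw [neg, ← sum_add_distrib]
  refine sum_congr rfl fun j _ => ?_
  unfold term
  split_ifs <;> ring

theorem Sound.sig_nonneg (hp : p.Sound) (r : ℕ) : 0 ≤ p.sig r :=
  sum_nonneg fun j hj => mul_nonneg (abs_nonneg _) (hp.u_nonneg j (mem_range.1 hj))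

theorem Sound.grid_nonneg (hp : p.Sound) (r : ℕ) : 0 ≤ p.grid r := by
  have := hp.sig_nonneg r
  have := hp.e_pos
  unfold grid
  positivity

theorem Sound.sig_le (hp : p.Sound) (r : ℕ) : p.sig r ≤ p.K * p.grid r := by
  have h1 := hp.sig_nonneg r
  have h2 := hp.K_gt
  unfold grid
  nlinarith

/-- The rounding error of a single contribution. -/
theorem Sound.dig_bounds (hp : p.Sound) {r j c : ℕ} (hj : j < p.n) (hc : c ≤ p.M) :
    p.dig r j c * p.grid r ≤ p.term r j (p.xval j c) ∧
      p.term r j (p.xval j c) ≤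
        p.dig r j c * p.grid r + (if p.B r j ≠ 0 then 1 else 0) * p.grid r := by
  obtain ⟨h0, h1⟩ := hp.xval_mem hj hc
  obtain ⟨t0, t1⟩ := term_nonneg (r := r) h0 h1
  have hg := hp.grid_nonneg r
  obtain ⟨a1, a2⟩ := roundDigit_mul_le (K := p.K) hg t0
  refine ⟨a1, ?_⟩
  by_cases hB : p.B r j = 0
  · have : p.term r j (p.xval j c) = 0 := by simp [term, hB]
    rw [this]
    simp only [hB, ne_eq, not_true_eq_false, if_false, zero_mul, add_zero]
    positivity
  · rw [if_pos hB, one_mul]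
    rcases a2 with a2 | a2
    · exact a2
    · unfold dig
      rw [a2]
      have h2 : p.term r j (p.xval j c) ≤ p.sig r := t1.trans
        (single_le_sum (f := fun j => |p.B r j| * p.u j)
          (fun j hj => mul_nonneg (abs_nonneg _) (hp.u_nonneg j (mem_range.1 hj))) (mem_range.2 hj))
      have h3 := hp.sig_le r
      have h4 : ((p.K - 1 : ℕ) : ℝ) = p.K - 1 := by
        have := hp.K_pos
        rw [Nat.cast_sub (by omega), Nat.cast_one]
      rw [h4]
      linarith

theorem Sound.B_ne_zero (hp : p.Sound) {r j c : ℕ} (h : p.dig r j c ≠ 0) : p.B r j ≠ 0 := by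
  intro hB
  apply h
  have : p.term r j (p.xval j c) = 0 := by simp [term, hB]
  rw [dig, this, roundDigit, card_eq_zero, filter_eq_empty_iff]
  intro q _
  have := hp.grid_nonneg r
  push Not
  positivity

theorem Sound.sum_bounds (hp : p.Sound) {x : ℕ → ℕ} (hx : ∀ j < p.n, x j ≤ p.M) (r : ℕ) :
    ((∑ j ∈ range p.n, p.dig r j (x j) : ℕ) : ℝ) * p.grid r ≤
        ∑ j ∈ range p.n, p.B r j * p.xval j (x j) + p.neg r ∧
      ∑ j ∈ range p.n, p.B r j * p.xval j (x j) + p.neg r ≤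
        ((∑ j ∈ range p.n, p.dig r j (x j) : ℕ) : ℝ) * p.grid r + p.sup r * p.grid r := by
  rw [← sum_term, Nat.cast_sum, sum_mul, sup, sum_mul, ← sum_add_distrib]
  exact ⟨sum_le_sum fun j hj => (hp.dig_bounds (mem_range.1 hj) (hx j (mem_range.1 hj))).1,
    sum_le_sum fun j hj => (hp.dig_bounds (mem_range.1 hj) (hx j (mem_range.1 hj))).2⟩

theorem Sound.sum_lt (hp : p.Sound) {x : ℕ → ℕ} (hx : ∀ j < p.n, x j ≤ p.M) (r : ℕ) :
    ∑ j ∈ range p.n, p.dig r j (x j) < p.K := by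
  have h1 := (hp.sum_bounds hx r).1
  rw [← sum_term] at h1
  have h2 : ∑ j ∈ range p.n, p.term r j (p.xval j (x j)) ≤ p.sig r := sum_le_sum fun j hj => by
    obtain ⟨a0, a1⟩ := hp.xval_mem (mem_range.1 hj) (hx j (mem_range.1 hj))
    exact (term_nonneg a0 a1).2
  rcases (hp.sig_nonneg r).eq_or_lt with h0 | h0
  · -- all contributions vanish
    have : ∑ j ∈ range p.n, p.dig r j (x j) = 0 := by
      refine sum_eq_zero fun j hj => ?_
      obtain ⟨a0, a1⟩ := hp.xval_mem (mem_range.1 hj) (hx j (mem_range.1 hj))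
      obtain ⟨t0, t1⟩ := term_nonneg (r := r) a0 a1
      have t2 := single_le_sum (f := fun j => |p.B r j| * p.u j)
          (fun j hj => mul_nonneg (abs_nonneg _) (hp.u_nonneg j (mem_range.1 hj))) hj
      have t3 : p.term r j (p.xval j (x j)) ≤ 0 := t1.trans (t2.trans h0.ge)
      rw [dig, roundDigit, card_eq_zero, filter_eq_empty_iff]
      intro q _
      have := hp.grid_nonneg r
      push Not
      exact t3.trans (by positivity)
    rw [this]
    exact hp.K_pos
  · have h3 : p.sig r < p.K * p.grid r := by
      have := hp.K_gt
      unfold grid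
      nlinarith
    have h4 : 0 < p.grid r := by
      have := hp.e_pos
      unfold grid
      positivity
    have h5 := (h1.trans h2).trans_lt h3
    exact_mod_cast lt_of_mul_lt_mul_right h5 h4.le

theorem Sound.step_le (hp : p.Sound) (r : ℕ) : p.sig r / p.M ≤ p.e / 5 * p.sig r := by
  have h1 := hp.sig_nonneg r
  have h2 := hp.K_gt
  have h3 := hp.M_pos
  have h4 := M_eq (p := p)
  rw [div_le_iff₀ h3]
  have : 1 ≤ p.e / 5 * p.M := by rw [h4]; linarith
  nlinarith

theorem sup_nonneg (r : ℕ) : 0 ≤ p.sup r := sum_nonneg fun j _ => by split_ifs <;> norm_num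

/-- A solution of the relaxed problem violates the constraints only slightly. -/
theorem Sound.constraint_le (hp : p.Sound) {x : ℕ → ℕ} (hx : ∀ j < p.n, x j ≤ p.M) {r : ℕ}
    (hr : r < p.m) (hs : 1 ≤ p.sup r) (hok : p.ok r (∑ j ∈ range p.n, p.dig r j (x j))) :
    ∑ j ∈ range p.n, p.B r j * p.xval j (x j) ≤ p.b r + p.e * p.sup r * p.sig r := by
  have h1 := (hp.sum_bounds hx r).2
  have h2 := hok hr
  have h3 := hp.step_le r
  have h4 := hp.sig_nonneg r
  have h5 := hp.e_pos
  have h6 : p.grid r = 4 * p.e * p.sig r / 5 := rfl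
  rw [h6] at h1 h2
  have h7 : 0 ≤ (p.sup r - 1) * (p.e * p.sig r) := mul_nonneg (by linarith) (by positivity)
  nlinarith

theorem Sound.ylo_le_yhi (hp : p.Sound) (r D : ℕ) : p.ylo r D ≤ p.yhi r D := by
  have h1 := hp.grid_nonneg r
  have h2 : 0 ≤ p.sig r / p.M := div_nonneg (hp.sig_nonneg r) hp.M_pos.le
  have h3 := sup_nonneg (p := p) r
  unfold ylo yhi
  nlinarith

theorem Sound.yval_mem (hp : p.Sound) (r D : ℕ) :
    p.ylo r D ≤ p.yval r D ∧ p.yval r D ≤ p.yhi r D := by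
  have := hp.ylo_le_yhi r D
  unfold yval
  split_ifs with h1 h2
  · exact ⟨le_rfl, this⟩
  · exact ⟨this, le_rfl⟩
  · push Not at h1 h2
    exact ⟨h1.le, h2.le⟩

theorem yval_sq_le {r D : ℕ} {y : ℝ} (h1 : p.ylo r D ≤ y) (h2 : y ≤ p.yhi r D) :
    p.yval r D * p.yval r D ≤ y ^ 2 := by
  unfold yval
  split_ifs with h3 h4
  · nlinarith
  · nlinarith
  · nlinarith [sq_nonneg y]

theorem Sound.abs_sub_yval_le (hp : p.Sound) {x : ℕ → ℕ} (hx : ∀ j < p.n, x j ≤ p.M) (r : ℕ) :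
    |∑ j ∈ range p.n, p.B r j * p.xval j (x j) -
      p.yval r (∑ j ∈ range p.n, p.dig r j (x j))| ≤ p.e * (p.sup r + 1) * p.sig r := by
  obtain ⟨h1, h2⟩ := hp.sum_bounds hx r
  obtain ⟨h3, h4⟩ := hp.yval_mem r (∑ j ∈ range p.n, p.dig r j (x j))
  have h5 := hp.step_le r
  have h6 : p.grid r = 4 * p.e * p.sig r / 5 := rfl
  unfold ylo at h3
  unfold yhi at h4
  have h7 : 0 ≤ p.e * p.sig r := mul_nonneg hp.e_pos.le (hp.sig_nonneg r)
  have h8 : 0 ≤ p.sup r * (p.e * p.sig r) := mul_nonneg (sup_nonneg r) h7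
  have h9 : p.sup r * p.grid r = 4 / 5 * (p.sup r * (p.e * p.sig r)) := by rw [h6]; ring
  rw [abs_le]
  constructor <;> nlinarith

/-- Each point of the range of a variable lies in one of the intervals. -/
theorem exists_interval {M : ℕ} (hM : 0 < M) {u z : ℝ} (h0 : 0 ≤ z) (h1 : z ≤ u) :
    ∃ c < M, (c : ℝ) / M * u ≤ z ∧ z ≤ ((c : ℝ) + 1) / M * u := by
  have hM' : (0 : ℝ) < M := by exact_mod_cast hM
  have key : ∀ N : ℕ, 0 < N → z ≤ (N : ℝ) / M * u → ∃ c < N, (c : ℝ) / M * u ≤ z ∧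
      z ≤ ((c : ℝ) + 1) / M * u := by
    intro N hN
    induction N with
    | zero => omega
    | succ N ih =>
      intro h2
      push_cast at h2
      by_cases h3 : (N : ℝ) / M * u ≤ z
      · exact ⟨N, by omega, h3, h2⟩
      · push Not at h3
        rcases Nat.eq_zero_or_pos N with h4 | h4
        · rw [h4] at h3
          simp at h3
          linarith
        · obtain ⟨c, hc, h⟩ := ih h4 h3.le
          exact ⟨c, by omega, h⟩
  exact key M hM (by rwa [div_self hM'.ne', one_mul])

/-- The choices that represent the point `z`. -/
def Near (p : RowData) (x : ℕ → ℕ) (z : ℕ → ℝ) : Prop :=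
  ∀ j < p.n, x j ≤ p.M ∧ |p.xval j (x j) - z j| ≤ p.u j / p.M ∧
    p.cost j (x j) ≤ p.d j * z j ^ 2 - p.mu j * z j

theorem Sound.exists_choice (hp : p.Sound) {j : ℕ} (hj : j < p.n) {z : ℝ} (h0 : 0 ≤ z)
    (h1 : z ≤ p.u j) : ∃ c ≤ p.M, c ≠ 0 ∧ |p.xval j c - z| ≤ p.u j / p.M ∧
      p.cost j c ≤ p.d j * z ^ 2 - p.mu j * z := by
  have hM := hp.M_pos
  obtain ⟨c, hc, h2, h3⟩ := exists_interval (M := p.M) (by exact_mod_cast hM) h0 h1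
  refine ⟨c + 1, hc, by omega, ?_, ?_⟩
  · have hx : p.xval j (c + 1) = rep (p.d j) (p.mu j) ((c : ℝ) / p.M * p.u j)
        (((c : ℝ) + 1) / p.M * p.u j) := by simp [xval]
    rw [hx]
    obtain ⟨g1, g2⟩ := rep_mem (mu := p.mu j) (h2.trans h3) (hp.d_nonneg j hj)
    have h4 : ((c : ℝ) + 1) / p.M * p.u j = (c : ℝ) / p.M * p.u j + p.u j / p.M := by ring
    rw [abs_le]
    constructor <;> linarith
  · have hx : p.xval j (c + 1) = rep (p.d j) (p.mu j) ((c : ℝ) / p.M * p.u j)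
        (((c : ℝ) + 1) / p.M * p.u j) := by simp [xval]
    rw [cost, hx]
    exact rep_le (hp.d_nonneg j hj) h2 h3

theorem Near.abs_sub_le {x : ℕ → ℕ} {z : ℕ → ℝ} (h : p.Near x z) (r : ℕ) :
    |∑ j ∈ range p.n, p.B r j * p.xval j (x j) - ∑ j ∈ range p.n, p.B r j * z j| ≤
      p.sig r / p.M := by
  rw [← sum_sub_distrib, sig, sum_div]
  refine (abs_sum_le_sum_abs _ _).trans (sum_le_sum fun j hj => ?_)
  rw [← mul_sub, abs_mul, mul_div_assoc]
  exact mul_le_mul_of_nonneg_left (h j (mem_range.1 hj)).2.1 (abs_nonneg _)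

theorem Near.ok (hp : p.Sound) {x : ℕ → ℕ} {z : ℕ → ℝ} (h : p.Near x z) {r : ℕ}
    (hz : r < p.m → ∑ j ∈ range p.n, p.B r j * z j ≤ p.b r) :
    p.ok r (∑ j ∈ range p.n, p.dig r j (x j)) := by
  intro hr
  have h1 := (hp.sum_bounds (fun j hj => (h j hj).1) r).1
  have h2 := (abs_le.1 (h.abs_sub_le r)).2
  have := hz hr
  linarith

theorem Near.yval_sq_le (hp : p.Sound) {x : ℕ → ℕ} {z : ℕ → ℝ} (h : p.Near x z) (r : ℕ) :
    p.yval r (∑ j ∈ range p.n, p.dig r j (x j)) * p.yval r (∑ j ∈ range p.n, p.dig r j (x j)) ≤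
      (∑ j ∈ range p.n, p.B r j * z j) ^ 2 := by
  obtain ⟨h1, h2⟩ := hp.sum_bounds (fun j hj => (h j hj).1) r
  have h3 := abs_le.1 (h.abs_sub_le r)
  refine RowData.yval_sq_le ?_ ?_
  · unfold ylo
    linarith
  · unfold yhi
    linarith

end RowData

/-! ### Preparing the numerical data -/

namespace RealRAM

open Finset

/-! Names for further real arrays: `reaB` holds the rows and `reaE` the precision, `reaSig`, `reaNeg` and
`reaSup` the data of the rows, `reaX` the values of the choices and `reaY` those of the
`y`-variables. -/

notation "reaB" => 10
notation "reaSig" => 11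
notation "reaNeg" => 12
notation "reaSup" => 13
notation "reaE" => 14
notation "reaX" => 15
notation "reaY" => 18
notation "reaW" => 20
notation "reaG" => 21
notation "reaPt" => 22
notation "reaLo" => 25
notation "reaHi" => 26
notation "reaBest" => 27

/-- The rows, their arrangement along the tree, and the precision are in memory. -/
structure Base (p : RowData) (s : Store) : Prop where
  n : s.nat 0 0 0 = p.n
  m : s.nat 0 1 0 = p.m
  H : s.nat 0 2 0 = p.H
  k : s.nat 0 4 0 = p.k
  R : s.nat arrR 0 0 = p.R
  K : s.nat arrK 0 0 = p.K
  L : s.nat arrL 0 0 = p.L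
  M : s.nat arrM 0 0 = p.M
  B : ∀ r < p.R, ∀ j < p.n, s.real reaB r j = p.B r j
  b : ∀ r < p.m, s.real 2 r 0 = p.b r
  u : ∀ j < p.n, s.real 3 j 0 = p.u j
  d : ∀ j < p.n, s.real 4 j 0 = p.d j
  mu : ∀ j < p.n, s.real 5 j 0 = p.mu j
  lam : ∀ h < p.H, s.real 6 h 0 = p.lam h
  e : s.real reaE 0 0 = p.e
  top : ∀ r < p.R, s.nat arrTop r 0 = p.top r
  col : ∀ r < p.R, s.nat arrCol r 0 = p.col r
  par : ∀ t < p.k + p.n, s.nat arrPar t 0 = p.par t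

theorem Base.congr {p : RowData} {s s' : Store} (h : Base p s)
    (hs : Frame [3, 4, 19, 20, 21, 22, 23, 24, 25, 26, 27, 28, 29, 30, 31, 32, 33, 34, 35, 36, 37, 38,
      39, 40, 41, 42, 43, 44, 45, 46, 47, 50, 51, 52, 53, 54, 55, 56, 57]
      [8, 9, 11, 12, 13, 15, 16, 17, 18, 19, 20, 21, 22, 24, 25, 26, 27] s s') : Base p s' := by
  constructor <;> simp only [hs.nat 0 (by decide), hs.nat arrR (by decide),
    hs.nat arrK (by decide), hs.nat arrL (by decide), hs.nat arrM (by decide),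
    hs.nat arrTop (by decide), hs.nat arrCol (by decide), hs.nat arrPar (by decide),
    hs.real reaB (by decide), hs.real 2 (by decide), hs.real 3 (by decide), hs.real 4 (by decide),
    hs.real 5 (by decide), hs.real 6 (by decide), hs.real reaE (by decide)]
  exacts [h.n, h.m, h.H, h.k, h.R, h.K, h.L, h.M, h.B, h.b, h.u, h.d, h.mu, h.lam, h.e, h.top, h.col,
    h.par]

/-- Compute the scaling factor, the smallest value and the size of the support of each row. -/
def rowSums : Prog :=
  forP ctrR (nv arrR) (forP ctrJ (nv 0) (seqs [
    .ite (.realLe 0 (r2 reaB (nv ctrR) (nv ctrJ)))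
      (.setReal reaSig (nv ctrR) 0
        (r1 reaSig (nv ctrR) + r2 reaB (nv ctrR) (nv ctrJ) * r1 3 (nv ctrJ)))
      (seqs [
        .setReal reaSig (nv ctrR) 0
          (r1 reaSig (nv ctrR) + (0 - r2 reaB (nv ctrR) (nv ctrJ)) * r1 3 (nv ctrJ)),
        .setReal reaNeg (nv ctrR) 0
          (r1 reaNeg (nv ctrR) + (0 - r2 reaB (nv ctrR) (nv ctrJ)) * r1 3 (nv ctrJ))]),
    .ite (.and (.realLe (r2 reaB (nv ctrR) (nv ctrJ)) 0) (.realLe 0 (r2 reaB (nv ctrR) (nv ctrJ))))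
      .skip
      (.setReal reaSup (nv ctrR) 0 (r1 reaSup (nv ctrR) + 1))]))

/-- The results of `rowSums`. -/
structure HasSums (p : RowData) (s : Store) : Prop where
  sig : ∀ r < p.R, s.real reaSig r 0 = p.sig r
  neg : ∀ r < p.R, s.real reaNeg r 0 = p.neg r
  sup : ∀ r < p.R, s.real reaSup r 0 = p.sup r

theorem rowSums_spec {p : RowData} {s : Store} (hb : Base p s) (h1 : ∀ r, s.real reaSig r 0 = 0)
    (h2 : ∀ r, s.real reaNeg r 0 = 0) (h3 : ∀ r, s.real reaSup r 0 = 0) :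
    WP rowSums s fun t s' => t ≤ 300 * ((p.R + 1) * (p.n + 1)) ∧ HasSums p s' := by
  -- `g r` is the number of terms that have been added in row `r`
  let Inv : (ℕ → ℕ) → Store → Prop := fun g s' => ∀ r < p.R,
    s'.real reaSig r 0 = ∑ j ∈ range (g r), |p.B r j| * p.u j ∧
    s'.real reaNeg r 0 = ∑ j ∈ range (g r), (if 0 ≤ p.B r j then 0 else -p.B r j * p.u j) ∧
    s'.real reaSup r 0 = ∑ j ∈ range (g r), (if p.B r j ≠ 0 then 1 else 0)
  have hInv : ∀ g g' s', (∀ r < p.R, g r = g' r) → Inv g s' → Inv g' s' := by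
    intro g g' s' h h' r hr
    have := h' r hr
    rwa [h r hr] at this
  unfold rowSums
  refine WP_forP [51, 54] [11, 12, 13] p.R (fun _ => 250 * (p.n + 1))
    (fun m => Inv fun r => if r < m then p.n else 0) ?_ ?_ ?_ ?_
  · intro r hr
    simp [h1, h2, h3]
  · intro m s' _ hs
    simp [hs.nat, hb.R]
  · intro r₀ s1 hr0 hI1 hf1 hc1
    refine WP_forP [54] [11, 12, 13] p.n (fun _ => 200)
      (fun m => Inv fun r => if r < r₀ then p.n else if r = r₀ then m else 0) ?_ ?_ ?_ ?_
    · refine hInv _ _ _ (fun r hr => ?_) hI1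
      split_ifs <;> rfl
    · intro m s' _ hs
      simp [hs.nat, hf1.nat, hb.n]
    · intro j s2 hj hI2 hf2 hc2
      have hb2 : Base p s2 := hb.congr ((hf1.mono (by decide) (by decide)).trans
        (hf2.mono (by decide) (by decide)))
      have e1 : s2.nat ctrR 0 0 = r₀ := by simp [hf2.nat, hc1]
      have e2 := hb2.B r₀ hr0 j hj
      have e3 := hb2.u j hj
      obtain ⟨i1, i2, i3⟩ := hI2 r₀ hr0
      simp only [lt_irrefl, if_false, if_true] at i1 i2 i3
      have other : ∀ s3 : Store, (∀ r, r ≠ r₀ → s3.real reaSig r 0 = s2.real reaSig r 0 ∧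
          s3.real reaNeg r 0 = s2.real reaNeg r 0 ∧ s3.real reaSup r 0 = s2.real reaSup r 0) →
          (s3.real reaSig r₀ 0 = ∑ j ∈ range (j + 1), |p.B r₀ j| * p.u j ∧
          s3.real reaNeg r₀ 0 = ∑ j ∈ range (j + 1), (if 0 ≤ p.B r₀ j then 0 else -p.B r₀ j * p.u j) ∧
          s3.real reaSup r₀ 0 = ∑ j ∈ range (j + 1), (if p.B r₀ j ≠ 0 then 1 else 0)) →
          Inv (fun r => if r < r₀ then p.n else if r = r₀ then j + 1 else 0) s3 := by
        intro s3 g1 g2 r hr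
        by_cases h : r = r₀
        · subst h
          simpa using g2
        · obtain ⟨k1, k2, k3⟩ := g1 r h
          rw [k1, k2, k3]
          simpa [h] using hI2 r hr
      simp only [sum_range_succ] at other
      simp only [WP_seqs_cons, WP_seqs_singleton, WP_ite, WP_setReal, WP_skip, holds_realLe, holds_and,
        eval_r2, eval_nv, eval_realLit, real_writeReal, nat_writeReal, e1, hc2, e2]
      norm_num only [false_and, if_false]
      refine ⟨fun g1 => ⟨fun g2 => ⟨by simp, other _ ?_ ?_⟩, fun g2 => ⟨by simp, other _ ?_ ?_⟩⟩,
        fun g1 => ⟨fun g2 => ⟨by simp, other _ ?_ ?_⟩, fun g2 => ⟨by simp, other _ ?_ ?_⟩⟩⟩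
      · intro r hr
        simp [e1, hr]
      · have : p.B r₀ j = 0 := le_antisymm g2.1 g2.2
        simp [e1, e2, e3, hc2, i1, i2, i3, this]
      · intro r hr
        simp [e1, hr]
      · have : p.B r₀ j ≠ 0 := fun h => g2 ⟨h.le, h.ge⟩
        simp [e1, e2, e3, hc2, i1, i2, i3, this, g1, abs_of_nonneg g1]
      · intro r hr
        simp [e1, hr]
      · exact absurd g2.2 g1
      · intro r hr
        simp [e1, hr]
      · push Not at g1
        simp [e1, e2, e3, hc2, i1, i2, i3, g1.ne, not_le.2 g1, abs_of_neg g1]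
    · intro τ s2 hI2 hf2 hτ
      refine ⟨?_, hInv _ _ _ (fun r hr => ?_) hI2⟩
      · simp at hτ
        omega
      · split_ifs <;> first | rfl | omega
  · intro τ s1 hI1 hf1 hτ
    refine ⟨?_, ?_⟩
    · have := for_cost (A := 300 * (p.n + 1)) hτ (by simp; omega)
      linarith
    · constructor <;> intro r hr <;> have := hI1 r hr <;> simp only [hr, if_true] at this
      exacts [this.1, this.2.1, this.2.2]

/-- Compute the values and the costs of the choices for each variable. -/
def choices : Prog :=
  forP ctrJ (nv 0) (forP ctrC (nv arrM) (seqs [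
    setR reaLo (.ofNat (nv ctrC) / .ofNat (nv arrM) * r1 3 (nv ctrJ)),
    setR reaHi ((.ofNat (nv ctrC) + 1) / .ofNat (nv arrM) * r1 3 (nv ctrJ)),
    .ite (.realLe (r1 5 (nv ctrJ)) (2 * r1 4 (nv ctrJ) * rv reaLo))
      (setR reaPt (rv reaLo))
      (.ite (.realLe (2 * r1 4 (nv ctrJ) * rv reaHi) (r1 5 (nv ctrJ)))
        (setR reaPt (rv reaHi))
        (setR reaPt (r1 5 (nv ctrJ) / (2 * r1 4 (nv ctrJ))))),
    .setReal reaX (nv ctrJ) (nv ctrC + 1) (rv reaPt),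
    .setReal reaCst (nv ctrJ) (nv ctrC + 1)
      (r1 4 (nv ctrJ) * rv reaPt * rv reaPt - r1 5 (nv ctrJ) * rv reaPt)]))

/-- The results of `choices`. -/
structure HasChoices (p : RowData) (s : Store) : Prop where
  x : ∀ j < p.n, ∀ c ≤ p.M, s.real reaX j c = p.xval j c
  cst : ∀ j < p.n, ∀ c ≤ p.M, s.real reaCst j c = p.cost j c

theorem choices_spec {p : RowData} {s : Store} (hb : Base p s) (h1 : ∀ j, s.real reaX j 0 = 0)
    (h2 : ∀ j, s.real reaCst j 0 = 0) :
    WP choices s fun t s' => t ≤ 300 * ((p.n + 1) * (p.M + 1)) ∧ HasChoices p s' := by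
  let Inv : (ℕ → ℕ → Prop) → Store → Prop := fun D s' => ∀ j < p.n, ∀ c ≤ p.M, (c = 0 ∨ D j c) →
    s'.real reaX j c = p.xval j c ∧ s'.real reaCst j c = p.cost j c
  unfold choices
  refine WP_forP [53, 54] [15, 16, 22, 25, 26] p.n (fun _ => 250 * (p.M + 1))
    (fun m => Inv fun j _ => j < m) ?_ ?_ ?_ ?_
  · rintro j hj c hc (rfl | h)
    · simp [h1, h2, RowData.cost, RowData.xval]
    · omega
  · intro m s' _ hs
    simp [hs.nat, hb.n]
  · intro j s1 hj hI1 hf1 hc1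
    refine WP_forP [53] [15, 16, 22, 25, 26] p.M (fun _ => 200)
      (fun m => Inv fun j' c => j' < j ∨ j' = j ∧ c ≤ m) ?_ ?_ ?_ ?_
    · intro j' hj' c hc h
      rw [real_writeNat]
      exact hI1 j' hj' c hc (by omega)
    · intro m s' _ hs
      simp [hs.nat, hf1.nat, hb.M]
    · intro c s2 hc hI2 hf2 hc2
      have hb2 : Base p s2 := hb.congr ((hf1.mono (by decide) (by decide)).trans
        (hf2.mono (by decide) (by decide)))
      have e1 : s2.nat ctrJ 0 0 = j := by simp [hf2.nat, hc1]
      have e3 := hb2.u j hj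
      have e4 := hb2.d j hj
      have e5 := hb2.mu j hj
      have e6 := hb2.M
      have last : ∀ s3 : Store, (∀ j' c', ¬ (j' = j ∧ c' = c + 1) →
          s3.real reaX j' c' = s2.real reaX j' c' ∧ s3.real reaCst j' c' = s2.real reaCst j' c') →
          s3.real reaX j (c + 1) = p.xval j (c + 1) → s3.real reaCst j (c + 1) = p.cost j (c + 1) →
          Inv (fun j' c' => j' < j ∨ j' = j ∧ c' ≤ c + 1) s3 := by
        intro s3 g1 g2 g3 j' hj' c' hc' h
        by_cases h' : j' = j ∧ c' = c + 1
        · obtain ⟨rfl, rfl⟩ := h'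
          exact ⟨g2, g3⟩
        · obtain ⟨k1, k2⟩ := g1 j' c' h'
          rw [k1, k2]
          exact hI2 j' hj' c' hc' (by omega)
      have ex : p.xval j (c + 1) = RowData.rep (p.d j) (p.mu j) ((c : ℝ) / p.M * p.u j)
        (((c : ℝ) + 1) / p.M * p.u j) := by simp [RowData.xval]
      simp only [WP_seqs_cons, WP_seqs_singleton, WP_ite, WP_setReal, WP_setR, holds_realLe,
        eval_r1, eval_nv, eval_realLit, real_writeReal, nat_writeReal, eval_realMul, eval_realDiv,
        eval_rv, eval_realAdd, eval_ofNat, e1, hc2, e6]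
      norm_num only [false_and, if_false, and_self, if_true, e3, e4, e5]
      refine ⟨fun g1 => ⟨by simp, last _ ?_ ?_ ?_⟩,
        fun g1 => ⟨fun g2 => ⟨by simp, last _ ?_ ?_ ?_⟩, fun g2 => ⟨by simp, last _ ?_ ?_ ?_⟩⟩⟩
      · intro j' c' h'
        simp [e1, hc2, h']
      · rw [ex, RowData.rep, if_pos g1]
        simp [e1, hc2]
      · rw [RowData.cost, ex, RowData.rep, if_pos g1]
        simp [e1, hc2, e4, e5]
      · intro j' c' h'
        simp [e1, hc2, h']
      · rw [ex, RowData.rep, if_neg g1, if_pos g2]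
        simp [e1, hc2]
      · rw [RowData.cost, ex, RowData.rep, if_neg g1, if_pos g2]
        simp [e1, hc2, e4, e5]
      · intro j' c' h'
        simp [e1, hc2, h']
      · rw [ex, RowData.rep, if_neg g1, if_neg g2]
        simp [e1, hc2]
      · rw [RowData.cost, ex, RowData.rep, if_neg g1, if_neg g2]
        simp [e1, hc2, e4, e5]
    · intro τ s2 hI2 hf2 hτ
      refine ⟨?_, fun j' hj' c hc h => ?_⟩
      · simp at hτ
        omega
      · rw [real_writeNat]
        exact hI2 j' hj' c hc (by omega)
  · intro τ s1 hI1 hf1 hτ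
    refine ⟨?_, ?_⟩
    · have := for_cost (A := 300 * (p.M + 1)) hτ (by simp; omega)
      linarith
    · constructor <;> intro j hj c hc
      exacts [(hI1 j hj c hc (Or.inr hj)).1, (hI1 j hj c hc (Or.inr hj)).2]


/-- Compute the powers of the number of digits. -/
def powers : Prog := seqs [
  .setNat arrPow 0 0 1,
  forP ctrC (nv arrL) (forP ctrI (nv arrK)
    (.setNat arrPow (nv ctrC + 1) 0 (n1 arrPow (nv ctrC + 1) + n1 arrPow (nv ctrC)))),
  setN arrS (n1 arrPow (nv arrL))]

theorem powers_spec {p : RowData} {s : Store} (hb : Base p s) (h1 : ∀ c, s.nat arrPow c 0 = 0) :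
    WP powers s fun t s' => t ≤ 200 * ((p.L + 1) * (p.K + 1)) ∧
      (∀ c ≤ p.L, s'.nat arrPow c 0 = p.K ^ c) ∧ s'.nat arrS 0 0 = p.K ^ p.L := by
  let Inv : (ℕ → ℕ) → Store → Prop := fun g s' => ∀ c, s'.nat arrPow c 0 = g c
  unfold powers
  simp only [WP_seqs_cons, WP_seqs_singleton, WP_setNat, WP_setN]
  set s1 := s.writeNat arrPow (NExp.eval s 0) (NExp.eval s 0) (NExp.eval s 1) with hs1
  have hf0 : Frame [19] [] s s1 := (Frame.refl _ _ _).writeNat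
  refine WP_forP [19, 53, 55] [] p.L (fun _ => 70 * (p.K + 1))
    (fun m => Inv fun c => if c ≤ m then p.K ^ c else 0) ?_ ?_ ?_ ?_
  · intro c
    rcases Nat.eq_zero_or_pos c with rfl | h
    · simp [hs1]
    · simp [hs1, h.ne', h1]
  · intro m s' _ hs
    simp [hs.nat, hf0.nat, hb.L]
  · intro c s2 hc hI2 hf2 hc2
    refine WP_forP [19, 55] [] p.K (fun _ => 40)
      (fun m => Inv fun c' => if c' ≤ c then p.K ^ c' else if c' = c + 1 then m * p.K ^ c else 0)
      ?_ ?_ ?_ ?_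
    · intro c'
      simpa using hI2 c'
    · intro m s' _ hs
      simp [hs.nat, hf2.nat, hf0.nat, hb.K]
    · intro i s3 hi hI3 hf3 hc3
      have e1 : s3.nat ctrC 0 0 = c := by simp [hf3.nat, hc2]
      simp only [WP_setNat]
      refine ⟨by simp, fun c' => ?_⟩
      have k1 := hI3 (c + 1)
      have k2 := hI3 c
      simp only [le_refl, if_true] at k1 k2
      rw [if_neg (by omega)] at k1
      by_cases h : c' = c + 1
      · subst h
        simp [e1, k1, k2]
        ring
      · simpa [e1, h] using hI3 c'
    · intro τ s3 hI3 hf3 hτ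
      refine ⟨?_, fun c' => ?_⟩
      · have := for_cost (A := 70) hτ (by simp)
        linarith
      · have : s3.nat arrPow c' 0 = if c' ≤ c then p.K ^ c' else
          if c' = c + 1 then p.K * p.K ^ c else 0 := hI3 c'
        simp only [nat_writeNat]
        norm_num only [false_and, if_false]
        rw [this]
        rcases Nat.lt_trichotomy c' (c + 1) with h | rfl | h
        · rw [if_pos (by omega), if_pos (by omega)]
        · rw [if_neg (by omega), if_pos rfl, if_pos le_rfl, pow_succ']
        · rw [if_neg (by omega), if_neg (by omega), if_neg (by omega)]
  · intro τ s2 hI2 hf2 hτ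
    have e := for_cost (A := 93 * (p.K + 1)) hτ (by simp; omega)
    have e1 : s2.nat arrL 0 0 = p.L := by simp [hf2.nat, hf0.nat, hb.L]
    refine ⟨?_, fun c hc => ?_, ?_⟩
    · simp
      nlinarith
    · have := hI2 c
      simpa [hc] using this
    · have := hI2 p.L
      simpa [e1] using this

/-- Round the contribution of variable `ctrJ` with value `reaPt` to row `ctrR`, and add it to the
code in `arrAcc`. -/
def digitP : Prog := seqs [
  .ite (.realLe 0 (r2 reaB (nv ctrR) (nv ctrJ)))
    (setR reaW (r2 reaB (nv ctrR) (nv ctrJ) * rv reaPt))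
    (setR reaW ((0 - r2 reaB (nv ctrR) (nv ctrJ)) * (r1 3 (nv ctrJ) - rv reaPt))),
  setR reaG (4 * rv reaE * r1 reaSig (nv ctrR) / 5),
  setN arrDig 0,
  setN arrKp (n1 arrPow (n1 arrCol (nv ctrR))),
  forP ctrI (nv arrK - 1) (.ite (.realLe (rv reaW) ((.ofNat (nv ctrI) + 1) * rv reaG)) .skip
    (.seq (setN arrDig (nv arrDig + 1)) (setN arrAcc (nv arrAcc + nv arrKp))))]

theorem digitP_spec {p : RowData} {s : Store} {r j : ℕ} {x : ℝ} (hb : Base p s)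
    (hs : HasSums p s) (hpow : ∀ c ≤ p.L, s.nat arrPow c 0 = p.K ^ c) (hL : p.col r ≤ p.L)
    (hr : r < p.R) (hj : j < p.n) (h1 : s.nat ctrR 0 0 = r) (h2 : s.nat ctrJ 0 0 = j)
    (h3 : s.real reaPt 0 0 = x) :
    WP digitP s fun t s' => t ≤ 200 * (p.K + 1) ∧
      s'.nat arrDig 0 0 = roundDigit (p.grid r) p.K (p.term r j x) ∧
      s'.nat arrAcc 0 0 = s.nat arrAcc 0 0 +
        roundDigit (p.grid r) p.K (p.term r j x) * p.K ^ p.col r := by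
  have main : ∀ (τ₀ : ℕ) (s1 : Store), τ₀ ≤ 50 → Frame [] [20] s s1 →
      s1.real reaW 0 0 = p.term r j x → WP (seqs [
        setR reaG (4 * rv reaE * r1 reaSig (nv ctrR) / 5),
        setN arrDig 0,
        setN arrKp (n1 arrPow (n1 arrCol (nv ctrR))),
        forP ctrI (nv arrK - 1) (.ite (.realLe (rv reaW) ((.ofNat (nv ctrI) + 1) * rv reaG)) .skip
          (.seq (setN arrDig (nv arrDig + 1)) (setN arrAcc (nv arrAcc + nv arrKp))))]) s1
        fun t s' => τ₀ + t ≤ 200 * (p.K + 1) ∧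
      s'.nat arrDig 0 0 = roundDigit (p.grid r) p.K (p.term r j x) ∧
      s'.nat arrAcc 0 0 = s.nat arrAcc 0 0 +
        roundDigit (p.grid r) p.K (p.term r j x) * p.K ^ p.col r := by
    intro τ₀ s1 hτ₀ hf1 hw
    simp only [WP_seqs_cons, WP_seqs_singleton, WP_setR, WP_setN]
    set s2 := ((s1.writeReal _ _ _ _).writeNat _ _ _ _).writeNat _ _ _ _ with hs2
    have hf2 : Frame [35, 37] [21] s1 s2 :=
      (Frame.refl _ _ _).writeReal.writeNat.writeNat
    have e1 : s2.real reaW 0 0 = p.term r j x := by simp [hf2.real, hw]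
    have e2 : s2.real reaG 0 0 = p.grid r := by
      simp [hs2, hf1.real, hf1.nat, h1, hb.e, hs.sig r hr, RowData.grid]
    have e3 : s2.nat arrKp 0 0 = p.K ^ p.col r := by
      simp [hs2, hf1.real, hf1.nat, h1, hb.col r hr, hpow _ hL]
    have e4 : s2.nat arrDig 0 0 = 0 := by simp [hs2]
    refine WP_forP [35, 36, 55] [] (p.K - 1) (fun _ => 60)
      (fun m s' => s'.nat arrDig 0 0 = ((range m).filter fun q : ℕ =>
          ((q : ℝ) + 1) * p.grid r < p.term r j x).card ∧
        s'.nat arrAcc 0 0 = s.nat arrAcc 0 0 + s'.nat arrDig 0 0 * p.K ^ p.col r) ?_ ?_ ?_ ?_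
    · simp [e4, hf2.nat, hf1.nat]
    · intro m s' _ hs'
      simp [hs'.nat, hf2.nat, hf1.nat, hb.K]
    · intro i s3 hi hI3 hf3 hc3
      obtain ⟨i1, i2⟩ := hI3
      have g1 : s3.real reaW 0 0 = p.term r j x := by simp [hf3.real, e1]
      have g2 : s3.real reaG 0 0 = p.grid r := by simp [hf3.real, e2]
      have g3 : s3.nat arrKp 0 0 = p.K ^ p.col r := by simp [hf3.nat, e3]
      simp only [WP_ite, WP_skip, WP_seq, WP_setN, holds_realLe, eval_rv, eval_realMul, eval_realAdd,
        eval_ofNat, eval_nv, eval_realLit, g1, g2, hc3]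
      refine ⟨fun h => ⟨by simp, ?_⟩, fun h => ⟨by simp, ?_⟩⟩
      · have : ¬ ((i : ℝ) + 1) * p.grid r < p.term r j x := not_lt.2 (by simpa using h)
        rw [range_add_one, filter_insert, if_neg this]
        simpa using ⟨i1, i2⟩
      · have : ((i : ℝ) + 1) * p.grid r < p.term r j x := by simpa using h
        rw [range_add_one, filter_insert, if_pos this, card_insert_of_notMem (by simp), ← i1]
        simp [g3, i2]
        ring
    · intro τ s3 hI3 hf3 hτ
      obtain ⟨i1, i2⟩ := hI3
      refine ⟨?_, i1, ?_⟩
      · have := for_cost (A := 100) hτ (by simp)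
        have h2 : (p.K - 1 + 1) * 100 ≤ (p.K + 1) * 100 := Nat.mul_le_mul_right _ (by omega)
        simp
        omega
      · rw [i2, i1]
        rfl
  unfold digitP
  rw [WP_seqs_cons, WP_ite]
  simp only [WP_setR, holds_realLe]
  have hB := hb.B r hr j hj
  refine ⟨fun h => (main _ _ (by simp) ((Frame.refl _ _ _).writeReal) ?_).mono fun t s' h => h,
    fun h => (main _ _ (by simp) ((Frame.refl _ _ _).writeReal) ?_).mono fun t s' h => h⟩
  · simp only [eval_realLit, eval_r2, eval_nv, h1, h2, hB] at h
    rw [RowData.term, if_pos (by simpa using h)]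
    simp [h1, h2, h3, hB]
  · simp only [eval_realLit, eval_r2, eval_nv, h1, h2, hB] at h
    rw [RowData.term, if_neg (by simpa using h)]
    simp [h1, h2, h3, hB, hb.u j hj]

/-- Compute the codes of the choices. -/
def codes : Prog :=
  forP ctrJ (nv 0) (forP ctrC (nv arrM + 1) (seqs [
    setR reaPt (r2 reaX (nv ctrJ) (nv ctrC)),
    setN arrAcc 0,
    forP ctrR (nv arrR) digitP,
    .setNat arrCode (nv ctrJ) (nv ctrC) (nv arrAcc)]))

theorem codes_spec {p : RowData} {s : Store} (hb : Base p s) (hs : HasSums p s)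
    (hx : HasChoices p s) (hpow : ∀ c ≤ p.L, s.nat arrPow c 0 = p.K ^ c)
    (hL : ∀ r < p.R, p.col r ≤ p.L) :
    WP codes s fun t s' => t ≤ 400 * ((p.n + 1) * ((p.M + 2) * ((p.R + 1) * (p.K + 1)))) ∧
      ∀ j < p.n, ∀ c ≤ p.M, s'.nat arrCode j c = ∑ r ∈ range p.R, p.dig r j c * p.K ^ p.col r := by
  let Inv : (ℕ → ℕ → Prop) → Store → Prop := fun D s' => ∀ j < p.n, ∀ c ≤ p.M, D j c →
    s'.nat arrCode j c = ∑ r ∈ range p.R, p.dig r j c * p.K ^ p.col r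
  unfold codes
  refine WP_forP [20, 35, 36, 37, 51, 53, 54, 55] [20, 21, 22] p.n
    (fun _ => 350 * ((p.M + 2) * ((p.R + 1) * (p.K + 1)))) (fun m => Inv fun j _ => j < m) ?_ ?_ ?_ ?_
  · intro j hj c hc h
    omega
  · intro m s' _ hs
    simp [hs.nat, hb.n]
  · intro j s1 hj hI1 hf1 hc1
    refine WP_forP [20, 35, 36, 37, 51, 53, 55] [20, 21, 22] (p.M + 1)
      (fun _ => 300 * ((p.R + 1) * (p.K + 1)))
      (fun m => Inv fun j' c => j' < j ∨ j' = j ∧ c < m) ?_ ?_ ?_ ?_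
    · intro j' hj' c hc h
      rw [nat_writeNat, if_neg (by norm_num)]
      exact hI1 j' hj' c hc (by omega)
    · intro m s' _ hs
      simp [hs.nat, hf1.nat, hb.M]
    · intro c s2 hc hI2 hf2 hc2
      have hf02 := (hf1.mono (List.Subset.refl _) (List.Subset.refl _)).trans
        (hf2.mono (by decide) (List.Subset.refl _))
      simp only [WP_seqs_cons, WP_seqs_singleton, WP_setR, WP_setN, WP_setNat]
      set s3 := (s2.writeReal _ _ _ _).writeNat _ _ _ _ with hs3
      have hf3 : Frame [36] [22] s2 s3 := (Frame.refl _ _ _).writeReal.writeNat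
      have e1 : s2.nat ctrJ 0 0 = j := by simp [hf2.nat, hc1]
      have e4 : s3.real reaPt 0 0 = p.xval j c := by
        simp [hs3, e1, hc2, hf2.real, hf1.real, hx.x j hj c (by omega)]
      have e5 : s3.nat arrAcc 0 0 = 0 := by simp [hs3]
      refine WP_forP [35, 36, 37, 51, 55] [20, 21] p.R (fun _ => 200 * (p.K + 1))
        (fun m s' => s'.nat arrAcc 0 0 = ∑ r ∈ range m, p.dig r j c * p.K ^ p.col r) ?_ ?_ ?_ ?_
      · simp [e5]
      · intro m s' _ hs'
        simp [hs'.nat, hf3.nat, hf02.nat, hb.R]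
      · intro r s4 hr hI4 hf4 hc4
        have hf04 := (hf02.mono (List.Subset.refl _) (List.Subset.refl _)).trans
          ((hf3.mono (by decide) (by decide)).trans (hf4.mono (by decide) (by decide)))
        refine (digitP_spec (p := p) (r := r) (j := j) (x := p.xval j c)
          (hb.congr (hf04.mono (by decide) (by decide))) ?_ ?_ (hL r hr) hr hj hc4 ?_ ?_).mono ?_
        · constructor <;> simp only [hf04.real reaSig (by decide), hf04.real reaNeg (by decide),
            hf04.real reaSup (by decide)]
          exacts [hs.sig, hs.neg, hs.sup]
        · simpa [hf04.nat] using hpow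
        · simp [hf4.nat, hf3.nat, e1]
        · simp [hf4.real, e4]
        · rintro t s5 ⟨i1, i2, i3⟩
          refine ⟨i1, ?_⟩
          rw [nat_writeNat, if_neg (by norm_num), i3, hI4, sum_range_succ]
          rfl
      · intro τ s4 hI4 hf4 hτ
        have g1 : s4.nat ctrJ 0 0 = j := by simp [hf4.nat, hf3.nat, e1]
        have g2 : s4.nat ctrC 0 0 = c := by simp [hf4.nat, hf3.nat, hc2]
        refine ⟨?_, fun j' hj' c' hc' h => ?_⟩
        · have := for_cost (A := 250 * (p.K + 1)) hτ (by simp; omega)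
          have h2 : (p.R + 1) * (250 * (p.K + 1)) = 250 * ((p.R + 1) * (p.K + 1)) := by ring
          have h3 : 1 ≤ (p.R + 1) * (p.K + 1) := Nat.mul_pos (by omega) (by omega)
          simp
          omega
        · by_cases h' : j' = j ∧ c' = c
          · obtain ⟨rfl, rfl⟩ := h'
            simp [g1, g2, hI4]
          · have := hI2 j' hj' c' hc' (by omega)
            simp [g1, g2, h', hf4.nat, hf3.nat, this]
    · intro τ s2 hI2 hf2 hτ
      refine ⟨?_, fun j' hj' c hc h => ?_⟩
      · have h3 : 1 ≤ (p.R + 1) * (p.K + 1) := Nat.mul_pos (by omega) (by omega)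
        have := for_cost (A := 350 * ((p.R + 1) * (p.K + 1))) hτ (by simp; omega)
        linarith
      · rw [nat_writeNat, if_neg (by norm_num)]
        exact hI2 j' hj' c hc (by omega)
  · intro τ s1 hI1 hf1 hτ
    refine ⟨?_, fun j hj c hc => hI1 j hj c hc hj⟩
    have h3 : 1 ≤ (p.M + 2) * ((p.R + 1) * (p.K + 1)) :=
      Nat.mul_pos (by omega) (Nat.mul_pos (by omega) (by omega))
    have := for_cost (A := 400 * ((p.M + 2) * ((p.R + 1) * (p.K + 1)))) hτ (by simp; omega)
    linarith


/-- Compute, for each row and each rounded sum, whether the sum is allowed, the value of the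
corresponding `y`-variable, and the resulting cost. -/
def penalties : Prog :=
  forP ctrR (nv arrR) (forP ctrC (nv arrK) (seqs [
    setR reaG (4 * rv reaE * r1 reaSig (nv ctrR) / 5),
    .ite (.natLe (n1 0 1) (nv ctrR))
      (seqs [
        setR reaLo (.ofNat (nv ctrC) * rv reaG - r1 reaNeg (nv ctrR) -
          r1 reaSig (nv ctrR) / .ofNat (nv arrM)),
        setR reaHi ((.ofNat (nv ctrC) + r1 reaSup (nv ctrR)) * rv reaG - r1 reaNeg (nv ctrR) +
          r1 reaSig (nv ctrR) / .ofNat (nv arrM)),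
        .setNat arrPok (nv ctrR) (nv ctrC) 1,
        .ite (.realLe 0 (rv reaLo)) (setR reaPt (rv reaLo))
          (.ite (.realLe (rv reaHi) 0) (setR reaPt (rv reaHi)) (setR reaPt 0)),
        .setReal reaY (nv ctrR) (nv ctrC) (rv reaPt),
        .setReal reaPen (nv ctrR) (nv ctrC) (r1 6 (nv ctrR - n1 0 1) * rv reaPt * rv reaPt)])
      (.ite (.realLe (.ofNat (nv ctrC) * rv reaG) (r1 2 (nv ctrR) + r1 reaNeg (nv ctrR) +
          r1 reaSig (nv ctrR) / .ofNat (nv arrM)))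
        (.setNat arrPok (nv ctrR) (nv ctrC) 1) .skip)]))

/-- The results of `penalties`. -/
structure HasPenalties (p : RowData) (s : Store) : Prop where
  pok : ∀ r < p.R, ∀ d < p.K, (s.nat arrPok r d ≠ 0 ↔ p.ok r d)
  pen : ∀ r < p.R, ∀ d < p.K, s.real reaPen r d = p.pen r d
  yval : ∀ r < p.R, ∀ d < p.K, p.m ≤ r → s.real reaY r d = p.yval r d

theorem penalties_spec {p : RowData} {s : Store} (hb : Base p s) (hs : HasSums p s)
    (h1 : ∀ r d, s.nat arrPok r d = 0) (h2 : ∀ r d, s.real reaPen r d = 0) :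
    WP penalties s fun t s' => t ≤ 500 * ((p.R + 1) * (p.K + 1)) ∧ HasPenalties p s' := by
  let Inv : (ℕ → ℕ → Prop) → Store → Prop := fun D s' => ∀ r < p.R, ∀ d < p.K,
    (D r d → (s'.nat arrPok r d ≠ 0 ↔ p.ok r d) ∧ s'.real reaPen r d = p.pen r d ∧
      (p.m ≤ r → s'.real reaY r d = p.yval r d)) ∧
    (¬ D r d → s'.nat arrPok r d = 0 ∧ s'.real reaPen r d = 0)
  have hInv : ∀ D D' s' s'', (∀ r d, d < p.K → (D r d ↔ D' r d)) →
      Frame [51, 53] [] s' s'' → Inv D s' → Inv D' s'' := by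
    intro D D' s' s'' h hf hI r hr d hd
    have := hI r hr d hd
    rw [h r d hd] at this
    simpa [hf.nat, hf.real] using this
  unfold penalties
  refine WP_forP [21, 51, 53] [17, 18, 21, 22, 25, 26] p.R (fun _ => 430 * (p.K + 1))
    (fun m => Inv fun r _ => r < m) ?_ ?_ ?_ ?_
  · intro r hr d hd
    simp [h1, h2]
  · intro m s' _ hs
    simp [hs.nat, hb.R]
  · intro r s1 hr hI1 hf1 hc1
    refine WP_forP [21, 53] [17, 18, 21, 22, 25, 26] p.K (fun _ => 400)
      (fun m => Inv fun r' d => r' < r ∨ r' = r ∧ d < m) ?_ ?_ ?_ ?_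
    · exact hInv _ _ _ _ (fun r' d _ => by omega) (Frame.refl _ _ _).writeNat hI1
    · intro m s' _ hs
      simp [hs.nat, hf1.nat, hb.K]
    · intro d s2 hd hI2 hf2 hc2
      have hf02 := (hf1.mono (List.Subset.refl _) (List.Subset.refl _)).trans
        (hf2.mono (by decide) (List.Subset.refl _))
      have hb2 : Base p s2 := hb.congr (hf02.mono (by decide) (by decide))
      have e1 : s2.nat ctrR 0 0 = r := by simp [hf2.nat, hc1]
      have e2 : s2.real reaSig r 0 = p.sig r := by simp [hf02.real, hs.sig r hr]
      have e3 : s2.real reaNeg r 0 = p.neg r := by simp [hf02.real, hs.neg r hr]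
      have e4 : s2.real reaSup r 0 = p.sup r := by simp [hf02.real, hs.sup r hr]
      obtain ⟨i1, i2⟩ := (hI2 r hr d hd).2 (by omega)
      have last : ∀ s3 : Store, (∀ r' d', ¬ (r' = r ∧ d' = d) →
          s3.nat arrPok r' d' = s2.nat arrPok r' d' ∧ s3.real reaPen r' d' = s2.real reaPen r' d' ∧
          s3.real reaY r' d' = s2.real reaY r' d') →
          (s3.nat arrPok r d ≠ 0 ↔ p.ok r d) → s3.real reaPen r d = p.pen r d →
          (p.m ≤ r → s3.real reaY r d = p.yval r d) →
          Inv (fun r' d' => r' < r ∨ r' = r ∧ d' < d + 1) (s3.writeNat ctrC 0 0 (d + 1)) := by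
        intro s3 g1 g2 g3 g4
        refine hInv (fun r' d' => r' < r ∨ r' = r ∧ d' < d + 1) _ s3 _ (fun _ _ _ => Iff.rfl)
          (Frame.refl _ _ _).writeNat ?_
        intro r' hr' d' hd'
        by_cases h' : r' = r ∧ d' = d
        · obtain ⟨rfl, rfl⟩ := h'
          exact ⟨fun _ => ⟨g2, g3, g4⟩, fun h => by omega⟩
        · obtain ⟨k1, k2, k3⟩ := g1 r' d' h'
          rw [k1, k2, k3]
          have := hI2 r' hr' d' hd'
          exact ⟨fun h => this.1 (by omega), fun h => this.2 (by omega)⟩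
      simp only [WP_seqs_cons, WP_seqs_singleton, WP_ite, WP_setReal, WP_setR, WP_setNat, WP_skip,
        holds_realLe, holds_natLe]
      refine ⟨fun g => ?_, fun g => ?_⟩
      · have hm : p.m ≤ r := by simpa [e1, hb2.m] using g
        have elam := hb2.lam (r - p.m) (by rw [RowData.R] at hr; omega)
        have pokr : p.ok r d := fun h => absurd h (not_lt.2 hm)
        have penr : p.pen r d = p.lam (r - p.m) * p.yval r d * p.yval r d := if_neg (not_lt.2 hm)
        simp only [eval_realLit, eval_r1, eval_nv, real_writeReal, nat_writeReal, eval_realMul,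
          eval_realDiv, eval_realSub, nat_writeNat, real_writeNat,
          eval_rv, eval_realAdd, eval_ofNat, eval_n1, eval_natSub, eval_natLit, e1, hc2, hb2.M, hb2.m,
          hb2.e]
        norm_num only [false_and, if_false, and_self, if_true, e2, e3, e4]
        rw [show (d : ℝ) * (4 * p.e * p.sig r / 5) - p.neg r - p.sig r / p.M = p.ylo r d by
            rw [RowData.ylo, RowData.grid],
          show ((d : ℝ) + p.sup r) * (4 * p.e * p.sig r / 5) - p.neg r + p.sig r / p.M = p.yhi r d by
            rw [RowData.yhi, RowData.grid]]
        refine ⟨fun g1 => ⟨by simp, ?_⟩, fun g1 => ⟨fun g2 => ⟨by simp, ?_⟩,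
          fun g2 => ⟨by simp, ?_⟩⟩⟩
        · have hy : p.yval r d = p.ylo r d := by rw [RowData.yval, if_pos g1]
          refine last _ ?_ ?_ ?_ ?_
          · intro r' d' h'
            simp [h']
          · simp [pokr]
          · rw [penr, hy]
            simp [elam]
          · intro _
            rw [hy]
            simp
        · have hy : p.yval r d = p.yhi r d := by rw [RowData.yval, if_neg g1, if_pos g2]
          refine last _ ?_ ?_ ?_ ?_
          · intro r' d' h'
            simp [h']
          · simp [pokr]
          · rw [penr, hy]
            simp [elam]
          · intro _
            rw [hy]
            simp
        · have hy : p.yval r d = 0 := by rw [RowData.yval, if_neg g1, if_neg g2]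
          refine last _ ?_ ?_ ?_ ?_
          · intro r' d' h'
            simp [h']
          · simp [pokr]
          · rw [penr, hy]
            simp
          · intro _
            rw [hy]
            simp
      · have hm : r < p.m := by simpa [e1, hb2.m] using g
        have eb := hb2.b r hm
        have penr : p.pen r d = 0 := if_pos hm
        have pokr : p.ok r d ↔ (d : ℝ) * (4 * p.e * p.sig r / 5) ≤ p.b r + p.neg r + p.sig r / p.M := by
          simp [RowData.ok, RowData.grid, hm]
        simp only [eval_r1, eval_nv, real_writeReal, nat_writeReal, eval_realMul,
          eval_realDiv, eval_rv, eval_realAdd, eval_ofNat, e1, hc2, hb2.M, eval_realLit, hb2.e, eb]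
        norm_num only [false_and, if_false, and_self, if_true, e2, e3, e4, eb]
        rw [← pokr]
        refine ⟨fun g1 => ⟨by simp, last _ ?_ ?_ ?_ ?_⟩, fun g1 => ⟨by simp, last _ ?_ ?_ ?_ ?_⟩⟩
        · intro r' d' h'
          simp [h']
        · simp [g1]
        · simp [penr, i2]
        · omega
        · intro r' d' h'
          simp
        · simp [g1, i1]
        · simp [penr, i2]
        · omega
    · intro τ s2 hI2 hf2 hτ
      refine ⟨?_, hInv _ _ _ _ (fun r' d _ => by omega) (Frame.refl _ _ _).writeNat hI2⟩
      have := for_cost (A := 430) hτ (by simp)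
      linarith
  · intro τ s1 hI1 hf1 hτ
    refine ⟨?_, ?_⟩
    · have := for_cost (A := 500 * (p.K + 1)) hτ (by simp; omega)
      linarith
    · constructor <;> intro r hr d hd <;> have := (hI1 r hr d hd).1 hr
      exacts [this.1, this.2.1, this.2.2]

/-- Compute the multiples of the number of variables. -/
def multiples : Prog := forP ctrC (nv 0) (.setNat arrMul (nv ctrC + 1) 0 (n1 arrMul (nv ctrC) + nv 0))

theorem multiples_spec {s : Store} {n : ℕ} (hn : s.nat 0 0 0 = n) (h1 : s.nat arrMul 0 0 = 0) :
    WP multiples s fun t s' => t ≤ 50 * (n + 1) ∧ ∀ c ≤ n, s'.nat arrMul c 0 = c * n := by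
  unfold multiples
  refine WP_forP [25, 53] [] n (fun _ => 25)
    (fun m s' => ∀ c ≤ m, s'.nat arrMul c 0 = c * n) ?_ ?_ ?_ ?_
  · intro c hc
    obtain rfl : c = 0 := by omega
    simp [h1]
  · intro m s' _ hs
    simp [hs.nat, hn]
  · intro c s2 hc hI2 hf2 hc2
    simp only [WP_setNat]
    refine ⟨by simp, fun c' h' => ?_⟩
    by_cases h : c' = c + 1
    · subst h
      simp [hc2, hI2 c le_rfl, hf2.nat, hn]
      ring
    · simp [hc2, h, hI2 c' (by omega)]
  · intro τ s1 hI1 hf1 hτ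
    refine ⟨?_, hI1⟩
    have := for_cost (A := 50) hτ (by simp)
    linarith

theorem noCarry_zero {K a b : ℕ} (hK : 0 < K) : NoCarry K 0 a b ↔ a = 0 ∧ b = 0 := by
  constructor
  · rintro ⟨f, g, -, rfl, rfl⟩
    simp
  · rintro ⟨rfl, rfl⟩
    exact ⟨0, 0, by simpa using hK, by simp, by simp⟩

theorem noCarry_succ {K L a b : ℕ} : NoCarry K (L + 1) a b ↔ ∃ x y a' b', x + y < K ∧
    NoCarry K L a' b' ∧ a = a' + x * K ^ L ∧ b = b' + y * K ^ L := by
  constructor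
  · rintro ⟨f, g, h, rfl, rfl⟩
    exact ⟨f L, g L, _, _, h L, ⟨f, g, h, rfl, rfl⟩, sum_range_succ _ _, sum_range_succ _ _⟩
  · rintro ⟨x, y, a', b', h, ⟨f, g, h', rfl, rfl⟩, rfl, rfl⟩
    refine ⟨fun c => if c = L then x else f c, fun c => if c = L then y else g c, fun c => ?_, ?_, ?_⟩
    · dsimp only
      split_ifs
      exacts [h, h' c]
    · rw [sum_range_succ]
      dsimp only
      rw [if_pos rfl]
      exact congrArg (· + x * K ^ L) (sum_congr rfl fun c hc => by
        rw [if_neg (mem_range.1 hc).ne])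
    · rw [sum_range_succ]
      dsimp only
      rw [if_pos rfl]
      exact congrArg (· + y * K ^ L) (sum_congr rfl fun c hc => by
        rw [if_neg (mem_range.1 hc).ne])

/-- List all pairs of codes that can be added without a carry.  The pairs with one more digit arise
from the previous ones by adding leading digits `ctrX` and `ctrY` whose sum is smaller than the number
of digits; `arrOff` and `arrLo` are the amounts that they contribute to the codes. -/
def pairs : Prog := .seq (.setNat arrLen 0 0 1) (forP ctrC (nv arrL) (seqs [
  setN arrOff 0,
  forP ctrX (nv arrK) (seqs [
    setN arrLo 0,
    forP ctrY (nv arrK - nv ctrX) (seqs [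
      forP ctrI (n1 arrLen (nv ctrC)) (seqs [
        .setNat arrPairA (nv ctrC + 1) (n1 arrLen (nv ctrC + 1))
          (n2 arrPairA (nv ctrC) (nv ctrI) + nv arrOff),
        .setNat arrPairB (nv ctrC + 1) (n1 arrLen (nv ctrC + 1))
          (n2 arrPairB (nv ctrC) (nv ctrI) + nv arrLo),
        .setNat arrLen (nv ctrC + 1) 0 (n1 arrLen (nv ctrC + 1) + 1)]),
      setN arrLo (nv arrLo + n1 arrPow (nv ctrC))]),
    setN arrOff (nv arrOff + n1 arrPow (nv ctrC))])]))

theorem sum_range_sub_eq (K : ℕ) : ∑ x ∈ range K, (K - x) = K * (K + 1) / 2 := by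
  refine Nat.eq_div_of_mul_eq_right two_ne_zero ?_
  induction K with
  | zero => simp
  | succ K ih =>
    rw [sum_range_succ', mul_add]
    have : ∑ x ∈ range K, (K + 1 - (x + 1)) = ∑ x ∈ range K, (K - x) :=
      sum_congr rfl fun x _ => by omega
    rw [this, ih]
    simp
    ring

/-- A level of the list of pairs: the `N` entries in row `c` are exactly the pairs in `Q`. -/
structure PairTab (s : Store) (c N : ℕ) (Q : ℕ → ℕ → Prop) : Prop where
  len : s.nat arrLen c 0 = N
  mem : ∀ i < N, Q (s.nat arrPairA c i) (s.nat arrPairB c i)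
  surj : ∀ a b, Q a b → ∃ i < N, s.nat arrPairA c i = a ∧ s.nat arrPairB c i = b

set_option maxHeartbeats 800000 in
theorem pairs_spec {s : Store} {K L : ℕ} (hK0 : 0 < K) (hK : s.nat arrK 0 0 = K)
    (hL : s.nat arrL 0 0 = L) (hpow : ∀ c ≤ L, s.nat arrPow c 0 = K ^ c)
    (h1 : ∀ c, s.nat arrLen c 0 = 0) (h2 : s.nat arrPairA 0 0 = 0) (h3 : s.nat arrPairB 0 0 = 0) :
    WP pairs s fun t s' => t ≤ 2000 * ((L + 1) * (K * (K + 1) / 2) ^ L) ∧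
      PairTab s' L ((K * (K + 1) / 2) ^ L) (NoCarry K L) := by
  set T := K * (K + 1) / 2 with hT
  have hT1 : 0 < T := by
    rw [hT]
    have : 1 * 2 ≤ K * (K + 1) := Nat.mul_le_mul hK0 (by omega)
    omega
  have hKT : ∑ x ∈ range K, (K - x) = T := sum_range_sub_eq K
  have hKK : (K + 1) * (K + 1) ≤ 4 * T := by
    have h4 : 2 * T = K * (K + 1) := Nat.mul_div_cancel' (Nat.even_mul_succ_self K).two_dvd
    nlinarith
  let Inv : ℕ → Store → Prop := fun c s' => PairTab s' c (T ^ c) (NoCarry K c) ∧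
    ∀ c' > c, s'.nat arrLen c' 0 = 0
  unfold pairs
  rw [WP_seq]
  simp only [WP_setNat]
  set s0 := s.writeNat _ _ _ _ with hs0
  have hf0 : Frame [24] [] s s0 := (Frame.refl _ _ _).writeNat
  refine WP_forP [22, 23, 24, 39, 40, 53, 55, 56, 57] [] L
    (fun _ => 1600 * T ^ L) Inv ?_ ?_ ?_ ?_
  · refine ⟨⟨?_, ?_, ?_⟩, ?_⟩
    · simp [hs0]
    · intro i hi
      obtain rfl : i = 0 := by simpa using hi
      rw [noCarry_zero hK0]
      simp [hs0, h2, h3]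
    · intro a b h
      rw [noCarry_zero hK0] at h
      exact ⟨0, by simp, by simp [hs0, h2, h3, h]⟩
    · intro c' h
      simp [hs0, h1, (Nat.ne_of_gt h : c' ≠ 0)]
  · intro m s' _ hs
    simp [hs.nat, hf0.nat, hL]
  · intro c s1 hc hI1 hf1 hc1
    obtain ⟨hP1, hz1⟩ := hI1
    have hTL : T * T ^ c ≤ T ^ L := by
      rw [← pow_succ']
      exact Nat.pow_le_pow_right hT1 hc
    let In : (ℕ → ℕ → ℕ → Prop) → ℕ → Store → Prop := fun D N s' =>
      s'.nat arrPairA c = s1.nat arrPairA c ∧ s'.nat arrPairB c = s1.nat arrPairB c ∧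
      s'.nat arrLen c 0 = T ^ c ∧ (∀ c' > c + 1, s'.nat arrLen c' 0 = 0) ∧
      PairTab s' (c + 1) N fun a b => ∃ x y i, D x y i ∧ x + y < K ∧ i < T ^ c ∧
        a = s1.nat arrPairA c i + x * K ^ c ∧ b = s1.nat arrPairB c i + y * K ^ c
    have hIn : ∀ D D' N N' s' s'', (∀ x y i, x + y < K → i < T ^ c → (D x y i ↔ D' x y i)) → N = N' →
        Frame [39, 40, 53, 55, 56, 57] [] s' s'' → In D N s' → In D' N' s'' := by
      rintro D D' N _ s' s'' h rfl hf ⟨g1, g2, g3, g4, ⟨g5, g6, g7⟩⟩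
      have key : ∀ a b, (∃ x y i, D x y i ∧ x + y < K ∧ i < T ^ c ∧
          a = s1.nat arrPairA c i + x * K ^ c ∧ b = s1.nat arrPairB c i + y * K ^ c) ↔
          (∃ x y i, D' x y i ∧ x + y < K ∧ i < T ^ c ∧
          a = s1.nat arrPairA c i + x * K ^ c ∧ b = s1.nat arrPairB c i + y * K ^ c) := by
        intro a b
        constructor <;> rintro ⟨x, y, i, k1, k2, k3, k4⟩
        exacts [⟨x, y, i, (h x y i k2 k3).1 k1, k2, k3, k4⟩, ⟨x, y, i, (h x y i k2 k3).2 k1, k2, k3, k4⟩]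
      simp only [key] at g6 g7
      refine ⟨?_, ?_, ?_, ?_, ⟨?_, ?_, ?_⟩⟩ <;> simp only [hf.nat arrPairA (by decide),
        hf.nat arrPairB (by decide), hf.nat arrLen (by decide)]
      exacts [g1, g2, g3, g4, g5, g6, g7]
    simp only [WP_seqs_cons, WP_seqs_singleton, WP_setN]
    set s2 := s1.writeNat _ _ _ _ with hs2
    have hf2 : Frame [40] [] s1 s2 := (Frame.refl _ _ _).writeNat
    refine WP_forP [22, 23, 24, 39, 40, 55, 56, 57] [] K
      (fun _ => 300 * ((K + 1) * T ^ c))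
      (fun m s' => In (fun x _ _ => x < m) ((∑ x ∈ range m, (K - x)) * T ^ c) s' ∧
        s'.nat arrOff 0 0 = m * K ^ c) ?_ ?_ ?_ ?_
    · refine ⟨⟨rfl, rfl, ?_, ?_, ?_, ?_, ?_⟩, ?_⟩
      · simp [hs2, hP1.len]
      · intro c' h'
        simp [hs2, hz1 c' (by omega)]
      · simp [hs2, hz1]
      · simp
      · simp
      · simp [hs2]
    · intro m s' _ hs
      simp [hs.nat, hf2.nat, hf1.nat, hf0.nat, hK]
    · rintro X s3 hX ⟨hI3, ho3⟩ hf3 hc3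
      simp only [WP_seqs_cons, WP_seqs_singleton, WP_setN]
      set s4 := s3.writeNat arrLo 0 0 (NExp.eval s3 0) with hs4
      have hf4 : Frame [39] [] s3 s4 := (Frame.refl _ _ _).writeNat
      refine WP_forP [22, 23, 24, 39, 55, 57] [] (K - X)
        (fun _ => 200 * T ^ c)
        (fun m s' => In (fun x y _ => x < X ∨ x = X ∧ y < m)
          ((∑ x ∈ range X, (K - x)) * T ^ c + m * T ^ c) s' ∧
          s'.nat arrLo 0 0 = m * K ^ c) ?_ ?_ ?_ ?_
      · refine ⟨hIn _ _ _ _ s3 _ (fun x y i _ _ => by omega) (by simp)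
          ((hf4.mono (by decide) (List.Subset.refl _)).writeNat) hI3, ?_⟩
        simp [hs4]
      · intro m s' _ hs
        simp [hs.nat, hf4.nat, hf3.nat, hf2.nat, hf1.nat, hf0.nat, hK, hc3]
      · rintro Y s5 hY ⟨hI5, ho5⟩ hf5 hc5
        have hf15 : Frame [22, 23, 24, 39, 40, 55, 56, 57] [] s1 s5 :=
          (hf2.mono (by decide) (by decide)).trans ((hf3.mono (by decide) (by decide)).trans
          ((hf4.mono (by decide) (by decide)).trans (hf5.mono (by decide) (by decide))))
        simp only [WP_seqs_cons, WP_seqs_singleton, WP_setN]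
        refine WP_forP [22, 23, 24, 55] [] (T ^ c) (fun _ => 100)
          (fun m s' => In (fun x y i => x < X ∨ x = X ∧ (y < Y ∨ y = Y ∧ i < m))
            ((∑ x ∈ range X, (K - x)) * T ^ c + Y * T ^ c + m) s') ?_ ?_ ?_ ?_
        · exact hIn _ _ _ _ s5 _ (fun x y i _ _ => by omega) (by simp)
            ((Frame.refl _ _ _).writeNat) hI5
        · intro m s' h hs
          simp [hs.nat, hf15.nat, hc1, h.2.2.1]
        · rintro i s6 hi hI6 hf6 hc6
          obtain ⟨g1, g2, g3, g4, ⟨g5, g6, g7⟩⟩ := hI6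
          have hf16 := hf15.trans (hf6.mono (by decide) (by decide))
          have e1 : s6.nat ctrC 0 0 = c := by simp [hf16.nat, hc1]
          have e2 : s6.nat arrOff 0 0 = X * K ^ c := by
            simp [hf6.nat, hf5.nat, hf4.nat, ho3]
          have e3 : s6.nat arrLo 0 0 = Y * K ^ c := by simp [hf6.nat, ho5]
          simp only [WP_seqs_cons, WP_seqs_singleton, WP_setNat]
          refine ⟨by simp, hIn (fun x y l => (x < X ∨ x = X ∧ (y < Y ∨ y = Y ∧ l < i)) ∨
            (x = X ∧ y = Y ∧ l = i)) _ _ _ _ _ (fun x y l _ _ => by omega) rfl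
            (Frame.refl _ _ _).writeNat ?_⟩
          refine ⟨?_, ?_, ?_, ?_, ⟨?_, ?_, ?_⟩⟩
          · rw [← g1]
            funext l
            simp [e1]
          · rw [← g2]
            funext l
            simp [e1]
          · simp [e1, g3]
          · intro c' h'
            simp [e1, g4 c' h', (Nat.ne_of_gt h')]
          · simp [e1, g5]
            ring
          · intro l hl
            rcases Nat.lt_or_ge l ((∑ x ∈ range X, (K - x)) * T ^ c + Y * T ^ c + i) with h | h
            · obtain ⟨x, y, i', k1, k2, k3, k4, k5⟩ := g6 l h
              refine ⟨x, y, i', Or.inl k1, k2, k3, ?_, ?_⟩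
              · simp [e1, g5, h.ne, k4]
              · simp [e1, g5, h.ne, k5]
            · replace h : l = (∑ x ∈ range X, (K - x)) * T ^ c + Y * T ^ c + i := by omega
              refine ⟨X, Y, i, Or.inr ⟨rfl, rfl, rfl⟩, by omega, hi, ?_, ?_⟩
              · simp [e1, g5, h, hc6, e2, g1]
              · simp [e1, g5, h, hc6, e3, g2]
          · rintro a b ⟨x, y, i', k1 | ⟨rfl, rfl, rfl⟩, k2, k3, k4, k5⟩
            · obtain ⟨l, hl, l1, l2⟩ := g7 a b ⟨x, y, i', k1, k2, k3, k4, k5⟩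
              refine ⟨l, by omega, ?_, ?_⟩
              · simp [e1, g5, hl.ne, l1]
              · simp [e1, g5, hl.ne, l2]
            · refine ⟨_, Nat.lt_succ_self _, ?_, ?_⟩
              · simp [e1, g5, hc6, e2, g1, k4]
              · simp [e1, g5, hc6, e3, g2, k5]
        · intro τ s6 hI6 hf6 hτ
          have e1 : s6.nat ctrC 0 0 = c := by simp [hf6.nat, hf15.nat, hc1]
          have e2 : s6.nat arrPow c 0 = K ^ c := by
            simp [hf6.nat, hf15.nat, hf1.nat, hf0.nat, hpow c hc.le]
          have e3 : s6.nat arrLo 0 0 = Y * K ^ c := by simp [hf6.nat, ho5]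
          refine ⟨?_, hIn _ _ _ _ s6 _ (fun x y i _ _ => by omega) (by ring)
            (Frame.refl _ _ _).writeNat.writeNat hI6, ?_⟩
          · rw [sum_const, card_range, smul_eq_mul] at hτ
            have : 1 ≤ T ^ c := Nat.pow_pos hT1
            simp at hτ ⊢
            nlinarith
          · simp [e1, e2, e3]
            ring
      · rintro τ s5 ⟨hI5, ho5⟩ hf5 hτ
        have hf15 : Frame [22, 23, 24, 39, 40, 55, 56, 57] [] s1 s5 :=
          (hf2.mono (by decide) (by decide)).trans ((hf3.mono (by decide) (by decide)).trans
          ((hf4.mono (by decide) (by decide)).trans (hf5.mono (by decide) (by decide))))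
        have e1 : s5.nat ctrC 0 0 = c := by simp [hf15.nat, hc1]
        have e2 : s5.nat arrPow c 0 = K ^ c := by
          simp [hf15.nat, hf1.nat, hf0.nat, hpow c hc.le]
        have e3 : s5.nat arrOff 0 0 = X * K ^ c := by
          simp [hf5.nat, hf4.nat, ho3]
        refine ⟨?_, hIn _ _ _ _ s5 _ (fun x y i _ _ => by omega) ?_
            (Frame.refl _ _ _).writeNat.writeNat hI5, ?_⟩
        · have h4 : 1 ≤ T ^ c := Nat.pow_pos hT1
          have := for_cost (A := 250 * T ^ c) hτ (by simp; omega)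
          have h5 : (K - X + 1) * (250 * T ^ c) ≤ (K + 1) * (250 * T ^ c) :=
            Nat.mul_le_mul_right _ (by omega)
          have h6 : 1 ≤ (K + 1) * T ^ c := Nat.mul_pos (by omega) h4
          simp
          nlinarith
        · rw [sum_range_succ, add_mul]
        · simp [e1, e2, e3]
          ring
    · rintro τ s3 ⟨⟨g1, g2, g3, g4, ⟨g5, g6, g7⟩⟩, -⟩ hf3 hτ
      have h4 : 1 ≤ T ^ c := Nat.pow_pos hT1
      have h6 : 1 ≤ (K + 1) * T ^ c := Nat.mul_pos (by omega) h4
      rw [hKT, ← pow_succ'] at g5 g6 g7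
      refine ⟨?_, ⟨?_, ?_, ?_⟩, ?_⟩
      · have := for_cost (A := 350 * ((K + 1) * T ^ c)) hτ (by simp; omega)
        have h7 : 1 ≤ (K + 1) * ((K + 1) * T ^ c) := Nat.mul_pos (by omega) h6
        have h8 := Nat.mul_le_mul_right (T ^ c) hKK
        simp
        nlinarith
      · simp [g5]
      · intro i hi
        obtain ⟨x, y, l, k1, k2, k3, k4, k5⟩ := g6 i hi
        exact noCarry_succ.2 ⟨x, y, _, _, k2, hP1.mem l k3, by simpa using k4, by simpa using k5⟩
      · intro a b h
        obtain ⟨x, y, a', b', k2, h', rfl, rfl⟩ := noCarry_succ.1 h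
        obtain ⟨l, k3, rfl, rfl⟩ := hP1.surj _ _ h'
        obtain ⟨i, hi, l1, l2⟩ := g7 _ _ ⟨x, y, l, by omega, k2, k3, rfl, rfl⟩
        exact ⟨i, hi, by simpa using l1, by simpa using l2⟩
      · intro c' h'
        simp [g4 c' h']
  · rintro τ s1 ⟨hI1, -⟩ hf1 hτ
    refine ⟨?_, hI1⟩
    have h7 : 1 ≤ T ^ L := Nat.pow_pos hT1
    have := for_cost (A := 1650 * T ^ L) hτ (by simp; omega)
    have h8 : 1 ≤ (L + 1) * T ^ L := Nat.mul_pos (by omega) h7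
    simp
    nlinarith


theorem HasSums.congr {p : RowData} {s s' : Store} {A B : List ℕ} (h : HasSums p s)
    (hs : Frame A B s s') (h1 : reaSig ∉ B := by decide) (h2 : reaNeg ∉ B := by decide)
    (h3 : reaSup ∉ B := by decide) : HasSums p s' := by
  constructor <;> simp only [hs.real _ h1, hs.real _ h2, hs.real _ h3]
  exacts [h.sig, h.neg, h.sup]

theorem HasChoices.congr {p : RowData} {s s' : Store} {A B : List ℕ} (h : HasChoices p s)
    (hs : Frame A B s s') (h1 : reaX ∉ B := by decide) (h2 : reaCst ∉ B := by decide) :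
    HasChoices p s' := by
  constructor <;> simp only [hs.real _ h1, hs.real _ h2]
  exacts [h.x, h.cst]

theorem HasPenalties.congr {p : RowData} {s s' : Store} {A B : List ℕ} (h : HasPenalties p s)
    (hs : Frame A B s s') (h1 : arrPok ∉ A := by decide) (h2 : reaPen ∉ B := by decide)
    (h3 : reaY ∉ B := by decide) : HasPenalties p s' := by
  constructor <;> simp only [hs.nat _ h1, hs.real _ h2, hs.real _ h3]
  exacts [h.pok, h.pen, h.yval]

/-- Compute everything that the dynamic program needs. -/
def prepare : Prog := seqs [powers, rowSums, choices, codes, penalties, pairs, multiples]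

theorem prepare_spec {p : RowData} {s : Store} (hb : Base p s) (hK : 0 < p.K)
    (hL : ∀ r < p.R, p.col r ≤ p.L) (hn : ∀ a, 18 < a → a < 30 → ∀ i j, s.nat a i j = 0)
    (hr : ∀ a, 10 < a → a ≠ 14 → ∀ i j, s.real a i j = 0) :
    WP prepare s fun t s' => t ≤ 3000 * ((p.n + 1) * ((p.M + 2) * ((p.R + 1) * (p.K + 1))) +
        (p.L + 1) * (p.K + 1 + (p.K * (p.K + 1) / 2) ^ p.L)) ∧
      Base p s' ∧ HasSums p s' ∧ HasChoices p s' ∧ HasPenalties p s' ∧ Loaded p.tree s' := by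
  unfold prepare
  simp only [WP_seqs_cons, WP_seqs_singleton]
  refine (WP.frame [19, 30, 53, 55] [] (powers_spec hb (fun c => hn _ (by norm_num) (by norm_num) _ _))).mono ?_
  rintro t1 s1 ⟨⟨ht1, hpow1, hS1⟩, hf1⟩
  have hb1 := hb.congr (hf1.mono (by decide) (by decide))
  refine (WP.frame [51, 54] [11, 12, 13] (rowSums_spec hb1 (fun r => ?_) (fun r => ?_)
    (fun r => ?_))).mono ?_
  · rw [hf1.real _ (by decide), hr _ (by norm_num) (by norm_num)]
  · rw [hf1.real _ (by decide), hr _ (by norm_num) (by norm_num)]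
  · rw [hf1.real _ (by decide), hr _ (by norm_num) (by norm_num)]
  rintro t2 s2 ⟨⟨ht2, hs2⟩, hf2⟩
  have hb2 := hb1.congr (hf2.mono (by decide) (by decide))
  refine (WP.frame [53, 54] [15, 16, 22, 25, 26] (choices_spec hb2 (fun r => ?_)
    (fun r => ?_))).mono ?_
  · rw [hf2.real _ (by decide), hf1.real _ (by decide), hr _ (by norm_num) (by norm_num)]
  · rw [hf2.real _ (by decide), hf1.real _ (by decide), hr _ (by norm_num) (by norm_num)]
  rintro t3 s3 ⟨⟨ht3, hx3⟩, hf3⟩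
  have hb3 := hb2.congr (hf3.mono (by decide) (by decide))
  have hf13 := hf2.mono (A' := [51, 53, 54]) (B' := [11, 12, 13, 15, 16, 22, 25, 26]) (by decide) (by decide)
    |>.trans (hf3.mono (by decide) (by decide))
  refine (WP.frame [20, 35, 36, 37, 51, 53, 54, 55] [20, 21, 22] (codes_spec hb3 (hs2.congr hf3) hx3 ?_
    hL)).mono ?_
  · simpa only [hf13.nat arrPow (by decide)] using hpow1
  rintro t4 s4 ⟨⟨ht4, hc4⟩, hf4⟩
  have hb4 := hb3.congr (hf4.mono (by decide) (by decide))
  have hf14 := (hf13.mono (A' := [20, 35, 36, 37, 51, 53, 54, 55])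
    (B' := [11, 12, 13, 15, 16, 20, 21, 22, 25, 26]) (by decide) (by decide)).trans
    (hf4.mono (by decide) (by decide))
  refine (WP.frame [21, 51, 53] [17, 18, 21, 22, 25, 26] (penalties_spec hb4
    ((hs2.congr hf3).congr hf4) (fun r d => ?_) (fun r d => ?_))).mono ?_
  · rw [hf14.nat _ (by decide), hf1.nat _ (by decide), hn _ (by norm_num) (by norm_num)]
  · rw [hf14.real _ (by decide), hf1.real _ (by decide), hr _ (by norm_num) (by norm_num)]
  rintro t5 s5 ⟨⟨ht5, hp5⟩, hf5⟩
  have hb5 := hb4.congr (hf5.mono (by decide) (by decide))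
  have hf15 := (hf14.mono (A' := [20, 21, 35, 36, 37, 51, 53, 54, 55])
    (B' := [11, 12, 13, 15, 16, 17, 18, 20, 21, 22, 25, 26]) (by decide) (by decide)).trans
    (hf5.mono (by decide) (by decide))
  refine (WP.frame [22, 23, 24, 39, 40, 53, 55, 56, 57] [] (pairs_spec hK hb5.K hb5.L ?_ (fun c => ?_)
    ?_ ?_)).mono ?_
  · simpa only [hf15.nat arrPow (by decide)] using hpow1
  · rw [hf15.nat _ (by decide), hf1.nat _ (by decide), hn _ (by norm_num) (by norm_num)]
  · rw [hf15.nat _ (by decide), hf1.nat _ (by decide), hn _ (by norm_num) (by norm_num)]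
  · rw [hf15.nat _ (by decide), hf1.nat _ (by decide), hn _ (by norm_num) (by norm_num)]
  rintro t6 s6 ⟨⟨ht6, hp6⟩, hf6⟩
  have hb6 := hb5.congr (hf6.mono (by decide) (by decide))
  have hf16 := (hf15.mono (A' := [20, 21, 22, 23, 24, 35, 36, 37, 39, 40, 51, 53, 54, 55, 56, 57])
    (B' := [11, 12, 13, 15, 16, 17, 18, 20, 21, 22, 25, 26]) (by decide) (by decide)).trans
    (hf6.mono (by decide) (by decide))
  refine (WP.frame [25, 53] [] (multiples_spec hb6.n ?_)).mono ?_
  · rw [hf16.nat _ (by decide), hf1.nat _ (by decide), hn _ (by norm_num) (by norm_num)]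
  rintro t7 s7 ⟨⟨ht7, hm7⟩, hf7⟩
  have hb7 := hb6.congr (hf7.mono (by decide) (by decide))
  have hf17 := (hf16.mono (A' := [20, 21, 22, 23, 24, 25, 35, 36, 37, 39, 40, 51, 53, 54, 55, 56, 57])
    (B' := [11, 12, 13, 15, 16, 17, 18, 20, 21, 22, 25, 26]) (by decide) (by decide)).trans
    (hf7.mono (by decide) (by decide))
  have hs7 := ((((hs2.congr hf3).congr hf4).congr hf5).congr hf6).congr hf7
  have hx7 := (((hx3.congr hf4).congr hf5).congr hf6).congr hf7
  have hp7 := (hp5.congr hf6).congr hf7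
  refine ⟨?_, hb7, hs7, hx7, hp7, ?_⟩
  · generalize (p.K * (p.K + 1) / 2) ^ p.L = V at *
    set a := p.n + 1
    set b := p.M + 2
    set c := p.R + 1
    set d := p.K + 1
    set l := p.L + 1
    have g1 : 1 ≤ a := by omega
    have g2 : 1 ≤ b := by omega
    have g3 : 1 ≤ c := by omega
    have g4 : 1 ≤ d := by omega
    have k1 : l * (d + V) = l * d + l * V := mul_add _ _ _
    have k2 : c * a ≤ a * (b * (c * d)) := by
      have := Nat.mul_le_mul_left (c * a) (Nat.mul_le_mul g2 g4)
      nlinarith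
    have k3 : a * (p.M + 1) ≤ a * (b * (c * d)) := by
      have := Nat.mul_le_mul_left (a * b) (Nat.mul_le_mul g3 g4)
      have : a * (p.M + 1) ≤ a * b := Nat.mul_le_mul_left _ (by omega)
      nlinarith
    have k4 : c * d ≤ a * (b * (c * d)) := by
      have := Nat.mul_le_mul_left (c * d) (Nat.mul_le_mul g1 g2)
      nlinarith
    have k5 : a ≤ a * (b * (c * d)) :=
      Nat.le_mul_of_pos_right _ (Nat.mul_pos g2 (Nat.mul_pos g3 g4))
    omega
  · refine ⟨hb7.n, hb7.k, hb7.R, hb7.K, hb7.L, hb7.M, ?_, hb7.top, hb7.col, hb7.par, ?_, ?_, hp7.pok,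
      hp7.pen, hx7.cst, hm7, ?_, ?_, ?_⟩
    · rw [hf17.nat _ (by decide), hS1]
      rfl
    · simp only [hf17.nat arrPow (by decide)]
      exact hpow1
    · intro j hj c hc
      rw [hf7.nat _ (by decide), hf6.nat _ (by decide), hf5.nat _ (by decide), hc4 j hj c hc]
      rfl
    · rw [hf7.nat _ (by decide)]
      exact hp6.len
    · simp only [hf7.nat arrPairA (by decide), hf7.nat arrPairB (by decide)]
      exact hp6.mem
    · simp only [hf7.nat arrPairA (by decide), hf7.nat arrPairB (by decide)]
      exact hp6.surj

end RealRAM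

/-! ### Arranging the rows along the tree -/

namespace RealRAM

open Finset

/-- List the rows of the constraint matrix, followed by the eigenvectors. -/
def rows : Prog := .seq (setN arrR (n1 0 1 + n1 0 2))
  (forP ctrR (nv arrR) (forP ctrJ (nv 0) (.ite (.natLe (n1 0 1) (nv ctrR))
    (.setReal reaB (nv ctrR) (nv ctrJ) (r2 7 (nv ctrR - n1 0 1) (nv ctrJ)))
    (.setReal reaB (nv ctrR) (nv ctrJ) (r2 1 (nv ctrR) (nv ctrJ))))))

theorem rows_spec {s : Store} {n m H : ℕ} (hn : s.nat 0 0 0 = n) (hm : s.nat 0 1 0 = m)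
    (hH : s.nat 0 2 0 = H) :
    WP rows s fun t s' => t ≤ 200 * ((m + H + 1) * (n + 1)) ∧ s'.nat arrR 0 0 = m + H ∧
      ∀ r < m + H, ∀ j < n, s'.real reaB r j = if m ≤ r then s.real 7 (r - m) j else s.real 1 r j := by
  let Inv : (ℕ → ℕ → Prop) → Store → Prop := fun D s' => ∀ r < m + H, ∀ j < n, D r j →
    s'.real reaB r j = if m ≤ r then s.real 7 (r - m) j else s.real 1 r j
  unfold rows
  rw [WP_seq]
  simp only [WP_setN]
  set s0 := s.writeNat _ _ _ _ with hs0
  have hf0 : Frame [10] [] s s0 := (Frame.refl _ _ _).writeNat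
  have hR : s0.nat arrR 0 0 = m + H := by simp [hs0, hm, hH]
  refine WP_forP [51, 54] [10] (m + H) (fun _ => 70 * (n + 1)) (fun a => Inv fun r _ => r < a) ?_ ?_ ?_ ?_
  · intro r _ j _ h
    omega
  · intro a s' _ hs
    simp [hs.nat, hR]
  · intro r s1 hr hI1 hf1 hc1
    refine WP_forP [54] [10] n (fun _ => 40) (fun a => Inv fun r' j => r' < r ∨ r' = r ∧ j < a)
      ?_ ?_ ?_ ?_
    · intro r' hr' j hj h
      rw [real_writeNat]
      exact hI1 r' hr' j hj (by omega)
    · intro a s' _ hs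
      simp [hs.nat, hf1.nat, hf0.nat, hn]
    · intro j s2 hj hI2 hf2 hc2
      have e1 : s2.nat ctrR 0 0 = r := by simp [hf2.nat, hc1]
      have e2 : s2.nat 0 1 0 = m := by simp [hf2.nat, hf1.nat, hf0.nat, hm]
      have last : ∀ s3 : Store, (∀ r' j', ¬ (r' = r ∧ j' = j) →
          s3.real reaB r' j' = s2.real reaB r' j') →
          (s3.real reaB r j = if m ≤ r then s.real 7 (r - m) j else s.real 1 r j) →
          Inv (fun r' j' => r' < r ∨ r' = r ∧ j' < j + 1) s3 := by
        intro s3 g1 g2 r' hr' j' hj' h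
        by_cases h' : r' = r ∧ j' = j
        · obtain ⟨rfl, rfl⟩ := h'
          exact g2
        · rw [g1 r' j' h']
          exact hI2 r' hr' j' hj' (by omega)
      simp only [WP_ite, WP_setReal, holds_natLe]
      refine ⟨fun g => ⟨by simp, last _ ?_ ?_⟩, fun g => ⟨by simp, last _ ?_ ?_⟩⟩
      · intro r' j' h'
        simp [e1, hc2, h']
      · have : m ≤ r := by simpa [e1, e2] using g
        simp [e1, e2, hc2, this, hf2.real, hf1.real, hf0.real]
      · intro r' j' h'
        simp [e1, hc2, h']
      · have : ¬ m ≤ r := by simpa [e1, e2] using g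
        simp [e1, hc2, this, hf2.real, hf1.real, hf0.real]
    · intro τ s2 hI2 hf2 hτ
      refine ⟨?_, fun r' hr' j hj h => ?_⟩
      · have := for_cost (A := 70) hτ (by simp)
        linarith
      · rw [real_writeNat]
        exact hI2 r' hr' j hj (by omega)
  · intro τ s1 hI1 hf1 hτ
    refine ⟨?_, ?_, fun r hr j hj => hI1 r hr j hj hr⟩
    · have := for_cost (A := 93 * (n + 1)) hτ (by simp; omega)
      have : 1 ≤ (m + H + 1) * (n + 1) := Nat.mul_pos (by omega) (by omega)
      simp
      nlinarith
    · simp [hf1.nat, hR]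

/-- Row `x` belongs to the bag of node `t`; the eigenvectors belong to all bags. -/
def inBag (t x : NExp) : Test := .neg (.and (.neg (.natLe (n1 0 1) x)) (.neg (.natLe 1 (n2 2 t x))))

/-- Give row `ctrR` the least colour that does not occur in the bag of node `ctrT`. -/
def colour : Prog := seqs [
  forP ctrX (nv arrR) (.ite (.and (.natLe 1 (n1 arrDone (nv ctrX))) (inBag (nv ctrT) (nv ctrX)))
    (.setNat arrUsed (nv ctrR) (n1 arrCol (nv ctrX)) 1) .skip),
  forP ctrC (nv arrR + 1) (.ite (.natLe (n2 arrUsed (nv ctrR) (nv arrR - nv ctrC)) 0)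
    (.setNat arrCol (nv ctrR) 0 (nv arrR - nv ctrC)) .skip),
  .setNat arrTop (nv ctrR) 0 (nv ctrT),
  .setNat arrDone (nv ctrR) 0 1,
  .ite (.natLe (n1 arrCol (nv ctrR) + 1) (nv arrL)) .skip (setN arrL (n1 arrCol (nv ctrR) + 1))]

/-- Colour the rows greedily in the order in which they appear on the way from the root to the
leaves. -/
def colours : Prog := forP ctrT (n1 0 4) (forP ctrR (nv arrR)
  (.ite (.and (.natLe (n1 arrDone (nv ctrR)) 0) (inBag (nv ctrT) (nv ctrR))) colour .skip))

/-- The rows in `g` have been coloured. -/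
structure Coloured (m R W : ℕ) (bag : ℕ → ℕ → Prop) (top : ℕ → ℕ) (g : ℕ → Prop) (s : Store) :
    Prop where
  done : ∀ r < R, (s.nat arrDone r 0 ≠ 0 ↔ g r)
  used : ∀ r < R, ¬ g r → ∀ c, s.nat arrUsed r c = 0
  top_eq : ∀ r < R, g r → s.nat arrTop r 0 = top r
  col : ∀ r < R, g r → s.nat arrCol r 0 < s.nat arrL 0 0
  ne : ∀ r < R, ∀ r' < R, g r → g r' → bag (top r') r → top r < top r' ∨ top r = top r' ∧ r < r' →
    s.nat arrCol r 0 ≠ s.nat arrCol r' 0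
  le : s.nat arrL 0 0 ≤ W

theorem Coloured.congr {m R W : ℕ} {bag : ℕ → ℕ → Prop} {top : ℕ → ℕ} {g g' : ℕ → Prop}
    {s s' : Store} (h : Coloured m R W bag top g s) (hg : ∀ r < R, g r ↔ g' r)
    (hs : Frame [50, 51, 53, 56] [] s s') : Coloured m R W bag top g' s' := by
  constructor
  · intro r hr
    rw [← hg r hr, hs.nat _ (by decide)]
    exact h.done r hr
  · intro r hr
    rw [← hg r hr, hs.nat _ (by decide)]
    exact h.used r hr
  · intro r hr
    rw [← hg r hr, hs.nat _ (by decide)]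
    exact h.top_eq r hr
  · intro r hr
    rw [← hg r hr, hs.nat _ (by decide), hs.nat _ (by decide)]
    exact h.col r hr
  · intro r hr r' hr'
    rw [← hg r hr, ← hg r' hr', hs.nat _ (by decide)]
    exact h.ne r hr r' hr'
  · rw [hs.nat _ (by decide)]
    exact h.le

theorem colour_spec {m k R W t r : ℕ} {bag : ℕ → ℕ → Prop} {top : ℕ → ℕ} {g : ℕ → Prop} {s : Store}
    (hm : s.nat 0 1 0 = m) (hR : s.nat arrR 0 0 = R)
    (hbag : ∀ t < k, ∀ r < R, (bag t r ↔ m ≤ r ∨ 1 ≤ s.nat 2 t r))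
    (hW : ∀ t < k, ∀ J ⊆ range R, (∀ r ∈ J, bag t r) → J.card ≤ W)
    (hC : Coloured m R W bag top g s) (ht : s.nat ctrT 0 0 = t) (hr : s.nat ctrR 0 0 = r)
    (htk : t < k) (hrR : r < R) (htop : top r = t) (hrt : bag t r) (hgr : ¬ g r)
    (hg : ∀ r' < R, g r' → top r' < t ∨ top r' = t ∧ r' < r) :
    WP colour s fun τ s' => τ ≤ 300 * (R + 1) ∧ Coloured m R W bag top (fun r' => g r' ∨ r' = r) s' := by
  unfold colour
  simp only [WP_seqs_cons, WP_seqs_singleton, WP_setNat]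
  refine WP_forP [14, 56] [] R (fun _ => 80)
    (fun a s' => ∀ r' < R, ∀ c, (r' ≠ r → s'.nat arrUsed r' c = s.nat arrUsed r' c) ∧
      (s'.nat arrUsed r c ≠ 0 ↔ ∃ x < a, g x ∧ bag t x ∧ s.nat arrCol x 0 = c)) ?_ ?_ ?_ ?_
  · intro r' hr' c
    simp [hC.used r hrR hgr]
  · intro a s' _ hs
    simp [hs.nat, hR]
  · intro x s1 hx hI1 hf1 hc1
    have e1 : s1.nat ctrT 0 0 = t := by simp [hf1.nat, ht]
    have e2 : s1.nat ctrR 0 0 = r := by simp [hf1.nat, hr]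
    have e3 : s1.nat 0 1 0 = m := by simp [hf1.nat, hm]
    have e4 : s1.nat 2 t x = s.nat 2 t x := by simp [hf1.nat]
    have e5 : s1.nat arrDone x 0 = s.nat arrDone x 0 := by simp [hf1.nat]
    have e6 : s1.nat arrCol x 0 = s.nat arrCol x 0 := by simp [hf1.nat]
    have e7 := hbag t htk x hx
    have e8 := hC.done x hx
    have test : (Test.and (.natLe 1 (n1 arrDone (nv ctrX))) (inBag (nv ctrT) (nv ctrX))).Holds s1 ↔
        g x ∧ bag t x := by
      rw [← e8, e7]
      simp only [inBag, holds_and, holds_neg, holds_natLe, eval_natLit, eval_n1, eval_n2, eval_nv, e1, e3,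
        e4, e5, hc1, Nat.one_le_iff_ne_zero]
      tauto
    rw [WP_ite, test]
    simp only [WP_setNat, WP_skip]
    refine ⟨fun h => ⟨by simp [inBag], fun r' hr' c => ⟨fun hne => ?_, ?_⟩⟩,
      fun h => ⟨by simp [inBag], fun r' hr' c => ⟨fun hne => ?_, ?_⟩⟩⟩
    · simp [e2, hne, (hI1 r' hr' c).1 hne]
    · have := (hI1 r' hr' c).2
      simp only [nat_writeNat]
      norm_num only [false_and, if_false, true_and]
      simp only [eval_nv, eval_n1, e2, hc1, e6, eval_natLit, true_and]
      split_ifs with h'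
      · simp only [ne_eq, one_ne_zero, not_false_eq_true, true_iff]
        exact ⟨x, by omega, h.1, h.2, h'.symm⟩
      · rw [this]
        constructor
        · rintro ⟨y, hy, h1⟩
          exact ⟨y, by omega, h1⟩
        · rintro ⟨y, hy, h1, h2, h3⟩
          refine ⟨y, ?_, h1, h2, h3⟩
          rcases Nat.lt_succ_iff_lt_or_eq.1 hy with h4 | rfl
          · exact h4
          · exact absurd h3.symm h'
    · simp [(hI1 r' hr' c).1 hne]
    · have := (hI1 r' hr' c).2
      simp only [nat_writeNat]
      norm_num only [false_and, if_false, true_and]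
      rw [this]
      constructor
      · rintro ⟨y, hy, h1⟩
        exact ⟨y, by omega, h1⟩
      · rintro ⟨y, hy, h1, h2, h3⟩
        refine ⟨y, ?_, h1, h2, h3⟩
        rcases Nat.lt_succ_iff_lt_or_eq.1 hy with h4 | rfl
        · exact h4
        · exact absurd ⟨h1, h2⟩ h
  intro τ1 s1 hI1 hf1 hτ1
  have hR1 : s1.nat arrR 0 0 = R := by simp [hf1.nat, hR]
  have hr1 : s1.nat ctrR 0 0 = r := by simp [hf1.nat, hr]
  refine WP_forP [12, 53] [] (R + 1) (fun _ => 60)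
    (fun a s' => (∀ r', r' ≠ r → s'.nat arrCol r' 0 = s.nat arrCol r' 0) ∧
      ∀ c ≤ R, R + 1 ≤ c + a → s1.nat arrUsed r c = 0 →
        s1.nat arrUsed r (s'.nat arrCol r 0) = 0 ∧ s'.nat arrCol r 0 ≤ c) ?_ ?_ ?_ ?_
  · refine ⟨fun r' h => by simp [hf1.nat], fun c h1 h2 => by omega⟩
  · intro a s' _ hs
    simp [hs.nat, hR1]
  · rintro a s2 ha ⟨hI2, hI3⟩ hf2 hc2
    have e1 : s2.nat ctrR 0 0 = r := by simp [hf2.nat, hr1]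
    have e2 : s2.nat arrR 0 0 = R := by simp [hf2.nat, hR1]
    have e3 : s2.nat arrUsed = s1.nat arrUsed := by simp [hf2.nat]
    rw [WP_ite]
    simp only [WP_setNat, WP_skip, holds_natLe, eval_n2, eval_nv, eval_natSub, eval_natLit, e1, e2, e3,
      hc2]
    refine ⟨fun h => ⟨by simp, fun r' hne => by simp [hne, hI2 r' hne], fun c h1 h2 h3 => ?_⟩,
      fun h => ⟨by simp, fun r' hne => by simp [hI2 r' hne], fun c h1 h2 h3 => ?_⟩⟩
    · have : s1.nat arrUsed r (R - a) = 0 := by omega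
      simp [this]
      omega
    · have : c ≠ R - a := by
        rintro rfl
        omega
      simpa using hI3 c h1 (by omega) h3
  rintro τ2 s2 ⟨hI2, hI3⟩ hf2 hτ2
  have hr2 : s2.nat ctrR 0 0 = r := by simp [hf2.nat, hr1]
  have ht2 : s2.nat ctrT 0 0 = t := by simp [hf2.nat, hf1.nat, ht]
  -- fewer colours are in use than there are rows in the bag
  obtain ⟨c, hcW, hcR, hc⟩ : ∃ c, c + 1 ≤ W ∧ c ≤ R ∧ s1.nat arrUsed r c = 0 := by
    classical
    set J := (range R).filter fun x => g x ∧ bag t x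
    have hrJ : r ∉ J := by simp [J, hgr]
    have hJ1 : (insert r J).card ≤ W := by
      refine hW t htk _ ?_ ?_
      · intro x hx
        rcases mem_insert.1 hx with rfl | hx
        · exact mem_range.2 hrR
        · exact (mem_filter.1 hx).1
      · intro x hx
        rcases mem_insert.1 hx with rfl | hx
        · exact hrt
        · exact (mem_filter.1 hx).2.2
    have hJ2 : (insert r J).card ≤ R := by
      refine (card_le_card ?_).trans (card_range R).le
      intro x hx
      rcases mem_insert.1 hx with rfl | hx
      · exact mem_range.2 hrR
      · exact (mem_filter.1 hx).1
    rw [card_insert_of_notMem hrJ] at hJ1 hJ2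
    obtain ⟨c, h1, h2⟩ : ∃ c ∈ range (J.card + 1), c ∉ J.image fun x => s.nat arrCol x 0 := by
      by_contra! h
      have h3 : range (J.card + 1) ⊆ J.image fun x => s.nat arrCol x 0 := fun c hc => h c hc
      have := (card_le_card h3).trans card_image_le
      simp at this
    rw [mem_range] at h1
    refine ⟨c, by omega, by omega, ?_⟩
    by_contra h3
    obtain ⟨x, hx, h4, h5, h6⟩ := ((hI1 r hrR c).2).1 h3
    exact h2 (mem_image.2 ⟨x, mem_filter.2 ⟨mem_range.2 hx, h4, h5⟩, h6⟩)
  obtain ⟨hu, hle⟩ := hI3 c hcR (by omega) hc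
  generalize hcol : s2.nat arrCol r 0 = q at *
  have hu' : ∀ x < R, g x → bag t x → s.nat arrCol x 0 ≠ q := by
    intro x hx h1 h2 h3
    exact ((hI1 r hrR q).2).2 ⟨x, hx, h1, h2, h3⟩ hu
  set s3 := (s2.writeNat _ _ _ _).writeNat _ _ _ _ with hs3
  have hf3 : Frame [11, 13] [] s2 s3 := (Frame.refl _ _ _).writeNat.writeNat
  have hL3 : s3.nat arrL 0 0 = s.nat arrL 0 0 := by simp [hf3.nat, hf2.nat, hf1.nat]
  have last : ∀ s4 : Store, Frame [15] [] s3 s4 → s4.nat arrL 0 0 = max (s.nat arrL 0 0) (q + 1) →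
      Coloured m R W bag top (fun r' => g r' ∨ r' = r) s4 := by
    intro s4 hf4 h4
    have c1 : ∀ r', r' ≠ r → s4.nat arrCol r' 0 = s.nat arrCol r' 0 := by
      intro r' h
      rw [hf4.nat _ (by decide), hf3.nat _ (by decide), hI2 r' h]
    have c2 : s4.nat arrCol r 0 = q := by
      rw [hf4.nat _ (by decide), hf3.nat _ (by decide), hcol]
    have c3 : ∀ r', s4.nat arrDone r' 0 = if r' = r then 1 else s.nat arrDone r' 0 := by
      intro r'
      rw [hf4.nat _ (by decide)]
      simp [hs3, hr2, hf2.nat, hf1.nat]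
    have c4 : ∀ r', s4.nat arrTop r' 0 = if r' = r then t else s.nat arrTop r' 0 := by
      intro r'
      rw [hf4.nat _ (by decide)]
      simp [hs3, hr2, ht2, hf2.nat, hf1.nat]
    have hrne : ∀ r', g r' → r' ≠ r := by
      rintro r' h rfl
      exact hgr h
    constructor
    · intro r' hr'
      rw [c3]
      split_ifs with h
      · simp [h]
      · simp [h, hC.done r' hr']
    · intro r' hr' h c
      push Not at h
      rw [hf4.nat _ (by decide), hf3.nat _ (by decide), hf2.nat _ (by decide),
        (hI1 r' hr' c).1 h.2]
      exact hC.used r' hr' h.1 c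
    · rintro r' hr' (h | rfl)
      · rw [c4, if_neg (hrne r' h)]
        exact hC.top_eq r' hr' h
      · rw [c4, if_pos rfl, htop]
    · rintro r' hr' (h | rfl)
      · rw [c1 r' (hrne r' h), h4]
        exact lt_of_lt_of_le (hC.col r' hr' h) (le_max_left _ _)
      · rw [c2, h4]
        exact lt_of_lt_of_le (Nat.lt_succ_self q) (le_max_right _ _)
    · intro x hx y hy h1 h2 hb hlt
      rcases h1 with h1 | h1 <;> rcases h2 with h2 | h2
      · rw [c1 _ (hrne _ h1), c1 _ (hrne _ h2)]
        exact hC.ne x hx y hy h1 h2 hb hlt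
      · rw [c1 _ (hrne _ h1), h2, c2]
        rw [h2, htop] at hb
        exact hu' x hx h1 hb
      · have := hg y hy h2
        rw [h1, htop] at hlt
        omega
      · rw [h1, h2] at hlt
        omega
    · rw [h4]
      exact max_le hC.le (by omega)
  have hcost : τ1 + (τ2 + 50) ≤ 300 * (R + 1) := by
    have g1 := for_cost (A := 110) hτ1 (by simp)
    have g2 := for_cost (A := 90) hτ2 (by simp)
    omega
  have e1 : s3.nat arrCol r 0 = q := by simp [hf3.nat, hcol]
  have e2 : s3.nat ctrR 0 0 = r := by simp [hf3.nat, hr2]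
  rw [WP_ite]
  simp only [WP_skip, WP_setN, holds_natLe, eval_natAdd, eval_n1, eval_nv, eval_natLit, e1, e2, hL3]
  refine ⟨fun h => ⟨?_, last _ (Frame.refl _ _ _) ?_⟩,
    fun h => ⟨?_, last _ (Frame.refl _ _ _).writeNat ?_⟩⟩
  · simp
    omega
  · rw [hL3]
    omega
  · simp
    omega
  · simp
    omega

theorem colours_spec {m k R W : ℕ} {bag : ℕ → ℕ → Prop} {top : ℕ → ℕ} {s : Store}
    (hm : s.nat 0 1 0 = m) (hk : s.nat 0 4 0 = k) (hR : s.nat arrR 0 0 = R)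
    (hbag : ∀ t < k, ∀ r < R, (bag t r ↔ m ≤ r ∨ 1 ≤ s.nat 2 t r))
    (hW : ∀ t < k, ∀ J ⊆ range R, (∀ r ∈ J, bag t r) → J.card ≤ W)
    (htop : ∀ r < R, top r < k ∧ bag (top r) r ∧ ∀ t < k, bag t r → top r ≤ t)
    (h1 : ∀ r, s.nat arrDone r 0 = 0) (h2 : ∀ r c, s.nat arrUsed r c = 0)
    (h3 : s.nat arrL 0 0 = 0) :
    WP colours s fun τ s' => τ ≤ 500 * ((k + 1) * ((R + 1) * (R + 1))) ∧
      Coloured m R W bag top (fun _ => True) s' := by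
  unfold colours
  refine WP_forP [11, 12, 13, 14, 15, 50, 51, 53, 56] [] k (fun _ => 450 * ((R + 1) * (R + 1)))
    (fun a => Coloured m R W bag top fun r => top r < a) ?_ ?_ ?_ ?_
  · constructor <;> simp [h1, h2, h3]
  · intro a s' _ hs
    simp [hs.nat, hk]
  · intro t s1 ht hI1 hf1 hc1
    refine WP_forP [11, 12, 13, 14, 15, 51, 53, 56] [] R (fun _ => 400 * (R + 1))
      (fun a => Coloured m R W bag top fun r => top r < t ∨ top r = t ∧ r < a) ?_ ?_ ?_ ?_
    · exact hI1.congr (by simp) (Frame.refl _ _ _).writeNat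
    · intro a s' _ hs
      simp [hs.nat, hf1.nat, hR]
    · intro r s2 hr hI2 hf2 hc2
      have hf02 := (hf1.mono (List.Subset.refl _) (List.Subset.refl _)).trans
        (hf2.mono (by decide) (by decide))
      have e1 : s2.nat ctrT 0 0 = t := by simp [hf2.nat, hc1]
      have e2 : s2.nat 0 1 0 = m := by simp [hf02.nat, hm]
      have e3 : s2.nat 2 = s.nat 2 := by simp [hf02.nat]
      have e4 := hI2.done r hr
      have e5 := hbag t ht r hr
      obtain ⟨g1, g2, g3⟩ := htop r hr
      have test : (Test.and (.natLe (n1 arrDone (nv ctrR)) 0) (inBag (nv ctrT) (nv ctrR))).Holds s2 ↔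
          top r = t := by
        have : (Test.and (.natLe (n1 arrDone (nv ctrR)) 0) (inBag (nv ctrT) (nv ctrR))).Holds s2 ↔
            ¬ (top r < t ∨ top r = t ∧ r < r) ∧ bag t r := by
          rw [← e4, e5]
          simp only [inBag, holds_and, holds_neg, holds_natLe, eval_natLit, eval_n1, eval_n2, eval_nv, e1,
            e2, e3, hc2, not_not, Nat.le_zero]
          tauto
        rw [this]
        constructor
        · rintro ⟨l1, l2⟩
          have := g3 t ht l2
          omega
        · rintro rfl
          exact ⟨by omega, g2⟩
      rw [WP_ite, test]
      refine ⟨fun h => (colour_spec (t := t) (r := r) e2 (by simp [hf02.nat, hR]) (by simpa [e3] using hbag)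
        hW hI2 e1 hc2 ht hr h (h ▸ g2) (by omega) (fun r' _ h => h)).mono ?_, fun h => ?_⟩
      · rintro τ s3 ⟨l1, l2⟩
        refine ⟨?_, l2.congr (fun r' hr' => ?_) (Frame.refl _ _ _).writeNat⟩
        · simp [inBag]
          omega
        · constructor
          · rintro ((h3 | h3) | h3)
            · exact Or.inl h3
            · exact Or.inr ⟨h3.1, by omega⟩
            · exact Or.inr ⟨h3 ▸ h, by omega⟩
          · rintro (h3 | h3)
            · exact Or.inl (Or.inl h3)
            · by_cases h5 : r' = r
              · exact Or.inr h5
              · exact Or.inl (Or.inr ⟨h3.1, by omega⟩)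
      · rw [WP_skip]
        refine ⟨?_, hI2.congr (fun r' hr' => ?_) (Frame.refl _ _ _).writeNat⟩
        · simp [inBag]
          omega
        · by_cases h5 : r' = r
          · subst h5
            simp [h]
          · omega
    · intro τ s2 hI2 hf2 hτ
      refine ⟨?_, hI2.congr (fun r hr => ?_) (Frame.refl _ _ _).writeNat⟩
      · have := for_cost (A := 450 * (R + 1)) hτ (by simp; omega)
        linarith
      · omega
  · intro τ s1 hI1 hf1 hτ
    refine ⟨?_, hI1.congr (fun r hr => by simp [(htop r hr).1]) (Frame.refl _ _ _)⟩
    have h4 : 1 ≤ (R + 1) * (R + 1) := Nat.mul_pos (by omega) (by omega)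
    have := for_cost (A := 500 * ((R + 1) * (R + 1))) hτ (by simp; omega)
    linarith

/-- Attach to the tree a leaf for each variable. -/
def parents : Prog := .seq
  (forP ctrT (n1 0 4) (.setNat arrPar (nv ctrT) 0 (n1 1 (nv ctrT))))
  (forP ctrJ (nv 0) (forP ctrR (nv arrR)
    (.ite (.and (.realLe (r2 reaB (nv ctrR) (nv ctrJ)) 0) (.realLe 0 (r2 reaB (nv ctrR) (nv ctrJ))))
      .skip
      (.ite (.natLe (n1 arrTop (nv ctrR)) (n1 arrPar (n1 0 4 + nv ctrJ))) .skip
        (.setNat arrPar (n1 0 4 + nv ctrJ) 0 (n1 arrTop (nv ctrR)))))))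

theorem parents_spec {k n R : ℕ} {s : Store} (hn : s.nat 0 0 0 = n) (hk : s.nat 0 4 0 = k)
    (hR : s.nat arrR 0 0 = R) (h0 : ∀ j, s.nat arrPar j 0 = 0) :
    WP parents s fun τ s' => τ ≤ 300 * ((k + n + 1) * (R + 1)) ∧
      (∀ t < k, s'.nat arrPar t 0 = s.nat 1 t 0) ∧
      ∀ j < n, s'.nat arrPar (k + j) 0 =
        ((range R).filter fun r => s.real reaB r j ≠ 0).sup fun r => s.nat arrTop r 0 := by
  unfold parents
  rw [WP_seq]
  refine WP_forP [16, 50] [] k (fun _ => 30) (fun a s' => ∀ t, s'.nat arrPar t 0 =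
    if t < a then s.nat 1 t 0 else 0) ?_ ?_ ?_ ?_
  · simp [h0]
  · intro a s' _ hs
    simp [hs.nat, hk]
  · intro t s1 ht hI1 hf1 hc1
    simp only [WP_setNat]
    refine ⟨by simp, fun t' => ?_⟩
    by_cases h : t' = t
    · subst h
      simp [hc1, hf1.nat]
    · have : (t' < t + 1) = (t' < t) := by
        simp only [eq_iff_iff]
        omega
      simp [hc1, h, this, hI1 t']
  intro τ1 s1 hI1 hf1 hτ1
  have hcost1 := for_cost (A := 60) hτ1 (by simp)
  let f : ℕ → ℕ → ℕ := fun a j =>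
    ((range a).filter fun r => s.real reaB r j ≠ 0).sup fun r => s.nat arrTop r 0
  let Inv : (ℕ → ℕ) → Store → Prop := fun g s' => (∀ t < k, s'.nat arrPar t 0 = s.nat 1 t 0) ∧
    ∀ j < n, s'.nat arrPar (k + j) 0 = f (g j) j
  have hInv : ∀ g g' s' s'', (∀ j < n, g j = g' j) → Frame [51, 54] [] s' s'' → Inv g s' →
      Inv g' s'' := by
    rintro g g' s' s'' h hf ⟨l1, l2⟩
    refine ⟨fun t ht => ?_, fun j hj => ?_⟩
    · rw [hf.nat _ (by decide), l1 t ht]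
    · rw [hf.nat _ (by decide), l2 j hj, h j hj]
  refine WP_forP [16, 51, 54] [] n (fun _ => 200 * (R + 1)) (fun a => Inv fun j => if j < a then R else 0)
    ?_ ?_ ?_ ?_
  · refine hInv (fun _ => 0) _ s1 _ (fun _ _ => by simp) (Frame.refl _ _ _).writeNat ⟨fun t ht => ?_, fun j hj => ?_⟩
    · simpa [ht] using hI1 t
    · simpa [f] using hI1 (k + j)
  · intro a s' _ hs
    simp [hs.nat, hf1.nat, hn]
  · intro j s2 hj hI2 hf2 hc2
    refine WP_forP [16, 51] [] R (fun _ => 120)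
      (fun a => Inv fun j' => if j' < j then R else if j' = j then a else 0) ?_ ?_ ?_ ?_
    · refine hInv _ _ _ _ (fun j' _ => ?_) (Frame.refl _ _ _).writeNat hI2
      split_ifs <;> rfl
    · intro a s' _ hs
      simp [hs.nat, hf2.nat, hf1.nat, hR]
    · rintro r s3 hr ⟨l1, l2⟩ hf3 hc3
      have e1 : s3.nat ctrJ 0 0 = j := by simp [hf3.nat, hc2]
      have e2 : s3.nat 0 4 0 = k := by simp [hf3.nat, hf2.nat, hf1.nat, hk]
      have e3 : s3.real reaB r j = s.real reaB r j := by simp [hf3.real, hf2.real, hf1.real]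
      have e4 : s3.nat arrTop r 0 = s.nat arrTop r 0 := by simp [hf3.nat, hf2.nat, hf1.nat]
      have e5 : s3.nat arrPar (k + j) 0 = f r j := by simpa using l2 j hj
      have last : ∀ s4 : Store, (∀ t, t ≠ k + j → s4.nat arrPar t 0 = s3.nat arrPar t 0) →
          s4.nat arrPar (k + j) 0 = f (r + 1) j →
          Inv (fun j' => if j' < j then R else if j' = j then r + 1 else 0)
            (s4.writeNat ctrR 0 0 (r + 1)) := by
        intro s4 g1 g2
        refine hInv (fun j' => if j' < j then R else if j' = j then r + 1 else 0) _ s4 _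
          (fun _ _ => rfl) (Frame.refl _ _ _).writeNat ⟨fun t ht => ?_, fun j' hj' => ?_⟩
        · rw [g1 t (by omega), l1 t ht]
        · by_cases h : j' = j
          · subst h
            simpa using g2
          · rw [g1 _ (by omega), l2 j' hj']
            simp [h]
      have fs : f (r + 1) j = if s.real reaB r j ≠ 0 then max (s.nat arrTop r 0) (f r j) else f r j := by
        simp only [f]
        rw [range_add_one, filter_insert]
        split_ifs with h
        · rw [sup_insert]
        · rfl
      simp only [WP_ite, WP_skip, WP_setNat, holds_and, holds_realLe, holds_natLe, eval_r2, eval_nv,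
        eval_realLit, eval_n1, eval_natAdd, eval_natLit, e1, hc3, e3, e2, e4, e5]
      refine ⟨fun h => ⟨by simp, last _ (fun _ _ => rfl) ?_⟩,
        fun h => ⟨fun h' => ⟨by simp, last _ (fun _ _ => rfl) ?_⟩, fun h' => ⟨by simp, last _ ?_ ?_⟩⟩⟩
      · have : s.real reaB r j = 0 := le_antisymm (by simpa using h.1) (by simpa using h.2)
        rw [e5, fs, if_neg (by simpa using this)]
      · have : s.real reaB r j ≠ 0 := fun h' => h (by simp [h'])
        rw [e5, fs, if_pos this, max_eq_right h']
      · intro t ht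
        simp [ht]
      · have : s.real reaB r j ≠ 0 := fun h' => h (by simp [h'])
        rw [fs, if_pos this, max_eq_left (by omega)]
        simp
    · intro τ s3 hI3 hf3 hτ
      refine ⟨?_, hInv _ _ _ _ (fun j' _ => ?_) (Frame.refl _ _ _).writeNat hI3⟩
      · have := for_cost (A := 200) hτ (by simp)
        linarith
      · rcases Nat.lt_trichotomy j' j with h | h | h
        · rw [if_pos h, if_pos (by omega)]
        · rw [if_neg (by omega), if_pos h, if_pos (by omega)]
        · rw [if_neg (by omega), if_neg (by omega), if_neg (by omega)]
  · rintro τ s2 ⟨l1, l2⟩ hf2 hτ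
    refine ⟨?_, l1, fun j hj => by simpa [hj] using l2 j hj⟩
    have := for_cost (A := 240 * (R + 1)) hτ (by simp; omega)
    nlinarith

/-- Choose the number of digits, as the least `K` with `5 < K * (4 * e)`.  If there are no rows, the
time bound does not depend on `ε`, and the precision `1` is used instead. -/
def grid : Prog := seqs [
  .ite (.natLe (nv arrR) 0) (setR reaE 1) (setR reaE (rv 0)),
  .while (.realLe (.ofNat (nv arrK) * (4 * rv reaE)) 5) (setN arrK (nv arrK + 1)),
  setN arrM (nv arrK + nv arrK + nv arrK + nv arrK)]

theorem grid_spec {R : ℕ} {e : ℝ} {s : Store} (hR : s.nat arrR 0 0 = R)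
    (he : e = if R = 0 then 1 else s.real 0 0 0) (h0 : 0 < e) (hK : s.nat arrK 0 0 = 0) :
    WP grid s fun t s' => ∃ K, t ≤ 100 * (K + 1) ∧ s'.real reaE 0 0 = e ∧ s'.nat arrK 0 0 = K ∧
      s'.nat arrM 0 0 = K + K + K + K ∧ 5 < K * (4 * e) ∧ K * (4 * e) ≤ 5 + 4 * e := by
  have main : ∀ s1 : Store, s1.real reaE 0 0 = e → s1.nat arrK 0 0 = 0 → WP (seqs [
      .while (.realLe (.ofNat (nv arrK) * (4 * rv reaE)) 5) (setN arrK (nv arrK + 1)),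
      setN arrM (nv arrK + nv arrK + nv arrK + nv arrK)]) s1 fun t s' => ∃ K, t + 50 ≤ 100 * (K + 1) ∧
      s'.real reaE 0 0 = e ∧ s'.nat arrK 0 0 = K ∧ s'.nat arrM 0 0 = K + K + K + K ∧
      5 < K * (4 * e) ∧ K * (4 * e) ≤ 5 + 4 * e := by
    intro s1 h1 h2
    have h4 : 0 < 4 * e := by linarith
    obtain ⟨N, hN⟩ : ∃ N : ℕ, 5 < N * (4 * e) := by
      obtain ⟨N, hN⟩ := exists_nat_gt (5 / (4 * e))
      exact ⟨N, by rwa [div_lt_iff₀ h4] at hN⟩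
    have key : ∀ a b s2, b + a = N → s2.real reaE 0 0 = e → s2.nat arrK 0 0 = b →
        b * (4 * e) ≤ 5 + 4 * e →
        WP (.while (.realLe (.ofNat (nv arrK) * (4 * rv reaE)) 5) (setN arrK (nv arrK + 1))) s2
        fun t s' => ∃ K, t + 30 * b ≤ 30 * (K + 1) ∧ s'.real reaE 0 0 = e ∧ s'.nat arrK 0 0 = K ∧
          5 < K * (4 * e) ∧ K * (4 * e) ≤ 5 + 4 * e := by
      intro a
      induction a with
      | zero =>
        intro b s2 hb g1 g2 g3
        rw [WP_while]
        have test : (Test.realLe (.ofNat (nv arrK) * (4 * rv reaE)) 5).Holds s2 ↔ b * (4 * e) ≤ 5 := by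
          simp [g1, g2]
        obtain rfl : b = N := by omega
        rw [test]
        refine ⟨fun h => absurd hN (not_lt.2 h), fun h => ⟨b, ?_, g1, g2, hN, g3⟩⟩
        simp
        omega
      | succ a ih =>
        intro b s2 hb g1 g2 g3
        rw [WP_while]
        have test : (Test.realLe (.ofNat (nv arrK) * (4 * rv reaE)) 5).Holds s2 ↔ b * (4 * e) ≤ 5 := by
          simp [g1, g2]
        rw [test, WP_setN]
        refine ⟨fun h => (ih (b + 1) _ (by omega) (by simp [g1]) (by simp [g2]) ?_).mono ?_,
          fun h => ⟨b, ?_, g1, g2, ?_, g3⟩⟩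
        · push_cast
          linarith
        · rintro t s3 ⟨K, k1, k2⟩
          refine ⟨K, ?_, k2⟩
          simp
          omega
        · simp
          omega
        · exact not_le.1 h
    rw [WP_seqs_cons]
    refine (key N 0 s1 (by omega) h1 h2 (by simp; linarith)).mono ?_
    rintro t s2 ⟨K, k1, k2, k3, k4⟩
    rw [WP_seqs_singleton, WP_setN]
    refine ⟨K, ?_, ?_, ?_, ?_, k4⟩
    · simp
      omega
    · simp [k2]
    · simp [k3]
    · simp [k3]
  unfold grid
  rw [WP_seqs_cons, WP_ite]
  simp only [WP_setR, holds_natLe]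
  refine ⟨fun h => (main _ ?_ ?_).mono ?_, fun h => (main _ ?_ ?_).mono ?_⟩
  · have : R = 0 := by simpa [hR] using h
    simp [he, this]
  · simp [hK]
  · rintro t s' ⟨K, k1, k2⟩
    refine ⟨K, ?_, k2⟩
    simp
    omega
  · have : R ≠ 0 := by simpa [hR] using h
    simp [he, this]
  · simp [hK]
  · rintro t s' ⟨K, k1, k2⟩
    refine ⟨K, ?_, k2⟩
    simp
    omega

end RealRAM

/-! ### Rooted tree-decompositions -/

namespace RootedTreeDecomposition

variable {m k : ℕ} {G : SimpleGraph (Fin m)}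

theorem pos (D : RootedTreeDecomposition G k) : 0 < k := by
  obtain ⟨t⟩ := D.isTreeDecomposition.isTree.connected.nonempty
  exact lt_of_le_of_lt (Nat.zero_le _) t.2

theorem exists_mem (D : RootedTreeDecomposition G k) (r : Fin m) : ∃ t, r ∈ D.bag t := by
  obtain ⟨t⟩ := (D.isTreeDecomposition.subtree r).nonempty
  exact ⟨t.1, t.2⟩

/-- The nodes whose bags contain `r` are closed under taking parents, up to the smallest one. -/
theorem mem_bag_par (D : RootedTreeDecomposition G k) {r : Fin m} {s a : Fin k} (hs : r ∈ D.bag s)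
    (ha : r ∈ D.bag a) (hlt : a < s) : r ∈ D.bag (D.par s) := by
  by_contra hp
  -- the descendants of `s` whose bags contain `r` cannot be left without passing the parent of `s`
  have hle : ∀ (i : ℕ) (t : Fin k), (D.par^[i] t).val ≤ t.val := by
    intro i
    induction i with
    | zero => simp
    | succ i ih => exact fun t => (Function.iterate_succ_apply D.par i t ▸ ih _).trans (D.par_le t)
  have key : ∀ x y : {t | r ∈ D.bag t}, ((parentGraph D.par).induce {t | r ∈ D.bag t}).Adj x y →
      (∃ i, D.par^[i] x.1 = s) → ∃ i, D.par^[i] y.1 = s := by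
    rintro ⟨x, hx⟩ ⟨y, hy⟩ hxy ⟨i, hi⟩
    simp only [SimpleGraph.comap_adj, Function.Embedding.subtype_apply, parentGraph,
      SimpleGraph.fromRel_adj] at hxy
    rcases hxy.2 with h | h
    · cases i with
      | zero =>
        simp only [Function.iterate_zero, id_eq] at hi
        rw [← hi, h] at hp
        exact absurd hy hp
      | succ i =>
        rw [Function.iterate_succ_apply, h] at hi
        exact ⟨i, hi⟩
    · exact ⟨i + 1, by rw [Function.iterate_succ_apply, h]; exact hi⟩
  have hreach := (D.isTreeDecomposition.subtree r).preconnected ⟨s, hs⟩ ⟨a, ha⟩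
  rw [SimpleGraph.reachable_iff_reflTransGen] at hreach
  have : ∃ i, D.par^[i] a = s := by
    refine Relation.ReflTransGen.head_induction_on (motive := fun x _ =>
      (∃ i, D.par^[i] x.1 = s) → ∃ i, D.par^[i] a = s) hreach id ?_ ⟨0, rfl⟩
    intro x y hxy _ ih hx
    exact ih (key x y hxy hx)
  obtain ⟨i, hi⟩ := this
  have := hle i a
  rw [hi] at this
  exact absurd this (not_le.2 hlt)

end RootedTreeDecomposition

namespace RootedTreeDecomposition

variable {m k : ℕ} {G : SimpleGraph (Fin m)} (D : RootedTreeDecomposition G k)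

/-- Row `r` belongs to the bag of node `t`.  Numbers `r ≥ m` stand for additional rows, which belong
to all bags. -/
def InBag (t r : ℕ) : Prop := m ≤ r ∨ ∃ (ht : t < k) (hr : r < m), (⟨r, hr⟩ : Fin m) ∈ D.bag ⟨t, ht⟩

/-- The parent pointers as a function on all natural numbers. -/
def parent (t : ℕ) : ℕ := if h : t < k then (D.par ⟨t, h⟩).val else 0

/-- The node closest to the root among those whose bags contain row `r`. -/
noncomputable def top (r : ℕ) : ℕ := sInf {t | t < k ∧ D.InBag t r}

theorem top_spec (r : ℕ) : D.top r < k ∧ D.InBag (D.top r) r ∧ ∀ t < k, D.InBag t r → D.top r ≤ t := by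
  have hne : {t | t < k ∧ D.InBag t r}.Nonempty := by
    by_cases hr : r < m
    · obtain ⟨t, ht⟩ := D.exists_mem ⟨r, hr⟩
      exact ⟨t.1, t.2, Or.inr ⟨t.2, hr, ht⟩⟩
    · exact ⟨0, D.pos, Or.inl (not_lt.1 hr)⟩
  obtain ⟨h1, h2⟩ := Nat.sInf_mem hne
  exact ⟨h1, h2, fun t ht h => Nat.sInf_le ⟨ht, h⟩⟩

theorem parent_lt {t : ℕ} (h0 : 0 < t) (ht : t < k) : D.parent t < t := by
  rw [parent, dif_pos ht]
  have h1 := D.par_le ⟨t, ht⟩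
  have h2 := D.par_eq ⟨t, ht⟩
  refine lt_of_le_of_ne h1 fun h => ?_
  have := h2.1 (Fin.ext h)
  simp at this
  omega

theorem parent_lt_card {t : ℕ} (ht : t < k) : D.parent t < k := by
  rw [parent, dif_pos ht]
  exact (D.par _).2

theorem inBag_parent {t r : ℕ} (ht : t < k) (h : D.InBag t r) (hne : D.top r ≠ t) :
    D.InBag (D.parent t) r := by
  obtain ⟨h1, h2, h3⟩ := D.top_spec r
  rcases h with h | ⟨_, hr, h⟩
  · exact Or.inl h
  · right
    rcases h2 with h2 | ⟨_, _, h2⟩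
    · omega
    have hlt : D.top r < t := lt_of_le_of_ne (h3 t ht (Or.inr ⟨ht, hr, h⟩)) hne
    have := D.mem_bag_par h h2 hlt
    refine ⟨D.parent_lt_card ht, hr, ?_⟩
    · simpa [parent, ht] using this

/-- If two rows have a common bag, the topmost bag of one of them contains the other one. -/
theorem inBag_top {t r r' : ℕ} (ht : t < k) (h : D.InBag t r) (h' : D.InBag t r')
    (hle : D.top r ≤ D.top r') : D.InBag (D.top r') r := by
  induction t using Nat.strong_induction_on with
  | _ t ih =>
    by_cases h1 : D.top r' = t
    · rwa [h1]
    · have h2 := (D.top_spec r').2.2 t ht h'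
      have h3 := D.parent_lt (t := t) (by omega) ht
      exact ih _ h3 (by omega) (D.inBag_parent ht h (by omega)) (D.inBag_parent ht h' h1)

theorem card_le {H t : ℕ} (ht : t < k) {J : Finset ℕ} (hJ : J ⊆ Finset.range (m + H))
    (h : ∀ r ∈ J, D.InBag t r) :
    J.card ≤ (Finset.univ.sup fun t => (D.bag t).card) + H := by
  have h1 : J ⊆ (D.bag ⟨t, ht⟩).image Fin.val ∪ (Finset.range H).image (m + ·) := by
    intro r hr
    rw [Finset.mem_union]
    rcases h r hr with h2 | ⟨_, hrm, h2⟩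
    · right
      have := Finset.mem_range.1 (hJ hr)
      exact Finset.mem_image.2 ⟨r - m, Finset.mem_range.2 (by omega), by omega⟩
    · exact Or.inl (Finset.mem_image.2 ⟨_, h2, rfl⟩)
  refine (Finset.card_le_card h1).trans ((Finset.card_union_le _ _).trans ?_)
  refine Nat.add_le_add (Finset.card_image_le.trans ?_) (Finset.card_image_le.trans (by simp))
  exact Finset.le_sup (f := fun t => (D.bag t).card) (Finset.mem_univ _)

end RootedTreeDecomposition

namespace Portfolio

open Finset RealRAM

variable {n m H k : ℕ} (I : Portfolio n m H) (D : RootedTreeDecomposition I.rowGraph k)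

/-- The rows of the constraint matrix, followed by the eigenvectors. -/
noncomputable def row (r j : ℕ) : ℝ := if m ≤ r then matCells I.v (r - m) j else matCells I.A r j

theorem row_lt {r j : ℕ} (hr : r < m) (hj : j < n) : I.row r j = I.A ⟨r, hr⟩ ⟨j, hj⟩ := by
  simp [row, matCells, hr, hj]

theorem row_add {h j : ℕ} (hh : h < H) (hj : j < n) : I.row (m + h) j = I.v ⟨h, hh⟩ ⟨j, hj⟩ := by
  simp [row, matCells, hh, hj]

theorem exists_row_ne_zero {r : ℕ} (hr : r < m + H) : ∃ j < n, I.row r j ≠ 0 := by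
  by_cases hrm : r < m
  · obtain ⟨j, hj⟩ := I.row_ne_zero ⟨r, hrm⟩
    exact ⟨j, j.2, by rwa [I.row_lt hrm j.2]⟩
  · by_contra! h
    obtain ⟨h', rfl⟩ : ∃ h', r = m + h' := ⟨r - m, by omega⟩
    have hh : h' < H := by omega
    have h1 := I.orthonormal ⟨h', hh⟩ ⟨h', hh⟩
    have h2 : ∀ j : Fin n, I.v ⟨h', hh⟩ j = 0 := fun j => by
      rw [← I.row_add hh j.2]
      exact h j j.2
    simp [h2] at h1

/-- The data of the problem in the form in which the program works with them. -/
noncomputable def rowData (e : ℝ) (K L : ℕ) (col : ℕ → ℕ) : RowData where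
  n := n
  m := m
  H := H
  k := k
  K := K
  L := L
  B := I.row
  b r := vecCells I.b r 0
  u j := vecCells I.u j 0
  d j := vecCells I.d j 0
  mu j := vecCells I.mu j 0
  lam h := vecCells I.lam h 0
  e := e
  top := D.top
  col := col
  par t := if t < k then D.parent t else
    ((range (m + H)).filter fun r => I.row r (t - k) ≠ 0).sup D.top
  bag t r := if t < k then D.InBag t r else I.row r (t - k) ≠ 0

/-- Rows with a common variable have a common bag. -/
theorem exists_inBag {r r' j : ℕ} (hj : j < n) (h : I.row r j ≠ 0)
    (h' : I.row r' j ≠ 0) : ∃ t < k, D.InBag t r ∧ D.InBag t r' := by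
  by_cases h1 : r < m
  · by_cases h2 : r' < m
    · by_cases h3 : r = r'
      · subst h3
        obtain ⟨g1, g2, -⟩ := D.top_spec r
        exact ⟨_, g1, g2, g2⟩
      · rw [I.row_lt h1 hj] at h
        rw [I.row_lt h2 hj] at h'
        have : I.rowGraph.Adj ⟨r, h1⟩ ⟨r', h2⟩ := by
          rw [rowGraph, SimpleGraph.fromRel_adj]
          exact ⟨by simpa using h3, Or.inl ⟨_, h, h'⟩⟩
        obtain ⟨t, g1, g2⟩ := D.isTreeDecomposition.edge _ _ this
        exact ⟨t, t.2, Or.inr ⟨t.2, h1, g1⟩, Or.inr ⟨t.2, h2, g2⟩⟩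
    · obtain ⟨g1, g2, -⟩ := D.top_spec r
      exact ⟨_, g1, g2, Or.inl (not_lt.1 h2)⟩
  · obtain ⟨g1, g2, -⟩ := D.top_spec r'
    exact ⟨_, g1, Or.inl (not_lt.1 h1), g2⟩

/-- The rows of variable `j` all belong to the lowest of their topmost bags. -/
theorem inBag_sup {r j : ℕ} (hj : j < n) (hr : r < m + H) (h : I.row r j ≠ 0) :
    ((range (m + H)).filter fun r => I.row r j ≠ 0).sup D.top < k ∧
      D.InBag (((range (m + H)).filter fun r => I.row r j ≠ 0).sup D.top) r := by
  have hmem : r ∈ (range (m + H)).filter fun r => I.row r j ≠ 0 := mem_filter.2 ⟨mem_range.2 hr, h⟩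
  obtain ⟨r', h1, h2⟩ := exists_mem_eq_sup _ ⟨r, hmem⟩ D.top
  rw [h2]
  obtain ⟨t, ht, h3, h4⟩ := I.exists_inBag D hj h (mem_filter.1 h1).2
  refine ⟨(D.top_spec r').1, D.inBag_top ht h3 h4 ?_⟩
  rw [← h2]
  exact le_sup (f := D.top) hmem

theorem sound_rowData {e : ℝ} {K L : ℕ} {col : ℕ → ℕ} (he : 0 < e) (hK : 5 < K * (4 * e)) :
    (I.rowData D e K L col).Sound where
  e_pos := he
  K_gt := hK
  u_nonneg j hj := by
    have hj : j < n := hj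
    simpa [rowData, vecCells, hj] using I.u_nonneg ⟨j, hj⟩
  d_nonneg j hj := by
    have hj : j < n := hj
    simpa [rowData, vecCells, hj] using I.d_nonneg ⟨j, hj⟩

/-- Colours that are greedily chosen from the root to the leaves differ within each bag. -/
theorem eq_of_col_eq {I : Portfolio n m H} {D : RootedTreeDecomposition I.rowGraph k} {col : ℕ → ℕ}
    (hne : ∀ r < m + H, ∀ r' < m + H, D.InBag (D.top r') r →
      D.top r < D.top r' ∨ D.top r = D.top r' ∧ r < r' → col r ≠ col r')
    {t r r' : ℕ} (ht : t < k) (hr : r < m + H) (hr' : r' < m + H) (h : D.InBag t r)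
    (h' : D.InBag t r') (hc : col r = col r') : r = r' := by
  by_contra h1
  rcases Nat.lt_trichotomy (D.top r) (D.top r') with h2 | h2 | h2
  · exact hne r hr r' hr' (D.inBag_top ht h h' h2.le) (Or.inl h2) hc
  · rcases Nat.lt_or_gt_of_ne h1 with h3 | h3
    · exact hne r hr r' hr' (D.inBag_top ht h h' h2.le) (Or.inr ⟨h2, h3⟩) hc
    · exact hne r' hr' r hr (D.inBag_top ht h' h h2.ge) (Or.inr ⟨h2.symm, h3⟩) hc.symm
  · exact hne r' hr' r hr (D.inBag_top ht h' h h2.le) (Or.inl h2) hc.symm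

theorem valid_rowData {I : Portfolio n m H} {D : RootedTreeDecomposition I.rowGraph k} {e : ℝ}
    {K L : ℕ} {col : ℕ → ℕ} (he : 0 < e) (hK : 5 < K * (4 * e)) (hL : ∀ r < m + H, col r < L)
    (hne : ∀ r < m + H, ∀ r' < m + H, D.InBag (D.top r') r →
      D.top r < D.top r' ∨ D.top r = D.top r' ∧ r < r' → col r ≠ col r') :
    (I.rowData D e K L col).tree.Valid := by
  have hS := I.sound_rowData D (L := L) (col := col) he hK
  have hkpos := D.pos
  have hbag : ∀ t r, (I.rowData D e K L col).tree.bag t r ↔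
      if t < k then D.InBag t r else I.row r (t - k) ≠ 0 := fun _ _ => Iff.rfl
  have hpar : ∀ t, (I.rowData D e K L col).tree.par t = if t < k then D.parent t else
    ((range (m + H)).filter fun r => I.row r (t - k) ≠ 0).sup D.top := fun _ => rfl
  have hsup : ∀ j, ((range (m + H)).filter fun r => I.row r j ≠ 0).sup D.top < k := by
    intro j
    rw [Finset.sup_lt_iff hkpos]
    exact fun r _ => (D.top_spec r).1
  have hinj : ∀ t < k, ∀ r < m + H, ∀ r' < m + H, D.InBag t r → D.InBag t r' → col r = col r' →
      r = r' := fun t ht r hr r' hr' h h' hc => eq_of_col_eq hne ht hr hr' h h' hc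
  constructor
  · intro s h0 hs
    rw [hpar]
    split_ifs with h
    · exact D.parent_lt h0 h
    · exact (hsup _).trans_le (not_lt.1 h)
  · intro r hr s hs h
    rw [hbag] at h
    split_ifs at h with h1
    · exact (D.top_spec r).2.2 s h1 h
    · exact ((D.top_spec r).1.trans_le (not_lt.1 h1)).le
  · exact fun r _ => (D.top_spec r).1.trans_le (Nat.le_add_right _ _)
  · intro r _
    rw [hbag]
    exact (if_pos (D.top_spec r).1).symm ▸ (D.top_spec r).2.1
  · intro s hs r hr h hne'
    rw [hbag] at h
    rw [hbag, hpar]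
    have hs : s < k + n := hs
    split_ifs at h ⊢ with h1 h2 h2
    · exact D.inBag_parent h1 h hne'
    · exact absurd (D.parent_lt_card h1) h2
    · exact (I.inBag_sup D (by omega) hr h).2
    · exact absurd (hsup _) h2
  · intro j hj r hr h
    obtain ⟨c, -, hc⟩ := h
    rw [hbag, if_neg (by simp [RowData.tree, rowData])]
    have := hS.B_ne_zero hc
    simpa [RowData.tree, rowData] using this
  · intro s hs r hr r' hr' h h' hc
    rw [hbag] at h h'
    have hs : s < k + n := hs
    split_ifs at h h' with h1
    · exact hinj s h1 r hr r' hr' h h' hc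
    · exact hinj _ (hsup (s - k)) r hr r' hr' (I.inBag_sup D (by omega) hr h).2
        (I.inBag_sup D (by omega) hr' h').2 hc
  · exact hL
  · exact fun r _ x hx => hS.sum_lt hx r

/-- Every row has a variable, and the rows of a variable have different colours. -/
theorem card_rows_le {I : Portfolio n m H} {D : RootedTreeDecomposition I.rowGraph k} {L : ℕ}
    {col : ℕ → ℕ} (hL : ∀ r < m + H, col r < L)
    (hne : ∀ r < m + H, ∀ r' < m + H, D.InBag (D.top r') r →
      D.top r < D.top r' ∨ D.top r = D.top r' ∧ r < r' → col r ≠ col r') : m + H ≤ n * L := by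
  choose! f hf using fun r (hr : r < m + H) => I.exists_row_ne_zero hr
  have := card_le_card_of_injOn (s := range (m + H)) (t := range n ×ˢ range L)
    (fun r => (f r, col r)) (fun r hr => ?_) (fun r hr r' hr' h => ?_)
  · simpa using this
  · have hr := mem_range.1 hr
    exact mem_product.2 ⟨mem_range.2 (hf r hr).1, mem_range.2 (hL r hr)⟩
  · have hr : r < m + H := by simpa using hr
    have hr' : r' < m + H := by simpa using hr'
    obtain ⟨h1, h2⟩ := Prod.mk.inj h
    obtain ⟨t, ht, g1, g2⟩ := I.exists_inBag D (hf r hr).1 (hf r hr).2 (h1 ▸ (hf r' hr').2)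
    exact eq_of_col_eq hne ht hr hr' g1 g2 h2

/-- The eigenvectors have different colours. -/
theorem eigen_le {I : Portfolio n m H} {D : RootedTreeDecomposition I.rowGraph k} {L : ℕ}
    {col : ℕ → ℕ} (hL : ∀ r < m + H, col r < L)
    (hne : ∀ r < m + H, ∀ r' < m + H, D.InBag (D.top r') r →
      D.top r < D.top r' ∨ D.top r = D.top r' ∧ r < r' → col r ≠ col r') : H ≤ L := by
  have := card_le_card_of_injOn (s := range H) (t := range L) (fun h => col (m + h)) (fun h hh => ?_)
    (fun h hh h' hh' hc => ?_)
  · simpa using this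
  · exact mem_range.2 (hL _ (by have := mem_range.1 hh; omega))
  · have hh : h < H := by simpa using hh
    have hh' : h' < H := by simpa using hh'
    have := eq_of_col_eq hne D.pos (by omega) (by omega) (Or.inl (Nat.le_add_right _ _))
      (Or.inl (Nat.le_add_right _ _)) hc
    omega

end Portfolio

/-! ### Reading the input and writing the output -/

namespace Portfolio

open Finset RealRAM

variable {n m H k : ℕ} (I : Portfolio n m H) (D : RootedTreeDecomposition I.rowGraph k)

/-- Compute the arrangement of the rows along the tree, and the precision. -/
def arrange : Prog := seqs [rows, colours, parents, grid]

theorem arrange_spec {ε : ℝ} (hε : 0 < ε) :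
    WP arrange (I.input D ε) fun t s' => ∃ (e : ℝ) (K L : ℕ) (col : ℕ → ℕ),
      t ≤ 1100 * ((k + n + 1) * ((m + H + 1) * (m + H + 1)) + K + 1) ∧
      e = (if m + H = 0 then 1 else ε) ∧ 5 < K * (4 * e) ∧ K * (4 * e) ≤ 5 + 4 * e ∧
      L ≤ (univ.sup fun t => (D.bag t).card) + H ∧ (∀ r < m + H, col r < L) ∧
      (∀ r < m + H, ∀ r' < m + H, D.InBag (D.top r') r →
        D.top r < D.top r' ∨ D.top r = D.top r' ∧ r < r' → col r ≠ col r') ∧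
      Base (I.rowData D e K L col) s' ∧
      Frame [10, 11, 12, 13, 14, 15, 16, 17, 18, 50, 51, 53, 54, 56] [10, 14] (I.input D ε) s' := by
  set s := I.input D ε with hs
  have in0 : s.nat 0 = vecCells ![n, m, H, I.N, k] := rfl
  have in1 : s.nat 1 = vecCells fun t => (D.par t).val := rfl
  have in2 : s.nat 2 = matCells fun t r => if r ∈ D.bag t then 1 else 0 := rfl
  have zn : ∀ a, 2 < a → ∀ i j, s.nat a i j = 0 := by
    intro a ha i j
    match a, ha with
    | a + 3, _ => rfl
  have zr : ∀ a, 7 < a → ∀ i j, s.real a i j = 0 := by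
    intro a ha i j
    match a, ha with
    | a + 8, _ => rfl
  have i0 : s.nat 0 0 0 = n := by simp [in0, vecCells]
  have i1 : s.nat 0 1 0 = m := by simp [in0, vecCells]
  have i2 : s.nat 0 2 0 = H := by simp [in0, vecCells]
  have i4 : s.nat 0 4 0 = k := by simp [in0, vecCells]
  have ie : s.real 0 0 0 = ε := by
    change vecCells ![ε] 0 0 = ε
    simp [vecCells]
  unfold arrange
  simp only [WP_seqs_cons, WP_seqs_singleton]
  refine (WP.frame [10, 51, 54] [10] (rows_spec i0 i1 i2)).mono ?_
  rintro t1 s1 ⟨⟨ht1, hR1, hB1⟩, hf1⟩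
  refine (WP.frame [11, 12, 13, 14, 15, 50, 51, 53, 56] [] (colours_spec (m := m) (k := k) (R := m + H)
    (W := (univ.sup fun t => (D.bag t).card) + H) (bag := D.InBag) (top := D.top)
    (by simp [hf1.nat, i1]) (by simp [hf1.nat, i4]) hR1 ?_
    (fun t ht J hJ h => D.card_le ht hJ h) (fun r _ => D.top_spec r)
    (fun r => ?_) (fun r c => ?_) ?_)).mono ?_
  · intro t ht r hr
    rw [hf1.nat _ (by decide), in2, RootedTreeDecomposition.InBag, matCells]
    by_cases h1 : r < m
    · simp only [ht, h1, exists_true_left, and_self, dif_pos]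
      split_ifs with h2 <;> simp [h2]
    · simp [not_lt.1 h1]
  · rw [hf1.nat _ (by decide), zn _ (by norm_num)]
  · rw [hf1.nat _ (by decide), zn _ (by norm_num)]
  · rw [hf1.nat _ (by decide), zn _ (by norm_num)]
  rintro t2 s2 ⟨⟨ht2, hC⟩, hf2⟩
  have hf02 := (hf1.mono (A' := [10, 11, 12, 13, 14, 15, 50, 51, 53, 54, 56]) (B' := [10]) (by decide)
    (by decide)).trans (hf2.mono (by decide) (by decide))
  have hR2 : s2.nat arrR 0 0 = m + H := by rw [hf2.nat _ (by decide), hR1]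
  refine (WP.frame [16, 50, 51, 54] [] (parents_spec (k := k) (n := n) (R := m + H)
    (by simp [hf02.nat, i0]) (by simp [hf02.nat, i4]) hR2 (fun j => ?_))).mono ?_
  · rw [hf02.nat _ (by decide), zn _ (by norm_num)]
  rintro t3 s3 ⟨⟨ht3, hp1, hp2⟩, hf3⟩
  have hf03 := (hf02.mono (A' := [10, 11, 12, 13, 14, 15, 16, 50, 51, 53, 54, 56]) (B' := [10])
    (by decide) (by decide)).trans (hf3.mono (by decide) (by decide))
  refine (WP.frame [17, 18] [14] (grid_spec (R := m + H) (e := if m + H = 0 then 1 else ε)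
    (by rw [hf3.nat _ (by decide), hR2]) (by simp [hf03.real, ie]) (by split_ifs <;> linarith)
    ?_)).mono ?_
  · rw [hf03.nat _ (by decide), zn _ (by norm_num)]
  rintro t4 s4 ⟨⟨K, ht4, h1, h2, h3, h4, h5⟩, hf4⟩
  have hf04 := (hf03.mono (A' := [10, 11, 12, 13, 14, 15, 16, 17, 18, 50, 51, 53, 54, 56])
    (B' := [10, 14]) (by decide) (by decide)).trans (hf4.mono (by decide) (by decide))
  refine ⟨_, K, s2.nat arrL 0 0, fun r => s2.nat arrCol r 0, ?_, rfl, h4, h5, hC.le,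
    fun r hr => hC.col r hr trivial, fun r hr r' hr' => hC.ne r hr r' hr' trivial trivial, ?_, hf04⟩
  · have g1 : (m + H + 1) * (n + 1) ≤ (k + n + 1) * ((m + H + 1) * (m + H + 1)) := by
      have a1 : n + 1 ≤ k + n + 1 := by omega
      have a2 : m + H + 1 ≤ (m + H + 1) * (m + H + 1) := Nat.le_mul_of_pos_left _ (by omega)
      calc _ = (n + 1) * (m + H + 1) := mul_comm _ _
        _ ≤ _ := Nat.mul_le_mul a1 a2
    have g2 : (k + 1) * ((m + H + 1) * (m + H + 1)) ≤ (k + n + 1) * ((m + H + 1) * (m + H + 1)) :=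
      Nat.mul_le_mul_right _ (by omega)
    have g3 : (k + n + 1) * (m + H + 1) ≤ (k + n + 1) * ((m + H + 1) * (m + H + 1)) :=
      Nat.mul_le_mul_left _ (Nat.le_mul_of_pos_left _ (by omega))
    linarith
  · constructor
    · simp [hf04.nat, i0, rowData]
    · simp [hf04.nat, i1, rowData]
    · simp [hf04.nat, i2, rowData]
    · simp [hf04.nat, i4, rowData]
    · rw [hf4.nat _ (by decide), hf3.nat _ (by decide), hR2]
      rfl
    · exact h2
    · rw [hf4.nat _ (by decide), hf3.nat _ (by decide)]
      rfl
    · exact h3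
    · intro r hr j hj
      have hr : r < m + H := hr
      have hj : j < n := hj
      rw [hf4.real _ (by decide), hf3.real _ (by decide), hf2.real _ (by decide), hB1 r hr j hj]
      rfl
    · intro r _
      rw [hf04.real _ (by decide)]
      rfl
    · intro r _
      rw [hf04.real _ (by decide)]
      rfl
    · intro r _
      rw [hf04.real _ (by decide)]
      rfl
    · intro r _
      rw [hf04.real _ (by decide)]
      rfl
    · intro r _
      rw [hf04.real _ (by decide)]
      rfl
    · exact h1
    · intro r hr
      rw [hf4.nat _ (by decide), hf3.nat _ (by decide), hC.top_eq r hr trivial]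
      rfl
    · intro r hr
      rw [hf4.nat _ (by decide), hf3.nat _ (by decide)]
      rfl
    · intro t ht
      have ht : t < k + n := ht
      rw [hf4.nat _ (by decide)]
      change _ = if t < k then D.parent t else _
      split_ifs with h
      · rw [hp1 t h, hf02.nat _ (by decide), in1]
        simp [vecCells, RootedTreeDecomposition.parent, h]
      · obtain ⟨j, rfl⟩ := Nat.exists_eq_add_of_le (not_lt.1 h)
        have hj : j < n := by omega
        rw [hp2 j hj, Nat.add_sub_cancel_left]
        have e1 : ((range (m + H)).filter fun r => s2.real reaB r j ≠ 0) =
            (range (m + H)).filter fun r => I.row r j ≠ 0 := by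
          refine filter_congr fun r hr => ?_
          rw [hf2.real _ (by decide), hB1 r (mem_range.1 hr) j hj]
          rfl
        rw [e1]
        exact sup_congr rfl fun r hr => hC.top_eq r (mem_range.1 (mem_filter.1 hr).1) trivial

end Portfolio

namespace RealRAM

open Finset

/-- Choose the best solution with at most `N` nonzero variables, and write it to the output. -/
def finish : Prog := seqs [
  setN varCnt 0,
  forP ctrC (nv 0 + 1)
    (.ite (.and (.natLe (nv ctrC) (n1 0 3)) (.natLe 1 (n2 arrOk (nv arrLoc) (nv ctrC))))
      (.ite (.and (.natLe 1 (nv 3)) (.realLe (rv reaBest) (r2 reaVal (nv arrLoc) (nv ctrC)))) .skip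
        (seqs [setN 3 1, setR reaBest (r2 reaVal (nv arrLoc) (nv ctrC)), setN varCnt (nv ctrC)]))
      .skip),
  forP ctrJ (nv 0) (seqs [
    setN arrD (n2 arrSol (nv arrLoc) (n1 arrMul (nv varCnt) + nv ctrJ)),
    .setReal 8 (nv ctrJ) 0 (r2 reaX (nv ctrJ) (nv arrD)),
    .ite (.natLe (nv arrD) 0) (.setNat 4 (nv ctrJ) 0 0) (.setNat 4 (nv ctrJ) 0 1)]),
  forP ctrX (n1 0 2) (seqs [
    setN ctrR (n1 0 1 + nv ctrX),
    setN arrOff 0,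
    forP ctrJ (nv 0) (seqs [
      setR reaPt (r1 8 (nv ctrJ)),
      digitP,
      setN arrOff (nv arrOff + nv arrDig)]),
    .setReal 9 (nv ctrX) 0 (r2 reaY (nv ctrR) (nv arrOff))])]

theorem finish_spec {p : RowData} {s : Store} {N row : ℕ} (hb : Base p s) (hs : HasSums p s)
    (hpow : ∀ c ≤ p.L, s.nat arrPow c 0 = p.K ^ c) (hL : ∀ r < p.R, p.col r ≤ p.L)
    (hmul : ∀ c ≤ p.n, s.nat arrMul c 0 = c * p.n) (hN : s.nat 0 3 0 = N)
    (hrow : s.nat arrLoc 0 0 = row) (h3 : s.nat 3 0 0 = 0) :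
    WP finish s fun t s' => t ≤ 900 * ((p.n + 1) * ((p.H + 1) * (p.K + 1))) ∧ ∃ cnt ≤ p.n,
      ((s'.nat 3 0 0 = 0 ∧ ∀ c ≤ p.n, c ≤ N → s.nat arrOk row c = 0) ∨
        (s'.nat 3 0 0 ≠ 0 ∧ cnt ≤ N ∧ s.nat arrOk row cnt ≠ 0 ∧
          ∀ c ≤ p.n, c ≤ N → s.nat arrOk row c ≠ 0 → s.real reaVal row cnt ≤ s.real reaVal row c)) ∧
      (∀ j < p.n, s'.real 8 j 0 = s.real reaX j (sol p.n s row cnt j) ∧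
        s'.nat 4 j 0 = if sol p.n s row cnt j = 0 then 0 else 1) ∧
      ∀ h < p.H, s'.real 9 h 0 = s.real reaY (p.m + h) (∑ j ∈ range p.n,
        roundDigit (p.grid (p.m + h)) p.K (p.term (p.m + h) j (s.real reaX j (sol p.n s row cnt j)))) := by
  unfold finish
  simp only [WP_seqs_cons, WP_seqs_singleton, WP_setN]
  set s0 := s.writeNat _ _ _ _ with hs0
  have hf0 : Frame [43] [] s s0 := (Frame.refl _ _ _).writeNat
  refine WP_forP [3, 43, 53] [27] (p.n + 1) (fun _ => 100)
    (fun a s' => s'.nat varCnt 0 0 ≤ p.n ∧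
      ((s'.nat 3 0 0 = 0 ∧ ∀ c < a, c ≤ N → s.nat arrOk row c = 0) ∨
        (s'.nat 3 0 0 ≠ 0 ∧ s'.nat varCnt 0 0 ≤ N ∧ s.nat arrOk row (s'.nat varCnt 0 0) ≠ 0 ∧
          s'.real reaBest 0 0 = s.real reaVal row (s'.nat varCnt 0 0) ∧
          ∀ c < a, c ≤ N → s.nat arrOk row c ≠ 0 →
            s.real reaVal row (s'.nat varCnt 0 0) ≤ s.real reaVal row c))) ?_ ?_ ?_ ?_
  · refine ⟨by simp [hs0], Or.inl ⟨by simp [hs0, h3], by omega⟩⟩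
  · intro a s' _ hs
    simp [hs.nat, hf0.nat, hb.n]
  · rintro c s1 hc ⟨hI0, hI1⟩ hf1 hc1
    have e1 : s1.nat 0 3 0 = N := by simp [hf1.nat, hf0.nat, hN]
    have e2 : s1.nat arrLoc 0 0 = row := by simp [hf1.nat, hf0.nat, hrow]
    have e3 : s1.nat arrOk = s.nat arrOk := by simp [hf1.nat, hf0.nat]
    have e4 : s1.real reaVal = s.real reaVal := by simp [hf1.real, hf0.real]
    have t1 : (Test.and (.natLe (nv ctrC) (n1 0 3)) (.natLe 1 (n2 arrOk (nv arrLoc) (nv ctrC)))).Holds s1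
        ↔ c ≤ N ∧ s.nat arrOk row c ≠ 0 := by
      simp [e1, e2, e3, hc1, Nat.one_le_iff_ne_zero]
    have t2 : (Test.and (.natLe 1 (nv 3))
        (.realLe (rv reaBest) (r2 reaVal (nv arrLoc) (nv ctrC)))).Holds s1
        ↔ s1.nat 3 0 0 ≠ 0 ∧ s1.real reaBest 0 0 ≤ s.real reaVal row c := by
      simp [e2, e4, hc1, Nat.one_le_iff_ne_zero]
    simp only [WP_ite, WP_skip, WP_seqs_cons, WP_seqs_singleton, WP_setN, WP_setR]
    rw [t1, t2]
    refine ⟨fun g1 => ⟨fun g2 => ⟨by simp, by simpa using hI0, Or.inr ?_⟩,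
      fun g2 => ⟨by simp, ?_, Or.inr ?_⟩⟩, fun g1 => ⟨by simp, by simpa using hI0, ?_⟩⟩
    · rcases hI1 with ⟨l1, -⟩ | ⟨l1, l2, l3, l4, l5⟩
      · exact absurd l1 g2.1
      · refine ⟨by simpa using l1, by simpa using l2, by simpa using l3, by simpa using l4, ?_⟩
        intro c' h1 h2 h4
        rcases Nat.lt_succ_iff_lt_or_eq.1 h1 with h | rfl
        · simpa using l5 c' h h2 h4
        · simpa [← l4] using g2.2
    · simp [hc1]
      omega
    · refine ⟨by simp, by simpa [hc1] using g1.1, by simpa [hc1] using g1.2, by simp [hc1, e2, e4], ?_⟩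
      intro c' h1 h2 h4
      simp only [nat_writeNat, eval_nv, nat_writeReal]
      norm_num only [if_true, if_false, and_self, false_and]
      simp only [hc1]
      rcases Nat.lt_succ_iff_lt_or_eq.1 h1 with h | rfl
      · rcases hI1 with ⟨-, l2⟩ | ⟨l1, l2, l3, l4, l5⟩
        · exact absurd (l2 c' h h2) h4
        · have := l5 c' h h2 h4
          rw [← l4] at this
          by_contra h6
          exact g2 ⟨l1, by linarith⟩
      · exact le_rfl
    · rcases hI1 with ⟨l1, l2⟩ | ⟨l1, l2, l3, l4, l5⟩
      · refine Or.inl ⟨by simpa using l1, fun c' h1 h2 => ?_⟩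
        rcases Nat.lt_succ_iff_lt_or_eq.1 h1 with h | rfl
        · exact l2 c' h h2
        · by_contra h
          exact g1 ⟨h2, h⟩
      · refine Or.inr ⟨by simpa using l1, by simpa using l2, by simpa using l3, by simpa using l4, ?_⟩
        intro c' h1 h2 h4
        rcases Nat.lt_succ_iff_lt_or_eq.1 h1 with h | rfl
        · simpa using l5 c' h h2 h4
        · exact absurd ⟨h2, h4⟩ g1
  rintro τ1 s1 ⟨hcnt, hI1⟩ hf1 hτ1
  have hcost1 := for_cost (A := 150) hτ1 (by simp)
  have hf01 := (hf0.mono (A' := [3, 43, 53]) (B' := [27]) (by decide) (by decide)).trans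
    (hf1.mono (List.Subset.refl _) (List.Subset.refl _))
  generalize hcnt' : s1.nat varCnt 0 0 = cnt at *
  have hsol : ∀ j < p.n, sol p.n s row cnt j = s.nat arrSol row (cnt * p.n + j) := by
    intro j hj
    rw [sol, if_pos hj]
  refine WP_forP [4, 38, 54] [8] p.n (fun _ => 80) (fun a s' => ∀ j < a,
    s'.real 8 j 0 = s.real reaX j (sol p.n s row cnt j) ∧
        s'.nat 4 j 0 = if sol p.n s row cnt j = 0 then 0 else 1) ?_ ?_ ?_ ?_
  · intro j hj
    omega
  · intro a s' _ hs
    simp [hs.nat, hf01.nat, hb.n]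
  · intro j s2 hj hI2 hf2 hc2
    have e1 : s2.nat arrLoc 0 0 = row := by simp [hf2.nat, hf01.nat, hrow]
    have e2 : s2.nat varCnt 0 0 = cnt := by simp [hf2.nat, hcnt']
    have e3 : s2.nat arrMul cnt 0 = cnt * p.n := by simp [hf2.nat, hf01.nat, hmul cnt hcnt]
    have e4 : s2.nat arrSol row (cnt * p.n + j) = sol p.n s row cnt j := by
      rw [hsol j hj]
      simp [hf2.nat, hf01.nat]
    have e5 : s2.real reaX = s.real reaX := by simp [hf2.real, hf01.real]
    simp only [WP_seqs_cons, WP_seqs_singleton, WP_setN, WP_setReal, WP_ite, WP_setNat]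
    set s3 := (s2.writeNat _ _ _ _).writeReal _ _ _ _ with hs3
    have d1 : s3.nat arrD 0 0 = sol p.n s row cnt j := by simp [hs3, e1, e2, e3, hc2, e4]
    have d2 : ∀ j', s3.real 8 j' 0 = if j' = j then s.real reaX j (sol p.n s row cnt j) else
        s2.real 8 j' 0 := by
      intro j'
      simp [hs3, e1, e2, e3, hc2, e4, e5]
    have d3 : s3.nat ctrJ 0 0 = j := by simp [hs3, hc2]
    have d4 : s3.nat 4 = s2.nat 4 := by
      funext i' j'
      simp [hs3]
    simp only [holds_natLe, eval_nv, eval_natLit, d1]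
    refine ⟨fun h => ⟨by simp, fun j' hj' => ?_⟩, fun h => ⟨by simp, fun j' hj' => ?_⟩⟩
    · rcases Nat.lt_succ_iff_lt_or_eq.1 hj' with h' | rfl
      · simpa [d2, d3, d4, h'.ne] using hI2 j' h'
      · simp [d2, d3]
        omega
    · rcases Nat.lt_succ_iff_lt_or_eq.1 hj' with h' | rfl
      · simpa [d2, d3, d4, h'.ne] using hI2 j' h'
      · simp [d2, d3]
        omega
  intro τ2 s2 hI2 hf2 hτ2
  have hcost2 := for_cost (A := 110) hτ2 (by simp)
  have hf02 := (hf01.mono (A' := [3, 4, 38, 43, 53, 54]) (B' := [8, 27]) (by decide) (by decide)).trans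
    (hf2.mono (by decide) (by decide))
  refine WP_forP [35, 36, 37, 40, 51, 54, 55, 56] [9, 20, 21, 22] p.H
    (fun _ => 350 * ((p.n + 1) * (p.K + 1))) (fun a s' => ∀ h < a, s'.real 9 h 0 =
      s.real reaY (p.m + h) (∑ j ∈ range p.n,
        roundDigit (p.grid (p.m + h)) p.K (p.term (p.m + h) j (s.real reaX j (sol p.n s row cnt j)))))
    ?_ ?_ ?_ ?_
  · intro h hh
    omega
  · intro a s' _ hs
    simp [hs.nat, hf02.nat, hb.H]
  · intro h s3 hh hI3 hf3 hc3
    have e1 : s3.nat 0 1 0 = p.m := by simp [hf3.nat, hf02.nat, hb.m]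
    have hr : p.m + h < p.R := by rw [RowData.R]; omega
    simp only [WP_seqs_cons, WP_seqs_singleton, WP_setN, WP_setReal]
    set s4 := (s3.writeNat _ _ _ _).writeNat _ _ _ _ with hs4
    have hf4 : Frame [40, 51] [] s3 s4 := (Frame.refl _ _ _).writeNat.writeNat
    have e2 : s4.nat ctrR 0 0 = p.m + h := by simp [hs4, e1, hc3]
    have e3 : s4.nat arrOff 0 0 = 0 := by simp [hs4]
    refine WP_forP [35, 36, 37, 40, 54, 55] [20, 21, 22] p.n (fun _ => 250 * (p.K + 1))
      (fun a s' => s'.nat arrOff 0 0 = ∑ j ∈ range a, roundDigit (p.grid (p.m + h)) p.K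
        (p.term (p.m + h) j (s.real reaX j (sol p.n s row cnt j)))) ?_ ?_ ?_ ?_
    · simpa using e3
    · intro a s' _ hs
      simp [hs.nat, hf4.nat, hf3.nat, hf02.nat, hb.n]
    · intro j s5 hj hI5 hf5 hc5
      simp only [WP_seqs_cons, WP_seqs_singleton, WP_setN, WP_setR]
      set s6 := s5.writeReal _ _ _ _ with hs6
      have hf6 : Frame [] [22] s5 s6 := (Frame.refl _ _ _).writeReal
      have hf06 := (hf02.mono (A' := [3, 4, 35, 36, 37, 38, 40, 43, 51, 53, 54, 55, 56])
        (B' := [8, 9, 20, 21, 22, 27]) (by decide) (by decide)).trans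
        ((hf3.mono (by decide) (by decide)).trans ((hf4.mono (by decide) (by decide)).trans
        ((hf5.mono (by decide) (by decide)).trans (hf6.mono (by decide) (by decide)))))
      refine (WP.frame [35, 36, 37, 55] [20, 21] (digitP_spec (p := p) (r := p.m + h) (j := j)
        (x := s.real reaX j (sol p.n s row cnt j)) (hb.congr (hf06.mono (by decide) (by decide)))
        (hs.congr hf06) ?_ (hL _ hr) hr hj ?_ ?_ ?_)).mono ?_
      · simpa only [hf06.nat arrPow (by decide)] using hpow
      · simp [hf6.nat, hf5.nat, e2]
      · simp [hf6.nat, hc5]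
      · have := (hI2 j hj).1
        simp [hs6, hc5, hf5.real, hf4.real, hf3.real, this]
      · rintro τ s7 ⟨⟨l1, l2, -⟩, hf7⟩
        refine ⟨?_, ?_⟩
        · simp
          omega
        · simp [l2, hf7.nat, hf6.nat, hI5, sum_range_succ]
    · intro τ s5 hI5 hf5 hτ
      have g1 : s5.nat ctrR 0 0 = p.m + h := by simp [hf5.nat, e2]
      have g2 : s5.nat ctrX 0 0 = h := by simp [hf5.nat, hf4.nat, hc3]
      have g3 : s5.real reaY = s.real reaY := by simp [hf5.real, hf4.real, hf3.real, hf02.real]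
      have g4 : s5.real 9 = s3.real 9 := by simp [hf5.real, hf4.real]
      refine ⟨?_, fun h' hh' => ?_⟩
      · have := for_cost (A := 300 * (p.K + 1)) hτ (by simp; omega)
        have l1 : 1 ≤ (p.n + 1) * (p.K + 1) := Nat.mul_pos (by omega) (by omega)
        have l2 : (p.n + 1) * (300 * (p.K + 1)) = 300 * ((p.n + 1) * (p.K + 1)) := by ring
        simp
        omega
      · rcases Nat.lt_succ_iff_lt_or_eq.1 hh' with h1 | rfl
        · simp [g2, g4, h1.ne, hI3 h' h1]
        · simp [g1, g2, g3, hI5]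
  intro τ3 s3 hI3 hf3 hτ3
  refine ⟨?_, cnt, hcnt, ?_, fun j hj => ?_, hI3⟩
  · have l1 : 1 ≤ (p.n + 1) * (p.K + 1) := Nat.mul_pos (by omega) (by omega)
    have := for_cost (A := 400 * ((p.n + 1) * (p.K + 1))) hτ3 (by simp; omega)
    have l2 : (p.n + 1) * ((p.H + 1) * (p.K + 1)) = (p.H + 1) * ((p.n + 1) * (p.K + 1)) := by ring
    have l3 : (p.H + 1) * (400 * ((p.n + 1) * (p.K + 1))) =
      400 * ((p.H + 1) * ((p.n + 1) * (p.K + 1))) := by ring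
    have l4 : p.n + 1 ≤ (p.H + 1) * ((p.n + 1) * (p.K + 1)) := by
      have : (p.n + 1) * 1 ≤ (p.n + 1) * ((p.H + 1) * (p.K + 1)) :=
        Nat.mul_le_mul_left _ (Nat.mul_pos (by omega) (by omega))
      linarith
    simp
    omega
  · have e1 : s3.nat 3 = s1.nat 3 := by rw [hf3.nat _ (by decide), hf2.nat _ (by decide)]
    rw [e1]
    rcases hI1 with ⟨l1, l2⟩ | ⟨l1, l2, l3, -, l5⟩
    · exact Or.inl ⟨l1, fun c hc => l2 c (by omega)⟩
    · exact Or.inr ⟨l1, l2, l3, fun c hc => l5 c (by omega)⟩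
  · rw [hf3.nat _ (by decide), hf3.real _ (by decide)]
    exact hI2 j hj

end RealRAM

/-! ### Correctness -/

namespace Portfolio

open Finset RealRAM

variable {n m H k : ℕ} {I : Portfolio n m H} {D : RootedTreeDecomposition I.rowGraph k} {e : ℝ}
  {K L : ℕ} {col : ℕ → ℕ}

theorem sum_A_eq {r : ℕ} (hr : r < m) (f : ℕ → ℝ) :
    ∑ j, I.A ⟨r, hr⟩ j * f j = ∑ j ∈ range n, (I.rowData D e K L col).B r j * f j := by
  rw [← Fin.sum_univ_eq_sum_range]
  exact sum_congr rfl fun j _ => by rw [← I.row_lt hr j.2]; rfl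

theorem sum_v_eq {h : ℕ} (hh : h < H) (f : ℕ → ℝ) :
    ∑ j, I.v ⟨h, hh⟩ j * f j = ∑ j ∈ range n, (I.rowData D e K L col).B (m + h) j * f j := by
  rw [← Fin.sum_univ_eq_sum_range]
  exact sum_congr rfl fun j _ => by rw [← I.row_add hh j.2]; rfl

theorem sum_vecCells (f : Fin n → ℝ) (g : ℝ → ℕ → ℝ) :
    ∑ j ∈ range n, g (vecCells f j 0) j = ∑ j, g (f j) j := by
  rw [← Fin.sum_univ_eq_sum_range (fun j => g (vecCells f j 0) j)]
  exact sum_congr rfl fun j _ => by simp [vecCells]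

theorem scale_eq {r : ℕ} {a : Fin n → ℝ} (ha : ∀ j : Fin n, I.row r j = a j) :
    (I.rowData D e K L col).sig r = I.scale a := by
  rw [RowData.sig, scale]
  change ∑ j ∈ range n, |I.row r j| * vecCells I.u j 0 = _
  rw [sum_vecCells I.u (fun x j => |I.row r j| * x)]
  exact sum_congr rfl fun j _ => by rw [ha]

theorem support_eq {r : ℕ} {a : Fin n → ℝ} (ha : ∀ j : Fin n, I.row r j = a j) :
    (I.rowData D e K L col).sup r = support a := by
  classical
  rw [RowData.sup, support]
  change ∑ j ∈ range n, (if I.row r j ≠ 0 then (1 : ℝ) else 0) = _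
  rw [← Fin.sum_univ_eq_sum_range (fun j => if I.row r j ≠ 0 then (1 : ℝ) else 0), Set.ncard_eq_toFinset_card']
  simp only [ha]
  rw [sum_boole]
  congr 2
  ext j
  simp

/-- The point given by a choice for each variable. -/
noncomputable def point (n H : ℕ) (p : RowData) (x : ℕ → ℕ) : PortfolioPoint n H where
  x j := p.xval j (x j)
  y h := p.yval (p.m + h) (∑ j ∈ range p.n, p.dig (p.m + h) j (x j))
  z j := if x j = 0 then 0 else 1

variable {x : ℕ → ℕ}

theorem objective_point : I.objective (point n H (I.rowData D e K L col) x) =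
    ∑ j ∈ range n, (I.rowData D e K L col).cost j (x j) + ∑ r ∈ range (m + H),
      (I.rowData D e K L col).pen r (∑ j ∈ range n, (I.rowData D e K L col).dig r j (x j)) := by
  set p := I.rowData D e K L col with hp
  have h1 : ∑ r ∈ range (m + H), p.pen r (∑ j ∈ range n, p.dig r j (x j)) =
      ∑ h : Fin H, I.lam h * (point n H p x).y h ^ 2 := by
    rw [sum_range_add, sum_eq_zero, zero_add]
    · refine Eq.trans ?_ (sum_vecCells I.lam fun l h =>
        l * p.yval (p.m + h) (∑ j ∈ range p.n, p.dig (p.m + h) j (x j)) ^ 2)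
      refine sum_congr rfl fun h _ => ?_
      rw [RowData.pen, if_neg (not_lt.2 (Nat.le_add_right p.m h) : ¬ m + h < p.m)]
      change vecCells I.lam (m + h - m) 0 * _ * _ = vecCells I.lam h 0 * _
      rw [Nat.add_sub_cancel_left, pow_two, mul_assoc]
      rfl
    · intro r hr
      exact if_pos (mem_range.1 hr)
  have h2 : ∑ j ∈ range n, p.cost j (x j) = ∑ j : Fin n, I.d j * (point n H p x).x j ^ 2 -
      ∑ j : Fin n, I.mu j * (point n H p x).x j := by
    refine Eq.trans ?_ (congrArg₂ (· - ·) (sum_vecCells I.d fun d j => d * p.xval j (x j) ^ 2)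
      (sum_vecCells I.mu fun d j => d * p.xval j (x j)))
    rw [← sum_sub_distrib]
    refine sum_congr rfl fun j _ => ?_
    rw [RowData.cost, pow_two, mul_assoc]
    rfl
  rw [objective, h1, h2]
  ring

theorem epsFeasible_point {ε : ℝ} (hε : e = if m + H = 0 then 1 else ε)
    (hS : (I.rowData D e K L col).Sound) (hx : ∀ j, x j ≤ (I.rowData D e K L col).M)
    (hok : ∀ r < m + H, (I.rowData D e K L col).ok r
      (∑ j ∈ range n, (I.rowData D e K L col).dig r j (x j)))
    (hcard : ((range n).filter fun j => x j ≠ 0).card ≤ I.N) :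
    I.EpsFeasible ε (point n H (I.rowData D e K L col) x) := by
  set p := I.rowData D e K L col with hp
  refine ⟨⟨fun j => ?_, fun j => ?_, fun j hj => ?_, ?_⟩, fun r => ?_, fun h => ?_⟩
  · have := hS.xval_mem (j := j) j.2 (hx j)
    have hu : p.u j = I.u j := by simp [hp, rowData, vecCells]
    rwa [hu] at this
  · change (if x j = 0 then 0 else 1) = 0 ∨ (if x j = 0 then 0 else 1) = 1
    split_ifs <;> simp
  · change (if x j = 0 then 0 else 1) = 0 at hj
    have : x j = 0 := by
      by_contra h
      simp [h] at hj
    change p.xval j (x j) = 0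
    rw [this, RowData.xval, if_pos rfl]
  · change ∑ j : Fin n, (if x j = 0 then 0 else 1) ≤ I.N
    rw [Fin.sum_univ_eq_sum_range (fun j => if x j = 0 then 0 else 1)]
    refine le_trans (le_of_eq ?_) hcard
    rw [card_filter]
    exact sum_congr rfl fun j _ => by split_ifs <;> simp_all
  · obtain ⟨r, hr⟩ := r
    have he : e = ε := by rw [hε, if_neg (by omega)]
    have ha : ∀ j : Fin n, I.row r j = I.A ⟨r, hr⟩ j := fun j => I.row_lt hr j.2
    have hb : p.b r = I.b ⟨r, hr⟩ := by simp [hp, rowData, vecCells, hr]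
    obtain ⟨j, hj⟩ := I.row_ne_zero ⟨r, hr⟩
    have hsup : 1 ≤ p.sup r := by
      rw [support_eq ha, support]
      exact_mod_cast (Set.ncard_pos (Set.toFinite _)).2 ⟨j, hj⟩
    have := hS.constraint_le (fun j _ => hx j) hr hsup (hok r (by omega))
    rw [support_eq ha, scale_eq ha, hb] at this
    change ∑ j : Fin n, I.A ⟨r, hr⟩ j * p.xval j (x j) ≤ _
    rw [sum_A_eq (D := D) (e := e) (K := K) (L := L) (col := col) hr (fun j => p.xval j (x j)), ← he]
    exact this
  · obtain ⟨h, hh⟩ := h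
    have he : e = ε := by rw [hε, if_neg (by omega)]
    have ha : ∀ j : Fin n, I.row (m + h) j = I.v ⟨h, hh⟩ j := fun j => I.row_add hh j.2
    have := hS.abs_sub_yval_le (fun j _ => hx j) (m + h)
    rw [support_eq ha, scale_eq ha] at this
    change |∑ j : Fin n, I.v ⟨h, hh⟩ j * p.xval j (x j) - _| ≤ _
    rw [sum_v_eq (D := D) (e := e) (K := K) (L := L) (col := col) hh (fun j => p.xval j (x j)), ← he]
    exact this

theorem exists_choice_le (hS : (I.rowData D e K L col).Sound) {q : PortfolioPoint n H}
    (hq : I.Feasible q) : ∃ x : ℕ → ℕ, (∀ j, n ≤ j → x j = 0) ∧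
      (∀ j, x j ≤ (I.rowData D e K L col).M) ∧
      (∀ r < m + H, (I.rowData D e K L col).ok r
        (∑ j ∈ range n, (I.rowData D e K L col).dig r j (x j))) ∧
      ((range n).filter fun j => x j ≠ 0).card ≤ I.N ∧
      I.objective (point n H (I.rowData D e K L col) x) ≤ I.objective q := by
  set p := I.rowData D e K L col with hp
  obtain ⟨⟨hq1, hq2, hq3, hq4⟩, hq5, hq6⟩ := hq
  let w : ℕ → ℝ := fun j => vecCells q.x j 0
  have hw : ∀ j : Fin n, w j = q.x j := fun j => by simp [w, vecCells]
  have hu : ∀ j : Fin n, p.u j = I.u j := fun j => by simp [hp, rowData, vecCells]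
  have hM := hS.M_pos
  have : ∀ j, ∃ c ≤ p.M, (n ≤ j → c = 0) ∧ (∀ h : j < n, q.z ⟨j, h⟩ = 0 → c = 0) ∧
      (j < n → |p.xval j c - w j| ≤ p.u j / p.M ∧ p.cost j c ≤ p.d j * w j ^ 2 - p.mu j * w j) := by
    intro j
    by_cases hj : j < n
    · have h1 := hq1 ⟨j, hj⟩
      rw [← hw, ← hu] at h1
      by_cases hz : q.z ⟨j, hj⟩ = 0
      · have h2 := hq3 _ hz
        rw [← hw] at h2
        refine ⟨0, Nat.zero_le _, fun _ => rfl, fun _ _ => rfl, fun _ => ?_⟩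
        have hx0 : p.xval j 0 = 0 := if_pos rfl
        have h3 : w j = 0 := h2
        rw [RowData.cost, hx0, h3]
        simpa using div_nonneg (hS.u_nonneg j hj) hM.le
      · obtain ⟨c, hc, -, h2⟩ := hS.exists_choice hj h1.1 h1.2
        exact ⟨c, hc, fun h => absurd hj (not_lt.2 h), fun _ h => absurd h hz, fun _ => h2⟩
    · exact ⟨0, Nat.zero_le _, fun _ => rfl, fun _ _ => rfl, fun h => absurd h hj⟩
  choose x hx1 hx2 hx3 hx4 using this
  have near : p.Near x w := fun j hj => ⟨hx1 j, hx4 j hj⟩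
  have hwA : ∀ r (hr : r < m), ∑ j, I.A ⟨r, hr⟩ j * q.x j = ∑ j ∈ range n, p.B r j * w j := by
    intro r hr
    rw [← sum_A_eq hr w]
    simp [hw]
  have hwv : ∀ h (hh : h < H), q.y ⟨h, hh⟩ = ∑ j ∈ range n, p.B (m + h) j * w j := by
    intro h hh
    rw [← sum_v_eq hh w, ← hq6]
    simp [hw]
  refine ⟨x, hx2, hx1, fun r _ => near.ok hS fun hr => ?_, ?_, ?_⟩
  · have hb : p.b r = I.b ⟨r, hr⟩ := by
      have hr : r < m := hr
      simp [hp, rowData, vecCells, hr]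
    rw [hb]
    exact (hwA r hr).symm.trans_le (hq5 _)
  · refine le_trans ?_ hq4
    rw [card_filter, ← Fin.sum_univ_eq_sum_range (fun j => if x j ≠ 0 then 1 else 0)]
    refine sum_le_sum fun j _ => ?_
    split_ifs with h
    · rcases hq2 j with h1 | h1
      · exact absurd (hx3 j j.2 h1) h
      · exact h1.ge
    · exact Nat.zero_le _
  · have h1 : ∑ h, I.lam h * (point n H p x).y h ^ 2 ≤ ∑ h, I.lam h * q.y h ^ 2 := by
      refine sum_le_sum fun h _ => mul_le_mul_of_nonneg_left ?_ (I.lam_pos h).le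
      have := near.yval_sq_le hS (m + h)
      rw [hwv h h.2, pow_two]
      exact this
    have h2 : ∑ j : Fin n, I.d j * (point n H p x).x j ^ 2 - ∑ j : Fin n, I.mu j * (point n H p x).x j ≤
        ∑ j, I.d j * q.x j ^ 2 - ∑ j, I.mu j * q.x j := by
      rw [← sum_sub_distrib, ← sum_sub_distrib]
      refine sum_le_sum fun j _ => ?_
      have := (hx4 j j.2).2
      have e1 : p.d j = I.d j := by simp [hp, rowData, vecCells]
      have e2 : p.mu j = I.mu j := by simp [hp, rowData, vecCells]
      rw [RowData.cost, e1, e2, hw] at this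
      rw [pow_two, ← mul_assoc]
      exact this
    rw [objective, objective]
    linarith

end Portfolio

/-! ### Running time -/

namespace Portfolio

open Finset RealRAM

/-- The total number of steps, in terms of the number `V` of pairs of codes. -/
theorem cost_le {n m H k K L V S t : ℕ} (hn : 1 ≤ n) (hk : k ≤ n + m) (hR : m + H ≤ n * L)
    (hH : H ≤ L) (hV : (K + 1) * (K + 1) ≤ 9 * V) (hS : S ≤ V)
    (ht : t ≤ 1100 * ((k + n + 1) * ((m + H + 1) * (m + H + 1)) + K + 1) +
      3000 * ((n + 1) * ((K + K + K + K + 2) * ((m + H + 1) * (K + 1))) + (L + 1) * (K + 1 + V)) +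
      500 * ((n + 1) * (K + K + K + K + 2)) +
      7000 * ((k + n + 1) * ((V + S + 1) * (L + 1) * ((n + 1) * (n + 1)) + (m + H))) +
      900 * ((n + 1) * ((H + 1) * (K + 1)))) :
    t ≤ 1000000 * (n ^ 3 * ((L + 1) ^ 3 * V)) := by
  have hV0 : 1 ≤ V := by
    rcases Nat.eq_zero_or_pos V with rfl | h
    · simp at hV
    · exact h
  have hK : K + 1 ≤ 9 * V := (Nat.le_mul_self _).trans hV
  have h1 : n + 1 ≤ 2 * n := by omega
  have h2 : m + H + 1 ≤ n * (L + 1) := by linarith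
  have h3 : k + n + 1 ≤ 3 * (n * (L + 1)) := by nlinarith
  have h4 : K + K + K + K + 2 ≤ 4 * (K + 1) := by omega
  have h5 : V + S + 1 ≤ 3 * V := by omega
  have hL : 1 ≤ L + 1 := by omega
  -- each of the summands is at most a constant times `X`
  set X := n ^ 3 * ((L + 1) ^ 3 * V) with hX
  have key : ∀ a b c, a ≤ 3 → b ≤ 3 → n ^ a * ((L + 1) ^ b * V) ≤ X ∧ (c ≤ n ^ a * (L + 1) ^ b → c ≤ X) := by
    intro a b c ha hb
    have g1 : n ^ a ≤ n ^ 3 := Nat.pow_le_pow_right hn ha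
    have g2 : (L + 1) ^ b ≤ (L + 1) ^ 3 := Nat.pow_le_pow_right hL hb
    have g3 : n ^ a * ((L + 1) ^ b * V) ≤ X := Nat.mul_le_mul g1 (Nat.mul_le_mul_right _ g2)
    refine ⟨g3, fun h => h.trans (le_trans ?_ g3)⟩
    rw [← mul_assoc]
    exact Nat.le_mul_of_pos_right _ hV0
  have a1 : (k + n + 1) * ((m + H + 1) * (m + H + 1)) ≤ 3 * X := by
    refine (Nat.mul_le_mul h3 (Nat.mul_le_mul h2 h2)).trans ?_
    have := (key 3 3 (n ^ 3 * (L + 1) ^ 3) le_rfl le_rfl).2 le_rfl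
    linarith
  have a2 : K + 1 ≤ 9 * X := by
    have := (key 0 0 0 (by norm_num) (by norm_num)).1
    simp at this
    omega
  have a3 : (n + 1) * ((K + K + K + K + 2) * ((m + H + 1) * (K + 1))) ≤ 72 * X := by
    refine (Nat.mul_le_mul h1 (Nat.mul_le_mul h4 (Nat.mul_le_mul_right _ h2))).trans ?_
    have := (key 2 1 0 (by norm_num) (by norm_num)).1
    calc 2 * n * (4 * (K + 1) * (n * (L + 1) * (K + 1)))
        = 8 * (n ^ 2 * (L + 1)) * ((K + 1) * (K + 1)) := by ring
      _ ≤ 8 * (n ^ 2 * (L + 1)) * (9 * V) := Nat.mul_le_mul_left _ hV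
      _ = 72 * (n ^ 2 * ((L + 1) ^ 1 * V)) := by ring
      _ ≤ _ := by omega
  have a4 : (L + 1) * (K + 1 + V) ≤ 10 * X := by
    have := (key 0 1 0 (by norm_num) (by norm_num)).1
    calc (L + 1) * (K + 1 + V) ≤ (L + 1) * (10 * V) := Nat.mul_le_mul_left _ (by omega)
      _ = 10 * (n ^ 0 * ((L + 1) ^ 1 * V)) := by ring
      _ ≤ _ := by omega
  have a5 : (n + 1) * (K + K + K + K + 2) ≤ 72 * X := by
    have := (key 1 0 0 (by norm_num) (by norm_num)).1
    calc (n + 1) * (K + K + K + K + 2) ≤ 2 * n * (4 * (9 * V)) :=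
          Nat.mul_le_mul h1 (h4.trans (Nat.mul_le_mul_left _ hK))
      _ = 72 * (n ^ 1 * ((L + 1) ^ 0 * V)) := by ring
      _ ≤ _ := by omega
  have a6 : (k + n + 1) * ((V + S + 1) * (L + 1) * ((n + 1) * (n + 1)) + (m + H)) ≤ 39 * X := by
    have g1 := (key 3 2 0 (by norm_num) (by norm_num)).1
    have g2 := (key 2 2 (n ^ 2 * (L + 1) ^ 2) (by norm_num) (by norm_num)).2 le_rfl
    calc (k + n + 1) * ((V + S + 1) * (L + 1) * ((n + 1) * (n + 1)) + (m + H))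
        ≤ 3 * (n * (L + 1)) * (3 * V * (L + 1) * (2 * n * (2 * n)) + n * (L + 1)) := by
          gcongr
          omega
      _ = 36 * (n ^ 3 * ((L + 1) ^ 2 * V)) + 3 * (n ^ 2 * (L + 1) ^ 2) := by ring
      _ ≤ _ := by omega
  have a7 : (n + 1) * ((H + 1) * (K + 1)) ≤ 18 * X := by
    have := (key 1 1 0 (by norm_num) (by norm_num)).1
    calc (n + 1) * ((H + 1) * (K + 1)) ≤ 2 * n * ((L + 1) * (9 * V)) := by gcongr
      _ = 18 * (n ^ 1 * ((L + 1) ^ 1 * V)) := by ring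
      _ ≤ _ := by omega
  omega

/-- A polynomial factor is absorbed by a slightly larger base.  Here `117 / 128` bounds
`K * (K + 1) / 2 / g ^ 2` for `K = 5 / 8 * g + 1` and `g ≥ 2`. -/
theorem exists_pow_le : ∃ C : ℝ, 0 ≤ C ∧ ∀ L : ℕ, ((L : ℝ) + 1) ^ 3 * (117 / 128 : ℝ) ^ L ≤ C := by
  have h := (tendsto_pow_const_mul_const_pow_of_abs_lt_one 3
    (show |(117 / 128 : ℝ)| < 1 by rw [abs_of_pos] <;> norm_num)).bddAbove_range
  obtain ⟨C, hC⟩ := h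
  refine ⟨128 / 117 * |C|, by positivity, fun L => ?_⟩
  have := hC ⟨L + 1, rfl⟩
  push_cast at this
  rw [pow_succ (117 / 128 : ℝ)] at this
  have h1 := le_abs_self C
  linarith

/-- The number of pairs of codes, multiplied by a polynomial. -/
theorem exists_pairs_le : ∃ C : ℝ, 0 ≤ C ∧ ∀ (K L : ℕ) (g : ℝ), 2 ≤ g → (L ≠ 0 → K ≤ 5 / 8 * g + 1) →
    ((L : ℝ) + 1) ^ 3 * ((K * (K + 1) / 2 : ℕ) : ℝ) ^ L ≤ C * g ^ (2 * L) := by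
  obtain ⟨C, hC0, hC⟩ := exists_pow_le
  refine ⟨C, hC0, fun K L g hg hK => ?_⟩
  have h1 : ((K * (K + 1) / 2 : ℕ) : ℝ) ^ L ≤ (117 / 128 * g ^ 2) ^ L := by
    rcases Nat.eq_zero_or_pos L with rfl | hL
    · simp
    · refine pow_le_pow_left₀ (Nat.cast_nonneg _) ?_ L
      have h2 := hK hL.ne'
      have h3 : ((K * (K + 1) / 2 : ℕ) : ℝ) ≤ (K * (K + 1) : ℝ) / 2 := by
        have := Nat.cast_div_le (α := ℝ) (m := K * (K + 1)) (n := 2)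
        push_cast at this
        exact this
      have h4 : (0 : ℝ) ≤ K := Nat.cast_nonneg _
      nlinarith
  calc ((L : ℝ) + 1) ^ 3 * ((K * (K + 1) / 2 : ℕ) : ℝ) ^ L
      ≤ ((L : ℝ) + 1) ^ 3 * (117 / 128 * g ^ 2) ^ L := by gcongr
    _ = ((L : ℝ) + 1) ^ 3 * (117 / 128) ^ L * g ^ (2 * L) := by rw [mul_pow, pow_mul, mul_assoc]
    _ ≤ C * g ^ (2 * L) := by gcongr; exact hC L

end Portfolio

/-! ### The algorithm -/

namespace Portfolio

open Finset RealRAM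

/-- The algorithm: round the problem along the tree-decomposition, solve the rounded problem by
dynamic programming, and read off the best solution from the table of the root. -/
def algorithm : Prog := seqs [arrange, prepare, initTables, treeDP, finish]

theorem sq_succ_le_of_le_two {K L : ℕ} (h : K ≤ 2) (hL : L = 0) :
    (K + 1) * (K + 1) ≤ 9 * (K * (K + 1) / 2) ^ L := by
  subst hL
  rw [pow_zero]
  exact (Nat.mul_le_mul (show K + 1 ≤ 3 by omega) (show K + 1 ≤ 3 by omega) :)

theorem sq_succ_le_pow {K L : ℕ} (h : 0 < K) (hL : L ≠ 0) :
    (K + 1) * (K + 1) ≤ 9 * (K * (K + 1) / 2) ^ L := by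
  have hT : 2 * (K * (K + 1) / 2) = K * (K + 1) :=
    Nat.mul_div_cancel' (Nat.even_mul_succ_self K).two_dvd
  have h1 : K * (K + 1) / 2 ≤ (K * (K + 1) / 2) ^ L := Nat.le_self_pow hL _
  nlinarith

set_option maxHeartbeats 1000000 in
theorem algorithm_spec {n m H k : ℕ} (I : Portfolio n m H) (D : RootedTreeDecomposition I.rowGraph k)
    {ε : ℝ} (hn : 1 ≤ n) (hk : k ≤ n + m) (hε : 0 < ε) (hε1 : ε < 1) :
    WP algorithm (I.input D ε) fun t s => (∃ K L : ℕ,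
      t ≤ 1000000 * (n ^ 3 * ((L + 1) ^ 3 * (K * (K + 1) / 2) ^ L)) ∧
        L ≤ (univ.sup fun t => (D.bag t).card) + H ∧ (L ≠ 0 → K ≤ 5 / 8 * (2 / ε) + 1)) ∧
      ((DeclaresInfeasible s ∧ ∀ p, ¬ I.Feasible p) ∨ (¬ DeclaresInfeasible s ∧
        I.EpsFeasible ε (output n H s) ∧ I.Superoptimal (output n H s))) := by
  have zn : ∀ a, 2 < a → ∀ i j, (I.input D ε).nat a i j = 0 := by
    intro a ha i j
    match a, ha with
    | a + 3, _ => rfl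
  have zr : ∀ a, 7 < a → ∀ i j, (I.input D ε).real a i j = 0 := by
    intro a ha i j
    match a, ha with
    | a + 8, _ => rfl
  unfold algorithm
  rw [WP_seqs_cons]
  refine (I.arrange_spec D hε).mono ?_
  rintro t1 s1 ⟨e, K, L, col, ht1, he, hK, hK', hLW, hcol, hne, hb1, hf1⟩
  have he0 : 0 < e := by
    rw [he]
    split_ifs <;> linarith
  have hS := I.sound_rowData D (L := L) (col := col) he0 hK
  have hV := valid_rowData (D := D) he0 hK hcol hne
  have hR := card_rows_le hcol hne
  have hHL := eigen_le hcol hne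
  have hkpos := D.pos
  have hKpos : 0 < K := hS.K_pos
  set p := I.rowData D e K L col with hp
  have hcol' : ∀ r < p.R, p.col r ≤ p.L := fun r hr => (hcol r hr).le
  rw [WP_seqs_cons]
  refine (WP.frame [19, 20, 21, 22, 23, 24, 25, 30, 35, 36, 37, 39, 40, 51, 53, 54, 55, 56, 57]
    [11, 12, 13, 15, 16, 17, 18, 20, 21, 22, 25, 26] (prepare_spec hb1 hKpos hcol' ?_ ?_)).mono ?_
  · intro a ha ha' i j
    rw [hf1.nat a (by simp; omega), zn a (by omega)]
  · intro a ha ha' i j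
    rw [hf1.real a (by simp; omega), zr a (by omega)]
  rintro t2 s2 ⟨⟨ht2, hb2, hs2, hx2, hp2, hl2⟩, hf2⟩
  rw [WP_seqs_cons]
  refine (WP.frame [26, 27, 28, 29, 31, 32, 33, 34, 35, 36, 37, 38, 39, 40, 41, 42, 43, 44, 45, 46, 47,
      50, 51, 52, 53, 54, 55, 56, 57] [19, 24] (initTables_spec hV hl2 hKpos hkpos ?_ ?_ ?_ ?_)).mono ?_
  · intro row c
    rw [hf2.nat _ (by decide), hf1.nat _ (by decide), zn _ (by norm_num)]
  · intro row c
    rw [hf2.nat _ (by decide), hf1.nat _ (by decide), zn _ (by norm_num)]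
  · rw [hf2.real _ (by decide), hf1.real _ (by decide), zr _ (by norm_num)]
  · intro u
    rw [hf2.nat _ (by decide), hf1.nat _ (by decide), zn _ (by norm_num)]
  rintro t3 s3 ⟨⟨ht3, hT3⟩, hf3⟩
  rw [WP_seqs_cons]
  refine (WP.frame [26, 27, 28, 29, 31, 32, 33, 34, 35, 36, 37, 38, 39, 40, 41, 42, 43, 44, 45, 46, 47,
      50, 51, 52, 53, 54, 55, 56, 57] [19, 24] (treeDP_spec hV (hl2.congr hf3) hKpos hkpos hT3)).mono ?_
  rintro t4 s4 ⟨⟨ht4, h, F, hStage, hF, hT4⟩, hf4⟩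
  have hf24 := hf3.trans hf4
  have hl4 := hl2.congr hf24
  have hb4 := hb2.congr (hf24.mono (by decide) (by decide))
  have hx4 := hx2.congr hf24
  have hp4 := hp2.congr hf24
  rw [WP_seqs_singleton]
  refine (finish_spec (N := I.N) hb4 (hs2.congr hf24) hl4.pow hcol' hl4.mul ?_ rfl ?_).mono ?_
  · rw [hf24.nat _ (by decide), hf2.nat _ (by decide), hf1.nat _ (by decide)]
    change vecCells ![n, m, H, I.N, k] 3 0 = I.N
    simp [vecCells]
  · rw [hf24.nat _ (by decide), hf2.nat _ (by decide), hf1.nat _ (by decide), zn _ (by norm_num)]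
  rintro t5 s5 ⟨ht5, cnt, hcnt, hflag, hout, hy⟩
  set row := s4.nat arrLoc 0 0 with hrow
  have hK2 : (K + 1) * (K + 1) ≤ 9 * (K * (K + 1) / 2) ^ L ∧ (L ≠ 0 → e = ε) := by
    by_cases h0 : m + H = 0
    · have hm : m = 0 := by omega
      have hW : (univ.sup fun t => (D.bag t).card) = 0 := by
        subst hm
        refine Nat.eq_zero_of_le_zero (Finset.sup_le fun t _ => ?_)
        exact (card_le_univ _).trans (by simp)
      have hL : L = 0 := by omega
      rw [if_pos h0] at he
      have h2 : K ≤ 2 := by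
        by_contra h3
        have h4 : (3 : ℝ) ≤ K := by exact_mod_cast not_le.1 h3
        rw [he] at hK'
        linarith only [h4, hK']
      exact ⟨sq_succ_le_of_le_two h2 hL, fun h => absurd hL h⟩
    · rw [if_neg h0] at he
      refine ⟨sq_succ_le_pow hKpos ?_, fun _ => he⟩
      rintro rfl
      rw [Nat.mul_zero] at hR
      exact h0 (by omega)
  refine ⟨⟨K, L, ?_, hLW, fun hL => ?_⟩, ?_⟩
  · have hSV : K ^ L ≤ (K * (K + 1) / 2) ^ L := by
      refine Nat.pow_le_pow_left ?_ L
      rw [Nat.le_div_iff_mul_le two_pos]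
      exact Nat.mul_le_mul_left _ (by omega)
    have ht2 : t2 ≤ 3000 * ((n + 1) * ((K + K + K + K + 2) * ((m + H + 1) * (K + 1))) +
      (L + 1) * (K + 1 + (K * (K + 1) / 2) ^ L)) := ht2
    have ht3 : t3 ≤ 500 * ((n + 1) * (K + K + K + K + 2)) := ht3
    have ht4 : t4 ≤ 7000 * ((k + n + 1) * (((K * (K + 1) / 2) ^ L + K ^ L + 1) * (L + 1) *
      ((n + 1) * (n + 1)) + (m + H))) := ht4
    have ht5 : t5 ≤ 900 * ((n + 1) * ((H + 1) * (K + 1))) := ht5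
    refine cost_le (k := k) (K := K) (L := L) (V := (K * (K + 1) / 2) ^ L) (S := K ^ L) hn hk hR hHL
      hK2.1 hSV ?_
    omega
  · rw [hK2.2 hL] at hK'
    have h1 : 5 / 8 * (2 / ε) + 1 = (5 + 4 * ε) / (4 * ε) := by
      field_simp
      ring
    rw [h1, le_div_iff₀ (by linarith)]
    exact hK'
  -- the table at the root describes the solutions of the relaxed problem
  have htab : ∀ c ≤ n, (s4.nat arrOk row c ≠ 0 → p.tree.Sem h F 0 0 c (s4.real reaVal row c)
      (sol n s4 row c)) ∧ ∀ v x, p.tree.Sem h F 0 0 c v x → s4.nat arrOk row c ≠ 0 ∧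
        s4.real reaVal row c ≤ v := fun c hc => hT4.tab 0 le_rfl 0 (Nat.pow_pos hKpos) c hc
  -- a feasible point yields an entry of this table that is not more expensive
  have hfeas : ∀ q, I.Feasible q → ∃ c ≤ n, c ≤ I.N ∧ s4.nat arrOk row c ≠ 0 ∧
      s4.real reaVal row c ≤ I.objective q := by
    intro q hq
    obtain ⟨x, h1, h2, h3, h4, h5⟩ := exists_choice_le hS hq
    have hc : ((range n).filter fun j => x j ≠ 0).card ≤ n :=
      (card_filter_le _ _).trans (card_range n).le
    obtain ⟨g1, g2⟩ := (htab _ hc).2 _ x ((hStage.sem_final hV hF).2 ⟨h1, h2, rfl, rfl, h3, rfl⟩)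
    refine ⟨_, hc, h4, g1, g2.trans (le_trans (le_of_eq ?_) h5)⟩
    rw [objective_point]
    rfl
  rcases hflag with ⟨hf, hno⟩ | ⟨hf, hcN, hok, hbest⟩
  · refine Or.inl ⟨hf, fun q hq => ?_⟩
    obtain ⟨c, hc, hcN, h1, -⟩ := hfeas q hq
    exact h1 (hno c hc hcN)
  · have hsem := (htab cnt hcnt).1 hok
    obtain ⟨g1, g2, -, g4, g5, g6⟩ := (hStage.sem_final hV hF).1 hsem
    have hpoint : output n H s5 = point n H p (sol n s4 row cnt) := by
      have hX : ∀ j < n, s4.real reaX j (sol n s4 row cnt j) = p.xval j (sol n s4 row cnt j) :=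
        fun j hj => hx4.x j hj _ (g2 j)
      have hx : (output n H s5).x = (point n H p (sol n s4 row cnt)).x := by
        funext j
        exact ((hout j j.2).1).trans (hX j j.2)
      have hz : (output n H s5).z = (point n H p (sol n s4 row cnt)).z := by
        funext j
        exact (hout j j.2).2
      have hyy : (output n H s5).y = (point n H p (sol n s4 row cnt)).y := by
        funext h'
        refine (hy h' h'.2).trans ?_
        have e1 : ∑ j ∈ range p.n, roundDigit (p.grid (p.m + h')) p.K (p.term (p.m + h') j
            (s4.real reaX j (sol p.n s4 row cnt j))) =
            ∑ j ∈ range p.n, p.dig (p.m + h') j (sol n s4 row cnt j) := by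
          refine sum_congr rfl fun j hj => ?_
          rw [RowData.dig, ← hX j (mem_range.1 hj)]
          rfl
        have hr : p.m + h' < p.R := Nat.add_lt_add_left h'.2 m
        rw [e1]
        exact hp4.yval _ hr _ (hS.sum_lt (fun j _ => g2 j) _) (Nat.le_add_right _ _)
      calc output n H s5 = ⟨(output n H s5).x, (output n H s5).y, (output n H s5).z⟩ := rfl
        _ = _ := by rw [hx, hyy, hz]
    refine Or.inr ⟨hf, ?_, fun q hq => ?_⟩
    · rw [hpoint]
      exact epsFeasible_point he hS g2 g5 (g4 ▸ hcN)
    · obtain ⟨c, hc, hcN', h1, h2⟩ := hfeas q hq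
      rw [hpoint, objective_point]
      refine le_trans (le_of_eq ?_) ((hbest c hc hcN' h1).trans h2)
      rw [g6]
      rfl

end Portfolio

theorem lemma4 :
    ∃ (P : RealRAM.Prog) (C : ℝ),
      ∀ (n m H k : ℕ) (I : Portfolio n m H) (D : RootedTreeDecomposition I.rowGraph k) (ε : ℝ),
        1 ≤ n → k ≤ n + m → 0 < ε → ε < 1 →
          ∃ (t : ℕ) (s : RealRAM.Store),
            RealRAM.Exec P (I.input D ε) t s ∧
            (t : ℝ) ≤ C * (n * (2 / ε) ^ (2 * D.width + 2 * H + 2) * (n : ℝ) ^ 2) ∧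
            ((Portfolio.DeclaresInfeasible s ∧ ∀ p, ¬ I.Feasible p) ∨
              (¬ Portfolio.DeclaresInfeasible s ∧
                I.EpsFeasible ε (Portfolio.output n H s) ∧
                I.Superoptimal (Portfolio.output n H s))) := by
  obtain ⟨C, hC0, hC⟩ := Portfolio.exists_pairs_le
  refine ⟨Portfolio.algorithm, 1000000 * C, fun n m H k I D ε hn hk hε hε1 => ?_⟩
  obtain ⟨t, s, hexec, ⟨K, L, ht, hL, hK⟩, hres⟩ := Portfolio.algorithm_spec I D hn hk hε hε1
  refine ⟨t, s, hexec, ?_, hres⟩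
  have hg : 2 ≤ 2 / ε := by
    rw [le_div_iff₀ hε]
    linarith
  have hexp : (2 / ε : ℝ) ^ (2 * D.width + 2 * H + 2) =
      (2 / ε) ^ (2 * ((Finset.univ.sup fun t => (D.bag t).card) + H)) := by
    rw [← zpow_natCast]
    congr 1
    rw [RootedTreeDecomposition.width]
    push_cast
    ring
  have h1 : (2 / ε : ℝ) ^ (2 * L) ≤ (2 / ε) ^ (2 * ((Finset.univ.sup fun t => (D.bag t).card) + H)) :=
    pow_le_pow_right₀ (by linarith) (by omega)
  have h2 := hC K L (2 / ε) hg hK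
  have h3 : (t : ℝ) ≤ 1000000 * ((n : ℝ) ^ 3 * (((L : ℝ) + 1) ^ 3 * ((K * (K + 1) / 2 : ℕ) : ℝ) ^ L)) := by
    exact_mod_cast ht
  rw [hexp]
  calc (t : ℝ) ≤ 1000000 * ((n : ℝ) ^ 3 * (C * (2 / ε) ^
        (2 * ((Finset.univ.sup fun t => (D.bag t).card) + H)))) := by
        exact h3.trans (mul_le_mul_of_nonneg_left (mul_le_mul_of_nonneg_left
          (h2.trans (mul_le_mul_of_nonneg_left h1 hC0)) (by positivity)) (by norm_num))
    _ = _ := by ring
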